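/- Let $(E,\rho)$ be a non-empty compact metric space, $\Omega=E^{\mathbb Z^d}$ with the product topology, and $\theta_x\eta(y)=\eta(y-x)$. **Environment.** Let $(\eta_t)_{t\ge 0}$ be a Feller process on $\Omega$ with càdlàg paths, path measures $\mathbb P^E_\eta$, semigroup $S^E_t$ and generator $L^E$ on $C(\Omega)$, which is translation invariant: $\mathbb P^E_\eta(\theta_x\eta_t\in\cdot)=\mathbb P^E_{\theta_x\eta}(\eta_t\in\cdot)$. Suppose there is a translation invariant coupling $\widehat{\mathbb P}^E_{\eta,\xi}$ of $\mathbb P^E_\eta$ and $\mathbb P^E_\xi$ ($\eta,\xi\in\Omega$), that is, a law of a pair $(\eta^1_t,\eta^2_t)_{t\ge0}$ with these marginals, which has the strong marginal Markov property $$\widehat{\mathbb E}^E_{\eta,\xi}\bigl[1_{t\ge\tau}f(\eta^i_t)\,\big|\,\mathcal F_\tau\bigr]=1_{t\ge\tau}\,S^E_{t-\tau}f(\eta^i_\tau)\qquad(i=1,2,\ t\ge 0)$$ for all $f\in C(\Omega)$ and all stopping times $\tau$ of the canonical filtration $(\mathcal F_t)$ of the pair, and which satisfies $$\int_0^\infty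 t^d\sup_{\eta,\xi\in\Omega}\widehat{\mathbb E}^E_{\eta,\xi}\,\rho\bigl(\eta^1_t(0),\eta^2_t(0)\bigr)\,dt<\infty .$$ **Walker.** Let $\alpha:\Omega\times\mathbb Z^d\to[0,\infty)$ be such that $\alpha(\cdot,z)$ is continuous for every $z$, $$\sum_{z}\|z\|\sup_{\eta}\alpha(\eta,z)<\infty\qquad\text{and}\qquad \sum_z\sum_{x}\ \sup\frac{\alpha(\eta,z)-\alpha(\xi,z)}{\rho(\eta(x),\xi(x))}<\infty ,$$ where the last supremum is over all $\eta,\xi\in\Omega$ that differ at $x$ and only there (and is $0$ if there are none). Let $(\eta_t,X_t)_{t\ge0}$ be the Markov process on $\Omega\times\mathbb Z^d$ with càdlàg paths, path measures $\mathbb P_{\eta,x}$ and generator $$Lf(\eta,x)=L^Ef(\cdot,x)(\eta)+\sum_{z\in\mathbb Z^d}\alpha(\theta_{-x}\eta,z)\,[f(\eta,x+z)-f(\eta,x)] ,$$ where $f(\cdot,x)$ lies in the domain of $L^E$ for all $x$ and vanishes for all but finitely many $x$. The environment process is $(\theta_{-X_t}\eta_t)_{t\ge0}$. **Proposition.** The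 environment process has an ergodic probability measure $\mu^{EP}$, which is its only stationary probability measure. Put $$v=\int\sum_{z\in\mathbb Z^d}z\,\alpha(\eta,z)\,\mu^{EP}(d\eta)\in\mathbb R^d .$$ Then, as $t\to\infty$, for every $\eta\in\Omega$ and $x\in\mathbb Z^d$, $X_t/t\to v$ almost surely and in $L^1$ with respect to $\mathbb P_{\eta,x}$. For each fixed $x$, the $L^1$ convergence is uniform in $\eta\in\Omega$. -/

import Mathlib

open MeasureTheory ProbabilityTheory Filter Set Topology
open scoped NNReal ENNReal

/-! ### Càdlàg path space and Markov processes -/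

section Paths

/-- Right-continuous with left limits (the left limit at `0` is no condition). -/
def IsCadlag {S : Type*} [TopologicalSpace S] (w : ℝ≥0 → S) : Prop :=
  ∀ t : ℝ≥0, ContinuousWithinAt w (Ici t) t ∧ ∃ l : S, Tendsto w (𝓝[<] t) (𝓝 l)

/-- The path space `D([0,∞), S)`; it carries the σ-algebra generated by the evaluations
(the one induced from the product σ-algebra on `ℝ≥0 → S`). -/
abbrev CadlagPath (S : Type*) [TopologicalSpace S] : Type _ := {w : ℝ≥0 → S // IsCadlag w}

/-- The canonical filtration `𝓕 t = σ(w s : s ≤ t)` of the path space. -/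
def canonicalFiltration (S : Type*) [TopologicalSpace S] [mS : MeasurableSpace S] :
    Filtration ℝ≥0 (inferInstance : MeasurableSpace (CadlagPath S)) where
  seq t := ⨆ s : Iic t, mS.comap (fun w : CadlagPath S => w.1 s.1)
  mono' := by
    intro a b hab
    exact iSup_le fun s => le_iSup
      (fun s : Iic b => mS.comap (fun w : CadlagPath S => w.1 s.1)) ⟨s.1, le_trans s.2 hab⟩
  le' := by
    intro t
    refine iSup_le fun s => ?_
    exact ((measurable_pi_apply s.1).comp measurable_subtype_coe).comap_le

/-- `S_t f (x) = E_x[f(w_t)]`. -/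
noncomputable def semigroup {S : Type*} [TopologicalSpace S] [MeasurableSpace S]
    (P : Kernel S (CadlagPath S)) (t : ℝ≥0) (f : S → ℝ) (x : S) : ℝ :=
  ∫ w, f (w.1 t) ∂(P x)

/-- The kernel `x ↦ P_x` of path measures is a (time-homogeneous) Markov process. -/
structure IsMarkovProcess {S : Type*} [TopologicalSpace S] [MeasurableSpace S]
    (P : Kernel S (CadlagPath S)) : Prop where
  prob : ∀ x, IsProbabilityMeasure (P x)
  start : ∀ x, ∀ᵐ w ∂(P x), w.1 0 = x
  markov : ∀ (x : S) (s t : ℝ≥0) (f : S → ℝ), Measurable f → (∃ C : ℝ, ∀ y, |f y| ≤ C) →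
    (P x)[fun w => f (w.1 (s + t)) | canonicalFiltration S s]
      =ᵐ[P x] fun w => semigroup P t f (w.1 s)

/-- `(f, g)` is in the (strong, sup-norm) generator of the process: `(S_t f - f) / t → g`
uniformly as `t ↓ 0`. -/
def HasGenerator {S : Type*} [TopologicalSpace S] [MeasurableSpace S]
    (P : Kernel S (CadlagPath S)) (f g : S → ℝ) : Prop :=
  TendstoUniformly (fun (t : ℝ≥0) (x : S) => (semigroup P t f x - f x) / (t : ℝ)) g (𝓝[>] 0)

end Paths

/-! ### Configurations, shifts, Lipschitz seminorms -/

section Config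

/-- The lattice `ℤ^d`. -/
abbrev IntLattice (d : ℕ) : Type := Fin d → ℤ

/-- The configuration space `Ω = E^{ℤ^d}`. -/
abbrev Config (d : ℕ) (E : Type*) : Type _ := IntLattice d → E

/-- `θ_x η (y) = η (y - x)`. -/
def shiftConfig {d : ℕ} {E : Type*} (x : IntLattice d) (η : Config d E) : Config d E :=
  fun y => η (y - x)

/-- `(η, ξ) ∈ (Ω × Ω)_x`: the configurations differ at `x` and only there. -/
def DifferExactlyAt {d : ℕ} {E : Type*} (x : IntLattice d) (η ξ : Config d E) : Prop :=
  η x ≠ ξ x ∧ ∀ y, y ≠ x → η y = ξ y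

/-- `δ_f(x)`, the Lipschitz constant of `f` in the variable `η(x)`, with values in `[0,∞]`
(the set of difference quotients is symmetric, so cutting it at `0` is harmless). -/
noncomputable def siteLipschitz {d : ℕ} {E : Type*} [MetricSpace E] (f : Config d E → ℝ)
    (x : IntLattice d) : ℝ≥0∞ :=
  ⨆ (η : Config d E) (ξ : Config d E) (_ : DifferExactlyAt x η ξ),
    ENNReal.ofReal ((f η - f ξ) / dist (η x) (ξ x))

/-- `|||f||| = ∑_x δ_f(x)`. -/
noncomputable def tripleNorm {d : ℕ} {E : Type*} [MetricSpace E] (f : Config d E → ℝ) : ℝ≥0∞ :=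
  ∑' x : IntLattice d, siteLipschitz f x

/-- The jump rates: `α η z` is the rate of a jump by `z` if the environment seen from the walker
is `η`. They are nonnegative, continuous in `η`, and satisfy `‖α‖₁ < ∞` and `|||α||| < ∞`. -/
structure IsJumpRate {d : ℕ} {E : Type*} [MetricSpace E]
    (α : Config d E → IntLattice d → ℝ) : Prop where
  nonneg : ∀ η z, 0 ≤ α η z
  continuous : ∀ z, Continuous fun η => α η z
  moment : ∑' z : IntLattice d, ‖z‖ₑ * ⨆ η, ‖α η z‖ₑ < ∞
  lipschitz : ∑' z : IntLattice d, tripleNorm (fun η => α η z) < ∞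

end Config

/-! ### The environment and its coupling -/

section Environment

variable {d : ℕ} {E : Type*} [MetricSpace E] [MeasurableSpace E]

/-- The environment: a translation invariant Feller process on `Ω`, given by its path
measures `P^E_η`. (Strong continuity of the semigroup comes from the right-continuity of the
paths.) -/
structure IsEnvironment (PE : Kernel (Config d E) (CadlagPath (Config d E))) : Prop where
  markov : IsMarkovProcess PE
  feller : ∀ (t : ℝ≥0) (f : Config d E → ℝ), Continuous f → Continuous (semigroup PE t f)
  translation : ∀ (x : IntLattice d) (η : Config d E) (t : ℝ≥0) (A : Set (Config d E)),
    MeasurableSet A → PE η {w | shiftConfig x (w.1 t) ∈ A} = PE (shiftConfig x η) {w | w.1 t ∈ A}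

/-- The strong marginal Markov property of a law `Q` on the space of coupled paths, for the
coordinate `π` (first or second) of the pair:
`E[1_{t ≥ τ} f(η^i_t) | 𝓕_τ] = 1_{t ≥ τ} S^E_{t-τ} f(η^i_τ)` for all stopping times `τ` of the
canonical filtration of the pair. -/
def StrongMarginalMarkov (PE : Kernel (Config d E) (CadlagPath (Config d E)))
    (Q : Measure (CadlagPath (Config d E × Config d E)))
    (π : Config d E × Config d E → Config d E) : Prop :=
  ∀ (τ : CadlagPath (Config d E × Config d E) → WithTop ℝ≥0)
    (hτ : IsStoppingTime (canonicalFiltration (Config d E × Config d E)) τ)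
    (t : ℝ≥0) (f : Config d E → ℝ), Continuous f →
    Q[{w | τ w ≤ t}.indicator (fun w => f (π (w.1 t))) | hτ.measurableSpace]
      =ᵐ[Q] {w | τ w ≤ t}.indicator
        (fun w => semigroup PE (t - (τ w).untopD 0) f (π (w.1 ((τ w).untopD 0))))

/-- A translation invariant coupling `(η, ξ) ↦ P̂^E_{η,ξ}` of the environment with the strong
marginal Markov property. -/
structure IsEnvironmentCoupling (PE : Kernel (Config d E) (CadlagPath (Config d E)))
    (Q : Config d E → Config d E → Measure (CadlagPath (Config d E × Config d E))) : Prop where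
  prob : ∀ η ξ, IsProbabilityMeasure (Q η ξ)
  marginal_fst : ∀ η ξ (A : Set (ℝ≥0 → Config d E)), MeasurableSet A →
    Q η ξ {w | (fun t => (w.1 t).1) ∈ A} = PE η {w | w.1 ∈ A}
  marginal_snd : ∀ η ξ (A : Set (ℝ≥0 → Config d E)), MeasurableSet A →
    Q η ξ {w | (fun t => (w.1 t).2) ∈ A} = PE ξ {w | w.1 ∈ A}
  translation : ∀ (x : IntLattice d) η ξ (t : ℝ≥0) (A : Set (Config d E × Config d E)),
    MeasurableSet A →
    Q η ξ {w | (shiftConfig x (w.1 t).1, shiftConfig x (w.1 t).2) ∈ A}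
      = Q (shiftConfig x η) (shiftConfig x ξ) {w | w.1 t ∈ A}
  markov_fst : ∀ η ξ, StrongMarginalMarkov PE (Q η ξ) Prod.fst
  markov_snd : ∀ η ξ, StrongMarginalMarkov PE (Q η ξ) Prod.snd

/-- `∫_0^∞ t^d sup_{η,ξ} Ê_{η,ξ} ρ(η¹_t(0), η²_t(0)) dt < ∞`. -/
def IntegrableCouplingDecay
    (Q : Config d E → Config d E → Measure (CadlagPath (Config d E × Config d E))) : Prop :=
  ∫⁻ t in Ioi (0 : ℝ), ENNReal.ofReal (t ^ d) *
    ⨆ (η : Config d E) (ξ : Config d E),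
      ∫⁻ w, edist ((w.1 t.toNNReal).1 0) ((w.1 t.toNNReal).2 0) ∂(Q η ξ) < ∞

end Environment

/-! ### The walker and the environment process -/

section Walk

variable {d : ℕ} {E : Type*} [MetricSpace E] [MeasurableSpace E]

/-- `P_{η,x}` are the path measures of the Markov process `(η_t, X_t)` on `Ω × ℤ^d` with generator
`L f(η,x) = L^E f(·,x)(η) + ∑_z α(θ_{-x} η, z) [f(η,x+z) - f(η,x)]`.
The formula for the generator is required for the `f` that vanish for all but finitely many `x`
and have `f(·,x)` in the domain of `L^E` for every `x`; here `g x = L^E f(·,x)`. -/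
structure IsWalkInEnvironment (PE : Kernel (Config d E) (CadlagPath (Config d E)))
    (α : Config d E → IntLattice d → ℝ)
    (P : Kernel (Config d E × IntLattice d) (CadlagPath (Config d E × IntLattice d))) : Prop where
  markov : IsMarkovProcess P
  generator : ∀ f g : IntLattice d → Config d E → ℝ,
    {x | f x ≠ 0}.Finite → (∀ x, Continuous (f x)) → (∀ x, HasGenerator PE (f x) (g x)) →
    HasGenerator P (fun p => f p.2 p.1)
      (fun p => g p.2 p.1
        + ∑' z : IntLattice d, α (shiftConfig (-p.2) p.1) z * (f (p.2 + z) p.1 - f p.2 p.1))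

/-- The position `X_t`, as a vector of `ℝ^d`. -/
def walker (w : CadlagPath (Config d E × IntLattice d)) (t : ℝ≥0) : Fin d → ℝ :=
  fun i => ((w.1 t).2 i : ℝ)

/-- The environment process `θ_{-X_t} η_t`. -/
def seenFromWalker (w : CadlagPath (Config d E × IntLattice d)) (t : ℝ≥0) : Config d E :=
  shiftConfig (-(w.1 t).2) (w.1 t).1

/-- The measure `μ` is stationary for the environment process, whose law started from `η` is that
of `θ_{-X_t} η_t` under `P_{η,0}`. -/
def IsStationaryEP (P : Kernel (Config d E × IntLattice d) (CadlagPath (Config d E × IntLattice d)))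
    (μ : Measure (Config d E)) : Prop :=
  ∀ (t : ℝ≥0) (A : Set (Config d E)), MeasurableSet A →
    ∫⁻ η, P (η, 0) {w | seenFromWalker w t ∈ A} ∂μ = μ A

/-- The measure `μ` is ergodic for the environment process: it is stationary and every
almost surely invariant set is trivial. -/
def IsErgodicEP (P : Kernel (Config d E × IntLattice d) (CadlagPath (Config d E × IntLattice d)))
    (μ : Measure (Config d E)) : Prop :=
  IsStationaryEP P μ ∧ ∀ A : Set (Config d E), MeasurableSet A →
    (∀ t : ℝ≥0, ∀ᵐ η ∂μ, P (η, 0) {w | seenFromWalker w t ∈ A} = A.indicator 1 η) →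
    μ A = 0 ∨ μ A = 1

/-- The local drift `∑_z z α(η, z)`. -/
noncomputable def localDrift (α : Config d E → IntLattice d → ℝ) (η : Config d E) : Fin d → ℝ :=
  ∑' z : IntLattice d, α η z • (fun i => (z i : ℝ))

end Walk

/-! ### Joint measurability of paths and the Markov property in integral form -/

section PathKernel

variable {S : Type*} [TopologicalSpace S] [MeasurableSpace S]

/-! Imagine two walkers, started at the same site in two coupled environments, that jump together
whenever their rates allow it. With M the sum of ‖z‖ times the supremal rate of z, a walker
essentially stays in the cone ‖y‖ ≤ (M+1)r, which at time r has of the order of r^d sites. Hence t^d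
times the coupling distance of the environments, integrated over time, controls the expected loss of
coupling; after a late time T the total loss is at most 1/2. With probability e^{-ΛT} no clock has
rung before T. So the walkers stay together with a probability bounded below uniformly in the
starting environments, and the oscillation of a function under the environment process shrinks by a
fixed factor κ < 1, up to an arbitrarily small error (`exists_evolEP_le_add_mul`). Iteration gives
uniform mixing; a weak limit of the laws is the stationary measure, it is the only one, and
uniqueness makes it ergodic.

The coupled walk is never constructed. Lazy jumps make the total jump rate a constant Λ
(`exists_isUniformizedRate`). The generator, tested on functions carried by one site, yields the
forward equation for `evol P`, the decomposition at the last ring of a clock of rate Λ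
(`solvesForward`). Bounded solutions are unique, because each further ring costs a factor 1 -
e^{-Λt} (`SolvesForward.le`). Uniqueness gives the backward equation (`evol_eq_backwardOp`) and
translation covariance; Picard iteration of the backward equation gives the Feller property. Along a
coupled pair of environments the backward equation becomes an inequality for the gap between the
values of `evol P` at two environments and one common walker position (`lintegral_mul_gap_le`), with
an arbitrary weight that depends on the past. Iterating it (`lintegral_mul_gap_le_of_pow`), the
weights collect the rates of the joint jumps, and this replaces the coupled walk. Leaving the cone
is controlled by the Lyapunov function `escape`, which needs only a first moment of the jumps.

For the law of large numbers, mixing provides a bounded corrector: adding the increments of a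
bounded function of the environment process to those of the walk makes the conditional mean of a
unit step constant up to ε (`exists_corrector`). What remains is a sum of martingale differences.
Truncating step k at level k + 1, with the summable maximal bound `measure_exists_le` for the
discarded part and for the motion between integer times, gives almost sure convergence. Truncating
at a fixed level gives an L¹ bound of order √n for the martingale part, uniformly in the starting
environment. -/

lemma CadlagPath.measurable_eval (t : ℝ≥0) : Measurable fun w : CadlagPath S => w.1 t :=
  (measurable_pi_apply t).comp measurable_subtype_coe

/-- By right-continuity, the value at t is the limit of the values at the next grid points to the
right of t; for a fixed mesh only countably many evaluations occur. -/
lemma CadlagPath.measurable_uncurry_eval [TopologicalSpace.PseudoMetrizableSpace S]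
    [BorelSpace S] : Measurable fun q : ℝ≥0 × CadlagPath S => q.2.1 q.1 := by
  let a : ℕ → ℝ≥0 → ℝ≥0 := fun n t => (⌊t * (n + 1)⌋₊ + 1) / (n + 1)
  have hle : ∀ n t, t ≤ a n t := by
    intro n t
    have h : t * (n + 1) ≤ ⌊t * (n + 1)⌋₊ + 1 := (Nat.lt_floor_add_one _).le
    exact (le_div_iff₀ (by positivity)).2 h
  have hub : ∀ n t, a n t ≤ t + 1 / (n + 1) := by
    intro n t
    have h : (⌊t * (n + 1)⌋₊ : ℝ≥0) ≤ t * (n + 1) := Nat.floor_le (by positivity)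
    have h2 : t + 1 / (n + 1) = (t * (n + 1) + 1) / ((n : ℝ≥0) + 1) := by
      field_simp
    rw [h2]
    simp only [a]
    gcongr
  have hlim : ∀ t, Tendsto (fun n => a n t) atTop (𝓝[≥] t) := by
    intro t
    refine tendsto_nhdsWithin_iff.2 ⟨?_, Eventually.of_forall fun n => hle n t⟩
    refine tendsto_of_tendsto_of_tendsto_of_le_of_le tendsto_const_nhds ?_
      (fun n => hle n t) (fun n => hub n t)
    simpa using (tendsto_const_nhds (x := t)).add
      (tendsto_one_div_add_atTop_nhds_zero_nat (𝕜 := ℝ≥0))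
  refine measurable_of_tendsto_metrizable
    (f := fun n (q : ℝ≥0 × CadlagPath S) => q.2.1 (a n q.1)) (fun n => ?_) ?_
  · have h1 : Measurable fun q : ℕ × CadlagPath S => q.2.1 ((q.1 + 1 : ℝ≥0) / (n + 1)) :=
      measurable_from_prod_countable_right fun k =>
        CadlagPath.measurable_eval ((k + 1 : ℝ≥0) / (n + 1))
    have h2 : Measurable fun q : ℝ≥0 × CadlagPath S => (⌊q.1 * (n + 1)⌋₊, q.2) :=
      (Nat.measurable_floor.comp (measurable_fst.mul_const _)).prodMk measurable_snd
    exact h1.comp h2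
  · rw [tendsto_pi_nhds]
    intro q
    have := (q.2.2 q.1).1
    exact Tendsto.comp this (hlim q.1)

/-- The transition operator `f ↦ E_x[f(w_t)]` on nonnegative functions, with real time. -/
noncomputable def evol (P : Kernel S (CadlagPath S)) (t : ℝ) (f : S → ℝ≥0∞) (x : S) : ℝ≥0∞ :=
  ∫⁻ w, f (w.1 t.toNNReal) ∂(P x)


lemma evol_const (P : Kernel S (CadlagPath S)) [IsMarkovKernel P] (t : ℝ) (c : ℝ≥0∞) (x : S) :
    evol P t (fun _ => c) x = c := by
  simp [evol]

lemma evol_mono (P : Kernel S (CadlagPath S)) (t : ℝ) {f g : S → ℝ≥0∞} (h : ∀ x, f x ≤ g x)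
    (x : S) : evol P t f x ≤ evol P t g x :=
  lintegral_mono fun _ => h _

lemma evol_add (P : Kernel S (CadlagPath S)) (t : ℝ) {f g : S → ℝ≥0∞} (hf : Measurable f)
    (x : S) : evol P t (fun y => f y + g y) x = evol P t f x + evol P t g x :=
  lintegral_add_left (hf.comp (CadlagPath.measurable_eval _)) _

lemma evol_const_mul (P : Kernel S (CadlagPath S)) (t : ℝ) {f : S → ℝ≥0∞} (hf : Measurable f)
    (c : ℝ≥0∞) (x : S) : evol P t (fun y => c * f y) x = c * evol P t f x :=
  lintegral_const_mul _ (hf.comp (CadlagPath.measurable_eval _))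

lemma evol_tsum (P : Kernel S (CadlagPath S)) (t : ℝ) {ι : Type*} [Countable ι]
    {f : ι → S → ℝ≥0∞} (hf : ∀ i, Measurable (f i)) (x : S) :
    evol P t (fun y => ∑' i, f i y) x = ∑' i, evol P t (f i) x :=
  lintegral_tsum fun i => ((hf i).comp (CadlagPath.measurable_eval _)).aemeasurable

lemma Measurable.evol [TopologicalSpace.PseudoMetrizableSpace S] [BorelSpace S]
    (P : Kernel S (CadlagPath S)) [IsMarkovKernel P] {A : Type*} [MeasurableSpace A]
    {F : A → S → ℝ≥0∞} {τ : A → ℝ} {ξ : A → S} (hF : Measurable (Function.uncurry F))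
    (hτ : Measurable τ) (hξ : Measurable ξ) :
    Measurable fun a => evol P (τ a) (F a) (ξ a) := by
  have hev : Measurable fun q : A × CadlagPath S => q.2.1 (τ q.1).toNNReal :=
    CadlagPath.measurable_uncurry_eval.comp
      ((measurable_real_toNNReal.comp (hτ.comp measurable_fst)).prodMk measurable_snd)
  have h : Measurable fun q : A × CadlagPath S => F q.1 (q.2.1 (τ q.1).toNNReal) :=
    hF.comp (measurable_fst.prodMk hev)
  exact Measurable.lintegral_kernel_prod_right' (κ := P.comap ξ hξ) h

lemma measurable_evol [TopologicalSpace.PseudoMetrizableSpace S] [BorelSpace S]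
    (P : Kernel S (CadlagPath S)) [IsMarkovKernel P] (t : ℝ) {f : S → ℝ≥0∞} (hf : Measurable f) :
    Measurable (evol P t f) :=
  Measurable.evol P (F := fun _ => f) (hf.comp measurable_snd) measurable_const measurable_id

/-- The law of `w_t` under `P x`, as a kernel in `(t, x)`. -/
noncomputable def transitionKernel [TopologicalSpace.PseudoMetrizableSpace S] [BorelSpace S]
    (P : Kernel S (CadlagPath S)) [IsMarkovKernel P] : Kernel (ℝ × S) S where
  toFun q := (P q.2).map fun w => w.1 q.1.toNNReal
  measurable' := by
    refine Measure.measurable_of_measurable_coe _ fun A hA => ?_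
    have := Measurable.evol P (A := ℝ × S) (F := fun _ => A.indicator 1)
      ((measurable_one.indicator hA).comp measurable_snd) measurable_fst measurable_snd
    convert this using 2 with q
    rw [Measure.map_apply (CadlagPath.measurable_eval _) hA,
      ← lintegral_indicator_one (CadlagPath.measurable_eval _ hA)]
    rfl

instance [TopologicalSpace.PseudoMetrizableSpace S] [BorelSpace S]
    (P : Kernel S (CadlagPath S)) [IsMarkovKernel P] : IsMarkovKernel (transitionKernel P) :=
  ⟨fun _ => Measure.isProbabilityMeasure_map (CadlagPath.measurable_eval _).aemeasurable⟩

lemma lintegral_transitionKernel [TopologicalSpace.PseudoMetrizableSpace S] [BorelSpace S]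
    (P : Kernel S (CadlagPath S)) [IsMarkovKernel P] (t : ℝ) (x : S) {f : S → ℝ≥0∞}
    (hf : Measurable f) : ∫⁻ y, f y ∂(transitionKernel P (t, x)) = evol P t f x :=
  lintegral_map hf (CadlagPath.measurable_eval _)

lemma CadlagPath.measurable_eval_canonicalFiltration {s t : ℝ≥0} (h : s ≤ t) :
    Measurable[canonicalFiltration S t] fun w : CadlagPath S => w.1 s := by
  refine Measurable.mono (comap_measurable _) ?_ le_rfl
  exact le_iSup (fun s : Iic t =>
    (inferInstance : MeasurableSpace S).comap (fun w : CadlagPath S => w.1 s.1)) ⟨s, h⟩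

/-- Conditional expectations give the identity on rectangles, so on an event of the past the joint
law of the states at times s and s + t is a composition product with the transition kernel. This
passes from events of the past to weights `m` of the past. -/
theorem IsMarkovProcess.lintegral_mul_eval {P : Kernel S (CadlagPath S)} (hP : IsMarkovProcess P)
    (x : S) (s t : ℝ≥0) {m : CadlagPath S → ℝ≥0∞} (hm : Measurable[canonicalFiltration S s] m)
    {Φ : S × S → ℝ≥0∞} (hΦ : Measurable Φ) :
    ∫⁻ w, m w * Φ (w.1 s, w.1 (s + t)) ∂(P x)
      = ∫⁻ w, m w * ∫⁻ w', Φ (w.1 s, w'.1 t) ∂(P (w.1 s)) ∂(P x) := by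
  have : IsMarkovKernel P := ⟨hP.prob⟩
  have hle := (canonicalFiltration S).le s
  have ev := fun r => CadlagPath.measurable_eval (S := S) r
  let K : Kernel S S := P.map fun w => w.1 t
  have : IsMarkovKernel K := Kernel.IsMarkovKernel.map _ (ev t)
  have hKΦ : ∀ (y : S) (Ψ : S → ℝ≥0∞), Measurable Ψ → ∫⁻ z, Ψ z ∂(K y) = ∫⁻ w', Ψ (w'.1 t) ∂(P y) := by
    intro y Ψ hΨ
    rw [Kernel.lintegral_map _ (ev t) _ hΨ]
  have hmeasK : Measurable fun y => ∫⁻ w', Φ (y, w'.1 t) ∂(P y) := by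
    have := (hΦ.lintegral_kernel_prod_right' (κ := K))
    convert this using 2 with y
    exact (hKΦ y (fun z => Φ (y, z)) (hΦ.comp measurable_prodMk_left)).symm
  have rect : ∀ A, MeasurableSet[canonicalFiltration S s] A → ∀ C, MeasurableSet C →
      ∫⁻ w in A, C.indicator 1 (w.1 (s + t)) ∂(P x) = ∫⁻ w in A, K (w.1 s) C ∂(P x) := by
    intro A hA C hC
    have hCm : Measurable (C.indicator (1 : S → ℝ)) := measurable_one.indicator hC
    have hb : ∀ y, ‖C.indicator (1 : S → ℝ) y‖ ≤ 1 := fun y =>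
      (norm_indicator_le_norm_self _ _).trans (by simp)
    have hmk := hP.markov x s t (C.indicator 1) hCm ⟨1, hb⟩
    have hint : Integrable (fun w : CadlagPath S => C.indicator (1 : S → ℝ) (w.1 (s + t))) (P x) :=
      Integrable.of_bound (hCm.comp (ev _)).aestronglyMeasurable 1 (.of_forall fun w => hb _)
    have h1 := setIntegral_condExp hle hint hA
    rw [setIntegral_congr_ae (hle _ hA) (hmk.mono fun w hw _ => hw)] at h1
    have hsg : ∀ y, semigroup P t (C.indicator 1) y = (K y).real C := by
      intro y
      have : (fun w : CadlagPath S => C.indicator (1 : S → ℝ) (w.1 t))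
          = ((fun w : CadlagPath S => w.1 t) ⁻¹' C).indicator 1 := rfl
      rw [semigroup, this, integral_indicator_one (ev t hC), Kernel.map_apply _ (ev t),
        measureReal_def, measureReal_def, Measure.map_apply (ev t) hC]
    have h2 : ∀ w : CadlagPath S, K (w.1 s) C
        = ENNReal.ofReal (semigroup P t (C.indicator 1) (w.1 s)) := by
      intro w
      rw [hsg, measureReal_def, ENNReal.ofReal_toReal (measure_ne_top _ _)]
    have hKm : Measurable fun y => semigroup P t (C.indicator 1) y := by
      simp_rw [hsg, measureReal_def]
      exact (K.measurable_coe hC).ennreal_toReal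
    simp_rw [h2]
    rw [← ofReal_integral_eq_lintegral_ofReal, h1, ofReal_integral_eq_lintegral_ofReal]
    · refine lintegral_congr fun w => ?_
      by_cases h : w.1 (s + t) ∈ C <;> simp [h]
    · exact hint.integrableOn
    · exact .of_forall fun w => indicator_nonneg (fun _ _ => zero_le_one) _
    · refine (Integrable.of_bound (hKm.comp (ev s)).aestronglyMeasurable 1
        (.of_forall fun w => ?_)).integrableOn
      rw [Function.comp_apply, hsg, Real.norm_of_nonneg measureReal_nonneg]
      exact measureReal_le_one
    · exact .of_forall fun w => by simp [hsg]
  have key : ∀ A, MeasurableSet[canonicalFiltration S s] A →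
      ∫⁻ w in A, Φ (w.1 s, w.1 (s + t)) ∂(P x)
        = ∫⁻ w in A, ∫⁻ w', Φ (w.1 s, w'.1 t) ∂(P (w.1 s)) ∂(P x) := by
    intro A hA
    have h : ((P x).restrict A).map (fun w => (w.1 s, w.1 (s + t)))
        = (((P x).restrict A).map fun w => w.1 s) ⊗ₘ K := by
      refine Measure.ext_prod fun {B C} hB hC => ?_
      have hB' : MeasurableSet[canonicalFiltration S s] ((fun w : CadlagPath S => w.1 s) ⁻¹' B) :=
        CadlagPath.measurable_eval_canonicalFiltration le_rfl hB
      rw [Measure.map_apply ((ev s).prodMk (ev (s + t))) (hB.prod hC),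
        Measure.compProd_apply_prod hB hC, setLIntegral_map hB (K.measurable_coe hC) (ev s),
        Measure.restrict_restrict (hle _ hB'), ← rect _ (hB'.inter hA) C hC,
        ← Measure.restrict_restrict (hle _ hB')]
      have : (fun w : CadlagPath S => C.indicator (1 : S → ℝ≥0∞) (w.1 (s + t)))
          = ((fun w : CadlagPath S => w.1 (s + t)) ⁻¹' C).indicator 1 := rfl
      rw [this, lintegral_indicator_one (ev _ hC), Measure.restrict_apply (ev _ hC), inter_comm]
      rfl
    rw [← lintegral_map hΦ ((ev s).prodMk (ev (s + t))), h, Measure.lintegral_compProd hΦ,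
      lintegral_map hΦ.lintegral_kernel_prod_right' (ev s)]
    exact lintegral_congr fun w => hKΦ _ (fun z => Φ (w.1 s, z)) (hΦ.comp measurable_prodMk_left)
  have hm1 : Measurable fun w : CadlagPath S => Φ (w.1 s, w.1 (s + t)) :=
    hΦ.comp ((ev s).prodMk (ev (s + t)))
  have hm2 : Measurable fun w : CadlagPath S => ∫⁻ w', Φ (w.1 s, w'.1 t) ∂(P (w.1 s)) :=
    hmeasK.comp (ev s)
  -- Since `m` sees only the past, both sides are integrals of `m` against measures trimmed to the
  -- past, and these need to be compared on events of the past only.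
  have htrim : ∀ g : CadlagPath S → ℝ≥0∞, Measurable g →
      ∫⁻ w, m w * g w ∂(P x) = ∫⁻ w, m w ∂((P x).withDensity g).trim hle := by
    intro g hg
    rw [lintegral_trim hle hm, lintegral_withDensity_eq_lintegral_mul _ hg (hm.mono hle le_rfl)]
    exact lintegral_congr fun w => mul_comm _ _
  rw [htrim _ hm1, htrim _ hm2]
  congr 1
  refine @Measure.ext _ (canonicalFiltration S s) _ _ fun A hA => ?_
  rw [trim_measurableSet_eq hle hA, trim_measurableSet_eq hle hA, withDensity_apply _ (hle _ hA),
    withDensity_apply _ (hle _ hA), key A hA]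

theorem IsMarkovProcess.evol_add_time {P : Kernel S (CadlagPath S)} (hP : IsMarkovProcess P)
    {s t : ℝ} (hs : 0 ≤ s) (ht : 0 ≤ t) {f : S → ℝ≥0∞} (hf : Measurable f) (x : S) :
    evol P (s + t) f x = evol P s (evol P t f) x := by
  have := hP.lintegral_mul_eval x s.toNNReal t.toNNReal (m := fun _ => 1)
    (@measurable_const _ _ _ (canonicalFiltration S _) _) (Φ := fun q => f q.2)
    (hf.comp measurable_snd)
  simp only [one_mul] at this
  rw [evol, Real.toNNReal_add hs ht, this]
  rfl

theorem IsMarkovProcess.evol_zero {P : Kernel S (CadlagPath S)} (hP : IsMarkovProcess P)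
    (f : S → ℝ≥0∞) (x : S) : evol P 0 f x = f x := by
  have := hP.prob x
  rw [evol, lintegral_congr_ae (g := fun _ => f x)]
  · simp
  · filter_upwards [hP.start x] with w hw
    simp [hw]

end PathKernel

/-! ### Transition semigroups and functions with smooth orbits -/

section Semigroup

variable {S : Type*} [TopologicalSpace S] [MeasurableSpace S]

lemma integrable_eval (P : Kernel S (CadlagPath S)) [IsMarkovKernel P] {f : S → ℝ}
    (hf : Measurable f) {B : ℝ} (hB : ∀ y, |f y| ≤ B) (t : ℝ≥0) (x : S) :
    Integrable (fun w : CadlagPath S => f (w.1 t)) (P x) :=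
  Integrable.of_bound (hf.comp (CadlagPath.measurable_eval t)).aestronglyMeasurable B
    (.of_forall fun _ => hB _)

lemma semigroup_const (P : Kernel S (CadlagPath S)) [IsMarkovKernel P] (t : ℝ≥0) (c : ℝ) (x : S) :
    semigroup P t (fun _ => c) x = c := by
  simp [semigroup]

lemma abs_semigroup_sub_le (P : Kernel S (CadlagPath S)) [IsMarkovKernel P] {f g : S → ℝ}
    (hf : Measurable f) (hg : Measurable g) {B B' ε : ℝ} (hB : ∀ y, |f y| ≤ B)
    (hB' : ∀ y, |g y| ≤ B') (h : ∀ y, |f y - g y| ≤ ε) (t : ℝ≥0) (x : S) :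
    |semigroup P t f x - semigroup P t g x| ≤ ε := by
  rw [semigroup, semigroup,
    ← integral_sub (integrable_eval P hf hB t x) (integrable_eval P hg hB' t x)]
  have := norm_integral_le_of_norm_le_const (μ := P x)
    (f := fun w : CadlagPath S => f (w.1 t) - g (w.1 t)) (.of_forall fun w => h (w.1 t))
  simpa using this

lemma abs_semigroup_le (P : Kernel S (CadlagPath S)) [IsMarkovKernel P] {f : S → ℝ}
    {B : ℝ} (hB : ∀ y, |f y| ≤ B) (t : ℝ≥0) (x : S) :
    |semigroup P t f x| ≤ B := by
  have := norm_integral_le_of_norm_le_const (μ := P x)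
    (f := fun w : CadlagPath S => f (w.1 t)) (.of_forall fun w => hB (w.1 t))
  simpa [semigroup] using this

lemma semigroup_sub (P : Kernel S (CadlagPath S)) [IsMarkovKernel P] {f g : S → ℝ}
    (hf : Measurable f) (hg : Measurable g) {B B' : ℝ} (hB : ∀ y, |f y| ≤ B)
    (hB' : ∀ y, |g y| ≤ B') (t : ℝ≥0) (x : S) :
    semigroup P t (fun y => f y - g y) x = semigroup P t f x - semigroup P t g x :=
  integral_sub (integrable_eval P hf hB t x) (integrable_eval P hg hB' t x)

lemma semigroup_add (P : Kernel S (CadlagPath S)) [IsMarkovKernel P] {f g : S → ℝ}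
    (hf : Measurable f) (hg : Measurable g) {B B' : ℝ} (hB : ∀ y, |f y| ≤ B)
    (hB' : ∀ y, |g y| ≤ B') (t : ℝ≥0) (x : S) :
    semigroup P t (fun y => f y + g y) x = semigroup P t f x + semigroup P t g x :=
  integral_add (integrable_eval P hf hB t x) (integrable_eval P hg hB' t x)

lemma semigroup_const_mul (P : Kernel S (CadlagPath S)) (f : S → ℝ) (c : ℝ) (t : ℝ≥0) (x : S) :
    semigroup P t (fun y => c * f y) x = c * semigroup P t f x :=
  integral_const_mul _ _

lemma Measurable.semigroup [TopologicalSpace.PseudoMetrizableSpace S] [BorelSpace S]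
    (P : Kernel S (CadlagPath S)) [IsMarkovKernel P] {A : Type*} [MeasurableSpace A]
    {F : A → S → ℝ} {τ : A → ℝ≥0} {ξ : A → S} (hF : Measurable (Function.uncurry F))
    (hτ : Measurable τ) (hξ : Measurable ξ) :
    Measurable fun a => semigroup P (τ a) (F a) (ξ a) := by
  have hev : Measurable fun q : A × CadlagPath S => q.2.1 (τ q.1) :=
    CadlagPath.measurable_uncurry_eval.comp ((hτ.comp measurable_fst).prodMk measurable_snd)
  have h : Measurable fun q : A × CadlagPath S => F q.1 (q.2.1 (τ q.1)) :=
    hF.comp (measurable_fst.prodMk hev)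
  exact (StronglyMeasurable.integral_kernel_prod_right' (κ := P.comap ξ hξ)
    h.stronglyMeasurable).measurable

lemma measurable_semigroup [TopologicalSpace.PseudoMetrizableSpace S] [BorelSpace S]
    (P : Kernel S (CadlagPath S)) [IsMarkovKernel P] (t : ℝ≥0) {f : S → ℝ} (hf : Measurable f) :
    Measurable (semigroup P t f) :=
  Measurable.semigroup P (F := fun _ => f) (hf.comp measurable_snd) measurable_const measurable_id

theorem IsMarkovProcess.semigroup_add_time {P : Kernel S (CadlagPath S)} (hP : IsMarkovProcess P)
    (s t : ℝ≥0) {f : S → ℝ} (hf : Measurable f) {B : ℝ} (hB : ∀ y, |f y| ≤ B) (x : S) :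
    semigroup P (s + t) f x = semigroup P s (semigroup P t f) x := by
  have : IsMarkovKernel P := ⟨hP.prob⟩
  have h := integral_condExp (μ := P x) (f := fun w : CadlagPath S => f (w.1 (s + t)))
    ((canonicalFiltration S).le s)
  rw [integral_congr_ae (hP.markov x s t f hf ⟨B, hB⟩)] at h
  exact h.symm

theorem IsMarkovProcess.semigroup_zero {P : Kernel S (CadlagPath S)} (hP : IsMarkovProcess P)
    (f : S → ℝ) (x : S) : semigroup P 0 f x = f x := by
  have := hP.prob x
  rw [semigroup, integral_congr_ae (g := fun _ => f x)]
  · simp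
  · filter_upwards [hP.start x] with w hw
    simp [hw]

lemma tendsto_semigroup_right (P : Kernel S (CadlagPath S)) [IsMarkovKernel P]
    [OpensMeasurableSpace S] {f : S → ℝ} (hf : Continuous f) {B : ℝ} (hB : ∀ y, |f y| ≤ B)
    (t : ℝ≥0) (x : S) :
    Tendsto (fun s => semigroup P s f x) (𝓝[≥] t) (𝓝 (semigroup P t f x)) := by
  refine tendsto_integral_filter_of_dominated_convergence (fun _ => B)
    (.of_forall fun s => (hf.measurable.comp (CadlagPath.measurable_eval s)).aestronglyMeasurable)
    (.of_forall fun s => .of_forall fun w => hB _) (integrable_const _) (.of_forall fun w => ?_)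
  exact (hf.tendsto _).comp (w.2 t).1

/-- A function `φ` in the domain of the generator, with image `ℓ`, whose orbits are `C^{1,1}`. -/
structure IsSmoothOrbit (P : Kernel S (CadlagPath S)) (C : ℝ) (φ ℓ : S → ℝ) : Prop where
  continuous_fst : Continuous φ
  continuous_snd : Continuous ℓ
  bound_fst : ∀ x, |φ x| ≤ C
  bound_snd : ∀ x, |ℓ x| ≤ C
  expansion : ∀ (r : ℝ≥0) x, |semigroup P r φ x - φ x - r * ℓ x| ≤ C * r ^ 2
  lipschitz : ∀ (r : ℝ≥0) x, |semigroup P r ℓ x - ℓ x| ≤ C * r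

lemma IsSmoothOrbit.hasGenerator {P : Kernel S (CadlagPath S)} {C : ℝ} {φ ℓ : S → ℝ}
    (h : IsSmoothOrbit P C φ ℓ) : HasGenerator P φ ℓ := by
  rw [HasGenerator, Metric.tendstoUniformly_iff]
  intro ε hε
  have h0 : Tendsto (fun t : ℝ≥0 => C * (t : ℝ)) (𝓝[>] 0) (𝓝 0) := by
    have : Continuous fun t : ℝ≥0 => C * (t : ℝ) := by fun_prop
    simpa using (this.tendsto 0).mono_left nhdsWithin_le_nhds
  filter_upwards [h0.eventually_lt_const hε, self_mem_nhdsWithin] with t ht ht0 x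
  have ht0 : (0 : ℝ) < t := ht0
  rw [dist_comm, Real.dist_eq]
  have := h.expansion t x
  rw [show (semigroup P t φ x - φ x) / (t : ℝ) - ℓ x
    = (semigroup P t φ x - φ x - t * ℓ x) / t by field_simp, abs_div, abs_of_pos ht0,
    div_lt_iff₀ ht0]
  nlinarith

variable [TopologicalSpace.PseudoMetrizableSpace S] [BorelSpace S]

/-- S_u commutes with every S_r and contracts the sup norm, so all the bounds survive with the same
constant C. The uniformity in u is what Duhamel's formula needs. -/
lemma IsSmoothOrbit.semigroup {P : Kernel S (CadlagPath S)} (hP : IsMarkovProcess P)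
    (hfeller : ∀ (t : ℝ≥0) (f : S → ℝ), Continuous f → Continuous (semigroup P t f))
    {C : ℝ} {φ ℓ : S → ℝ} (h : IsSmoothOrbit P C φ ℓ) (u : ℝ≥0) :
    IsSmoothOrbit P C (semigroup P u φ) (semigroup P u ℓ) := by
  have : IsMarkovKernel P := ⟨hP.prob⟩
  have mφ := h.continuous_fst.measurable
  have mℓ := h.continuous_snd.measurable
  refine ⟨hfeller _ _ h.continuous_fst, hfeller _ _ h.continuous_snd,
    abs_semigroup_le P h.bound_fst u, abs_semigroup_le P h.bound_snd u, fun r x => ?_, fun r x => ?_⟩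
  · rw [← hP.semigroup_add_time r u mφ h.bound_fst, add_comm,
      hP.semigroup_add_time u r mφ h.bound_fst, ← semigroup_const_mul, 
      ← semigroup_sub P (measurable_semigroup P r mφ) mφ (abs_semigroup_le P h.bound_fst r)
        h.bound_fst, ← semigroup_sub P (B := C + C) (B' := r * C)]
    · exact abs_semigroup_le P (h.expansion r) u x
    · exact (measurable_semigroup P r mφ).sub mφ
    · exact mℓ.const_mul _
    · exact fun y => (abs_sub _ _).trans (add_le_add (abs_semigroup_le P h.bound_fst r y) (h.bound_fst y))
    · intro y
      rw [abs_mul, NNReal.abs_eq]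
      exact mul_le_mul_of_nonneg_left (h.bound_snd y) r.2
  · rw [← hP.semigroup_add_time r u mℓ h.bound_snd, add_comm,
      hP.semigroup_add_time u r mℓ h.bound_snd,
      ← semigroup_sub P (measurable_semigroup P r mℓ) mℓ (abs_semigroup_le P h.bound_snd r)
        h.bound_snd]
    exact abs_semigroup_le P (h.lipschitz r) u x

/-- `∫_0^h S_u ψ du`. -/
noncomputable def orbitIntegral (P : Kernel S (CadlagPath S)) (h : ℝ) (ψ : S → ℝ) (x : S) : ℝ :=
  ∫ u in (0 : ℝ)..h, _root_.semigroup P u.toNNReal ψ x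

lemma measurable_orbit (P : Kernel S (CadlagPath S)) [IsMarkovKernel P] {ψ : S → ℝ}
    (hψ : Measurable ψ) (x : S) : Measurable fun u : ℝ => _root_.semigroup P u.toNNReal ψ x :=
  Measurable.semigroup P (F := fun _ => ψ) (hψ.comp measurable_snd) measurable_real_toNNReal
    measurable_const

lemma intervalIntegrable_orbit (P : Kernel S (CadlagPath S)) [IsMarkovKernel P] {ψ : S → ℝ}
    (hψ : Measurable ψ) {B : ℝ} (hB : ∀ y, |ψ y| ≤ B) (x : S) (a b : ℝ) :
    IntervalIntegrable (fun u : ℝ => _root_.semigroup P u.toNNReal ψ x) volume a b := by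
  rw [intervalIntegrable_iff]
  exact Measure.integrableOn_of_bounded (M := B) (by simp)
    (measurable_orbit P hψ x).aestronglyMeasurable
    (.of_forall fun u => abs_semigroup_le P hB _ x)

lemma IsMarkovProcess.semigroup_orbitIntegral {P : Kernel S (CadlagPath S)}
    (hP : IsMarkovProcess P) {ψ : S → ℝ} (hψ : Measurable ψ) {B : ℝ} (hB : ∀ y, |ψ y| ≤ B)
    {h : ℝ} (hh : 0 ≤ h) (r : ℝ≥0) (x : S) :
    _root_.semigroup P r (orbitIntegral P h ψ) x
      = ∫ u in (r : ℝ)..(r + h), _root_.semigroup P u.toNNReal ψ x := by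
  have : IsMarkovKernel P := ⟨hP.prob⟩
  have hm : Measurable fun q : CadlagPath S × ℝ => _root_.semigroup P q.2.toNNReal ψ (q.1.1 r) :=
    Measurable.semigroup P (F := fun _ => ψ) (hψ.comp measurable_snd)
      (measurable_real_toNNReal.comp measurable_snd)
      ((CadlagPath.measurable_eval r).comp measurable_fst)
  rw [_root_.semigroup]
  simp only [orbitIntegral, intervalIntegral.integral_of_le hh]
  rw [integral_integral_swap]
  · rw [← intervalIntegral.integral_of_le hh]
    have h1 : ∀ u ∈ uIcc 0 h, (∫ w, _root_.semigroup P u.toNNReal ψ (w.1 r) ∂(P x))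
        = _root_.semigroup P (u + r).toNNReal ψ x := by
      intro u hu
      rw [uIcc_of_le hh] at hu
      rw [Real.toNNReal_add hu.1 r.coe_nonneg, add_comm, Real.toNNReal_coe,
        hP.semigroup_add_time r _ hψ hB]
      rfl
    rw [intervalIntegral.integral_congr h1,
      intervalIntegral.integral_comp_add_right (fun u => _root_.semigroup P u.toNNReal ψ x)]
    simp [add_comm]
  · refine Integrable.of_bound hm.aestronglyMeasurable B (.of_forall fun q => ?_)
    exact abs_semigroup_le P hB _ _

lemma measurable_orbitIntegral (P : Kernel S (CadlagPath S)) [IsMarkovKernel P] {ψ : S → ℝ}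
    (hψ : Measurable ψ) {h : ℝ} (hh : 0 ≤ h) : Measurable (orbitIntegral P h ψ) := by
  have hm : Measurable fun q : S × ℝ => _root_.semigroup P q.2.toNNReal ψ q.1 :=
    Measurable.semigroup P (F := fun _ => ψ) (hψ.comp measurable_snd)
      (measurable_real_toNNReal.comp measurable_snd) measurable_fst
  have : orbitIntegral P h ψ
      = fun x => ∫ u, _root_.semigroup P u.toNNReal ψ x ∂(volume.restrict (Ioc 0 h)) :=
    funext fun x => intervalIntegral.integral_of_le hh
  rw [this]
  exact hm.stronglyMeasurable.integral_prod_right.measurable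

lemma abs_orbitIntegral_le (P : Kernel S (CadlagPath S)) [IsMarkovKernel P] {ψ : S → ℝ}
    {B : ℝ} (hB : ∀ y, |ψ y| ≤ B) {h : ℝ} (hh : 0 ≤ h) (x : S) :
    |orbitIntegral P h ψ x| ≤ B * h := by
  have := intervalIntegral.norm_integral_le_of_norm_le_const (a := 0) (b := h)
    (f := fun u : ℝ => _root_.semigroup P u.toNNReal ψ x) (C := B)
    (fun u _ => abs_semigroup_le P hB _ x)
  simpa [orbitIntegral, abs_of_nonneg hh] using this

lemma continuous_orbitIntegral (P : Kernel S (CadlagPath S)) [IsMarkovKernel P]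
    (hfeller : ∀ (t : ℝ≥0) (f : S → ℝ), Continuous f → Continuous (_root_.semigroup P t f))
    {ψ : S → ℝ} (hψ : Continuous ψ) {B : ℝ} (hB : ∀ y, |ψ y| ≤ B) (h : ℝ) :
    Continuous (orbitIntegral P h ψ) := by
  refine intervalIntegral.continuous_of_dominated_interval (bound := fun _ => B)
    (fun x => (measurable_orbit P hψ.measurable x).aestronglyMeasurable)
    (fun x => .of_forall fun u _ => abs_semigroup_le P hB _ x) (by simp)
    (.of_forall fun u _ => hfeller _ _ hψ)

/-- S_r moves the time window [0, h] to [r, h + r]; in the difference the common part cancels and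
only the ends of the windows are left. -/
lemma IsMarkovProcess.semigroup_orbitIntegral_sub {P : Kernel S (CadlagPath S)}
    (hP : IsMarkovProcess P) {ψ : S → ℝ} (hψ : Measurable ψ) {B : ℝ} (hB : ∀ y, |ψ y| ≤ B)
    {h : ℝ} (hh : 0 ≤ h) (r : ℝ≥0) (x : S) :
    _root_.semigroup P r (orbitIntegral P h ψ) x - orbitIntegral P h ψ x
      = (∫ u in h..(h + r), _root_.semigroup P u.toNNReal ψ x)
        - ∫ u in (0 : ℝ)..r, _root_.semigroup P u.toNNReal ψ x := by
  have : IsMarkovKernel P := ⟨hP.prob⟩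
  have hi := intervalIntegrable_orbit P hψ hB x
  rw [hP.semigroup_orbitIntegral hψ hB hh, orbitIntegral, add_comm h,
    intervalIntegral.integral_interval_sub_interval_comm (hi _ _) (hi _ _) (hi _ _),
    intervalIntegral.integral_symm 0 (r : ℝ), intervalIntegral.integral_symm _ h]
  ring

/-- Averaging an orbit with Lipschitz dependence on time gives a smooth orbit. -/
lemma IsMarkovProcess.abs_semigroup_orbitIntegral_sub_sub_le {P : Kernel S (CadlagPath S)}
    (hP : IsMarkovProcess P) {ψ : S → ℝ} (hψ : Measurable ψ) {B : ℝ} (hB : ∀ y, |ψ y| ≤ B)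
    {C : ℝ} (hC : ∀ (r : ℝ≥0) x, |_root_.semigroup P r ψ x - ψ x| ≤ C * r)
    (h r : ℝ≥0) (x : S) :
    |_root_.semigroup P r (orbitIntegral P h ψ) x - orbitIntegral P h ψ x
      - r * (_root_.semigroup P h ψ x - ψ x)| ≤ 2 * C * r ^ 2 := by
  have : IsMarkovKernel P := ⟨hP.prob⟩
  have hC0 : 0 ≤ C := by simpa using (abs_nonneg _).trans (hC 1 x)
  have hi := intervalIntegrable_orbit P hψ hB x
  have hc : ∀ (v : ℝ≥0) (u : ℝ), u ∈ uIoc (v : ℝ) (v + r) →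
      ‖_root_.semigroup P u.toNNReal ψ x - _root_.semigroup P v ψ x‖ ≤ C * r := by
    intro v u hu
    rw [uIoc_of_le (by simp)] at hu
    obtain ⟨e, rfl⟩ : ∃ e : ℝ≥0, u = v + e := ⟨(u - v).toNNReal, by rw [Real.coe_toNNReal _ (by linarith [hu.1])]; ring⟩
    have he : e ≤ r := by exact_mod_cast (add_le_add_iff_left (v : ℝ)).1 hu.2
    rw [Real.toNNReal_add v.coe_nonneg e.coe_nonneg, Real.toNNReal_coe, Real.toNNReal_coe,
      hP.semigroup_add_time v e hψ hB]
    refine (abs_semigroup_sub_le P (measurable_semigroup P e hψ) hψ (abs_semigroup_le P hB e) hB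
      (hC e) v x).trans ?_
    gcongr
  have e1 : ∀ v : ℝ≥0, |(∫ u in (v : ℝ)..(v + r), _root_.semigroup P u.toNNReal ψ x)
      - r * _root_.semigroup P v ψ x| ≤ C * r ^ 2 := by
    intro v
    have := intervalIntegral.norm_integral_le_of_norm_le_const (hc v)
    rw [intervalIntegral.integral_sub (hi _ _) (by simp)] at this
    simpa [abs_of_nonneg, sq, mul_assoc] using this
  have h1 := e1 h
  have h2 := e1 0
  rw [hP.semigroup_zero, NNReal.coe_zero, zero_add] at h2
  rw [hP.semigroup_orbitIntegral_sub hψ hB h.coe_nonneg]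
  rw [abs_le] at *
  constructor <;> nlinarith [h1.1, h1.2, h2.1, h2.2]

lemma IsMarkovProcess.abs_semigroup_orbitIntegral_sub_le {P : Kernel S (CadlagPath S)}
    (hP : IsMarkovProcess P) {ψ : S → ℝ} (hψ : Measurable ψ) {B : ℝ} (hB : ∀ y, |ψ y| ≤ B)
    (h r : ℝ≥0) (x : S) :
    |_root_.semigroup P r (orbitIntegral P h ψ) x - orbitIntegral P h ψ x| ≤ 2 * B * r := by
  have : IsMarkovKernel P := ⟨hP.prob⟩
  rw [hP.semigroup_orbitIntegral_sub hψ hB h.coe_nonneg]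
  have e1 : ∀ v : ℝ, |∫ u in v..(v + r), _root_.semigroup P u.toNNReal ψ x| ≤ B * r := by
    intro v
    have := intervalIntegral.norm_integral_le_of_norm_le_const (a := v) (b := v + r)
      (f := fun u : ℝ => _root_.semigroup P u.toNNReal ψ x) (C := B)
      (fun u _ => abs_semigroup_le P hB _ x)
    simpa [abs_of_nonneg] using this
  have h1 := e1 h
  have h2 := e1 0
  rw [zero_add] at h2
  rw [abs_le] at *
  constructor <;> linarith [h1.1, h1.2, h2.1, h2.2]

/-- One time average makes an orbit Lipschitz in time; a second one makes it differentiable, with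
the Lipschitz derivative S_h ψ₁ - ψ₁, where ψ₁ is the first average. This supplies elements of the
domain without appeal to strong continuity. -/
theorem IsMarkovProcess.exists_isSmoothOrbit {P : Kernel S (CadlagPath S)}
    (hP : IsMarkovProcess P)
    (hfeller : ∀ (t : ℝ≥0) (f : S → ℝ), Continuous f → Continuous (_root_.semigroup P t f))
    {ψ : S → ℝ} (hψ : Continuous ψ) {B : ℝ} (hB : ∀ y, |ψ y| ≤ B) (h : ℝ≥0) :
    ∃ C ℓ, IsSmoothOrbit P C (orbitIntegral P h (orbitIntegral P h ψ)) ℓ := by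
  have : IsMarkovKernel P := ⟨hP.prob⟩
  rcases isEmpty_or_nonempty S with hS | ⟨⟨x0⟩⟩
  · exact ⟨0, fun _ => 0, continuous_of_const fun x => isEmptyElim x, continuous_const,
      fun x => isEmptyElim x, fun x => isEmptyElim x, fun _ x => isEmptyElim x,
      fun _ x => isEmptyElim x⟩
  have hB0 : 0 ≤ B := (abs_nonneg _).trans (hB x0)
  set ψ₁ := orbitIntegral P h ψ with hψ₁
  have c1 : Continuous ψ₁ := continuous_orbitIntegral P hfeller hψ hB h
  have b1 : ∀ y, |ψ₁ y| ≤ B * h := abs_orbitIntegral_le P hB h.coe_nonneg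
  have L1 : ∀ (r : ℝ≥0) x, |_root_.semigroup P r ψ₁ x - ψ₁ x| ≤ 2 * B * r :=
    hP.abs_semigroup_orbitIntegral_sub_le hψ.measurable hB h
  have b2 := abs_semigroup_le P b1 h
  have m1 := measurable_semigroup P h c1.measurable
  have hl : ∀ x, |_root_.semigroup P h ψ₁ x - ψ₁ x| ≤ 2 * (B * h) := fun x =>
    (abs_sub _ _).trans (by linarith [b1 x, b2 x])
  -- The sum of the separate constants: 4B for the expansion and for the Lipschitz estimate, 2Bh for
  -- the bound on ℓ, Bh² for the bound on φ.
  refine ⟨4 * B + 2 * (B * h) + B * h * h, fun x => _root_.semigroup P h ψ₁ x - ψ₁ x,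
    continuous_orbitIntegral P hfeller c1 b1 h, (hfeller _ _ c1).sub c1, fun x => ?_, fun x => ?_,
    fun r x => ?_, fun r x => ?_⟩
  · refine (abs_orbitIntegral_le P b1 h.coe_nonneg x).trans ?_
    have : 0 ≤ B * h := by positivity
    linarith
  · refine (hl x).trans ?_
    have : 0 ≤ B * h * h := by positivity
    linarith
  · refine (hP.abs_semigroup_orbitIntegral_sub_sub_le c1.measurable b1 L1 h r x).trans ?_
    have : 0 ≤ B * h * h := by positivity
    have : 0 ≤ B * h := by positivity
    gcongr
    linarith
  · rw [semigroup_sub P m1 c1.measurable b2 b1, ← hP.semigroup_add_time r h c1.measurable b1, add_comm r,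
      hP.semigroup_add_time h r c1.measurable b1, sub_sub_sub_comm]
    have e1 := abs_semigroup_sub_le P (measurable_semigroup P r c1.measurable) c1.measurable
      (abs_semigroup_le P b1 r) b1 (L1 r) h x
    refine (abs_sub _ _).trans ((add_le_add e1 (L1 r x)).trans ?_)
    have : 0 ≤ B * h * h * r := by positivity
    have : 0 ≤ B * h * r := by positivity
    linarith

/-- The double average involves S_u ψ(x) only for u ≤ 2h, and u ↦ S_u ψ(x) is right-continuous at 0.
Pointwise convergence is enough later, by dominated convergence. -/
theorem IsMarkovProcess.tendsto_orbitIntegral_orbitIntegral {P : Kernel S (CadlagPath S)}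
    (hP : IsMarkovProcess P) {ψ : S → ℝ} (hψ : Continuous ψ) {B : ℝ} (hB : ∀ y, |ψ y| ≤ B) (x : S) :
    Tendsto (fun h : ℝ≥0 => ((h : ℝ) ^ 2)⁻¹ * orbitIntegral P h (orbitIntegral P h ψ) x)
      (𝓝[>] 0) (𝓝 (ψ x)) := by
  have : IsMarkovKernel P := ⟨hP.prob⟩
  have m := hψ.measurable
  have hr := tendsto_semigroup_right P hψ hB 0 x
  rw [hP.semigroup_zero, Metric.tendsto_nhdsWithin_nhds] at hr
  rw [Metric.tendsto_nhdsWithin_nhds]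
  intro ε hε
  obtain ⟨δ, hδ, H⟩ := hr (ε / 2) (by positivity)
  refine ⟨δ / 2, by positivity, fun {h} h0 hd => ?_⟩
  have h0' : (0 : ℝ) < h := h0
  have hd' : (h : ℝ) < δ / 2 := by simpa [NNReal.dist_eq] using hd
  have b1 : ∀ y, |orbitIntegral P h ψ y| ≤ B * h := abs_orbitIntegral_le P hB h.coe_nonneg
  have e1 : ∀ v : ℝ, v ∈ uIoc (0 : ℝ) h →
      ‖_root_.semigroup P v.toNNReal (orbitIntegral P h ψ) x - h * ψ x‖ ≤ ε / 2 * h := by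
    intro v hv
    rw [uIoc_of_le h.coe_nonneg] at hv
    rw [hP.semigroup_orbitIntegral m hB h.coe_nonneg, Real.coe_toNNReal _ hv.1.le]
    have : (h : ℝ) * ψ x = ∫ _ in v..(v + h), ψ x := by simp
    rw [this, ← intervalIntegral.integral_sub (intervalIntegrable_orbit P m hB x _ _) (by simp)]
    have := intervalIntegral.norm_integral_le_of_norm_le_const (a := v) (b := v + h)
      (f := fun u : ℝ => _root_.semigroup P u.toNNReal ψ x - ψ x) (C := ε / 2) (fun u hu => ?_)
    · simpa using this
    · rw [uIoc_of_le (by simp)] at hu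
      refine (H (x := u.toNNReal) (by simp) ?_).le
      have : 0 ≤ u := by linarith [hv.1, hu.1]
      rw [NNReal.dist_eq, Real.coe_toNNReal _ this, NNReal.coe_zero, sub_zero, abs_of_nonneg this]
      linarith [hu.2, hv.2]
  have e2 := intervalIntegral.norm_integral_le_of_norm_le_const e1
  rw [intervalIntegral.integral_sub (intervalIntegrable_orbit P
    (measurable_orbitIntegral P m h.coe_nonneg) b1 x _ _) (by simp)] at e2
  change ‖orbitIntegral P h (orbitIntegral P h ψ) x - _‖ ≤ _ at e2
  simp only [intervalIntegral.integral_const, sub_zero, smul_eq_mul, Real.norm_eq_abs,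
    abs_of_pos h0'] at e2
  rw [Real.dist_eq, show ((h : ℝ) ^ 2)⁻¹ * orbitIntegral P h (orbitIntegral P h ψ) x - ψ x
    = (orbitIntegral P h (orbitIntegral P h ψ) x - h * (h * ψ x)) / h ^ 2 by field_simp,
    abs_div, abs_of_pos (by positivity : (0 : ℝ) < h ^ 2), div_lt_iff₀ (by positivity)]
  have : 0 < ε / 2 * (h * h : ℝ) := by positivity
  nlinarith

end Semigroup

/-! ### Duhamel's formula and measure-determining functions -/

section Dynkin

variable {S : Type*} [TopologicalSpace S] [MeasurableSpace S]
  [TopologicalSpace.PseudoMetrizableSpace S] [BorelSpace S]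

/-- Duhamel's formula: the derivative of `s ↦ e^{cs} T_s (g s)` is
`e^{cs} T_s (L (g s) + g' s + c g s)`. -/
theorem IsMarkovProcess.integral_semigroup_eq_sub {P : Kernel S (CadlagPath S)}
    (hP : IsMarkovProcess P) {t : ℝ≥0} {g g' G : ℝ → S → ℝ} {C : ℝ} (c : ℝ)
    (hgm : Measurable (Function.uncurry g)) (hgb : ∀ s x, |g s x| ≤ C)
    (hg' : ∀ s, Continuous (g' s)) (hgb' : ∀ s x, |g' s x| ≤ C)
    (hgm' : Measurable (Function.uncurry g'))
    (hG : Measurable (Function.uncurry G)) (hGb : ∀ s x, |G s x| ≤ C)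
    (hgen : ∀ s : ℝ, 0 ≤ s → s ≤ t → HasGenerator P (g s) (G s))
    (hder : ∀ s h : ℝ, 0 ≤ s → 0 ≤ h → s + h ≤ t → ∀ x,
      |g (s + h) x - g s x - h * g' s x| ≤ C * h ^ 2) (x : S) :
    ∫ s in (0 : ℝ)..t, Real.exp (c * s)
        * semigroup P s.toNNReal (fun y => G s y + g' s y + c * g s y) x
      = Real.exp (c * t) * semigroup P t (g t) x - g 0 x := by
  have hg : ∀ s, Measurable (g s) := fun s => hgm.comp measurable_prodMk_left
  have : IsMarkovKernel P := ⟨hP.prob⟩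
  set F : ℝ → ℝ := fun s => semigroup P s.toNNReal (g s) x with hF
  have mG : ∀ s, Measurable (G s) := fun s => hG.comp measurable_prodMk_left
  have hC : 0 ≤ C := (abs_nonneg _).trans (hgb 0 x)
  -- the increment of `F`
  have hTg : ∀ s h : ℝ, 0 ≤ s → 0 ≤ h → F (s + h) - F s
      = (semigroup P (s + h).toNNReal (g (s + h)) x - semigroup P (s + h).toNNReal (g s) x)
        + (semigroup P s.toNNReal (semigroup P h.toNNReal (g s)) x
          - semigroup P s.toNNReal (g s) x) := by
    intro s h hs hh
    rw [← hP.semigroup_add_time _ _ (hg s) (hgb s), ← Real.toNNReal_add hs hh]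
    simp [hF]
  have hdg : ∀ s h : ℝ, 0 ≤ s → 0 ≤ h → s + h ≤ t → ∀ y,
      |g (s + h) y - g s y| ≤ C * h + C * h ^ 2 := by
    intro s h hs hh hst y
    have h1 := hder s h hs hh hst y
    have h2 : |h * g' s y| ≤ C * h := by
      rw [abs_mul, abs_of_nonneg hh, mul_comm]
      exact mul_le_mul_of_nonneg_right (hgb' s y) hh
    rw [abs_le] at *
    constructor <;> linarith [h1.1, h1.2, h2.1, h2.2]
  have hquot : ∀ s : ℝ, 0 ≤ s → s ≤ t → ∀ ε > 0, ∀ᶠ h : ℝ in 𝓝[>] 0, ∀ y,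
      |semigroup P h.toNNReal (g s) y - g s y - h * G s y| ≤ ε * h := by
    intro s hs hst ε hε
    have h1 := (Metric.tendstoUniformly_iff.1 (hgen s hs hst)) ε hε
    have h2 : Tendsto Real.toNNReal (𝓝[>] 0) (𝓝[>] 0) := by
      refine tendsto_nhdsWithin_iff.2 ⟨?_, ?_⟩
      · simpa using (continuous_real_toNNReal.tendsto 0).mono_left nhdsWithin_le_nhds
      · filter_upwards [self_mem_nhdsWithin] with h hh
        simpa using hh
    filter_upwards [h2.eventually h1, self_mem_nhdsWithin] with h hh h0 y
    have h0 : 0 < h := h0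
    have := hh y
    rw [dist_comm, Real.dist_eq, Real.coe_toNNReal _ h0.le, show
      (semigroup P h.toNNReal (g s) y - g s y) / h - G s y
      = (semigroup P h.toNNReal (g s) y - g s y - h * G s y) / h by field_simp, abs_div,
      abs_of_pos h0, div_lt_iff₀ h0] at this
    exact this.le
  have mT := fun (s h : ℝ) => measurable_semigroup P h.toNNReal (hg s)
  have bT := fun (s h : ℝ) => abs_semigroup_le P (hgb s) h.toNNReal
  -- Right-continuous paths yield only a right derivative; with the continuity of `F` this suffices
  -- for the fundamental theorem of calculus.
  have hright : ∀ s ∈ Ico (0 : ℝ) t, HasDerivWithinAt F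
      (semigroup P s.toNNReal (fun y => G s y + g' s y) x) (Ioi s) s := by
    intro s hs
    rw [hasDerivWithinAt_iff_isLittleO, Asymptotics.isLittleO_iff]
    intro ε hε
    have hsub : Tendsto (fun u : ℝ => u - s) (𝓝[>] s) (𝓝[>] 0) := by
      refine tendsto_nhdsWithin_iff.2 ⟨?_, ?_⟩
      · have : Continuous fun u : ℝ => u - s := by fun_prop
        simpa using (this.tendsto s).mono_left nhdsWithin_le_nhds
      · filter_upwards [self_mem_nhdsWithin] with u hu
        simpa using hu
    have hT' : ∀ᶠ u in 𝓝[>] s, |semigroup P u.toNNReal (g' s) x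
        - semigroup P s.toNNReal (g' s) x| < ε / 4 := by
      have h1 := tendsto_semigroup_right P (hg' s) (hgb' s) s.toNNReal x
      have h2 : Tendsto Real.toNNReal (𝓝[Ioi s] s) (𝓝[Ici s.toNNReal] s.toNNReal) := by
        refine tendsto_nhdsWithin_iff.2
          ⟨(continuous_real_toNNReal.tendsto s).mono_left nhdsWithin_le_nhds, ?_⟩
        filter_upwards [self_mem_nhdsWithin] with u hu
        exact Real.toNNReal_le_toNNReal (le_of_lt hu)
      exact (Metric.tendsto_nhds.1 (h1.comp h2)) (ε / 4) (by positivity)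
    have hsmall : ∀ᶠ u in 𝓝[>] s, C * (u - s) < ε / 4 := by
      have : Continuous fun u : ℝ => C * (u - s) := by fun_prop
      have := (this.tendsto s).mono_left (nhdsWithin_le_nhds (s := Ioi s))
      simp only [sub_self, mul_zero] at this
      exact this.eventually_lt_const (by positivity)
    have hlt : ∀ᶠ u : ℝ in 𝓝[>] s, u ≤ t := by
      filter_upwards [Ioo_mem_nhdsGT hs.2] with u hu using hu.2.le
    filter_upwards [hsub.eventually (hquot s hs.1 hs.2.le (ε / 4) (by positivity)), hT', hsmall,
      hlt, self_mem_nhdsWithin] with u h1 h2 h3 h4 h5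
    obtain ⟨h, rfl⟩ : ∃ h, u = s + h := ⟨u - s, by ring⟩
    have h0 : 0 < h := by simpa using h5
    simp only [add_sub_cancel_left] at *
    have e1 := hTg s h hs.1 h0.le
    have e2 := abs_semigroup_sub_le P (f := fun y => g (s + h) y - g s y) (g := fun y => h * g' s y)
      ((hg _).sub (hg _)) ((hg' s).measurable.const_mul h) (B := C + C) (B' := h * C)
      (fun y => (abs_sub _ _).trans (add_le_add (hgb _ _) (hgb _ _)))
      (fun y => by rw [abs_mul, abs_of_pos h0]; exact mul_le_mul_of_nonneg_left (hgb' s y) h0.le)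
      (hder s h hs.1 h0.le h4) (s + h).toNNReal x
    rw [semigroup_sub P (hg _) (hg _) (hgb _) (hgb _), semigroup_const_mul] at e2
    have e3 := abs_semigroup_sub_le P (f := fun y => semigroup P h.toNNReal (g s) y - g s y)
      (g := fun y => h * G s y)
      ((mT s h).sub (hg _)) ((mG s).const_mul h) (B := C + C) (B' := h * C)
      (fun y => (abs_sub _ _).trans (add_le_add (bT s h y) (hgb _ _)))
      (fun y => by rw [abs_mul, abs_of_pos h0]; exact mul_le_mul_of_nonneg_left (hGb s y) h0.le)
      h1 s.toNNReal x
    rw [semigroup_sub P (mT s h) (hg _) (bT s h) (hgb _), semigroup_const_mul] at e3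
    rw [semigroup_add P (mG s) (hg' s).measurable (hGb s) (hgb' s), Real.norm_eq_abs,
      Real.norm_eq_abs, abs_of_pos h0, smul_eq_mul, e1]
    have h3' : C * h ^ 2 ≤ ε / 4 * h := by nlinarith
    have h2' := abs_lt.1 h2
    rw [abs_le] at *
    constructor <;> nlinarith [e2.1, e2.2, e3.1, e3.2, h2'.1, h2'.2]
  -- Continuity from the left uses the generator at the fixed endpoint s: S_h g_s - g_s is O(h)
  -- uniformly in space, a bound that is kept by S_u with u = s - h.
  have hleft : ∀ s : ℝ, 0 ≤ s → s ≤ t → ContinuousWithinAt F (Icc 0 s) s := by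
    intro s hs hst
    rw [Metric.continuousWithinAt_iff]
    intro ε hε
    obtain ⟨δ, hδ, H⟩ := mem_nhdsGT_iff_exists_Ioc_subset.1 (hquot s hs hst 1 one_pos)
    have hδ : 0 < δ := hδ
    refine ⟨min (min δ 1) (ε / (4 * (1 + C))), by positivity, fun u hu hd => ?_⟩
    obtain ⟨h, rfl⟩ : ∃ h, s = u + h := ⟨s - u, by ring⟩
    have hh : 0 ≤ h := by simpa using hu.2
    rw [Real.dist_eq, show u - (u + h) = -h by ring, abs_neg, abs_of_nonneg hh, lt_min_iff, lt_min_iff] at hd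
    rw [dist_comm, Real.dist_eq]
    rcases hh.eq_or_lt with rfl | h0
    · simpa using hε
    have hd2 : 4 * (1 + C) * h < ε := by
      have := (lt_div_iff₀ (by positivity)).1 hd.2
      linarith
    have a1 := H ⟨h0, hd.1.1.le⟩
    have a2 : ∀ y, |semigroup P h.toNNReal (g (u + h)) y - g (u + h) y| ≤ (1 + C) * h := by
      intro y
      have e1 := a1 y
      have e2 : |h * G (u + h) y| ≤ C * h := by
        rw [abs_mul, abs_of_pos h0, mul_comm]
        exact mul_le_mul_of_nonneg_right (hGb _ y) h0.le
      rw [abs_le] at *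
      constructor <;> linarith [e1.1, e1.2, e2.1, e2.2]
    have a3 := abs_semigroup_sub_le P (mT (u + h) h) (hg _) (bT _ h) (hgb _) a2 u.toNNReal x
    rw [← hP.semigroup_add_time _ _ (hg _) (hgb _), ← Real.toNNReal_add hu.1 h0.le] at a3
    have a4 := abs_semigroup_sub_le P (hg (u + h)) (hg u) (hgb _) (hgb _)
      (hdg u h hu.1 h0.le hst) u.toNNReal x
    have a5 : C * h ^ 2 ≤ C * h := by
      have : h ^ 2 ≤ h := by nlinarith [hd.1.2]
      gcongr
    have a6 : 0 ≤ C * h := by positivity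
    change |semigroup P (u + h).toNNReal (g (u + h)) x - semigroup P u.toNNReal (g u) x| < ε
    rw [abs_lt]
    rw [abs_le] at a3 a4
    constructor <;> nlinarith [a3.1, a3.2, a4.1, a4.2]
  have hcont : ContinuousOn F (Icc 0 t) := by
    intro s hs
    rw [← Icc_union_Icc_eq_Icc hs.1 hs.2]
    refine (hleft s hs.1 hs.2).union ?_
    rcases hs.2.eq_or_lt with h | h
    · rw [h, Icc_self]
      exact continuousWithinAt_singleton
    · have := (hright s ⟨hs.1, h⟩).continuousWithinAt
      exact (continuousWithinAt_Ioi_iff_Ici.1 this).mono Icc_subset_Ici_self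
  have hexp : ∀ s : ℝ, HasDerivAt (fun u => Real.exp (c * u)) (Real.exp (c * s) * c) s := fun s => by
    simpa using ((hasDerivAt_id s).const_mul c).exp
  have hint : IntervalIntegrable (fun s : ℝ => Real.exp (c * s)
      * semigroup P s.toNNReal (fun y => G s y + g' s y + c * g s y) x) volume 0 t := by
    refine IntervalIntegrable.continuousOn_mul ?_ (by fun_prop)
    rw [intervalIntegrable_iff]
    refine Measure.integrableOn_of_bounded (M := C + C + |c| * C) (by simp) ?_
      (.of_forall fun u => ?_)
    · exact (Measurable.semigroup P (F := fun s y => G s y + g' s y + c * g s y)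
        ((hG.add hgm').add (hgm.const_mul c))
        measurable_real_toNNReal measurable_const).aestronglyMeasurable
    · refine abs_semigroup_le P (fun y => (abs_add_le _ _).trans (add_le_add
        ((abs_add_le _ _).trans (add_le_add (hGb _ _) (hgb' _ _))) ?_)) _ x
      rw [abs_mul]
      exact mul_le_mul_of_nonneg_left (hgb _ _) (abs_nonneg c)
  have := intervalIntegral.integral_eq_sub_of_hasDeriv_right_of_le t.coe_nonneg
    (f := fun s => Real.exp (c * s) * F s)
    (ContinuousOn.mul (by fun_prop) hcont) (fun s hs => ?_) hint
  · rw [this]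
    simp [hF, hP.semigroup_zero]
  · have h := (hexp s).hasDerivWithinAt.mul (hright s ⟨hs.1.le, hs.2⟩)
    refine h.congr_deriv ?_
    rw [semigroup_add P (f := fun y => G s y + g' s y) (g := fun y => c * g s y) (B := C + C)
      (B' := |c| * C) ((mG s).add (hg' s).measurable)
      ((hg s).const_mul c) (fun y => (abs_add_le _ _).trans (add_le_add (hGb _ _) (hgb' _ _)))
      (fun y => by rw [abs_mul]; exact mul_le_mul_of_nonneg_left (hgb _ _) (abs_nonneg c)),
      semigroup_const_mul]
    ring

/-- Smooth orbits determine finite measures. -/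
theorem IsMarkovProcess.measure_ext_of_isSmoothOrbit [CompactSpace S]
    {P : Kernel S (CadlagPath S)} (hP : IsMarkovProcess P)
    (hfeller : ∀ (t : ℝ≥0) (f : S → ℝ), Continuous f → Continuous (semigroup P t f))
    {μ ν : Measure S} [IsFiniteMeasure μ] [IsFiniteMeasure ν]
    (h : ∀ C φ ℓ, IsSmoothOrbit P C φ ℓ → (∀ x, 0 ≤ φ x) →
      ∫⁻ x, ENNReal.ofReal (φ x) ∂μ = ∫⁻ x, ENNReal.ofReal (φ x) ∂ν) : μ = ν := by
  have : IsMarkovKernel P := ⟨hP.prob⟩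
  refine ext_of_forall_lintegral_eq_of_IsFiniteMeasure fun f => ?_
  set ψ : S → ℝ := fun x => f x with hψdef
  have hψ : Continuous ψ := NNReal.continuous_coe.comp f.continuous
  obtain ⟨B, hB⟩ := isCompact_univ.exists_bound_of_continuousOn hψ.continuousOn
  have hψB : ∀ y, |ψ y| ≤ B := fun y => hB y (mem_univ y)
  -- Along h = 1/(n+1) the normalised double averages of ψ have smooth orbits, are bounded by B and
  -- converge to ψ pointwise, so integrals of ψ are limits of integrals of admissible functions.
  let a : ℕ → ℝ≥0 := fun n => 1 / (n + 1)
  have ha : Tendsto a atTop (𝓝[>] 0) := tendsto_nhdsWithin_iff.2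
    ⟨tendsto_one_div_add_atTop_nhds_zero_nat, .of_forall fun n => by
      change 0 < 1 / ((n : ℝ≥0) + 1); positivity⟩
  have hmeas : ∀ n, Measurable (orbitIntegral P (a n) (orbitIntegral P (a n) ψ)) := fun n =>
    measurable_orbitIntegral P (measurable_orbitIntegral P hψ.measurable (a n).coe_nonneg)
      (a n).coe_nonneg
  have hbd : ∀ n x, ((a n : ℝ) ^ 2)⁻¹ * orbitIntegral P (a n) (orbitIntegral P (a n) ψ) x ≤ B := by
    intro n x
    have h1 := abs_orbitIntegral_le P (abs_orbitIntegral_le P hψB (a n).coe_nonneg)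
      (a n).coe_nonneg x
    have h2 : (0 : ℝ) < a n := by change (0 : ℝ) < ((1 / (n + 1) : ℝ≥0) : ℝ); positivity
    rw [inv_mul_le_iff₀ (by positivity)]
    exact (le_abs_self _).trans (h1.trans (by nlinarith))
  have hlim : ∀ (m : Measure S) [IsFiniteMeasure m], Tendsto
      (fun n => ∫⁻ x, ENNReal.ofReal
        (((a n : ℝ) ^ 2)⁻¹ * orbitIntegral P (a n) (orbitIntegral P (a n) ψ) x) ∂m) atTop
      (𝓝 (∫⁻ x, f x ∂m)) := by
    intro m _
    refine tendsto_lintegral_of_dominated_convergence (fun _ => ENNReal.ofReal B)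
      (fun n => ((hmeas n).const_mul _).ennreal_ofReal)
      (fun n => .of_forall fun x => ENNReal.ofReal_le_ofReal (hbd n x))
      (by simp [ENNReal.mul_eq_top]) (.of_forall fun x => ?_)
    have := (hP.tendsto_orbitIntegral_orbitIntegral hψ hψB x).comp ha
    have := (ENNReal.continuous_ofReal.tendsto _).comp this
    rwa [show ENNReal.ofReal (ψ x) = f x by simp [ψ]] at this
  refine tendsto_nhds_unique ?_ (hlim ν)
  refine (hlim μ).congr fun n => ?_
  obtain ⟨C, ℓ, hC⟩ := hP.exists_isSmoothOrbit hfeller hψ hψB (a n)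
  have hn : ∀ (φ : S → ℝ), (∀ x, 0 ≤ φ x) → ∀ x, 0 ≤ orbitIntegral P (a n) φ x := fun φ hφ x =>
    intervalIntegral.integral_nonneg (a n).coe_nonneg fun u _ => integral_nonneg fun w => hφ _
  have := h C _ ℓ hC (hn _ (hn _ fun x => NNReal.coe_nonneg _))
  simp_rw [ENNReal.ofReal_mul (inv_nonneg.2 (sq_nonneg (a n : ℝ)))]
  rw [lintegral_const_mul _ (hmeas n).ennreal_ofReal, this, lintegral_const_mul _ (hmeas n).ennreal_ofReal]

end Dynkin

/-! ### Uniformization of the jump rates -/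

section Rates

variable {d : ℕ} {E : Type*} [MetricSpace E]

/-- Jump rates completed by lazy jumps `z = 0`, so that the total rate is a constant. -/
structure IsUniformizedRate (β : Config d E → IntLattice d → ℝ≥0∞) (lam : IntLattice d → ℝ≥0∞)
    (Λ : ℝ) : Prop where
  continuous : ∀ z, Continuous fun ζ => β ζ z
  pos : 0 < Λ
  tsum_eq : ∀ ζ, ∑' z, β ζ z = ENNReal.ofReal Λ
  le : ∀ ζ z, β ζ z ≤ lam z
  tsum_bound : ∑' z, lam z ≠ ∞
  moment : ∑' z, ‖z‖ₑ * lam z ≠ ∞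
  lipschitz : ∃ κ : IntLattice d → ℝ≥0∞, ∑' x, κ x ≠ ∞ ∧
    ∀ η ξ, ∑' z, (β η z - β ξ z) ≤ ∑' x, κ x * edist (η x) (ξ x)

/-- The operator `J f (η, x) = ∑_z β(θ_{-x} η, z) f(η, x + z)`. -/
noncomputable def jumpOp (β : Config d E → IntLattice d → ℝ≥0∞)
    (f : Config d E × IntLattice d → ℝ≥0∞) (p : Config d E × IntLattice d) : ℝ≥0∞ :=
  ∑' z, β (shiftConfig (-p.2) p.1) z * f (p.1, p.2 + z)

/-- The evolution of the environment alone, the walker being frozen. -/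
noncomputable def evolEnv [MeasurableSpace E] (PE : Kernel (Config d E) (CadlagPath (Config d E)))
    (t : ℝ) (f : Config d E × IntLattice d → ℝ≥0∞) (p : Config d E × IntLattice d) : ℝ≥0∞ :=
  evol PE t (fun ζ => f (ζ, p.2)) p.1

lemma continuous_shiftConfig (x : IntLattice d) :
    Continuous (shiftConfig x : Config d E → Config d E) :=
  continuous_pi fun y => continuous_apply (y - x)

lemma shiftConfig_zero (η : Config d E) : shiftConfig 0 η = η := by
  funext y; simp [shiftConfig]

lemma shiftConfig_shiftConfig (x y : IntLattice d) (η : Config d E) :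
    shiftConfig x (shiftConfig y η) = shiftConfig (x + y) η := by
  funext z; simp only [shiftConfig]; congr 1; abel

lemma DifferExactlyAt.abs_sub_le {f : Config d E → ℝ} {x : IntLattice d} {η ξ : Config d E}
    (h : DifferExactlyAt x η ξ) :
    ENNReal.ofReal |f η - f ξ| ≤ siteLipschitz f x * edist (η x) (ξ x) := by
  have key : ∀ η ξ : Config d E, DifferExactlyAt x η ξ →
      ENNReal.ofReal (f η - f ξ) ≤ siteLipschitz f x * edist (η x) (ξ x) := by
    intro η ξ h
    have h0 : 0 < dist (η x) (ξ x) := dist_pos.2 h.1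
    have h1 : ENNReal.ofReal ((f η - f ξ) / dist (η x) (ξ x)) ≤ siteLipschitz f x :=
      le_iSup₂_of_le η ξ (le_iSup_of_le h le_rfl)
    rw [edist_dist]
    calc ENNReal.ofReal (f η - f ξ)
        = ENNReal.ofReal ((f η - f ξ) / dist (η x) (ξ x) * dist (η x) (ξ x)) := by
          rw [div_mul_cancel₀ _ h0.ne']
      _ = ENNReal.ofReal ((f η - f ξ) / dist (η x) (ξ x)) * ENNReal.ofReal (dist (η x) (ξ x)) :=
          ENNReal.ofReal_mul' h0.le
      _ ≤ _ := by gcongr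
  rcases abs_cases (f η - f ξ) with h' | h'
  · rw [h'.1]; exact key η ξ h
  · rw [h'.1, neg_sub, edist_comm]
    exact key ξ η ⟨h.1.symm, fun y hy => (h.2 y hy).symm⟩

/-- Pass from ξ to η by changing one site at a time. Finitely many changes cost the sum of the site
constants, and continuity of f in the product topology handles the limit. -/
lemma ofReal_abs_sub_le_tsum_siteLipschitz {f : Config d E → ℝ} (hf : Continuous f)
    (η ξ : Config d E) :
    ENNReal.ofReal |f η - f ξ| ≤ ∑' x, siteLipschitz f x * edist (η x) (ξ x) := by
  classical
  let mix : Finset (IntLattice d) → Config d E := fun F x => if x ∈ F then η x else ξ x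
  have hfin : ∀ F : Finset (IntLattice d), ENNReal.ofReal |f (mix F) - f ξ|
      ≤ ∑ x ∈ F, siteLipschitz f x * edist (η x) (ξ x) := by
    intro F
    induction F using Finset.induction_on with
    | empty => simp [mix]
    | insert a F ha ih =>
      rw [Finset.sum_insert ha]
      refine (ENNReal.ofReal_le_ofReal (abs_sub_le _ (f (mix F)) _)).trans ?_
      rw [ENNReal.ofReal_add (abs_nonneg _) (abs_nonneg _)]
      refine add_le_add ?_ ih
      have hne : ∀ y, y ≠ a → mix (insert a F) y = mix F y := fun y hy => by simp [mix, hy]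
      have h1 : mix (insert a F) a = η a := by simp [mix]
      have h2 : mix F a = ξ a := by simp [mix, ha]
      by_cases h : η a = ξ a
      · have : mix (insert a F) = mix F := by
          funext y
          by_cases hy : y = a
          · rw [hy, h1, h2, h]
          · exact hne y hy
        simp [this]
      · have := DifferExactlyAt.abs_sub_le (f := f) (x := a) (η := mix (insert a F)) (ξ := mix F)
          ⟨by rwa [h1, h2], hne⟩
        rwa [h1, h2] at this
  have hlim : Tendsto mix atTop (𝓝 η) := by
    rw [tendsto_pi_nhds]
    intro x
    refine tendsto_const_nhds.congr' ?_
    filter_upwards [eventually_ge_atTop {x}] with F hF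
    have : x ∈ F := hF (Finset.mem_singleton_self x)
    simp [mix, this]
  have h2 : Tendsto (fun F => ENNReal.ofReal |f (mix F) - f ξ|) atTop
      (𝓝 (ENNReal.ofReal |f η - f ξ|)) := by
    have : Continuous fun ζ => ENNReal.ofReal |f ζ - f ξ| :=
      ENNReal.continuous_ofReal.comp (hf.sub continuous_const).abs
    exact (this.tendsto η).comp hlim
  exact le_of_tendsto h2 (.of_forall fun F => (hfin F).trans (ENNReal.sum_le_tsum F))

/-- The rates of the jumps `z ≠ 0`. -/
noncomputable def properRate (α : Config d E → IntLattice d → ℝ) (ζ : Config d E)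
    (z : IntLattice d) : ℝ := if z = 0 then 0 else α ζ z

/-- The uniformization of `α` with total rate `Λ`. -/
noncomputable def uniformize (α : Config d E → IntLattice d → ℝ) (Λ : ℝ) (ζ : Config d E)
    (z : IntLattice d) : ℝ := if z = 0 then Λ - ∑' y, properRate α ζ y else α ζ z

lemma one_le_enorm_intLattice {z : IntLattice d} (hz : z ≠ 0) : 1 ≤ ‖z‖ₑ := by
  obtain ⟨i, hi⟩ := Function.ne_iff.1 hz
  have h1 : (1 : ℝ) ≤ ‖z i‖ := by
    rw [Int.norm_eq_abs]
    exact_mod_cast Int.one_le_abs hi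
  have h2 : (1 : ℝ) ≤ ‖z‖ := h1.trans (norm_le_pi_norm z i)
  rw [← ofReal_norm]
  simpa using ENNReal.ofReal_le_ofReal h2

/-- Jumps by 0 do not move the walker, so their original rate may be discarded. For z ≠ 0 one has
‖z‖ ≥ 1, so the first moment bounds the total rate, and the lazy rate at z = 0 fills it up to Λ. -/
theorem IsJumpRate.exists_isUniformizedRate [CompactSpace E] {α : Config d E → IntLattice d → ℝ}
    (hα : IsJumpRate α) : ∃ (lam : IntLattice d → ℝ≥0∞) (Λ : ℝ),
      (∀ ζ, Summable (properRate α ζ)) ∧ (∀ ζ z, 0 ≤ uniformize α Λ ζ z) ∧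
      IsUniformizedRate (fun ζ z => ENNReal.ofReal (uniformize α Λ ζ z)) lam Λ := by
  classical
  set l : IntLattice d → ℝ≥0∞ := fun z => if z = 0 then 0 else ⨆ ζ, ‖α ζ z‖ₑ with hl
  have hlm : ∀ z, l z ≤ ‖z‖ₑ * ⨆ ζ, ‖α ζ z‖ₑ := by
    intro z
    by_cases hz : z = 0
    · simp [hl, hz]
    · simp only [hl, hz, if_false]
      exact le_mul_of_one_le_left zero_le (one_le_enorm_intLattice hz)
  have hL : ∑' z, l z ≠ ∞ := ((ENNReal.tsum_le_tsum hlm).trans_lt hα.moment).ne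
  have hlt : ∀ z, l z ≠ ∞ := fun z => ENNReal.ne_top_of_tsum_ne_top hL z
  -- The summand 1 keeps Λ positive even when the walker never moves.
  set Λ : ℝ := (∑' z, l z).toReal + 1 with hΛ
  have hΛ0 : 0 < Λ := by positivity
  have hpr0 : ∀ ζ z, 0 ≤ properRate α ζ z := by
    intro ζ z
    unfold properRate
    split_ifs
    · exact le_rfl
    · exact hα.nonneg ζ z
  have hprl : ∀ ζ z, ENNReal.ofReal (properRate α ζ z) ≤ l z := by
    intro ζ z
    by_cases hz : z = 0
    · simp [properRate, hz]
    · simp only [properRate, hl, hz, if_false]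
      rw [← Real.enorm_of_nonneg (hα.nonneg ζ z)]
      exact le_iSup (fun ζ => ‖α ζ z‖ₑ) ζ
  have hprl' : ∀ ζ z, properRate α ζ z ≤ (l z).toReal := fun ζ z =>
    (ENNReal.ofReal_le_iff_le_toReal (hlt z)).1 (hprl ζ z)
  have hlsum : Summable fun z => (l z).toReal := ENNReal.summable_toReal hL
  have hprs : ∀ ζ, Summable (properRate α ζ) := fun ζ =>
    Summable.of_nonneg_of_le (hpr0 ζ) (hprl' ζ) hlsum
  have hprΛ : ∀ ζ, ∑' z, properRate α ζ z ≤ Λ - 1 := by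
    intro ζ
    rw [hΛ, add_sub_cancel_right, ENNReal.tsum_toReal_eq hlt]
    exact (hprs ζ).tsum_le_tsum (hprl' ζ) hlsum
  have hprc : ∀ z, Continuous fun ζ => properRate α ζ z := by
    intro z
    unfold properRate
    split_ifs
    · exact continuous_const
    · exact hα.continuous z
  have hu0 : ∀ ζ z, 0 ≤ uniformize α Λ ζ z := by
    intro ζ z
    unfold uniformize
    split_ifs
    · linarith [hprΛ ζ]
    · exact hα.nonneg ζ z
  have hu : ∀ ζ, uniformize α Λ ζ = fun z => properRate α ζ z
      + (if z = 0 then Λ - ∑' y, properRate α ζ y else 0) := by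
    intro ζ
    funext z
    by_cases hz : z = 0 <;> simp [uniformize, properRate, hz]
  have husum : ∀ ζ, HasSum (uniformize α Λ ζ) Λ := by
    intro ζ
    rw [hu]
    have := (hprs ζ).hasSum.add (hasSum_ite_eq (0 : IntLattice d) (Λ - ∑' y, properRate α ζ y))
    simpa using this
  refine ⟨fun z => if z = 0 then ENNReal.ofReal Λ else l z, Λ, hprs, hu0,
    fun z => ?_, hΛ0, fun ζ => ?_, fun ζ z => ?_, ?_, ?_, ?_⟩
  · refine ENNReal.continuous_ofReal.comp ?_
    unfold uniformize
    split_ifs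
    · refine continuous_const.sub (continuous_tsum hprc hlsum fun z ζ => ?_)
      rw [Real.norm_of_nonneg (hpr0 ζ z)]
      exact hprl' ζ z
    · exact hα.continuous z
  · rw [← ENNReal.ofReal_tsum_of_nonneg (hu0 ζ) (husum ζ).summable, (husum ζ).tsum_eq]
  · by_cases hz : z = 0
    · simp only [hz, if_true, uniformize]
      exact ENNReal.ofReal_le_ofReal (sub_le_self _ (tsum_nonneg (hpr0 ζ)))
    · have := hprl ζ z
      simp only [properRate, hz, if_false] at this
      simpa only [hz, if_false, uniformize] using this
  · refine ((ENNReal.tsum_le_tsum (g := fun z => l z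
      + (if z = 0 then ENNReal.ofReal Λ else 0)) fun z => ?_).trans_lt ?_).ne
    · by_cases hz : z = 0 <;> simp [hz]
    · rw [ENNReal.tsum_add, tsum_ite_eq]
      exact ENNReal.add_lt_top.2 ⟨hL.lt_top, ENNReal.ofReal_lt_top⟩
  · refine ((ENNReal.tsum_le_tsum fun z => ?_).trans_lt hα.moment).ne
    by_cases hz : z = 0 <;> simp [hz, hl]
  -- The factor 2: the lazy rate is Λ minus the sum of the other rates, so it changes by at most as
  -- much as all of them together.
  · refine ⟨fun x => 2 * ∑' z, siteLipschitz (fun ζ => α ζ z) x, ?_, fun η ξ => ?_⟩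
    · rw [ENNReal.tsum_mul_left, ENNReal.tsum_comm]
      exact (ENNReal.mul_lt_top (by simp) hα.lipschitz).ne
    · set A := ∑' z, ENNReal.ofReal |properRate α η z - properRate α ξ z| with hA
      have hAs : Summable fun z => |properRate α ξ z - properRate α η z| :=
        ((hprs ξ).sub (hprs η)).abs
      have hA0 : ENNReal.ofReal (∑' z, properRate α ξ z - ∑' z, properRate α η z) ≤ A := by
        rw [← (hprs ξ).tsum_sub (hprs η), hA]
        simp_rw [abs_sub_comm (properRate α η _)]
        rw [← ENNReal.ofReal_tsum_of_nonneg (fun _ => abs_nonneg _) hAs]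
        refine ENNReal.ofReal_le_ofReal ?_
        exact ((hprs ξ).sub (hprs η)).tsum_le_tsum (fun z => le_abs_self _) hAs
      have hz : ∀ z, ENNReal.ofReal (uniformize α Λ η z) - ENNReal.ofReal (uniformize α Λ ξ z)
          ≤ ENNReal.ofReal |properRate α η z - properRate α ξ z| + (if z = 0 then A else 0) := by
        intro z
        rw [← ENNReal.ofReal_sub _ (hu0 ξ z)]
        by_cases hz : z = 0
        · simp only [uniformize, hz, if_true, sub_sub_sub_cancel_left]
          exact hA0.trans le_add_self
        · simp only [uniformize, properRate, hz, if_false, add_zero]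
          exact ENNReal.ofReal_le_ofReal (le_abs_self _)
      refine (ENNReal.tsum_le_tsum hz).trans ?_
      rw [ENNReal.tsum_add, tsum_ite_eq, ← hA, ← two_mul]
      simp_rw [mul_assoc, ENNReal.tsum_mul_left]
      gcongr
      simp_rw [← ENNReal.tsum_mul_right]
      rw [ENNReal.tsum_comm]
      refine ENNReal.tsum_le_tsum fun z => ?_
      refine le_trans ?_ (ofReal_abs_sub_le_tsum_siteLipschitz (hα.continuous z) η ξ)
      by_cases hz : z = 0 <;> simp [properRate, hz]

/-- The generator of the walk expressed by the uniformized rates. -/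
lemma tsum_uniformize_mul {α : Config d E → IntLattice d → ℝ} {Λ : ℝ} {ζ : Config d E}
    (hs : Summable (properRate α ζ)) {f : IntLattice d → ℝ} {B : ℝ} (hB : ∀ z, |f z| ≤ B) :
    ∑' z, α ζ z * (f z - f 0) + Λ * f 0 = ∑' z, uniformize α Λ ζ z * f z := by
  classical
  have hu : ∀ z, uniformize α Λ ζ z * f z = (properRate α ζ z * f z
      + (if z = 0 then (Λ - ∑' y, properRate α ζ y) * f 0 else 0)) := by
    intro z
    by_cases hz : z = 0 <;> simp [uniformize, properRate, hz]
  have h1 : ∀ z, α ζ z * (f z - f 0) = properRate α ζ z * f z - properRate α ζ z * f 0 := by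
    intro z
    by_cases hz : z = 0
    · simp [hz]
    · simp [properRate, hz]; ring
  have hsf : Summable fun z => properRate α ζ z * f z := by
    refine Summable.of_norm_bounded (g := fun z => |properRate α ζ z| * B) (hs.abs.mul_right B) fun z => ?_
    rw [Real.norm_eq_abs, abs_mul]
    exact mul_le_mul_of_nonneg_left (hB z) (abs_nonneg _)
  simp_rw [hu, h1]
  rw [hsf.tsum_sub (hs.mul_right _), hsf.tsum_add (hasSum_ite_eq _ _).summable, tsum_mul_right,
    tsum_ite_eq]
  ring

end Rates

/-! ### The forward equation for functions carried by one site -/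

section Forward

variable {d : ℕ} {E : Type*} [MetricSpace E] [CompactSpace E] [MeasurableSpace E] [BorelSpace E]

lemma hasGenerator_zero {S : Type*} [TopologicalSpace S] [MeasurableSpace S]
    (P : Kernel S (CadlagPath S)) : HasGenerator P (fun _ => 0) (fun _ => 0) := by
  rw [HasGenerator, Metric.tendstoUniformly_iff]
  intro ε hε
  simp [semigroup, hε]

lemma measurable_shift_neg : Measurable fun q : Config d E × IntLattice d =>
    shiftConfig (-q.2) q.1 :=
  measurable_from_prod_countable_left fun x =>
    (continuous_shiftConfig (E := E) (-x)).measurable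

lemma measurable_rate_apply {R : Type*} [MeasurableSpace R] {b : Config d E → IntLattice d → R}
    (hb : ∀ z, Measurable fun ζ => b ζ z) {A : Type*} [MeasurableSpace A] {ζ : A → Config d E}
    {z : A → IntLattice d} (hζ : Measurable ζ) (hz : Measurable z) :
    Measurable fun a => b (ζ a) (z a) := by
  have : Measurable fun q : Config d E × IntLattice d => b q.1 q.2 :=
    measurable_from_prod_countable_left fun z => hb z
  exact this.comp (hζ.prodMk hz)

/-- Duhamel's formula for g_s = 1_{x = x₀} S^E_{t-s} φ, an admissible test function at every time.
The time derivative of g_s cancels the environment part of the generator and the weight e^{Λs}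
cancels the loss term; only the gain term, jumps that land on x₀, is left. -/
theorem IsWalkInEnvironment.integral_forward {PE : Kernel (Config d E) (CadlagPath (Config d E))}
    (hPE : IsEnvironment PE) {α : Config d E → IntLattice d → ℝ}
    {P : Kernel (Config d E × IntLattice d) (CadlagPath (Config d E × IntLattice d))}
    (hP : IsWalkInEnvironment PE α P) {Λ : ℝ} (hΛ : 0 < Λ)
    (hs : ∀ ζ, Summable (properRate α ζ)) (hu0 : ∀ ζ z, 0 ≤ uniformize α Λ ζ z)
    (huΛ : ∀ ζ z, uniformize α Λ ζ z ≤ Λ) (hum : ∀ z, Measurable fun ζ => uniformize α Λ ζ z)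
    {C : ℝ} {φ ℓ : Config d E → ℝ} (hφ : IsSmoothOrbit PE C φ ℓ) (x₀ : IntLattice d) (t : ℝ≥0)
    (p : Config d E × IntLattice d) :
    ∫ s in (0 : ℝ)..t, Real.exp (Λ * s) * semigroup P s.toNNReal
        (fun q => uniformize α Λ (shiftConfig (-q.2) q.1) (x₀ - q.2)
          * semigroup PE (t - s).toNNReal φ q.1) p
      = Real.exp (Λ * t) * semigroup P t (fun q => if q.2 = x₀ then φ q.1 else 0) p
        - (if p.2 = x₀ then semigroup PE t φ p.1 else 0) := by
  have : IsMarkovKernel PE := ⟨hPE.markov.prob⟩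
  have mφ := hφ.continuous_fst.measurable
  have mℓ := hφ.continuous_snd.measurable
  have hC : 0 ≤ C := (abs_nonneg _).trans (hφ.bound_fst p.1)
  set b := uniformize α Λ with hb
  let g : ℝ → Config d E × IntLattice d → ℝ := fun s q =>
    if q.2 = x₀ then semigroup PE (t - s).toNNReal φ q.1 else 0
  let g' : ℝ → Config d E × IntLattice d → ℝ := fun s q =>
    if q.2 = x₀ then - semigroup PE (t - s).toNNReal ℓ q.1 else 0
  -- The image of g_s under the generator: - g' is the environment part, since L^E S^E_{t-s} φ =
  -- S^E_{t-s} ℓ, and the other two terms are the jump part in uniformized form.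
  let G : ℝ → Config d E × IntLattice d → ℝ := fun s q =>
    b (shiftConfig (-q.2) q.1) (x₀ - q.2) * semigroup PE (t - s).toNNReal φ q.1
      - g' s q - Λ * g s q
  have hset : MeasurableSet {q : ℝ × Config d E × IntLattice d | q.2.2 = x₀} :=
    measurableSet_eq_fun (measurable_snd.comp measurable_snd) measurable_const
  have mS : ∀ {ψ : Config d E → ℝ}, Measurable ψ → Measurable
      fun q : ℝ × Config d E × IntLattice d => semigroup PE (t - q.1).toNNReal ψ q.2.1 := by
    intro ψ hψ
    exact Measurable.semigroup PE (F := fun _ => ψ) (hψ.comp measurable_snd)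
      (measurable_real_toNNReal.comp (measurable_const.sub measurable_fst))
      (measurable_fst.comp measurable_snd)
  have mg : Measurable (Function.uncurry g) := Measurable.ite hset (mS mφ) measurable_const
  have mg' : Measurable (Function.uncurry g') := Measurable.ite hset (mS mℓ).neg measurable_const
  have mbS : Measurable fun q : ℝ × Config d E × IntLattice d =>
      b (shiftConfig (-q.2.2) q.2.1) (x₀ - q.2.2) :=
    measurable_rate_apply hum (measurable_shift_neg.comp measurable_snd)
      (measurable_const.sub (measurable_snd.comp measurable_snd))
  have mG : Measurable (Function.uncurry G) :=
    ((mbS.mul (mS mφ)).sub mg').sub (mg.const_mul Λ)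
  have bφ := fun r => abs_semigroup_le PE hφ.bound_fst r
  have bℓ := fun r => abs_semigroup_le PE hφ.bound_snd r
  have bg : ∀ s q, |g s q| ≤ C := by
    intro s q
    simp only [g]
    split_ifs
    · exact bφ _ _
    · simpa using hC
  have bg' : ∀ s q, |g' s q| ≤ C := by
    intro s q
    simp only [g']
    split_ifs
    · rw [abs_neg]; exact bℓ _ _
    · simpa using hC
  have bbS : ∀ ζ z r η, |b ζ z * semigroup PE r φ η| ≤ Λ * C := by
    intro ζ z r η
    rw [abs_mul, abs_of_nonneg (hu0 _ _)]
    exact mul_le_mul (huΛ _ _) (bφ _ _) (abs_nonneg _) hΛ.le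
  have bG : ∀ s q, |G s q| ≤ Λ * C + C + Λ * C := by
    intro s q
    refine (abs_sub _ _).trans (add_le_add ((abs_sub _ _).trans (add_le_add (bbS _ _ _ _) (bg' _ _))) ?_)
    rw [abs_mul, abs_of_pos hΛ]
    exact mul_le_mul_of_nonneg_left (bg _ _) hΛ.le
  have hΛC : 0 ≤ Λ * C := by positivity
  set C' := Λ * C + C + Λ * C + C with hC'
  have cont_site : ∀ {ψ : Config d E → ℝ}, Continuous ψ →
      Continuous fun q : Config d E × IntLattice d => if q.2 = x₀ then ψ q.1 else 0 := by
    intro ψ hψ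
    refine continuous_prod_of_discrete_right.2 fun x => ?_
    by_cases hx : x = x₀
    · simpa [hx] using hψ
    · simpa [hx] using continuous_const
  have main := hP.markov.integral_semigroup_eq_sub (t := t) (g := g) (g' := g') (G := G) (C := C') Λ mg
    (fun s q => (bg s q).trans (by linarith)) (fun s => cont_site (hPE.feller _ _ hφ.continuous_snd).neg)
    (fun s q => (bg' s q).trans (by linarith)) mg' mG (fun s q => (bG s q).trans (by linarith))
    (fun s hs0 hst => ?_) (fun s h hs0 hh hst q => ?_) p
  · have e1 : ∀ s q, G s q + g' s q + Λ * g s q = b (shiftConfig (-q.2) q.1) (x₀ - q.2)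
        * semigroup PE (t - s).toNNReal φ q.1 := by
      intro s q
      simp only [G]
      ring
    simp_rw [e1] at main
    rw [main]
    simp [g, hPE.markov.semigroup_zero]
  · have h1 := hP.generator (fun x η => if x = x₀ then semigroup PE (t - s).toNNReal φ η else 0)
      (fun x η => if x = x₀ then semigroup PE (t - s).toNNReal ℓ η else 0) ?_ ?_ ?_
    · convert h1 using 2 with q
      have h2 := tsum_uniformize_mul (α := α) (Λ := Λ) (hs (shiftConfig (-q.2) q.1))
        (f := fun z => g s (q.1, q.2 + z)) (fun z => bg _ _)
      have h3 : ∑' z, b (shiftConfig (-q.2) q.1) z * g s (q.1, q.2 + z)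
          = b (shiftConfig (-q.2) q.1) (x₀ - q.2) * semigroup PE (t - s).toNNReal φ q.1 := by
        rw [tsum_eq_single (x₀ - q.2)]
        · simp [g]
        · intro z hz
          have : q.2 + z ≠ x₀ := fun h => hz (by rw [← h]; abel)
          simp [g, this]
      simp only [add_zero] at h2
      rw [← hb, h3] at h2
      have h4 : G s q = - g' s q + (b (shiftConfig (-q.2) q.1) (x₀ - q.2)
          * semigroup PE (t - s).toNNReal φ q.1 - Λ * g s q) := by simp only [G]; ring
      rw [h4, ← h2, add_sub_cancel_right]
      congr 1
      by_cases hq : q.2 = x₀ <;> simp [g', hq]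
    · refine (finite_singleton x₀).subset fun x hx => ?_
      by_contra hne
      exact hx (funext fun η => if_neg hne)
    · intro x
      by_cases hx : x = x₀
      · simpa [hx] using hPE.feller _ _ hφ.continuous_fst
      · simpa [hx] using continuous_const
    · intro x
      by_cases hx : x = x₀
      · simpa [hx] using (hφ.semigroup hPE.markov hPE.feller _).hasGenerator
      · simpa [hx] using hasGenerator_zero PE
  · by_cases hq : q.2 = x₀
    · simp only [g, g', hq, if_true]
      obtain ⟨r, hr⟩ : ∃ r : ℝ≥0, (r : ℝ) = t - (s + h) := ⟨⟨t - (s + h), by linarith⟩, rfl⟩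
      obtain ⟨h, rfl⟩ : ∃ h' : ℝ≥0, (h' : ℝ) = h := ⟨⟨h, hh⟩, rfl⟩
      have e1 : (t - (s + h : ℝ)).toNNReal = r := by rw [← hr, Real.toNNReal_coe]
      have e2 : (t - s : ℝ).toNNReal = h + r := by
        rw [show (t - s : ℝ) = (h + r : ℝ≥0) by push_cast; linarith, Real.toNNReal_coe]
      have hr' := hφ.semigroup hPE.markov hPE.feller r
      have a1 := hr'.expansion h q.1
      have a2 := hr'.lipschitz h q.1
      rw [e1, e2, hPE.markov.semigroup_add_time _ _ mφ hφ.bound_fst,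
        hPE.markov.semigroup_add_time _ _ mℓ hφ.bound_snd]
      have hh2 : 0 ≤ Λ * C * (h : ℝ) ^ 2 := by positivity
      rw [abs_le] at *
      constructor <;> nlinarith [a1.1, a1.2, a2.1, a2.2, h.coe_nonneg]
    · simp only [g, g', hq, if_false]
      simp only [sub_self, mul_zero, abs_zero]
      positivity

end Forward

/-- The weight `e^{-Λ t}`. -/
noncomputable def decay (Λ t : ℝ) : ℝ≥0∞ := ENNReal.ofReal (Real.exp (-(Λ * t)))

lemma decay_ne_top (Λ t : ℝ) : decay Λ t ≠ ∞ := ENNReal.ofReal_ne_top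

lemma measurable_decay (Λ : ℝ) : Measurable (decay Λ) := by
  unfold decay; fun_prop

lemma decay_add (Λ s t : ℝ) : decay Λ (s + t) = decay Λ s * decay Λ t := by
  rw [decay, decay, decay, ← ENNReal.ofReal_mul (Real.exp_pos _).le, ← Real.exp_add]
  congr 2; ring

lemma decay_le_one {Λ t : ℝ} (hΛ : 0 ≤ Λ) (ht : 0 ≤ t) : decay Λ t ≤ 1 := by
  rw [decay, ENNReal.ofReal_le_one, Real.exp_le_one_iff]
  have := mul_nonneg hΛ ht
  linarith

section

variable {S : Type*} [TopologicalSpace S] [MeasurableSpace S]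

lemma ofReal_semigroup (P : Kernel S (CadlagPath S)) [IsMarkovKernel P] {f : S → ℝ}
    (hf : Measurable f) (hf0 : ∀ y, 0 ≤ f y) {B : ℝ} (hB : ∀ y, f y ≤ B) (t : ℝ) (x : S) :
    ENNReal.ofReal (semigroup P t.toNNReal f x) = evol P t (fun y => ENNReal.ofReal (f y)) x :=
  ofReal_integral_eq_lintegral_ofReal
    (integrable_eval P hf (fun y => by rw [abs_of_nonneg (hf0 y)]; exact hB y) _ x)
    (.of_forall fun _ => hf0 _)

end

/-! ### The forward equation for all nonnegative measurable functions -/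

section Forward

variable {d : ℕ} {E : Type*} [MetricSpace E] [CompactSpace E] [MeasurableSpace E] [BorelSpace E]

lemma Measurable.evolEnv (PE : Kernel (Config d E) (CadlagPath (Config d E))) [IsMarkovKernel PE]
    {A : Type*} [MeasurableSpace A] {F : A → Config d E × IntLattice d → ℝ≥0∞} {τ : A → ℝ}
    {ξ : A → Config d E × IntLattice d} (hF : Measurable (Function.uncurry F))
    (hτ : Measurable τ) (hξ : Measurable ξ) :
    Measurable fun a => evolEnv PE (τ a) (F a) (ξ a) := by
  refine Measurable.evol PE (F := fun a ζ => F a (ζ, (ξ a).2)) ?_ hτ (measurable_fst.comp hξ)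
  exact hF.comp (measurable_fst.prodMk
    (measurable_snd.prodMk (measurable_snd.comp (hξ.comp measurable_fst))))

lemma measurable_evolEnv (PE : Kernel (Config d E) (CadlagPath (Config d E))) [IsMarkovKernel PE]
    (t : ℝ) {f : Config d E × IntLattice d → ℝ≥0∞} (hf : Measurable f) :
    Measurable (evolEnv PE t f) :=
  Measurable.evolEnv PE (F := fun _ => f) (hf.comp measurable_snd) measurable_const measurable_id

lemma Measurable.jumpOp {β : Config d E → IntLattice d → ℝ≥0∞}
    (hβ : ∀ z, Measurable fun ζ => β ζ z)
    {A : Type*} [MeasurableSpace A] {F : A → Config d E × IntLattice d → ℝ≥0∞}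
    {ξ : A → Config d E × IntLattice d} (hF : Measurable (Function.uncurry F))
    (hξ : Measurable ξ) : Measurable fun a => jumpOp β (F a) (ξ a) := by
  refine Measurable.tsum fun z => ?_
  refine Measurable.mul ((hβ z).comp (measurable_shift_neg.comp hξ)) ?_
  exact hF.comp (measurable_id.prodMk ((measurable_fst.comp hξ).prodMk
    ((measurable_snd.comp hξ).add_const z)))

lemma measurable_jumpOp {β : Config d E → IntLattice d → ℝ≥0∞}
    (hβ : ∀ z, Measurable fun ζ => β ζ z) {f : Config d E × IntLattice d → ℝ≥0∞}
    (hf : Measurable f) : Measurable (jumpOp β f) :=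
  Measurable.jumpOp hβ (F := fun _ => f) (hf.comp measurable_snd) measurable_id

lemma jumpOp_site (β : Config d E → IntLattice d → ℝ≥0∞) (φ : Config d E → ℝ≥0∞)
    (x₀ : IntLattice d) (q : Config d E × IntLattice d) :
    jumpOp β (fun q => if q.2 = x₀ then φ q.1 else 0) q
      = β (shiftConfig (-q.2) q.1) (x₀ - q.2) * φ q.1 := by
  rw [jumpOp, tsum_eq_single (x₀ - q.2)]
  · simp
  · intro z hz
    have : q.2 + z ≠ x₀ := fun h => hz (by rw [← h]; abel)
    simp [this]

lemma evolEnv_site (PE : Kernel (Config d E) (CadlagPath (Config d E))) (t : ℝ)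
    (φ : Config d E → ℝ≥0∞) (x₀ : IntLattice d) (q : Config d E × IntLattice d) :
    evolEnv PE t (fun q => if q.2 = x₀ then φ q.1 else 0) q
      = if q.2 = x₀ then evol PE t φ q.1 else 0 := by
  by_cases h : q.2 = x₀ <;> simp [evolEnv, evol, h]

/-- The forward equation: decomposition at the last clock ring. -/
def SolvesForward (PE : Kernel (Config d E) (CadlagPath (Config d E)))
    (β : Config d E → IntLattice d → ℝ≥0∞) (Λ : ℝ)
    (T : ℝ → (Config d E × IntLattice d → ℝ≥0∞) → Config d E × IntLattice d → ℝ≥0∞) : Prop :=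
  ∀ t, 0 ≤ t → ∀ f, Measurable f → ∀ p, T t f p = decay Λ t * evolEnv PE t f p
    + ∫⁻ s in Ioo 0 t, decay Λ (t - s) * T s (jumpOp β (evolEnv PE (t - s) f)) p

/-- Both sides are integrals of φ against finite measures on Ω. They agree for φ with smooth orbits
by `integral_forward`, and such φ determine finite measures. -/
theorem IsWalkInEnvironment.forward_site {PE : Kernel (Config d E) (CadlagPath (Config d E))}
    (hPE : IsEnvironment PE) {α : Config d E → IntLattice d → ℝ}
    {P : Kernel (Config d E × IntLattice d) (CadlagPath (Config d E × IntLattice d))}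
    (hP : IsWalkInEnvironment PE α P) {Λ : ℝ} (hΛ : 0 < Λ)
    (hs : ∀ ζ, Summable (properRate α ζ)) (hu0 : ∀ ζ z, 0 ≤ uniformize α Λ ζ z)
    (huΛ : ∀ ζ z, uniformize α Λ ζ z ≤ Λ) (hum : ∀ z, Measurable fun ζ => uniformize α Λ ζ z)
    (x₀ : IntLattice d) {t : ℝ} (ht : 0 ≤ t) (p : Config d E × IntLattice d)
    {φ : Config d E → ℝ≥0∞} (hφ : Measurable φ) :
    evol P t (fun q => if q.2 = x₀ then φ q.1 else 0) p
      = decay Λ t * (if p.2 = x₀ then evol PE t φ p.1 else 0)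
        + ∫⁻ s in Ioo 0 t, decay Λ (t - s) * evol P s (fun q =>
          ENNReal.ofReal (uniformize α Λ (shiftConfig (-q.2) q.1) (x₀ - q.2))
            * evol PE (t - s) φ q.1) p := by
  classical
  have : IsMarkovKernel PE := ⟨hPE.markov.prob⟩
  have : IsMarkovKernel P := ⟨hP.markov.prob⟩
  set b := uniformize α Λ with hb
  have ev := fun r : ℝ≥0 => CadlagPath.measurable_eval (S := Config d E × IntLattice d) r
  have hset : MeasurableSet {q : Config d E × IntLattice d | q.2 = x₀} :=
    measurableSet_eq_fun measurable_snd measurable_const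
  -- joint evaluation
  have hev : Measurable fun q : ℝ × CadlagPath (Config d E × IntLattice d) => q.2.1 q.1.toNNReal :=
    CadlagPath.measurable_uncurry_eval.comp
      ((measurable_real_toNNReal.comp measurable_fst).prodMk measurable_snd)
  let D : ℝ × CadlagPath (Config d E × IntLattice d) → ℝ≥0∞ := fun q =>
    decay Λ (t - q.1) * ENNReal.ofReal (b (shiftConfig (-(q.2.1 q.1.toNNReal).2)
      (q.2.1 q.1.toNNReal).1) (x₀ - (q.2.1 q.1.toNNReal).2))
  have hD : Measurable D := by
    refine ((measurable_decay Λ).comp (measurable_const.sub measurable_fst)).mul ?_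
    exact (measurable_rate_apply hum (measurable_shift_neg.comp hev)
      (measurable_const.sub (measurable_snd.comp hev))).ennreal_ofReal
  let κ : Kernel (ℝ × CadlagPath (Config d E × IntLattice d)) (Config d E) :=
    (transitionKernel PE).comap (fun q => (t - q.1, (q.2.1 q.1.toNNReal).1))
      ((measurable_const.sub measurable_fst).prodMk (measurable_fst.comp hev))
  -- `ν₁` is the law of the environment at time t on the event that the walker is at x₀. `ν₂` adds
  -- the contribution of no ring to that of a last ring at time s which brings the walker to x₀.
  let ν₁ : Measure (Config d E) :=
    (((P p).map fun w => w.1 t.toNNReal).restrict {q | q.2 = x₀}).map Prod.fst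
  let ν₂ : Measure (Config d E) :=
    decay Λ t • (if p.2 = x₀ then transitionKernel PE (t, p.1) else 0)
      + ((((volume.restrict (Ioo 0 t)).prod (P p)).withDensity D).bind κ)
  have h₁ : ∀ φ : Config d E → ℝ≥0∞, Measurable φ → ∫⁻ ζ, φ ζ ∂ν₁
      = evol P t (fun q => if q.2 = x₀ then φ q.1 else 0) p := by
    intro φ hφ
    simp only [ν₁]
    have h2 : Measurable fun q : Config d E × IntLattice d => φ q.1 := hφ.comp measurable_fst
    rw [lintegral_map hφ measurable_fst, ← lintegral_indicator hset,
      lintegral_map (h2.indicator hset) (ev _)]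
    exact lintegral_congr fun w => by simp [indicator_apply]
  have h₂ : ∀ φ : Config d E → ℝ≥0∞, Measurable φ → ∫⁻ ζ, φ ζ ∂ν₂
      = decay Λ t * (if p.2 = x₀ then evol PE t φ p.1 else 0)
        + ∫⁻ s in Ioo 0 t, decay Λ (t - s) * evol P s (fun q =>
          ENNReal.ofReal (b (shiftConfig (-q.2) q.1) (x₀ - q.2)) * evol PE (t - s) φ q.1) p := by
    intro φ hφ
    simp only [ν₂]
    have hev2 : Measurable fun q : ℝ × CadlagPath (Config d E × IntLattice d) =>
        evol PE (t - q.1) φ (q.2.1 q.1.toNNReal).1 :=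
      Measurable.evol PE (F := fun _ => φ) (hφ.comp measurable_snd)
        (measurable_const.sub measurable_fst) (measurable_fst.comp hev)
    rw [lintegral_add_measure, lintegral_smul_measure, smul_eq_mul]
    congr 2
    · split_ifs
      · exact lintegral_transitionKernel PE t p.1 hφ
      · simp
    · rw [Measure.lintegral_bind κ.aemeasurable hφ.aemeasurable]
      have e1 : ∀ q, ∫⁻ ζ, φ ζ ∂κ q = evol PE (t - q.1) φ (q.2.1 q.1.toNNReal).1 := fun q =>
        lintegral_transitionKernel PE _ _ hφ
      simp_rw [e1]
      rw [lintegral_withDensity_eq_lintegral_mul _ hD hev2]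
      rw [lintegral_prod _ (hD.mul hev2).aemeasurable]
      refine lintegral_congr fun s => ?_
      simp only [Pi.mul_apply, D, mul_assoc]
      rw [lintegral_const_mul]
      · rfl
      · exact ((measurable_rate_apply hum (measurable_shift_neg.comp (ev _))
          (measurable_const.sub (measurable_snd.comp (ev _)))).ennreal_ofReal).mul
          (hev2.comp (measurable_prodMk_left (x := s)))
  rw [← h₁ φ hφ, ← h₂ φ hφ]
  have fin₁ : IsFiniteMeasure ν₁ := by
    constructor
    rw [← lintegral_one]
    change ∫⁻ ζ, (1 : Config d E → ℝ≥0∞) ζ ∂ν₁ < ∞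
    rw [h₁ _ measurable_one]
    refine (evol_mono P t (g := fun _ => 1) (fun q => ?_) p).trans_lt ?_
    · split_ifs <;> simp
    · rw [evol_const]; simp
  have fin₂ : IsFiniteMeasure ν₂ := by
    constructor
    rw [← lintegral_one]
    change ∫⁻ ζ, (1 : Config d E → ℝ≥0∞) ζ ∂ν₂ < ∞
    rw [h₂ _ measurable_one]
    have e1 : ∀ (r : ℝ) ζ, evol PE r (1 : Config d E → ℝ≥0∞) ζ = 1 := fun r ζ => evol_const PE r 1 ζ
    simp only [e1, mul_one]
    refine ENNReal.add_lt_top.2 ⟨ENNReal.mul_lt_top (decay_ne_top _ _).lt_top (by split_ifs <;> simp), ?_⟩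
    refine (setLIntegral_mono measurable_const (g := fun _ => 1 * ENNReal.ofReal Λ) fun s hs => ?_).trans_lt ?_
    · refine mul_le_mul' (decay_le_one hΛ.le (by linarith [hs.2])) ?_
      refine (evol_mono P s (g := fun _ => ENNReal.ofReal Λ) (fun q => ?_) p).trans
        (evol_const P s _ p).le
      exact ENNReal.ofReal_le_ofReal (huΛ _ _)
    · simp [ENNReal.mul_lt_top_iff]
  congr 1
  refine hPE.markov.measure_ext_of_isSmoothOrbit hPE.feller fun C ψ ℓ hψ hψ0 => ?_
  have mψ := hψ.continuous_fst.measurable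
  have bψ : ∀ y, ψ y ≤ C := fun y => (le_abs_self _).trans (hψ.bound_fst y)
  have bψ' := fun r => abs_semigroup_le PE hψ.bound_fst r
  have ψ'0 : ∀ r ζ, 0 ≤ semigroup PE r ψ ζ := fun r ζ => integral_nonneg fun w => hψ0 _
  have hC : 0 ≤ C := (abs_nonneg _).trans (hψ.bound_fst p.1)
  rw [h₁ _ mψ.ennreal_ofReal, h₂ _ mψ.ennreal_ofReal]
  have main := IsWalkInEnvironment.integral_forward hPE hP hΛ hs hu0 huΛ hum hψ x₀ t.toNNReal p
  rw [Real.coe_toNNReal _ ht] at main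
  let B : ℝ → Config d E × IntLattice d → ℝ := fun s q =>
    b (shiftConfig (-q.2) q.1) (x₀ - q.2) * semigroup PE (t - s).toNNReal ψ q.1
  have mB : Measurable (Function.uncurry B) := by
    refine Measurable.mul (measurable_rate_apply hum (measurable_shift_neg.comp measurable_snd)
      (measurable_const.sub (measurable_snd.comp measurable_snd))) ?_
    exact Measurable.semigroup PE (F := fun _ => ψ) (mψ.comp measurable_snd)
      (measurable_real_toNNReal.comp (measurable_const.sub measurable_fst))
      (measurable_fst.comp measurable_snd)
  have B0 : ∀ s q, 0 ≤ B s q := fun s q => mul_nonneg (hu0 _ _) (ψ'0 _ _)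
  have BΛ : ∀ s q, B s q ≤ Λ * C := fun s q =>
    mul_le_mul (huΛ _ _) ((le_abs_self _).trans (bψ' _ _)) (ψ'0 _ _) hΛ.le
  have msB : Measurable fun s : ℝ => semigroup P s.toNNReal (B s) p :=
    Measurable.semigroup P mB measurable_real_toNNReal measurable_const
  have sB0 : ∀ s : ℝ, 0 ≤ semigroup P s.toNNReal (B s) p := fun s => integral_nonneg fun w => B0 _ _
  have hint : IntervalIntegrable (fun s : ℝ => Real.exp (Λ * s) * semigroup P s.toNNReal (B s) p)
      volume 0 t := by
    refine IntervalIntegrable.continuousOn_mul ?_ (by fun_prop)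
    rw [intervalIntegrable_iff]
    exact Measure.integrableOn_of_bounded (M := Λ * C) (by simp) msB.aestronglyMeasurable
      (.of_forall fun s => abs_semigroup_le P
        (fun q => by rw [abs_of_nonneg (B0 s q)]; exact BΛ s q) _ p)
  have hI : ENNReal.ofReal (∫ s in (0 : ℝ)..t, Real.exp (Λ * s) * semigroup P s.toNNReal (B s) p)
      = ∫⁻ s in Ioo 0 t, ENNReal.ofReal (Real.exp (Λ * s)) * evol P s (fun q =>
          ENNReal.ofReal (b (shiftConfig (-q.2) q.1) (x₀ - q.2))
            * evol PE (t - s) (fun ζ => ENNReal.ofReal (ψ ζ)) q.1) p := by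
    rw [intervalIntegral.integral_of_le ht, restrict_Ioo_eq_restrict_Ioc,
      ofReal_integral_eq_lintegral_ofReal ((intervalIntegrable_iff_integrableOn_Ioc_of_le ht).1 hint)
        (.of_forall fun s => mul_nonneg (Real.exp_pos _).le (sB0 s))]
    refine lintegral_congr fun s => ?_
    rw [ENNReal.ofReal_mul (Real.exp_pos _).le,
      ofReal_semigroup P (f := B s) (mB.comp measurable_prodMk_left) (B0 s) (BΛ s)]
    congr 2
    funext q
    rw [← ofReal_semigroup PE mψ hψ0 bψ, ← ENNReal.ofReal_mul (hu0 _ _)]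
  change ∫ s in (0 : ℝ)..t, Real.exp (Λ * s) * semigroup P s.toNNReal (B s) p = _ at main
  have hf0 : ∀ q : Config d E × IntLattice d, 0 ≤ if q.2 = x₀ then ψ q.1 else 0 := fun q => by
    split_ifs
    · exact hψ0 _
    · exact le_rfl
  have hfC : ∀ q : Config d E × IntLattice d, (if q.2 = x₀ then ψ q.1 else 0) ≤ C := fun q => by
    split_ifs
    · exact bψ _
    · exact hC
  have mf : Measurable fun q : Config d E × IntLattice d => if q.2 = x₀ then ψ q.1 else 0 :=
    Measurable.ite hset (mψ.comp measurable_fst) measurable_const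
  have e3 : semigroup P t.toNNReal (fun q => if q.2 = x₀ then ψ q.1 else 0) p
      = Real.exp (-(Λ * t)) * (if p.2 = x₀ then semigroup PE t.toNNReal ψ p.1 else 0)
        + Real.exp (-(Λ * t))
          * ∫ s in (0 : ℝ)..t, Real.exp (Λ * s) * semigroup P s.toNNReal (B s) p := by
    rw [main, Real.exp_neg]
    field_simp
    ring
  have hsg0 : 0 ≤ if p.2 = x₀ then semigroup PE t.toNNReal ψ p.1 else 0 := by
    split_ifs
    · exact ψ'0 _ _
    · exact le_rfl
  have e4 := congrArg ENNReal.ofReal e3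
  rw [ofReal_semigroup P mf hf0 hfC, ENNReal.ofReal_add (mul_nonneg (Real.exp_pos _).le hsg0)
    (mul_nonneg (Real.exp_pos _).le (intervalIntegral.integral_nonneg ht fun s _ =>
      mul_nonneg (Real.exp_pos _).le (sB0 s))), ENNReal.ofReal_mul (Real.exp_pos _).le,
    ENNReal.ofReal_mul (Real.exp_pos _).le, hI] at e4
  have e5 : evol P t (fun q => if q.2 = x₀ then ENNReal.ofReal (ψ q.1) else 0) p
      = evol P t (fun q => ENNReal.ofReal (if q.2 = x₀ then ψ q.1 else 0)) p := by
    congr 1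
    funext q
    split_ifs <;> simp
  have e6 : ENNReal.ofReal (if p.2 = x₀ then semigroup PE t.toNNReal ψ p.1 else 0)
      = if p.2 = x₀ then evol PE t (fun ζ => ENNReal.ofReal (ψ ζ)) p.1 else 0 := by
    split_ifs
    · exact ofReal_semigroup PE mψ hψ0 bψ _ _
    · simp
  rw [e5, e4, e6]
  congr 1
  rw [← lintegral_const_mul' _ _ ENNReal.ofReal_ne_top]
  refine lintegral_congr fun s => ?_
  rw [← mul_assoc, ← ENNReal.ofReal_mul (Real.exp_pos _).le, ← Real.exp_add, decay]
  congr 3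
  ring

/-- The function f is the sum of its restrictions to the sites, and every term of the equation is
countably additive in f. -/
theorem IsWalkInEnvironment.solvesForward {PE : Kernel (Config d E) (CadlagPath (Config d E))}
    (hPE : IsEnvironment PE) {α : Config d E → IntLattice d → ℝ}
    {P : Kernel (Config d E × IntLattice d) (CadlagPath (Config d E × IntLattice d))}
    (hP : IsWalkInEnvironment PE α P) {Λ : ℝ} {lam : IntLattice d → ℝ≥0∞}
    (hs : ∀ ζ, Summable (properRate α ζ)) (hu0 : ∀ ζ z, 0 ≤ uniformize α Λ ζ z)
    (hβ : IsUniformizedRate (fun ζ z => ENNReal.ofReal (uniformize α Λ ζ z)) lam Λ) :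
    SolvesForward PE (fun ζ z => ENNReal.ofReal (uniformize α Λ ζ z)) Λ (evol P) := by
  classical
  have : IsMarkovKernel PE := ⟨hPE.markov.prob⟩
  have : IsMarkovKernel P := ⟨hP.markov.prob⟩
  intro t ht f hf p
  set β : Config d E → IntLattice d → ℝ≥0∞ := fun ζ z => ENNReal.ofReal (uniformize α Λ ζ z) with hβd
  have mβ : ∀ z, Measurable fun ζ => β ζ z := fun z => (hβ.continuous z).measurable
  have hum : ∀ z, Measurable fun ζ => uniformize α Λ ζ z := fun z => by
    have := (mβ z).ennreal_toReal
    simpa only [β, ENNReal.toReal_ofReal (hu0 _ _)] using this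
  have huΛ : ∀ ζ z, uniformize α Λ ζ z ≤ Λ := fun ζ z => by
    rw [← ENNReal.ofReal_le_ofReal_iff hβ.pos.le, ← hβ.tsum_eq ζ]
    exact ENNReal.le_tsum z
  let φ : IntLattice d → Config d E → ℝ≥0∞ := fun x ζ => f (ζ, x)
  have mφ : ∀ x, Measurable (φ x) := fun x => hf.comp measurable_prodMk_right
  let F : IntLattice d → Config d E × IntLattice d → ℝ≥0∞ := fun x q => if q.2 = x then φ x q.1 else 0
  have mF : ∀ x, Measurable (F x) := fun x => Measurable.ite
    (measurableSet_eq_fun measurable_snd measurable_const) ((mφ x).comp measurable_fst) measurable_const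
  have hfF : f = fun q => ∑' x, F x q := by
    funext q
    rw [tsum_eq_single q.2]
    · simp [F, φ]
    · intro x hx
      simp [F, hx.symm]
  have hEnv : ∀ r q, evolEnv PE r f q = ∑' x, evolEnv PE r (F x) q := by
    intro r q
    rw [hfF]
    exact evol_tsum PE r (fun x => (mF x).comp measurable_prodMk_right) q.1
  have hJ : ∀ r q, jumpOp β (evolEnv PE r f) q = ∑' x, jumpOp β (evolEnv PE r (F x)) q := by
    intro r q
    simp only [jumpOp, hEnv]
    rw [ENNReal.tsum_comm]
    simp_rw [ENNReal.tsum_mul_left]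
  have mJ : ∀ r x, Measurable (jumpOp β (evolEnv PE r (F x))) := fun r x =>
    measurable_jumpOp mβ (measurable_evolEnv PE r (mF x))
  have hT : ∀ x, evol P t (F x) p = decay Λ t * evolEnv PE t (F x) p
      + ∫⁻ s in Ioo 0 t, decay Λ (t - s) * evol P s (jumpOp β (evolEnv PE (t - s) (F x))) p := by
    intro x
    have := IsWalkInEnvironment.forward_site hPE hP hβ.pos hs hu0 huΛ hum x ht p (mφ x)
    rw [this, ← evolEnv_site]
    congr 1
    refine lintegral_congr fun s => ?_
    congr 2
    funext q
    have e1 : evolEnv PE (t - s) (F x) = fun q => if q.2 = x then evol PE (t - s) (φ x) q.1 else 0 :=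
      funext fun q => evolEnv_site PE (t - s) (φ x) x q
    rw [e1, jumpOp_site]
  have e1 : evol P t f p = ∑' x, evol P t (F x) p := by
    conv_lhs => rw [hfF]
    exact evol_tsum P t mF p
  have e2 : ∀ s, evol P s (jumpOp β (evolEnv PE (t - s) f)) p
      = ∑' x, evol P s (jumpOp β (evolEnv PE (t - s) (F x))) p := by
    intro s
    rw [funext (hJ (t - s))]
    exact evol_tsum P s (mJ (t - s)) p
  rw [e1, hEnv]
  simp_rw [e2, hT]
  rw [ENNReal.tsum_add, ENNReal.tsum_mul_left]
  congr 1
  simp_rw [← ENNReal.tsum_mul_left]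
  rw [lintegral_tsum]
  intro x
  refine (((measurable_decay Λ).comp (measurable_const.sub measurable_id)).mul ?_).aemeasurable
  refine Measurable.evol P (F := fun s => jumpOp β (evolEnv PE (t - s) (F x))) ?_ measurable_id
    measurable_const
  refine Measurable.jumpOp mβ (F := fun (a : ℝ × Config d E × IntLattice d) =>
    evolEnv PE (t - a.1) (F x)) ?_ measurable_snd
  exact Measurable.evolEnv PE (F := fun _ => F x) ((mF x).comp measurable_snd)
    (measurable_const.sub (measurable_fst.comp measurable_fst)) measurable_snd

end Forward

/-! ### Integrals over time intervals and the exponential clock -/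

lemma lintegral_Ioo_sub_left (F : ℝ → ℝ≥0∞) (a b c : ℝ) :
    ∫⁻ s in Ioo a b, F (c - s) = ∫⁻ s in Ioo (c - b) (c - a), F s := by
  rw [← lintegral_indicator measurableSet_Ioo, ← lintegral_indicator measurableSet_Ioo,
    ← lintegral_sub_left_eq_self ((Ioo (c - b) (c - a)).indicator F) c]
  refine lintegral_congr fun s => ?_
  simp only [indicator_apply, mem_Ioo]
  congr 1
  exact propext ⟨fun h => ⟨by linarith [h.2], by linarith [h.1]⟩,
    fun h => ⟨by linarith [h.2], by linarith [h.1]⟩⟩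

lemma lintegral_Ioo_sub_right (F : ℝ → ℝ≥0∞) (a b c : ℝ) :
    ∫⁻ s in Ioo a b, F (s - c) = ∫⁻ s in Ioo (a - c) (b - c), F s := by
  rw [← lintegral_indicator measurableSet_Ioo, ← lintegral_indicator measurableSet_Ioo,
    ← lintegral_sub_right_eq_self ((Ioo (a - c) (b - c)).indicator F) c]
  refine lintegral_congr fun s => ?_
  simp only [indicator_apply, mem_Ioo, sub_lt_sub_iff_right]

lemma lintegral_Ioo_triangle {F : ℝ → ℝ → ℝ≥0∞} (hF : Measurable (Function.uncurry F)) (a t : ℝ) :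
    ∫⁻ s in Ioo a t, ∫⁻ r in Ioo s t, F s r = ∫⁻ r in Ioo a t, ∫⁻ s in Ioo a r, F s r := by
  let H : ℝ → ℝ → ℝ≥0∞ := fun s r => {q : ℝ × ℝ | a < q.1 ∧ q.1 < q.2 ∧ q.2 < t}.indicator
    (Function.uncurry F) (s, r)
  have hset : MeasurableSet {q : ℝ × ℝ | a < q.1 ∧ q.1 < q.2 ∧ q.2 < t} :=
    (measurableSet_lt measurable_const measurable_fst).inter
      ((measurableSet_lt measurable_fst measurable_snd).inter
        (measurableSet_lt measurable_snd measurable_const))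
  have hH : Measurable (Function.uncurry H) := hF.indicator hset
  have h1 : ∫⁻ s in Ioo a t, ∫⁻ r in Ioo s t, F s r = ∫⁻ s, ∫⁻ r, H s r := by
    rw [← lintegral_indicator measurableSet_Ioo]
    refine lintegral_congr fun s => ?_
    by_cases hs : s ∈ Ioo a t
    · rw [indicator_of_mem hs, ← lintegral_indicator measurableSet_Ioo]
      refine lintegral_congr fun r => ?_
      simp [H, indicator_apply, hs.1]
    · rw [indicator_of_notMem hs, eq_comm, ← lintegral_zero (μ := (volume : Measure ℝ))]
      refine lintegral_congr fun r => indicator_of_notMem (fun h => hs ⟨h.1, h.2.1.trans h.2.2⟩) _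
  have h2 : ∫⁻ r in Ioo a t, ∫⁻ s in Ioo a r, F s r = ∫⁻ r, ∫⁻ s, H s r := by
    rw [← lintegral_indicator measurableSet_Ioo]
    refine lintegral_congr fun r => ?_
    by_cases hr : r ∈ Ioo a t
    · rw [indicator_of_mem hr, ← lintegral_indicator measurableSet_Ioo]
      refine lintegral_congr fun s => ?_
      simp [H, indicator_apply, hr.2]
    · rw [indicator_of_notMem hr, eq_comm, ← lintegral_zero (μ := (volume : Measure ℝ))]
      refine lintegral_congr fun s => indicator_of_notMem (fun h => hr ⟨h.1.trans h.2.1, h.2.2⟩) _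
  rw [h1, h2]
  exact lintegral_lintegral_swap hH.aemeasurable

lemma lintegral_decay {Λ : ℝ} (hΛ : 0 < Λ) {t : ℝ} (ht : 0 ≤ t) :
    ∫⁻ s in Ioo 0 t, decay Λ s * ENNReal.ofReal Λ = 1 - decay Λ t := by
  have h1 : ∀ s, decay Λ s * ENNReal.ofReal Λ = ENNReal.ofReal (Λ * Real.exp (-(Λ * s))) := by
    intro s
    rw [decay, ← ENNReal.ofReal_mul (Real.exp_pos _).le, mul_comm]
  simp_rw [h1]
  have hint : ∀ a b : ℝ, IntervalIntegrable (fun s => Λ * Real.exp (-(Λ * s))) volume a b :=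
    fun a b => (by fun_prop : Continuous fun s => Λ * Real.exp (-(Λ * s))).intervalIntegrable a b
  rw [restrict_Ioo_eq_restrict_Ioc, ← ofReal_integral_eq_lintegral_ofReal
    ((intervalIntegrable_iff_integrableOn_Ioc_of_le ht).1 (hint _ _))
    (.of_forall fun s => mul_nonneg hΛ.le (Real.exp_pos _).le), ← intervalIntegral.integral_of_le ht,
    intervalIntegral.integral_eq_sub_of_hasDerivAt (f := fun s => - Real.exp (-(Λ * s)))
      (fun s _ => ?_) (hint _ _)]
  · rw [decay, ← ENNReal.ofReal_one, ← ENNReal.ofReal_sub _ (Real.exp_pos _).le]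
    congr 1
    simp
    ring
  · have := (((hasDerivAt_id s).const_mul Λ).neg.exp).neg
    refine this.congr_deriv ?_
    simp
    ring

lemma lintegral_decay_sub {Λ : ℝ} (hΛ : 0 < Λ) {t : ℝ} (ht : 0 ≤ t) :
    ∫⁻ s in Ioo 0 t, decay Λ (t - s) * ENNReal.ofReal Λ = 1 - decay Λ t := by
  rw [lintegral_Ioo_sub_left (fun s => decay Λ s * ENNReal.ofReal Λ)]
  simpa using lintegral_decay hΛ ht

lemma decay_anti {Λ : ℝ} (hΛ : 0 ≤ Λ) {s t : ℝ} (h : s ≤ t) : decay Λ t ≤ decay Λ s := by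
  refine ENNReal.ofReal_le_ofReal (Real.exp_le_exp.2 ?_)
  have := mul_le_mul_of_nonneg_left h hΛ
  linarith

lemma one_sub_decay_lt_one (Λ t : ℝ) : 1 - decay Λ t < 1 :=
  ENNReal.sub_lt_self (by simp) (by simp) (by
    rw [decay]; exact (ENNReal.ofReal_pos.2 (Real.exp_pos _)).ne')

/-- Closes inductions over the number of clock rings: more than n rings contribute an error of order
κ^n. -/
lemma ENNReal.le_of_forall_le_add_mul_pow {a b c κ : ℝ≥0∞} (hc : c ≠ ∞) (hκ : κ < 1)
    (h : ∀ n : ℕ, a ≤ b + c * κ ^ n) : a ≤ b := by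
  have h1 : Tendsto (fun n : ℕ => b + c * κ ^ n) atTop (𝓝 (b + c * 0)) :=
    tendsto_const_nhds.add (ENNReal.Tendsto.const_mul
      (ENNReal.tendsto_pow_atTop_nhds_zero_of_lt_one hκ) (.inr hc))
  rw [mul_zero, add_zero] at h1
  exact ge_of_tendsto' h1 h

/-! ### Uniqueness for the forward equation; the backward equation -/

section Backward

variable {d : ℕ} {E : Type*} [MetricSpace E] [CompactSpace E] [MeasurableSpace E] [BorelSpace E]
  {PE : Kernel (Config d E) (CadlagPath (Config d E))} {β : Config d E → IntLattice d → ℝ≥0∞}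
  {lam : IntLattice d → ℝ≥0∞} {Λ : ℝ}

lemma IsUniformizedRate.jumpOp_le (hβ : IsUniformizedRate β lam Λ)
    {f : Config d E × IntLattice d → ℝ≥0∞} {c : ℝ≥0∞} (hf : ∀ q, f q ≤ c)
    (p : Config d E × IntLattice d) : jumpOp β f p ≤ ENNReal.ofReal Λ * c := by
  rw [← hβ.tsum_eq (shiftConfig (-p.2) p.1), ← ENNReal.tsum_mul_right]
  exact ENNReal.tsum_le_tsum fun z => by gcongr; exact hf _

lemma evol_le {S : Type*} [TopologicalSpace S] [MeasurableSpace S]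
    (P : Kernel S (CadlagPath S)) [IsMarkovKernel P] {f : S → ℝ≥0∞} {c : ℝ≥0∞}
    (hf : ∀ q, f q ≤ c) (t : ℝ) (x : S) : evol P t f x ≤ c :=
  (evol_mono P t hf x).trans (evol_const P t c x).le

lemma evolEnv_le [IsMarkovKernel PE] {f : Config d E × IntLattice d → ℝ≥0∞} {c : ℝ≥0∞}
    (hf : ∀ q, f q ≤ c) (t : ℝ) (p : Config d E × IntLattice d) : evolEnv PE t f p ≤ c :=
  evol_le PE (fun _ => hf _) t p.1

/-- Insert the equation into itself n times. The jump operator multiplies a bound by at most Λ, and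
Λ integrated against the clock weight gives 1 - e^{-Λs}, so the remainder is at most c(1 -
e^{-Λt})^n. A bound is needed only for the smaller solution; used in both directions this is
uniqueness. -/
theorem SolvesForward.le [IsMarkovKernel PE] (hβ : IsUniformizedRate β lam Λ)
    {T R : ℝ → (Config d E × IntLattice d → ℝ≥0∞) → Config d E × IntLattice d → ℝ≥0∞}
    (hT : SolvesForward PE β Λ T) (hR : SolvesForward PE β Λ R)
    (hTb : ∀ t, 0 ≤ t → ∀ f c, Measurable f → (∀ q, f q ≤ c) → ∀ p, T t f p ≤ c)
    {t : ℝ} (ht : 0 ≤ t) {f : Config d E × IntLattice d → ℝ≥0∞} {c : ℝ≥0∞} (hc : c ≠ ∞)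
    (hf : Measurable f) (hfc : ∀ q, f q ≤ c) (p : Config d E × IntLattice d) :
    T t f p ≤ R t f p := by
  have mβ : ∀ z, Measurable fun ζ => β ζ z := fun z => (hβ.continuous z).measurable
  have key : ∀ n : ℕ, ∀ s, 0 ≤ s → s ≤ t → ∀ f c, Measurable f → (∀ q, f q ≤ c) →
      T s f p ≤ R s f p + c * (1 - decay Λ t) ^ n := by
    intro n
    induction n with
    | zero =>
      intro s hs _ f c hf hfc
      rw [pow_zero, mul_one]
      exact (hTb s hs f c hf hfc p).trans le_add_self
    | succ n ih =>
      intro s hs hst f c hf hfc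
      rw [hT s hs f hf, hR s hs f hf, add_assoc]
      gcongr
      have md : Measurable fun u => decay Λ (s - u) * ENNReal.ofReal Λ :=
        ((measurable_decay Λ).comp (measurable_const.sub measurable_id)).mul_const _
      calc ∫⁻ u in Ioo 0 s, decay Λ (s - u) * T u (jumpOp β (evolEnv PE (s - u) f)) p
          ≤ ∫⁻ u in Ioo 0 s, (decay Λ (s - u) * R u (jumpOp β (evolEnv PE (s - u) f)) p
            + decay Λ (s - u) * ENNReal.ofReal Λ * (c * (1 - decay Λ t) ^ n)) := by
            refine setLIntegral_mono' measurableSet_Ioo fun u hu => ?_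
            have := ih u hu.1.le (hu.2.le.trans hst) _ _
              (measurable_jumpOp mβ (measurable_evolEnv PE (s - u) hf))
              (hβ.jumpOp_le (evolEnv_le hfc (s - u)))
            calc _ ≤ decay Λ (s - u) * (R u (jumpOp β (evolEnv PE (s - u) f)) p
                + ENNReal.ofReal Λ * c * (1 - decay Λ t) ^ n) := by gcongr
              _ = _ := by ring
        _ = _ := by
            rw [lintegral_add_right _ (md.mul_const _)]
        _ ≤ _ := by
            rw [lintegral_mul_const _ md, lintegral_decay_sub hβ.pos hs,
              pow_succ]
            refine add_le_add le_rfl ?_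
            have : 1 - decay Λ s ≤ 1 - decay Λ t := tsub_le_tsub_left (decay_anti hβ.pos.le hst) _
            calc (1 - decay Λ s) * (c * (1 - decay Λ t) ^ n)
                ≤ (1 - decay Λ t) * (c * (1 - decay Λ t) ^ n) := by gcongr
              _ = _ := by ring
  exact ENNReal.le_of_forall_le_add_mul_pow hc (one_sub_decay_lt_one Λ t)
    fun n => key n t ht le_rfl f c hf hfc

lemma evol_lintegral {S : Type*} [TopologicalSpace S] [MeasurableSpace S]
    (P : Kernel S (CadlagPath S)) [IsMarkovKernel P] {μ : Measure ℝ} [SFinite μ]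
    {F : ℝ → S → ℝ≥0∞} (hF : Measurable (Function.uncurry F)) (t : ℝ) (x : S) :
    evol P t (fun y => ∫⁻ s, F s y ∂μ) x = ∫⁻ s, evol P t (F s) x ∂μ := by
  have : Measurable fun q : CadlagPath S × ℝ => F q.2 (q.1.1 t.toNNReal) :=
    hF.comp (measurable_snd.prodMk ((CadlagPath.measurable_eval _).comp measurable_fst))
  exact lintegral_lintegral_swap this.aemeasurable

lemma evolEnv_lintegral [IsMarkovKernel PE] {μ : Measure ℝ} [SFinite μ]
    {F : ℝ → Config d E × IntLattice d → ℝ≥0∞} (hF : Measurable (Function.uncurry F)) (t : ℝ)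
    (p : Config d E × IntLattice d) :
    evolEnv PE t (fun y => ∫⁻ s, F s y ∂μ) p = ∫⁻ s, evolEnv PE t (F s) p ∂μ :=
  evol_lintegral PE (F := fun s ζ => F s (ζ, p.2))
    (hF.comp (measurable_fst.prodMk (measurable_snd.prodMk measurable_const))) t p.1

lemma jumpOp_lintegral {μ : Measure ℝ}
    {F : ℝ → Config d E × IntLattice d → ℝ≥0∞} (hF : Measurable (Function.uncurry F))
    (p : Config d E × IntLattice d) :
    jumpOp β (fun y => ∫⁻ s, F s y ∂μ) p = ∫⁻ s, jumpOp β (F s) p ∂μ := by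
  have h : ∀ q, Measurable fun s => F s q := fun q => hF.comp measurable_prodMk_right
  simp only [jumpOp]
  rw [lintegral_tsum fun z => ((h _).const_mul _).aemeasurable]
  exact tsum_congr fun z => (lintegral_const_mul _ (h _)).symm

lemma jumpOp_const_mul (f : Config d E × IntLattice d → ℝ≥0∞) (c : ℝ≥0∞)
    (p : Config d E × IntLattice d) : jumpOp β (fun q => c * f q) p = c * jumpOp β f p := by
  simp only [jumpOp]
  rw [← ENNReal.tsum_mul_left]
  exact tsum_congr fun z => by ring

lemma jumpOp_add (f g : Config d E × IntLattice d → ℝ≥0∞)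
    (p : Config d E × IntLattice d) : jumpOp β (fun q => f q + g q) p = jumpOp β f p + jumpOp β g p := by
  simp only [jumpOp]
  rw [← ENNReal.tsum_add]
  exact tsum_congr fun z => by ring

lemma jumpOp_mono {f g : Config d E × IntLattice d → ℝ≥0∞} (h : ∀ q, f q ≤ g q)
    (p : Config d E × IntLattice d) : jumpOp β f p ≤ jumpOp β g p :=
  ENNReal.tsum_le_tsum fun z => by gcongr; exact h _

/-- The operator on the right hand side of the backward equation. -/
noncomputable def backwardOp (PE : Kernel (Config d E) (CadlagPath (Config d E)))
    (β : Config d E → IntLattice d → ℝ≥0∞) (Λ : ℝ)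
    (T : ℝ → (Config d E × IntLattice d → ℝ≥0∞) → Config d E × IntLattice d → ℝ≥0∞) (t : ℝ)
    (f : Config d E × IntLattice d → ℝ≥0∞) (p : Config d E × IntLattice d) : ℝ≥0∞ :=
  decay Λ t * evolEnv PE t f p
    + ∫⁻ s in Ioo 0 t, decay Λ s * evolEnv PE s (jumpOp β (T (t - s) f)) p

lemma backwardOp_le [IsMarkovKernel PE] (hβ : IsUniformizedRate β lam Λ)
    {T : ℝ → (Config d E × IntLattice d → ℝ≥0∞) → Config d E × IntLattice d → ℝ≥0∞}
    {t : ℝ} (ht : 0 ≤ t) {f : Config d E × IntLattice d → ℝ≥0∞} {c : ℝ≥0∞} (hfc : ∀ q, f q ≤ c)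
    (hT : ∀ s, 0 ≤ s → s ≤ t → ∀ q, T s f q ≤ c) (p : Config d E × IntLattice d) :
    backwardOp PE β Λ T t f p ≤ c := by
  have h1 : ∫⁻ s in Ioo 0 t, decay Λ s * evolEnv PE s (jumpOp β (T (t - s) f)) p
      ≤ (1 - decay Λ t) * c := by
    rw [← lintegral_decay hβ.pos ht, ← lintegral_mul_const _ ((measurable_decay Λ).mul_const _)]
    refine setLIntegral_mono' measurableSet_Ioo fun s hs => ?_
    rw [mul_assoc]
    gcongr
    exact evolEnv_le (hβ.jumpOp_le (hT _ (by linarith [hs.2]) (by linarith [hs.1]))) s p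
  calc backwardOp PE β Λ T t f p ≤ decay Λ t * c + (1 - decay Λ t) * c :=
        add_le_add (by gcongr; exact evolEnv_le hfc t p) h1
    _ = c := by
      rw [← add_mul, add_tsub_cancel_of_le (decay_le_one hβ.pos.le ht), one_mul]

/-- Put the forward equation into the backward operator and integrate over the time s of the first
ring and the time r of the last one. Exchanging the two integrals leaves, for fixed r, the backward
operator at time r; its first term is the case in which first and last ring coincide. -/
theorem SolvesForward.backwardOp [IsMarkovKernel PE] (hβ : IsUniformizedRate β lam Λ)
    {P : Kernel (Config d E × IntLattice d) (CadlagPath (Config d E × IntLattice d))}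
    [IsMarkovKernel P] (hP : SolvesForward PE β Λ (evol P)) :
    SolvesForward PE β Λ (backwardOp PE β Λ (evol P)) := by
  have mβ : ∀ z, Measurable fun ζ => β ζ z := fun z => (hβ.continuous z).measurable
  intro t ht f hf p
  have md := measurable_decay Λ
  let h : ℝ → Config d E × IntLattice d → ℝ≥0∞ := fun r => jumpOp β (evolEnv PE (t - r) f)
  have mh : Measurable (Function.uncurry h) := by
    refine Measurable.jumpOp mβ (F := fun (a : ℝ × Config d E × IntLattice d) =>
      evolEnv PE (t - a.1) f) ?_ measurable_snd
    exact Measurable.evolEnv PE (F := fun _ => f) (hf.comp measurable_snd)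
      (measurable_const.sub (measurable_fst.comp measurable_fst)) measurable_snd
  -- The part after a first ring at s that has its last ring at r: run from s to r, jump and let the
  -- environment evolve up to t (both in `h r`), with no ring in between.
  let Ψ : ℝ → ℝ → Config d E × IntLattice d → ℝ≥0∞ := fun s r q =>
    decay Λ (t - r) * evol P (r - s) (h r) q
  have mΨ : Measurable fun a : (ℝ × ℝ) × Config d E × IntLattice d => Ψ a.1.1 a.1.2 a.2 := by
    refine (md.comp (measurable_const.sub (measurable_snd.comp measurable_fst))).mul ?_
    exact Measurable.evol P (F := fun (a : (ℝ × ℝ) × Config d E × IntLattice d) => h a.1.2)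
      (mh.comp ((measurable_snd.comp (measurable_fst.comp measurable_fst)).prodMk measurable_snd))
      ((measurable_snd.comp measurable_fst).sub (measurable_fst.comp measurable_fst)) measurable_snd
  have hsub : ∀ s ∈ Ioo 0 t, ∀ q, evol P (t - s) f q = decay Λ (t - s) * evolEnv PE (t - s) f q
      + ∫⁻ r in Ioo s t, Ψ s r q := by
    intro s hs q
    rw [hP (t - s) (by linarith [hs.2]) f hf q]
    congr 1
    have := lintegral_Ioo_sub_right (fun u => decay Λ (t - s - u)
      * evol P u (jumpOp β (evolEnv PE (t - s - u) f)) q) s t s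
    rw [sub_self] at this
    rw [← this]
    refine lintegral_congr fun r => ?_
    simp only [Ψ, h, sub_sub_sub_cancel_right]
  have hin : ∀ s ∈ Ioo 0 t, evolEnv PE s (jumpOp β (evol P (t - s) f)) p
      = decay Λ (t - s) * evolEnv PE s (h s) p
        + ∫⁻ r in Ioo s t, evolEnv PE s (jumpOp β (Ψ s r)) p := by
    intro s hs
    have mΨs : Measurable (Function.uncurry (Ψ s)) := 
      mΨ.comp ((measurable_const.prodMk measurable_fst).prodMk measurable_snd)
    have e1 : jumpOp β (evol P (t - s) f) = fun q => decay Λ (t - s) * h s q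
        + ∫⁻ r in Ioo s t, jumpOp β (Ψ s r) q := by
      funext q
      rw [funext (hsub s hs), jumpOp_add, jumpOp_const_mul, jumpOp_lintegral mΨs]
    rw [e1]
    have mhs : Measurable (h s) := mh.comp measurable_prodMk_left
    have mJΨ : Measurable (Function.uncurry fun r => jumpOp β (Ψ s r)) :=
      Measurable.jumpOp mβ (F := fun (a : ℝ × Config d E × IntLattice d) => Ψ s a.1)
        (mΨs.comp ((measurable_fst.comp measurable_fst).prodMk measurable_snd)) measurable_snd
    have e2 := evol_add PE s (f := fun ζ => decay Λ (t - s) * h s (ζ, p.2))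
      (g := fun ζ => ∫⁻ r in Ioo s t, jumpOp β (Ψ s r) (ζ, p.2))
      ((mhs.comp measurable_prodMk_right).const_mul _) p.1
    have e3 := evol_const_mul PE s (f := fun ζ => h s (ζ, p.2))
      (mhs.comp measurable_prodMk_right) (decay Λ (t - s)) p.1
    rw [e3] at e2
    rw [← evolEnv_lintegral mJΨ]
    exact e2
  have mEnvΨ : Measurable (Function.uncurry fun s r => decay Λ s * evolEnv PE s (jumpOp β (Ψ s r)) p) := by
    refine (md.comp measurable_fst).mul ?_
    refine Measurable.evolEnv PE (F := fun (a : ℝ × ℝ) => jumpOp β (Ψ a.1 a.2)) ?_ measurable_fst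
      measurable_const
    exact Measurable.jumpOp mβ (F := fun (a : (ℝ × ℝ) × Config d E × IntLattice d) => Ψ a.1.1 a.1.2)
      (mΨ.comp ((measurable_fst.comp measurable_fst).prodMk measurable_snd)) measurable_snd
  have menvh : Measurable fun s => evolEnv PE s (h s) p :=
    Measurable.evolEnv PE mh measurable_id measurable_const
  have hlast : ∀ r ∈ Ioo 0 t, ∫⁻ s in Ioo 0 r, decay Λ s * evolEnv PE s (jumpOp β (Ψ s r)) p
      = decay Λ (t - r) * ∫⁻ s in Ioo 0 r,
        decay Λ s * evolEnv PE s (jumpOp β (evol P (r - s) (h r))) p := by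
    intro r hr
    rw [← lintegral_const_mul' _ _ (decay_ne_top _ _)]
    refine lintegral_congr fun s => ?_
    have mh' : Measurable (jumpOp β (evol P (r - s) (h r))) :=
      measurable_jumpOp mβ (measurable_evol P _ (mh.comp measurable_prodMk_left))
    have e1 : jumpOp β (Ψ s r) = fun q => decay Λ (t - r) * jumpOp β (evol P (r - s) (h r)) q :=
      funext fun q => jumpOp_const_mul _ _ _
    rw [e1]
    have e2 := evol_const_mul PE s (f := fun ζ => jumpOp β (evol P (r - s) (h r)) (ζ, p.2))
      (mh'.comp measurable_prodMk_right) (decay Λ (t - r)) p.1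
    rw [mul_left_comm]
    congr 1
  have m1 : Measurable fun s => decay Λ (t - s) * (decay Λ s * evolEnv PE s (h s) p) :=
    (md.comp (measurable_const.sub measurable_id)).mul (md.mul menvh)
  rw [_root_.backwardOp]
  congr 1
  calc ∫⁻ s in Ioo 0 t, decay Λ s * evolEnv PE s (jumpOp β (evol P (t - s) f)) p
      = ∫⁻ s in Ioo 0 t, (decay Λ (t - s) * (decay Λ s * evolEnv PE s (h s) p)
        + ∫⁻ r in Ioo s t, decay Λ s * evolEnv PE s (jumpOp β (Ψ s r)) p) := by
        refine setLIntegral_congr_fun measurableSet_Ioo fun s hs => ?_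
        simp only [hin s hs]
        rw [lintegral_const_mul' _ _ (decay_ne_top _ _)]
        ring
    _ = (∫⁻ s in Ioo 0 t, decay Λ (t - s) * (decay Λ s * evolEnv PE s (h s) p))
        + ∫⁻ r in Ioo 0 t, ∫⁻ s in Ioo 0 r, decay Λ s * evolEnv PE s (jumpOp β (Ψ s r)) p := by
        rw [lintegral_add_left m1,
          lintegral_Ioo_triangle mEnvΨ]
    _ = ∫⁻ r in Ioo 0 t, decay Λ (t - r) * _root_.backwardOp PE β Λ (evol P) r (h r) p := by
        rw [← lintegral_add_left m1]
        refine setLIntegral_congr_fun measurableSet_Ioo fun r hr => ?_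
        simp only [hlast r hr]
        rw [_root_.backwardOp, mul_add]

/-- The backward equation: decomposition at the first clock ring. -/
theorem SolvesForward.evol_eq_backwardOp [IsMarkovKernel PE] (hβ : IsUniformizedRate β lam Λ)
    {P : Kernel (Config d E × IntLattice d) (CadlagPath (Config d E × IntLattice d))}
    [IsMarkovKernel P] (hP : SolvesForward PE β Λ (evol P)) {t : ℝ} (ht : 0 ≤ t)
    {f : Config d E × IntLattice d → ℝ≥0∞} {c : ℝ≥0∞} (hc : c ≠ ∞)
    (hf : Measurable f) (hfc : ∀ q, f q ≤ c) (p : Config d E × IntLattice d) :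
    evol P t f p = _root_.backwardOp PE β Λ (evol P) t f p :=
  le_antisymm
    (SolvesForward.le hβ hP (hP.backwardOp hβ)
      (fun t _ f c _ hfc p => evol_le P hfc t p) ht hc hf hfc p)
    (SolvesForward.le hβ (hP.backwardOp hβ) hP
      (fun t ht f c _ hfc p => backwardOp_le hβ ht hfc (fun s _ _ q => evol_le P hfc s q) p)
      ht hc hf hfc p)

end Backward

/-! ### Translation covariance and the Markov property of the environment process -/

section Translation

variable {d : ℕ} {E : Type*} [MetricSpace E] [CompactSpace E] [MeasurableSpace E] [BorelSpace E]
  {PE : Kernel (Config d E) (CadlagPath (Config d E))} {β : Config d E → IntLattice d → ℝ≥0∞}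
  {lam : IntLattice d → ℝ≥0∞} {Λ : ℝ}

lemma IsEnvironment.evol_shift (hPE : IsEnvironment PE) (t : ℝ) (a : IntLattice d)
    {φ : Config d E → ℝ≥0∞} (hφ : Measurable φ) (η : Config d E) :
    evol PE t (fun ζ => φ (shiftConfig a ζ)) η = evol PE t φ (shiftConfig a η) := by
  have ev := CadlagPath.measurable_eval (S := Config d E) t.toNNReal
  have msh : Measurable (shiftConfig a : Config d E → Config d E) :=
    (continuous_shiftConfig a).measurable
  have mcomp : Measurable fun w : CadlagPath (Config d E) => shiftConfig a (w.1 t.toNNReal) :=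
    msh.comp ev
  have h : (PE η).map (fun w => shiftConfig a (w.1 t.toNNReal))
      = (PE (shiftConfig a η)).map fun w => w.1 t.toNNReal := by
    ext A hA
    rw [Measure.map_apply mcomp hA, Measure.map_apply ev hA]
    exact hPE.translation a η t.toNNReal A hA
  rw [evol, evol, ← lintegral_map hφ mcomp, ← lintegral_map hφ ev, h]

/-- The simultaneous translation of environment and walker. -/
def shiftPair (a : IntLattice d) (p : Config d E × IntLattice d) : Config d E × IntLattice d :=
  (shiftConfig a p.1, p.2 + a)

lemma measurable_shiftPair (a : IntLattice d) :
    Measurable (shiftPair a : Config d E × IntLattice d → _) :=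
  ((continuous_shiftConfig a).measurable.comp measurable_fst).prodMk (measurable_snd.add_const a)

lemma shiftPair_neg_shiftPair (a : IntLattice d) (p : Config d E × IntLattice d) :
    shiftPair (-a) (shiftPair a p) = p := by
  simp [shiftPair, shiftConfig_shiftConfig, shiftConfig_zero]

/-- The environment is translation invariant, and the rates depend only on the environment seen from
the walker; so conjugation by a common translation preserves the forward equation. -/
theorem SolvesForward.shift (hPE : IsEnvironment PE) (hβ : IsUniformizedRate β lam Λ)
    {P : Kernel (Config d E × IntLattice d) (CadlagPath (Config d E × IntLattice d))}
    (hP : SolvesForward PE β Λ (evol P)) (a : IntLattice d) :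
    SolvesForward PE β Λ (fun t f p => evol P t (fun q => f (shiftPair (-a) q)) (shiftPair a p)) := by
  have : IsMarkovKernel PE := ⟨hPE.markov.prob⟩
  intro t ht f hf p
  have hEnv : ∀ r q, evolEnv PE r (fun q => f (shiftPair (-a) q)) q
      = evolEnv PE r f (shiftPair (-a) q) := fun r q =>
    hPE.evol_shift r (-a) (φ := fun ζ => f (ζ, q.2 + -a)) (hf.comp measurable_prodMk_right) q.1
  have hJ : ∀ r q, jumpOp β (evolEnv PE r (fun q => f (shiftPair (-a) q))) q
      = jumpOp β (evolEnv PE r f) (shiftPair (-a) q) := by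
    intro r q
    simp only [jumpOp, hEnv]
    refine tsum_congr fun z => ?_
    congr 2
    · simp only [shiftPair, shiftConfig_shiftConfig]
      congr 1; abel
    · simp only [shiftPair, Prod.mk.injEq, true_and]
      abel
  have mf : Measurable fun q => f (shiftPair (-a) q) := hf.comp (measurable_shiftPair (-a))
  simp only
  rw [hP t ht _ mf, hEnv, shiftPair_neg_shiftPair]
  congr 1
  refine lintegral_congr fun s => ?_
  rw [funext (hJ (t - s))]

/-- `f(η, x) = g(θ_{-x} η)`. -/
def liftEP (g : Config d E → ℝ≥0∞) (p : Config d E × IntLattice d) : ℝ≥0∞ :=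
  g (shiftConfig (-p.2) p.1)

lemma Measurable.liftEP {g : Config d E → ℝ≥0∞} (hg : Measurable g) : Measurable (liftEP g) :=
  hg.comp measurable_shift_neg

theorem SolvesForward.evol_shiftPair (hPE : IsEnvironment PE) (hβ : IsUniformizedRate β lam Λ)
    {P : Kernel (Config d E × IntLattice d) (CadlagPath (Config d E × IntLattice d))}
    [IsMarkovKernel P] (hP : SolvesForward PE β Λ (evol P)) {t : ℝ} (ht : 0 ≤ t)
    {f : Config d E × IntLattice d → ℝ≥0∞} {c : ℝ≥0∞} (hc : c ≠ ∞)
    (hf : Measurable f) (hfc : ∀ q, f q ≤ c) (a : IntLattice d) (p : Config d E × IntLattice d) :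
    evol P t (fun q => f (shiftPair (-a) q)) (shiftPair a p) = evol P t f p := by
  have : IsMarkovKernel PE := ⟨hPE.markov.prob⟩
  exact le_antisymm
    (SolvesForward.le hβ (hP.shift hPE hβ a) hP
      (fun t _ f c _ hfc p => evol_le P (fun q => hfc _) t _) ht hc hf hfc p)
    (SolvesForward.le hβ hP (hP.shift hPE hβ a)
      (fun t _ f c _ hfc p => evol_le P hfc t p) ht hc hf hfc p)

/-- By covariance the walker may be moved to the origin. Thus the transition operator maps functions
of the environment seen from the walker to functions of the same kind, which makes the environment
process Markov. -/
theorem SolvesForward.evol_liftEP (hPE : IsEnvironment PE) (hβ : IsUniformizedRate β lam Λ)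
    {P : Kernel (Config d E × IntLattice d) (CadlagPath (Config d E × IntLattice d))}
    [IsMarkovKernel P] (hP : SolvesForward PE β Λ (evol P)) {t : ℝ} (ht : 0 ≤ t)
    {g : Config d E → ℝ≥0∞} {c : ℝ≥0∞} (hc : c ≠ ∞) (hg : Measurable g) (hgc : ∀ q, g q ≤ c)
    (p : Config d E × IntLattice d) :
    evol P t (liftEP g) p = evol P t (liftEP g) (shiftConfig (-p.2) p.1, 0) := by
  have h := hP.evol_shiftPair hPE hβ ht hc hg.liftEP (fun q => hgc _) (-p.2) p
  have e1 : (fun q => liftEP g (shiftPair (-(-p.2)) q)) = liftEP g := by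
    funext q
    simp only [liftEP, shiftPair, shiftConfig_shiftConfig]
    congr 2; abel
  rw [e1] at h
  rw [← h]
  simp [shiftPair]

end Translation

/-! ### The Feller property by Picard iteration -/

section Feller

variable {d : ℕ} {E : Type*} [MetricSpace E] [CompactSpace E] [MeasurableSpace E] [BorelSpace E]
  {PE : Kernel (Config d E) (CadlagPath (Config d E))} {β : Config d E → IntLattice d → ℝ≥0∞}
  {lam : IntLattice d → ℝ≥0∞} {Λ : ℝ}

lemma ENNReal.continuous_tsum_of_le {X ι : Type*} [TopologicalSpace X] {f : ι → X → ℝ≥0∞}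
    {u : ι → ℝ≥0∞} (hf : ∀ i, Continuous (f i)) (hu : ∑' i, u i ≠ ∞) (h : ∀ i x, f i x ≤ u i) :
    Continuous fun x => ∑' i, f i x := by
  have hut : ∀ i, u i ≠ ∞ := fun i => ENNReal.ne_top_of_tsum_ne_top hu i
  have hft : ∀ i x, f i x ≠ ∞ := fun i x => ((h i x).trans_lt (hut i).lt_top).ne
  have hle : ∀ i x, (f i x).toReal ≤ (u i).toReal := fun i x => ENNReal.toReal_mono (hut i) (h i x)
  have hsum := ENNReal.summable_toReal hu
  have e : (fun x => ∑' i, f i x) = fun x => ENNReal.ofReal (∑' i, (f i x).toReal) := by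
    funext x
    rw [ENNReal.ofReal_tsum_of_nonneg (fun _ => ENNReal.toReal_nonneg)
      (Summable.of_nonneg_of_le (fun _ => ENNReal.toReal_nonneg) (fun i => hle i x) hsum)]
    exact tsum_congr fun i => (ENNReal.ofReal_toReal (hft i x)).symm
  rw [e]
  refine ENNReal.continuous_ofReal.comp (continuous_tsum (fun i => ?_) hsum fun i x => ?_)
  · exact ENNReal.continuousOn_toReal.comp_continuous (hf i) fun x => hft i x
  · rw [Real.norm_of_nonneg ENNReal.toReal_nonneg]
    exact hle i x

lemma IsEnvironment.continuous_evol (hPE : IsEnvironment PE) (t : ℝ) {φ : Config d E → ℝ≥0∞}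
    (hφ : Continuous φ) {c : ℝ≥0∞} (hc : c ≠ ∞) (hφc : ∀ ζ, φ ζ ≤ c) :
    Continuous (evol PE t φ) := by
  have : IsMarkovKernel PE := ⟨hPE.markov.prob⟩
  have hft : ∀ ζ, φ ζ ≠ ∞ := fun ζ => ((hφc ζ).trans_lt hc.lt_top).ne
  have hcont : Continuous fun ζ => (φ ζ).toReal := ENNReal.continuousOn_toReal.comp_continuous hφ hft
  have e : evol PE t φ = fun ζ => ENNReal.ofReal (semigroup PE t.toNNReal (fun ζ => (φ ζ).toReal) ζ) := by
    funext ζ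
    rw [ofReal_semigroup PE hcont.measurable (fun _ => ENNReal.toReal_nonneg)
      (fun ζ => ENNReal.toReal_mono hc (hφc ζ))]
    simp_rw [ENNReal.ofReal_toReal (hft _)]
  rw [e]
  exact ENNReal.continuous_ofReal.comp (hPE.feller _ _ hcont)

lemma IsEnvironment.continuous_evolEnv (hPE : IsEnvironment PE) (t : ℝ)
    {f : Config d E × IntLattice d → ℝ≥0∞} (hf : Continuous f) {c : ℝ≥0∞} (hc : c ≠ ∞)
    (hfc : ∀ q, f q ≤ c) : Continuous (evolEnv PE t f) :=
  continuous_prod_of_discrete_right.2 fun x =>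
    hPE.continuous_evol t (hf.comp (Continuous.prodMk_left x)) hc fun ζ => hfc _

lemma IsUniformizedRate.continuous_jumpOp (hβ : IsUniformizedRate β lam Λ)
    {f : Config d E × IntLattice d → ℝ≥0∞} (hf : Continuous f) {c : ℝ≥0∞} (hc : c ≠ ∞)
    (hfc : ∀ q, f q ≤ c) : Continuous (jumpOp β f) := by
  refine continuous_prod_of_discrete_right.2 fun x => ?_
  have hle : ∀ z ζ, β (shiftConfig (-x) ζ) z * f (ζ, x + z) ≤ lam z * c := fun z ζ =>
    mul_le_mul' (hβ.le _ _) (hfc _)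
  have hlz : ∀ z, lam z ≠ ∞ := fun z => ENNReal.ne_top_of_tsum_ne_top hβ.tsum_bound z
  refine ENNReal.continuous_tsum_of_le (u := fun z => lam z * c) (fun z => ?_) ?_ hle
  · have c1 : Continuous fun ζ => β (shiftConfig (-x) ζ) z :=
      (hβ.continuous z).comp (continuous_shiftConfig (-x))
    have c2 : Continuous fun ζ => f (ζ, x + z) := hf.comp (Continuous.prodMk_left _)
    refine continuous_iff_continuousAt.2 fun ζ => ENNReal.Tendsto.mul (c1.tendsto ζ) ?_ (c2.tendsto ζ) ?_
    · exact .inr ((hfc _).trans_lt hc.lt_top).ne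
    · exact .inr ((hβ.le _ _).trans_lt (hlz z).lt_top).ne
  · rw [ENNReal.tsum_mul_right]
    exact ENNReal.mul_ne_top hβ.tsum_bound hc

/-- Picard iteration of the backward equation. -/
noncomputable def picard (PE : Kernel (Config d E) (CadlagPath (Config d E)))
    (β : Config d E → IntLattice d → ℝ≥0∞) (Λ : ℝ) :
    ℕ → ℝ → (Config d E × IntLattice d → ℝ≥0∞) → Config d E × IntLattice d → ℝ≥0∞
  | 0 => fun _ _ _ => 0
  | n + 1 => backwardOp PE β Λ (picard PE β Λ n)

lemma picard_le [IsMarkovKernel PE] (hβ : IsUniformizedRate β lam Λ) (n : ℕ) {t : ℝ} (ht : 0 ≤ t)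
    {f : Config d E × IntLattice d → ℝ≥0∞} {c : ℝ≥0∞} (hfc : ∀ q, f q ≤ c)
    (p : Config d E × IntLattice d) : picard PE β Λ n t f p ≤ c := by
  induction n generalizing t p with
  | zero => exact zero_le
  | succ n ih => exact backwardOp_le hβ ht hfc (fun s hs _ q => ih hs q) p

lemma measurable_picard [IsMarkovKernel PE] (hβ : IsUniformizedRate β lam Λ) (n : ℕ)
    {f : Config d E × IntLattice d → ℝ≥0∞} (hf : Measurable f) :
    Measurable fun a : ℝ × Config d E × IntLattice d => picard PE β Λ n a.1 f a.2 := by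
  have mβ : ∀ z, Measurable fun ζ => β ζ z := fun z => (hβ.continuous z).measurable
  have md := measurable_decay Λ
  induction n with
  | zero => exact measurable_const
  | succ n ih =>
    refine ((md.comp measurable_fst).mul (Measurable.evolEnv PE (F := fun _ => f)
      (hf.comp measurable_snd) measurable_fst measurable_snd)).add ?_
    have hset : MeasurableSet {b : (ℝ × Config d E × IntLattice d) × ℝ | 0 < b.2 ∧ b.2 < b.1.1} :=
      (measurableSet_lt measurable_const measurable_snd).inter
        (measurableSet_lt measurable_snd (measurable_fst.comp measurable_fst))
    have hm : Measurable fun b : (ℝ × Config d E × IntLattice d) × ℝ =>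
        decay Λ b.2 * evolEnv PE b.2 (jumpOp β (picard PE β Λ n (b.1.1 - b.2) f)) b.1.2 := by
      refine (md.comp measurable_snd).mul ?_
      refine Measurable.evolEnv PE
        (F := fun (b : (ℝ × Config d E × IntLattice d) × ℝ) =>
          jumpOp β (picard PE β Λ n (b.1.1 - b.2) f)) ?_ measurable_snd
        (measurable_snd.comp measurable_fst)
      refine Measurable.jumpOp mβ
        (F := fun (b : ((ℝ × Config d E × IntLattice d) × ℝ) × Config d E × IntLattice d) =>
          picard PE β Λ n (b.1.1.1 - b.1.2) f) ?_ measurable_snd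
      exact ih.comp (((measurable_fst.comp (measurable_fst.comp (measurable_fst.comp
        measurable_fst))).sub (measurable_snd.comp (measurable_fst.comp measurable_fst))).prodMk
        measurable_snd)
    have e : (fun a : ℝ × Config d E × IntLattice d => ∫⁻ s in Ioo 0 a.1,
        decay Λ s * evolEnv PE s (jumpOp β (picard PE β Λ n (a.1 - s) f)) a.2)
        = fun a => ∫⁻ s, {b : (ℝ × Config d E × IntLattice d) × ℝ | 0 < b.2 ∧ b.2 < b.1.1}.indicator
          (fun b => decay Λ b.2 * evolEnv PE b.2 (jumpOp β (picard PE β Λ n (b.1.1 - b.2) f)) b.1.2)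
          (a, s) := by
      funext a
      rw [← lintegral_indicator measurableSet_Ioo]
      refine lintegral_congr fun s => ?_
      simp [indicator_apply]
    rw [e]
    exact (hm.indicator hset).lintegral_prod_right' (ν := volume)

lemma measurable_backwardOp_integrand [IsMarkovKernel PE] (hβ : IsUniformizedRate β lam Λ)
    {T : ℝ → (Config d E × IntLattice d → ℝ≥0∞) → Config d E × IntLattice d → ℝ≥0∞}
    {f : Config d E × IntLattice d → ℝ≥0∞}
    (hT : Measurable fun a : ℝ × Config d E × IntLattice d => T a.1 f a.2) (t : ℝ)
    (p : Config d E × IntLattice d) :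
    Measurable fun s => decay Λ s * evolEnv PE s (jumpOp β (T (t - s) f)) p := by
  refine (measurable_decay Λ).mul (Measurable.evolEnv PE (F := fun s => jumpOp β (T (t - s) f))
    ?_ measurable_id measurable_const)
  refine Measurable.jumpOp (fun z => (hβ.continuous z).measurable)
    (F := fun (b : ℝ × Config d E × IntLattice d) => T (t - b.1) f) ?_ measurable_snd
  exact hT.comp ((measurable_const.sub (measurable_fst.comp measurable_fst)).prodMk measurable_snd)

lemma continuous_picard (hPE : IsEnvironment PE) (hβ : IsUniformizedRate β lam Λ) (n : ℕ)
    {f : Config d E × IntLattice d → ℝ≥0∞} (hf : Continuous f) {c : ℝ≥0∞} (hc : c ≠ ∞)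
    (hfc : ∀ q, f q ≤ c) {t : ℝ} (ht : 0 ≤ t) : Continuous (picard PE β Λ n t f) := by
  have : IsMarkovKernel PE := ⟨hPE.markov.prob⟩
  induction n generalizing t with
  | zero => exact continuous_const
  | succ n ih =>
    have hj : ∀ s ∈ Ioo 0 t, ∀ q, jumpOp β (picard PE β Λ n (t - s) f) q ≤ ENNReal.ofReal Λ * c :=
      fun s hs => hβ.jumpOp_le (picard_le hβ n (by linarith [hs.2]) hfc)
    have hΛc : ENNReal.ofReal Λ * c ≠ ∞ := ENNReal.mul_ne_top ENNReal.ofReal_ne_top hc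
    refine ((ENNReal.continuous_const_mul (decay_ne_top Λ t)).comp
      (hPE.continuous_evolEnv t hf hc hfc)).add (continuous_iff_continuousAt.2 fun p => ?_)
    refine tendsto_lintegral_filter_of_dominated_convergence (fun _ => ENNReal.ofReal Λ * c)
      (.of_forall fun q => measurable_backwardOp_integrand hβ (measurable_picard hβ n hf.measurable)
        t q) (.of_forall fun q => ?_) ?_ ?_
    · refine (ae_restrict_iff' measurableSet_Ioo).2 (.of_forall fun s hs => ?_)
      exact mul_le_of_le_one_of_le (decay_le_one hβ.pos.le hs.1.le) (evolEnv_le (hj s hs) s q)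
    · rw [lintegral_const]
      exact ENNReal.mul_ne_top hΛc (by simp)
    · refine (ae_restrict_iff' measurableSet_Ioo).2 (.of_forall fun s hs => ?_)
      have h0 : 0 ≤ t - s := by linarith [hs.2]
      exact ((ENNReal.continuous_const_mul (decay_ne_top Λ s)).comp
        (hPE.continuous_evolEnv s (hβ.continuous_jumpOp (ih h0) hc (picard_le hβ n h0 hfc)) hΛc
          (hj s hs))).tendsto p

variable {P : Kernel (Config d E × IntLattice d) (CadlagPath (Config d E × IntLattice d))}

lemma backwardOp_mono {T R : ℝ → (Config d E × IntLattice d → ℝ≥0∞) → Config d E × IntLattice d → ℝ≥0∞}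
    {t : ℝ} {f : Config d E × IntLattice d → ℝ≥0∞}
    (h : ∀ s, 0 ≤ s → s ≤ t → ∀ q, T s f q ≤ R s f q) (p : Config d E × IntLattice d) :
    backwardOp PE β Λ T t f p ≤ backwardOp PE β Λ R t f p := by
  refine add_le_add le_rfl (setLIntegral_mono' measurableSet_Ioo fun s hs => ?_)
  gcongr
  exact evol_mono PE s (fun ζ => jumpOp_mono (h _ (by linarith [hs.2]) (by linarith [hs.1])) _) _

lemma SolvesForward.picard_le_evol [IsMarkovKernel PE] [IsMarkovKernel P]
    (hβ : IsUniformizedRate β lam Λ) (hP : SolvesForward PE β Λ (evol P)) (n : ℕ) {t : ℝ}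
    (ht : 0 ≤ t) {f : Config d E × IntLattice d → ℝ≥0∞} {c : ℝ≥0∞} (hc : c ≠ ∞)
    (hf : Measurable f) (hfc : ∀ q, f q ≤ c) (p : Config d E × IntLattice d) :
    picard PE β Λ n t f p ≤ evol P t f p := by
  induction n generalizing t p with
  | zero => exact zero_le
  | succ n ih =>
    rw [hP.evol_eq_backwardOp hβ ht hc hf hfc]
    exact backwardOp_mono (fun s hs _ q => ih hs q) p

/-- The n-th iterate accounts for fewer than n rings. The rest is at most c κ^n with κ = 1 -
e^{-Λt}, uniformly in the starting point and in times up to t. -/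
lemma SolvesForward.evol_le_picard_add [IsMarkovKernel PE] [IsMarkovKernel P]
    (hβ : IsUniformizedRate β lam Λ) (hP : SolvesForward PE β Λ (evol P)) (n : ℕ) {s t : ℝ}
    (hs : 0 ≤ s) (hst : s ≤ t) {f : Config d E × IntLattice d → ℝ≥0∞} {c : ℝ≥0∞} (hc : c ≠ ∞)
    (hf : Measurable f) (hfc : ∀ q, f q ≤ c) (p : Config d E × IntLattice d) :
    evol P s f p ≤ picard PE β Λ n s f p + c * (1 - decay Λ t) ^ n := by
  induction n generalizing s p with
  | zero => simpa [picard] using evol_le P hfc s p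
  | succ n ih =>
    set C := c * (1 - decay Λ t) ^ n
    have mβ : ∀ z, Measurable fun ζ => β ζ z := fun z => (hβ.continuous z).measurable
    have mp := measurable_picard (PE := PE) hβ n hf
    have md : Measurable fun r => decay Λ r * ENNReal.ofReal Λ := (measurable_decay Λ).mul_const _
    rw [hP.evol_eq_backwardOp hβ hs hc hf hfc, picard, _root_.backwardOp, _root_.backwardOp, add_assoc]
    refine add_le_add le_rfl ?_
    calc ∫⁻ r in Ioo 0 s, decay Λ r * evolEnv PE r (jumpOp β (evol P (s - r) f)) p
        ≤ ∫⁻ r in Ioo 0 s, (decay Λ r * evolEnv PE r (jumpOp β (picard PE β Λ n (s - r) f)) p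
            + decay Λ r * ENNReal.ofReal Λ * C) := by
          refine setLIntegral_mono' measurableSet_Ioo fun r hr => ?_
          rw [mul_assoc, ← mul_add]
          gcongr
          have mj : Measurable (jumpOp β (picard PE β Λ n (s - r) f)) :=
            measurable_jumpOp mβ (mp.comp (measurable_const.prodMk measurable_id))
          have h1 : ∀ ζ, jumpOp β (evol P (s - r) f) (ζ, p.2)
              ≤ jumpOp β (picard PE β Λ n (s - r) f) (ζ, p.2) + ENNReal.ofReal Λ * C := by
            intro ζ
            refine (jumpOp_mono (fun q => ih (by linarith [hr.2]) (by linarith [hr.1]) q) _).trans ?_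
            rw [jumpOp_add (picard PE β Λ n (s - r) f) (fun _ => C)]
            exact add_le_add le_rfl (hβ.jumpOp_le (fun _ => le_rfl) _)
          refine (evol_mono PE r h1 p.1).trans ?_
          have mj' : Measurable fun ζ => jumpOp β (picard PE β Λ n (s - r) f) (ζ, p.2) :=
            mj.comp measurable_prodMk_right
          rw [evol_add PE r mj', evol_const]
          rfl
      _ = (∫⁻ r in Ioo 0 s, decay Λ r * evolEnv PE r (jumpOp β (picard PE β Λ n (s - r) f)) p)
            + (1 - decay Λ s) * C := by
          rw [lintegral_add_right _ (md.mul_const _), lintegral_mul_const _ md,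
            lintegral_decay hβ.pos hs]
      _ ≤ _ := by
          have : 1 - decay Λ s ≤ 1 - decay Λ t := tsub_le_tsub_left (decay_anti hβ.pos.le hst) _
          refine add_le_add le_rfl ?_
          calc (1 - decay Λ s) * C ≤ (1 - decay Λ t) * C := by gcongr
            _ = _ := by rw [pow_succ]; ring

/-- A uniform limit of the continuous Picard iterates: they lie below the transition operator, hence
lower semicontinuity, and above it up to c κ^n, hence upper semicontinuity. -/
theorem SolvesForward.continuous_evol [IsMarkovKernel P] (hPE : IsEnvironment PE)
    (hβ : IsUniformizedRate β lam Λ) (hP : SolvesForward PE β Λ (evol P)) {t : ℝ}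
    (ht : 0 ≤ t) {f : Config d E × IntLattice d → ℝ≥0∞} (hf : Continuous f) {c : ℝ≥0∞} (hc : c ≠ ∞)
    (hfc : ∀ q, f q ≤ c) : Continuous (evol P t f) := by
  have : IsMarkovKernel PE := ⟨hPE.markov.prob⟩
  have hlow := fun n => hP.picard_le_evol hβ n ht hc hf.measurable hfc
  have hup := fun n => hP.evol_le_picard_add hβ n ht le_rfl hc hf.measurable hfc
  have hcont := fun n => continuous_picard hPE hβ n hf hc hfc ht
  have hlim : Tendsto (fun n : ℕ => c * (1 - decay Λ t) ^ n) atTop (𝓝 0) := by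
    have := ENNReal.Tendsto.const_mul
      (ENNReal.tendsto_pow_atTop_nhds_zero_of_lt_one (one_sub_decay_lt_one Λ t)) (.inr hc)
    rwa [mul_zero] at this
  refine continuous_iff_lower_upperSemicontinuous.2 ⟨fun p y hy => ?_, fun p y hy => ?_⟩
  · have h1 : Tendsto (fun n => picard PE β Λ n t f p) atTop (𝓝 (evol P t f p)) := by
      refine tendsto_of_tendsto_of_tendsto_of_le_of_le (g := fun n => evol P t f p
        - c * (1 - decay Λ t) ^ n) ?_ tendsto_const_nhds (fun n => tsub_le_iff_right.2 (hup n p))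
        (fun n => hlow n p)
      have := ENNReal.Tendsto.sub (tendsto_const_nhds (x := evol P t f p)) hlim (.inr (by simp))
      rwa [tsub_zero] at this
    obtain ⟨n, hn⟩ := (h1.eventually (lt_mem_nhds hy)).exists
    filter_upwards [(hcont n).continuousAt.eventually (lt_mem_nhds hn)] with q hq
    exact hq.trans_le (hlow n q)
  · have h1 : Tendsto (fun n => evol P t f p + c * (1 - decay Λ t) ^ n) atTop
        (𝓝 (evol P t f p)) := by
      have := (tendsto_const_nhds (x := evol P t f p)).add hlim
      rwa [add_zero] at this
    obtain ⟨n, hn⟩ := (h1.eventually (gt_mem_nhds hy)).exists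
    have hn' : picard PE β Λ n t f p + c * (1 - decay Λ t) ^ n < y :=
      lt_of_le_of_lt (add_le_add (hlow n p) le_rfl) hn
    have hc2 : Continuous fun q => picard PE β Λ n t f q + c * (1 - decay Λ t) ^ n :=
      (hcont n).add continuous_const
    filter_upwards [hc2.continuousAt.eventually (gt_mem_nhds hn')] with q hq
    exact (hup n q).trans_lt hq

end Feller

/-! ### The marginal Markov property of the coupled environments -/

section MarginalMarkov

variable {d : ℕ} {E : Type*} [MetricSpace E] [CompactSpace E] [MeasurableSpace E] [BorelSpace E]
  {PE : Kernel (Config d E) (CadlagPath (Config d E))}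
  {Q : Measure (CadlagPath (Config d E × Config d E))}
  {π : Config d E × Config d E → Config d E}

/-- Only constant times τ = s are needed here. The weight `m` may depend on both environments up to
time s; this freedom later allows it to record the joint jumps. -/
theorem StrongMarginalMarkov.lintegral_mul_eval [IsMarkovKernel PE] [IsProbabilityMeasure Q]
    (hQ : StrongMarginalMarkov PE Q π) (hπ : Measurable π) {s r : ℝ} (hs : 0 ≤ s) (hsr : s ≤ r)
    {m : CadlagPath (Config d E × Config d E) → ℝ≥0∞}
    (hm : Measurable[canonicalFiltration (Config d E × Config d E) s.toNNReal] m)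
    {φ : Config d E → ℝ≥0∞} (hφ : Measurable φ) :
    ∫⁻ w, m w * φ (π (w.1 r.toNNReal)) ∂Q
      = ∫⁻ w, m w * evol PE (r - s) φ (π (w.1 s.toNNReal)) ∂Q := by
  have hle := (canonicalFiltration (Config d E × Config d E)).le s.toNNReal
  have hev : ∀ r : ℝ≥0, Measurable fun w : CadlagPath (Config d E × Config d E) => π (w.1 r) :=
    fun r => hπ.comp (CadlagPath.measurable_eval r)
  have hsr' : s.toNNReal ≤ r.toNNReal := Real.toNNReal_le_toNNReal hsr
  have hrs : r.toNNReal - s.toNNReal = (r - s).toNNReal := by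
    rw [NNReal.sub_def, Real.coe_toNNReal _ hs, Real.coe_toNNReal _ (hs.trans hsr)]
  have key : ∀ A, MeasurableSet[canonicalFiltration (Config d E × Config d E) s.toNNReal] A →
      ∫⁻ w in A, φ (π (w.1 r.toNNReal)) ∂Q
        = ∫⁻ w in A, evol PE (r - s) φ (π (w.1 s.toNNReal)) ∂Q := by
    intro A hA
    let κ : Kernel (CadlagPath (Config d E × Config d E)) (Config d E) := (transitionKernel PE).comap
      (fun w => (r - s, π (w.1 s.toNNReal))) (measurable_const.prodMk (hev _))
    have hκ : ∀ (ψ : Config d E → ℝ≥0∞), Measurable ψ → ∀ w, ∫⁻ z, ψ z ∂(κ w)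
        = evol PE (r - s) ψ (π (w.1 s.toNNReal)) := fun ψ hψ w =>
      lintegral_transitionKernel PE (r - s) _ hψ
    have h : (Q.restrict A).map (fun w => π (w.1 r.toNNReal)) = (Q.restrict A).bind κ := by
      have i1 : IsFiniteMeasure ((Q.restrict A).map fun w => π (w.1 r.toNNReal)) := inferInstance
      refine ext_of_forall_lintegral_eq_of_IsFiniteMeasure fun f => ?_
      have hfm : Measurable fun ζ => (f ζ : ℝ≥0∞) :=
        (measurable_coe_nnreal_ennreal).comp f.continuous.measurable
      rw [lintegral_map hfm (hev _), Measure.lintegral_bind κ.measurable.aemeasurable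
        hfm.aemeasurable]
      simp_rw [hκ _ hfm]
      have hc : Continuous fun ζ => (f ζ : ℝ) := NNReal.continuous_coe.comp f.continuous
      have hm1 := hQ (fun _ => (s.toNNReal : WithTop ℝ≥0)) (isStoppingTime_const _ _) r.toNNReal _ hc
      rw [IsStoppingTime.measurableSpace_const] at hm1
      have huniv : {w : CadlagPath (Config d E × Config d E) | ((s.toNNReal : ℝ≥0) : WithTop ℝ≥0) ≤ (r.toNNReal : ℝ≥0)}
          = univ := by
        ext w; simpa using WithTop.coe_le_coe.2 hsr'
      rw [huniv] at hm1
      simp only [indicator_univ, WithTop.untopD_coe, hrs] at hm1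
      obtain ⟨B, hB⟩ := isCompact_univ.exists_bound_of_continuousOn hc.continuousOn
      have hb : ∀ ζ, ‖(f ζ : ℝ)‖ ≤ B := fun ζ => hB ζ (mem_univ _)
      have hint : Integrable (fun w : CadlagPath (Config d E × Config d E) => (f (π (w.1 r.toNNReal)) : ℝ)) Q :=
        Integrable.of_bound (hc.measurable.comp (hev _)).aestronglyMeasurable B
          (.of_forall fun w => hb _)
      have h1 := setIntegral_condExp hle hint hA
      rw [setIntegral_congr_ae (hle _ hA) (hm1.mono fun w hw _ => hw)] at h1
      have e1 : ∀ w : CadlagPath (Config d E × Config d E), (f (π (w.1 r.toNNReal)) : ℝ≥0∞)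
          = ENNReal.ofReal (f (π (w.1 r.toNNReal)) : ℝ) := fun w => by simp
      have e2 : ∀ w : CadlagPath (Config d E × Config d E), evol PE (r - s) (fun ζ => (f ζ : ℝ≥0∞)) (π (w.1 s.toNNReal))
          = ENNReal.ofReal (semigroup PE (r - s).toNNReal (fun ζ => (f ζ : ℝ)) (π (w.1 s.toNNReal))) := by
        intro w
        rw [ofReal_semigroup PE hc.measurable (fun _ => NNReal.coe_nonneg _)
          (fun ζ => (le_abs_self _).trans (hb ζ))]
        simp
      have hnn : ∀ ζ, 0 ≤ semigroup PE (r - s).toNNReal (fun ζ => (f ζ : ℝ)) ζ := fun ζ =>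
        integral_nonneg fun _ => NNReal.coe_nonneg _
      simp_rw [e2]
      simp only [e1]
      have hmS : Measurable (semigroup PE (r - s).toNNReal (fun ζ => (f ζ : ℝ))) :=
        measurable_semigroup PE _ hc.measurable
      rw [← ofReal_integral_eq_lintegral_ofReal hint.integrableOn
          (.of_forall fun _ => NNReal.coe_nonneg _), ← h1, ofReal_integral_eq_lintegral_ofReal
          ?_ (.of_forall fun _ => hnn _)]
      refine (Integrable.of_bound (hmS.comp (hev _)).aestronglyMeasurable B
        (.of_forall fun w => ?_)).integrableOn
      exact abs_semigroup_le PE hb _ _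
    rw [← lintegral_map hφ (hev _), h, Measure.lintegral_bind κ.measurable.aemeasurable
      hφ.aemeasurable]
    exact lintegral_congr fun w => hκ _ hφ w
  have hm1 : Measurable fun w : CadlagPath (Config d E × Config d E) => φ (π (w.1 r.toNNReal)) := hφ.comp (hev _)
  have hm2 : Measurable fun w : CadlagPath (Config d E × Config d E) => evol PE (r - s) φ (π (w.1 s.toNNReal)) :=
    (measurable_evol PE _ hφ).comp (hev _)
  have htrim : ∀ g : CadlagPath (Config d E × Config d E) → ℝ≥0∞, Measurable g →
      ∫⁻ w, m w * g w ∂Q = ∫⁻ w, m w ∂(Q.withDensity g).trim hle := by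
    intro g hg
    rw [lintegral_trim hle hm, lintegral_withDensity_eq_lintegral_mul _ hg (hm.mono hle le_rfl)]
    exact lintegral_congr fun w => mul_comm _ _
  rw [htrim _ hm1, htrim _ hm2]
  congr 1
  refine @Measure.ext _ (canonicalFiltration (Config d E × Config d E) s.toNNReal) _ _ fun A hA => ?_
  rw [trim_measurableSet_eq hle hA, trim_measurableSet_eq hle hA, withDensity_apply _ (hle _ hA),
    withDensity_apply _ (hle _ hA), key A hA]

end MarginalMarkov

/-! ### Supersolutions of mild equations -/

section Mild

/-- For a clock started at s: no ring before r means either no ring before t or a first ring between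
r and t. -/
lemma decay_add_lintegral {Λ : ℝ} (hΛ : 0 < Λ) {r t : ℝ} (h : r ≤ t) (s : ℝ) :
    decay Λ (t - s) + ∫⁻ u in Ioo r t, decay Λ (u - s) * ENNReal.ofReal Λ = decay Λ (r - s) := by
  have h1 : ∀ u, decay Λ (u - s) * ENNReal.ofReal Λ
      = decay Λ (r - s) * (decay Λ (u - r) * ENNReal.ofReal Λ) := by
    intro u
    rw [← mul_assoc, ← decay_add]
    congr 2; ring
  simp_rw [h1]
  have md : Measurable fun u => decay Λ (u - r) * ENNReal.ofReal Λ :=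
    ((measurable_decay Λ).comp (measurable_id.sub_const r)).mul_const _
  rw [lintegral_const_mul _ md,
    lintegral_Ioo_sub_right (fun u => decay Λ u * ENNReal.ofReal Λ), sub_self,
    lintegral_decay hΛ (sub_nonneg.2 h), show t - s = (r - s) + (t - r) by ring, decay_add, ← mul_add,
    add_tsub_cancel_of_le (decay_le_one hΛ.le (sub_nonneg.2 h)), mul_one]

/-- An integrated supersolution is a supersolution of the mild equation. -/
lemma lintegral_decay_mul_le {Λ : ℝ} (hΛ : 0 < Λ) {s t : ℝ} (hst : s ≤ t) {H v : ℝ → ℝ≥0∞}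
    (hH : Measurable H) (hv : Measurable v)
    (h : ∀ r, s ≤ r → r ≤ t → H r + ∫⁻ u in Ioo s r, v u ≤ H s) :
    decay Λ (t - s) * H t
      + ∫⁻ r in Ioo s t, decay Λ (r - s) * (ENNReal.ofReal Λ * H r + v r) ≤ H s := by
  have md : Measurable fun r => decay Λ (r - s) := (measurable_decay Λ).comp (measurable_id.sub_const s)
  -- Write e^{-Λ(r-s)} as e^{-Λ(t-s)} plus the probability of a first ring in (r, t), and exchange
  -- the order of integration.
  have h1 : ∫⁻ r in Ioo s t, decay Λ (r - s) * v r = decay Λ (t - s) * (∫⁻ r in Ioo s t, v r)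
      + ∫⁻ u in Ioo s t, decay Λ (u - s) * ENNReal.ofReal Λ * ∫⁻ r in Ioo s u, v r := by
    have hF : Measurable (Function.uncurry fun r u : ℝ => decay Λ (u - s) * ENNReal.ofReal Λ * v r) :=
      ((md.comp measurable_snd).mul_const _).mul (hv.comp measurable_fst)
    calc ∫⁻ r in Ioo s t, decay Λ (r - s) * v r
        = ∫⁻ r in Ioo s t, (decay Λ (t - s) * v r
            + ∫⁻ u in Ioo r t, decay Λ (u - s) * ENNReal.ofReal Λ * v r) := by
          refine setLIntegral_congr_fun measurableSet_Ioo fun r hr => ?_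
          rw [lintegral_mul_const _ (md.mul_const _), ← add_mul,
            decay_add_lintegral hΛ hr.2.le]
      _ = _ := by
          rw [lintegral_add_left (hv.const_mul _), lintegral_const_mul _ hv,
            lintegral_Ioo_triangle hF]
          congr 1
          refine lintegral_congr fun u => ?_
          rw [lintegral_const_mul _ hv]
  calc decay Λ (t - s) * H t + ∫⁻ r in Ioo s t, decay Λ (r - s) * (ENNReal.ofReal Λ * H r + v r)
      = decay Λ (t - s) * (H t + ∫⁻ r in Ioo s t, v r) + ∫⁻ r in Ioo s t,
          decay Λ (r - s) * ENNReal.ofReal Λ * (H r + ∫⁻ u in Ioo s r, v u) := by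
        have m1 : Measurable fun r => decay Λ (r - s) * ENNReal.ofReal Λ * H r :=
          (md.mul_const _).mul hH
        simp_rw [mul_add, ← mul_assoc]
        rw [lintegral_add_left m1, lintegral_add_left m1, h1]
        ring
    _ ≤ decay Λ (t - s) * H s + ∫⁻ r in Ioo s t, decay Λ (r - s) * ENNReal.ofReal Λ * H s := by
        refine add_le_add (by gcongr; exact h t hst le_rfl)
          (setLIntegral_mono' measurableSet_Ioo fun r hr => ?_)
        gcongr
        exact h r hr.1.le hr.2.le
    _ = H s := by
        rw [lintegral_mul_const _ (md.mul_const _), ← add_mul, decay_add_lintegral hΛ hst, sub_self]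
        simp [decay]

end Mild

/-! ### The gap between two walks at a common site -/

section Coupling

variable {d : ℕ} {E : Type*} [MetricSpace E] [CompactSpace E] [MeasurableSpace E] [BorelSpace E]
  {PE : Kernel (Config d E) (CadlagPath (Config d E))} {β : Config d E → IntLattice d → ℝ≥0∞}
  {lam : IntLattice d → ℝ≥0∞} {Λ : ℝ}
  {P : Kernel (Config d E × IntLattice d) (CadlagPath (Config d E × IntLattice d))}
  {Q : Measure (CadlagPath (Config d E × Config d E))}

lemma CadlagPath.measurable_real_eval {S : Type*} [TopologicalSpace S] [MeasurableSpace S]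
    [TopologicalSpace.PseudoMetrizableSpace S] [BorelSpace S] :
    Measurable fun q : ℝ × CadlagPath S => q.2.1 q.1.toNNReal :=
  CadlagPath.measurable_uncurry_eval.comp
    ((measurable_real_toNNReal.comp measurable_fst).prodMk measurable_snd)

lemma lintegral_mul_add {W : Type*} [MeasurableSpace W] {μ : Measure W} {m f : W → ℝ≥0∞}
    (hm : Measurable m) (hf : Measurable f) (g : W → ℝ≥0∞) :
    ∫⁻ w, m w * (f w + g w) ∂μ = ∫⁻ w, m w * f w ∂μ + ∫⁻ w, m w * g w ∂μ := by
  simp_rw [mul_add]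
  exact lintegral_add_left (hm.mul hf) _

lemma measurable_jumpOp_evol [IsMarkovKernel P] (hβ : IsUniformizedRate β lam Λ)
    {f : Config d E × IntLattice d → ℝ≥0∞} (hf : Measurable f) (t : ℝ) {A : Type*}
    [MeasurableSpace A] {τ : A → ℝ} (hτ : Measurable τ) {ξ : A → Config d E × IntLattice d}
    (hξ : Measurable ξ) : Measurable fun a => jumpOp β (evol P (t - τ a) f) (ξ a) := by
  refine Measurable.jumpOp (fun z => (hβ.continuous z).measurable)
    (F := fun a => evol P (t - τ a) f) ?_ hξ
  exact Measurable.evol P (F := fun _ => f) (hf.comp measurable_snd)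
    (measurable_const.sub (hτ.comp measurable_fst)) measurable_snd

/-- The backward equation runs the environment afresh from time s; the marginal Markov property
replaces this run by the continuation of one coordinate of the coupled path. Both coordinates are
then read along the same path, so they can be compared. -/
theorem StrongMarginalMarkov.lintegral_mul_evol [IsMarkovKernel PE] [IsMarkovKernel P]
    [IsProbabilityMeasure Q] {π : Config d E × Config d E → Config d E}
    (hQ : StrongMarginalMarkov PE Q π) (hπ : Measurable π) (hβ : IsUniformizedRate β lam Λ)
    (hP : SolvesForward PE β Λ (evol P)) {s t : ℝ} (hs : 0 ≤ s) (hst : s ≤ t)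
    {m : CadlagPath (Config d E × Config d E) → ℝ≥0∞}
    (hm : Measurable[canonicalFiltration (Config d E × Config d E) s.toNNReal] m)
    {f : Config d E × IntLattice d → ℝ≥0∞} {c : ℝ≥0∞} (hc : c ≠ ∞) (hf : Measurable f)
    (hfc : ∀ q, f q ≤ c) (y : IntLattice d) :
    ∫⁻ w, m w * evol P (t - s) f (π (w.1 s.toNNReal), y) ∂Q
      = decay Λ (t - s) * ∫⁻ w, m w * f (π (w.1 t.toNNReal), y) ∂Q
        + ∫⁻ r in Ioo s t, decay Λ (r - s)
          * ∫⁻ w, m w * jumpOp β (evol P (t - r) f) (π (w.1 r.toNNReal), y) ∂Q := by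
  have mβ : ∀ z, Measurable fun ζ => β ζ z := fun z => (hβ.continuous z).measurable
  have hm' : Measurable m := hm.mono ((canonicalFiltration _).le _) le_rfl
  have hev : ∀ r : ℝ≥0, Measurable fun w : CadlagPath (Config d E × Config d E) => π (w.1 r) :=
    fun r => hπ.comp (CadlagPath.measurable_eval r)
  have mdec : Measurable fun r => decay Λ (r - s) := (measurable_decay Λ).comp (measurable_id.sub_const s)
  have e1 : ∀ ζ, evol P (t - s) f (ζ, y) = decay Λ (t - s) * evol PE (t - s) (fun ζ => f (ζ, y)) ζ
      + ∫⁻ r in Ioo s t, decay Λ (r - s)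
        * evol PE (r - s) (fun ζ => jumpOp β (evol P (t - r) f) (ζ, y)) ζ := by
    intro ζ
    rw [hP.evol_eq_backwardOp hβ (sub_nonneg.2 hst) hc hf hfc, backwardOp]
    have := lintegral_Ioo_sub_right (fun r => decay Λ r
      * evolEnv PE r (jumpOp β (evol P (t - s - r) f)) (ζ, y)) s t s
    rw [sub_self] at this
    rw [← this]
    congr 1
    refine lintegral_congr fun r => ?_
    rw [show t - s - (r - s) = t - r by ring]
    rfl
  have mA : Measurable fun ζ => decay Λ (t - s) * evol PE (t - s) (fun ζ => f (ζ, y)) ζ :=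
    (measurable_evol PE _ (hf.comp measurable_prodMk_right)).const_mul _
  have mB : Measurable fun q : CadlagPath (Config d E × Config d E) × ℝ => m q.1 * (decay Λ (q.2 - s)
      * evol PE (q.2 - s) (fun ζ => jumpOp β (evol P (t - q.2) f) (ζ, y))
        (π (q.1.1 s.toNNReal))) := by
    refine (hm'.comp measurable_fst).mul ((mdec.comp measurable_snd).mul ?_)
    refine Measurable.evol PE (F := fun (q : CadlagPath (Config d E × Config d E) × ℝ) ζ =>
      jumpOp β (evol P (t - q.2) f) (ζ, y)) ?_ (measurable_snd.sub_const s)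
      ((hev _).comp measurable_fst)
    exact measurable_jumpOp_evol hβ hf t (measurable_snd.comp measurable_fst)
      (measurable_snd.prodMk measurable_const)
  have mJ : ∀ r, Measurable fun ζ => jumpOp β (evol P (t - r) f) (ζ, y) := fun r =>
    measurable_jumpOp_evol hβ hf t measurable_const (measurable_id.prodMk measurable_const)
  have mB' : ∀ w : CadlagPath (Config d E × Config d E), Measurable fun r => decay Λ (r - s)
      * evol PE (r - s) (fun ζ => jumpOp β (evol P (t - r) f) (ζ, y)) (π (w.1 s.toNNReal)) := by
    intro w
    refine mdec.mul (Measurable.evol PE (F := fun (r : ℝ) ζ => jumpOp β (evol P (t - r) f) (ζ, y))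
      ?_ (measurable_id.sub_const s) measurable_const)
    exact measurable_jumpOp_evol hβ hf t measurable_fst (measurable_snd.prodMk measurable_const)
  have mfy : Measurable fun ζ => f (ζ, y) := hf.comp measurable_prodMk_right
  have mAw : Measurable fun w : CadlagPath (Config d E × Config d E) =>
      decay Λ (t - s) * evol PE (t - s) (fun ζ => f (ζ, y)) (π (w.1 s.toNNReal)) := mA.comp (hev _)
  simp_rw [e1]
  rw [lintegral_mul_add hm' mAw]
  congr 1
  · rw [hQ.lintegral_mul_eval hπ hs hst hm mfy, ← lintegral_const_mul]
    · exact lintegral_congr fun w => by ring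
    · exact hm'.mul ((measurable_evol PE _ mfy).comp (hev _))
  · simp_rw [← lintegral_const_mul _ (mB' _)]
    rw [lintegral_lintegral_swap mB.aemeasurable]
    refine setLIntegral_congr_fun measurableSet_Ioo fun r hr => ?_
    rw [hQ.lintegral_mul_eval hπ hs hr.1.le hm (mJ r), ← lintegral_const_mul]
    · exact lintegral_congr fun w => by ring
    · exact hm'.mul ((measurable_evol PE _ (mJ r)).comp (hev _))

/-- Split both rate vectors into the joint part `G` and a remainder. Since the total rate is Λ for
every environment, the two remainders have the same mass Λ - ∑ G; on them the function is at most a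
+ D for one walker and at least a for the other. -/
lemma IsUniformizedRate.jumpOp_le_jumpOp_add (hβ : IsUniformizedRate β lam Λ)
    {u : Config d E × IntLattice d → ℝ≥0∞} {a D : ℝ≥0∞} (hua : ∀ q, a ≤ u q)
    (huD : ∀ q, u q ≤ a + D) {η ξ : Config d E} {y : IntLattice d} {G : IntLattice d → ℝ≥0∞}
    (hG : ∀ z, G z ≤ min (β (shiftConfig (-y) η) z) (β (shiftConfig (-y) ξ) z)) :
    jumpOp β u (η, y) ≤ jumpOp β u (ξ, y)
      + (∑' z, G z * (u (η, y + z) - u (ξ, y + z)) + (ENNReal.ofReal Λ - ∑' z, G z) * D) := by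
  set b := ENNReal.ofReal Λ - ∑' z, G z with hb
  have hsum : ∀ ζ : Config d E, (∀ z, G z ≤ β (shiftConfig (-y) ζ) z) →
      ∑' z, (β (shiftConfig (-y) ζ) z - G z) = b := by
    intro ζ h
    have hfin : ∑' z, G z ≠ ∞ := ne_top_of_le_ne_top ENNReal.ofReal_ne_top
      ((ENNReal.tsum_le_tsum h).trans_eq (hβ.tsum_eq _))
    refine ENNReal.eq_sub_of_add_eq hfin ?_
    rw [← ENNReal.tsum_add, ← hβ.tsum_eq (shiftConfig (-y) ζ)]
    exact tsum_congr fun z => tsub_add_cancel_of_le (h z)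
  have h1 := fun z => (hG z).trans (min_le_left _ _)
  have h2 := fun z => (hG z).trans (min_le_right _ _)
  calc jumpOp β u (η, y) = ∑' z, (G z * u (η, y + z)
        + (β (shiftConfig (-y) η) z - G z) * u (η, y + z)) := by
        refine tsum_congr fun z => ?_
        rw [← add_mul, add_tsub_cancel_of_le (h1 z)]
    _ ≤ ∑' z, ((G z * u (ξ, y + z) + G z * (u (η, y + z) - u (ξ, y + z)))
        + (β (shiftConfig (-y) η) z - G z) * (a + D)) := by
        refine ENNReal.tsum_le_tsum fun z => ?_
        rw [← mul_add]
        gcongr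
        · exact le_add_tsub
        · exact huD _
    _ = ∑' z, G z * u (ξ, y + z) + (∑' z, G z * (u (η, y + z) - u (ξ, y + z)) + b * D)
        + ∑' z, (β (shiftConfig (-y) ξ) z - G z) * a := by
        rw [ENNReal.tsum_add, ENNReal.tsum_add, ENNReal.tsum_mul_right, ENNReal.tsum_mul_right,
          hsum η h1, hsum ξ h2]
        ring
    _ ≤ ∑' z, G z * u (ξ, y + z) + (∑' z, G z * (u (η, y + z) - u (ξ, y + z)) + b * D)
        + ∑' z, (β (shiftConfig (-y) ξ) z - G z) * u (ξ, y + z) := by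
        gcongr
        exact hua _
    _ = (∑' z, G z * u (ξ, y + z) + ∑' z, (β (shiftConfig (-y) ξ) z - G z) * u (ξ, y + z))
        + (∑' z, G z * (u (η, y + z) - u (ξ, y + z)) + b * D) := by ring
    _ = _ := by
        congr 1
        rw [← ENNReal.tsum_add]
        refine tsum_congr fun z => ?_
        rw [← add_mul, add_tsub_cancel_of_le (h2 z)]

/-- The coupling inequality: `G r z (η, ξ)` are rates of joint jumps by `z` of two walkers at `y`;
after a jump that is not joint, the difference is bounded by the oscillation `D`. -/
theorem lintegral_mul_gap_le [IsMarkovKernel PE] [IsMarkovKernel P] [IsProbabilityMeasure Q]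
    (h1 : StrongMarginalMarkov PE Q Prod.fst) (h2 : StrongMarginalMarkov PE Q Prod.snd)
    (hβ : IsUniformizedRate β lam Λ) (hP : SolvesForward PE β Λ (evol P)) {s t : ℝ} (hs : 0 ≤ s)
    (hst : s ≤ t) {m : CadlagPath (Config d E × Config d E) → ℝ≥0∞}
    (hm : Measurable[canonicalFiltration (Config d E × Config d E) s.toNNReal] m)
    {c : ℝ≥0∞} (hc : c ≠ ∞) (hmc : ∀ w, m w ≤ c)
    {f : Config d E × IntLattice d → ℝ≥0∞} {a D : ℝ≥0∞} (ha : a ≠ ∞) (hD : D ≠ ∞)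
    (hf : Measurable f) (hfa : ∀ q, a ≤ f q) (hfD : ∀ q, f q ≤ a + D) (y : IntLattice d)
    {G : ℝ → IntLattice d → Config d E × Config d E → ℝ≥0∞}
    (hGm : ∀ z, Measurable fun q : ℝ × Config d E × Config d E => G q.1 z q.2)
    (hG : ∀ r z p, G r z p ≤ min (β (shiftConfig (-y) p.1) z) (β (shiftConfig (-y) p.2) z)) :
    ∫⁻ w, m w * (evol P (t - s) f ((w.1 s.toNNReal).1, y)
        - evol P (t - s) f ((w.1 s.toNNReal).2, y)) ∂Q
      ≤ decay Λ (t - s) * ∫⁻ w, m w * (f ((w.1 t.toNNReal).1, y) - f ((w.1 t.toNNReal).2, y)) ∂Q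
        + ∫⁻ r in Ioo s t, decay Λ (r - s) * ∫⁻ w, m w * (∑' z, G r z (w.1 r.toNNReal)
            * (evol P (t - r) f ((w.1 r.toNNReal).1, y + z)
              - evol P (t - r) f ((w.1 r.toNNReal).2, y + z))
            + (ENNReal.ofReal Λ - ∑' z, G r z (w.1 r.toNNReal)) * D) ∂Q := by
  have haD : a + D ≠ ∞ := ENNReal.add_ne_top.2 ⟨ha, hD⟩
  have mu := measurable_evol P (t - s) hf
  have hev : ∀ s : ℝ, Measurable fun w : CadlagPath (Config d E × Config d E) => w.1 s.toNNReal :=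
    fun r => CadlagPath.measurable_eval _
  have hevs := CadlagPath.measurable_eval_canonicalFiltration (S := Config d E × Config d E)
    (le_refl s.toNNReal)
  -- The event of the past on which the gap at time s is positive. Restricting the weight to it
  -- turns the truncated difference into a genuine one, so that it can be split into two integrals.
  let B : Set (CadlagPath (Config d E × Config d E)) := {w | evol P (t - s) f ((w.1 s.toNNReal).2, y)
    < evol P (t - s) f ((w.1 s.toNNReal).1, y)}
  have hB : MeasurableSet[canonicalFiltration (Config d E × Config d E) s.toNNReal] B :=
    hevs (measurableSet_lt (mu.comp (measurable_snd.prodMk measurable_const))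
      (mu.comp (measurable_fst.prodMk measurable_const)))
  let m' := B.indicator m
  have hm'B : Measurable[canonicalFiltration (Config d E × Config d E) s.toNNReal] m' :=
    hm.indicator hB
  have hm' : Measurable m' := hm'B.mono ((canonicalFiltration _).le _) le_rfl
  have hm'm : ∀ w, m' w ≤ m w := fun w => indicator_le_self _ _ _
  have hle : ∀ q, evol P (t - s) f q ≤ a + D := evol_le P hfD _
  -- the integrands
  let u : ℝ → Config d E × IntLattice d → ℝ≥0∞ := fun r => evol P (t - r) f
  let J : ℝ → CadlagPath (Config d E × Config d E) → ℝ≥0∞ := fun r w =>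
    jumpOp β (evol P (t - r) f) ((w.1 r.toNNReal).2, y)
  let R : ℝ → CadlagPath (Config d E × Config d E) → ℝ≥0∞ := fun r w =>
    ∑' z, G r z (w.1 r.toNNReal) * (evol P (t - r) f ((w.1 r.toNNReal).1, y + z)
      - evol P (t - r) f ((w.1 r.toNNReal).2, y + z))
      + (ENNReal.ofReal Λ - ∑' z, G r z (w.1 r.toNNReal)) * D
  have mdec : Measurable fun r => decay Λ (r - s) :=
    (measurable_decay Λ).comp (measurable_id.sub_const s)
  have mJ : Measurable fun q : ℝ × CadlagPath (Config d E × Config d E) => J q.1 q.2 :=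
    measurable_jumpOp_evol hβ hf t measurable_fst
      ((measurable_snd.comp CadlagPath.measurable_real_eval).prodMk measurable_const)
  have mmJ : Measurable fun r => ∫⁻ w, m' w * J r w ∂Q :=
    ((hm'.comp measurable_snd).mul mJ).lintegral_prod_right'
  have step : ∫⁻ w, m' w * evol P (t - s) f ((w.1 s.toNNReal).1, y) ∂Q
      ≤ ∫⁻ w, m' w * evol P (t - s) f ((w.1 s.toNNReal).2, y) ∂Q
        + (decay Λ (t - s) * ∫⁻ w, m' w * (f ((w.1 t.toNNReal).1, y) - f ((w.1 t.toNNReal).2, y)) ∂Q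
          + ∫⁻ r in Ioo s t, decay Λ (r - s) * ∫⁻ w, m' w * R r w ∂Q) := by
    rw [h1.lintegral_mul_evol measurable_fst hβ hP hs hst hm'B haD hf hfD y,
      h2.lintegral_mul_evol measurable_snd hβ hP hs hst hm'B haD hf hfD y]
    have i1 : ∫⁻ w, m' w * f ((w.1 t.toNNReal).1, y) ∂Q ≤ ∫⁻ w, m' w * f ((w.1 t.toNNReal).2, y) ∂Q
        + ∫⁻ w, m' w * (f ((w.1 t.toNNReal).1, y) - f ((w.1 t.toNNReal).2, y)) ∂Q := by
      have mf2 : Measurable fun w : CadlagPath (Config d E × Config d E) =>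
          f ((w.1 t.toNNReal).2, y) :=
        hf.comp ((measurable_snd.comp (hev t)).prodMk measurable_const)
      rw [← lintegral_mul_add hm' mf2]
      refine lintegral_mono fun w => ?_
      gcongr
      exact le_add_tsub
    have i2 : ∀ r, ∫⁻ w, m' w * jumpOp β (evol P (t - r) f) ((w.1 r.toNNReal).1, y) ∂Q
        ≤ ∫⁻ w, m' w * J r w ∂Q + ∫⁻ w, m' w * R r w ∂Q := by
      intro r
      have mJr : Measurable fun w => J r w := mJ.comp (measurable_const.prodMk measurable_id)
      rw [← lintegral_mul_add hm' mJr]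
      refine lintegral_mono fun w => ?_
      gcongr
      exact hβ.jumpOp_le_jumpOp_add (fun q => (evol_const P _ a q).symm.le.trans
        (evol_mono P _ hfa q)) (fun q => evol_le P hfD _ q) (fun z => hG r z _)
    calc _ ≤ decay Λ (t - s) * (∫⁻ w, m' w * f ((w.1 t.toNNReal).2, y) ∂Q
        + ∫⁻ w, m' w * (f ((w.1 t.toNNReal).1, y) - f ((w.1 t.toNNReal).2, y)) ∂Q)
          + ∫⁻ r in Ioo s t, decay Λ (r - s) * (∫⁻ w, m' w * J r w ∂Q
            + ∫⁻ w, m' w * R r w ∂Q) := by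
          gcongr with r
          exact i2 r
      _ = _ := by
          rw [lintegral_mul_add mdec mmJ, mul_add]
          ring
  -- Finiteness permits cancelling this term at the end; this is why the weight and f have to be
  -- bounded.
  have hfin : ∫⁻ w, m' w * evol P (t - s) f ((w.1 s.toNNReal).2, y) ∂Q ≠ ∞ := by
    refine ne_top_of_le_ne_top (b := c * (a + D)) (ENNReal.mul_ne_top hc haD) ?_
    calc _ ≤ ∫⁻ _, c * (a + D) ∂Q := lintegral_mono fun w =>
          mul_le_mul' ((hm'm w).trans (hmc w)) (hle _)
      _ = _ := by simp
  have mu2 : Measurable fun w : CadlagPath (Config d E × Config d E) =>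
      evol P (t - s) f ((w.1 s.toNNReal).2, y) :=
    mu.comp ((measurable_snd.comp (hev s)).prodMk measurable_const)
  have split : ∫⁻ w, m' w * evol P (t - s) f ((w.1 s.toNNReal).1, y) ∂Q
      = ∫⁻ w, m' w * evol P (t - s) f ((w.1 s.toNNReal).2, y) ∂Q
        + ∫⁻ w, m w * (evol P (t - s) f ((w.1 s.toNNReal).1, y)
        - evol P (t - s) f ((w.1 s.toNNReal).2, y)) ∂Q := by
    have mm2 : Measurable fun w => m' w * evol P (t - s) f ((w.1 s.toNNReal).2, y) := hm'.mul mu2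
    rw [← lintegral_add_left mm2]
    refine lintegral_congr fun w => ?_
    by_cases hw : w ∈ B
    · simp only [m', indicator_of_mem hw]
      rw [← mul_add, add_tsub_cancel_of_le (le_of_lt hw)]
    · simp only [m', indicator_of_notMem hw]
      have hle2 : evol P (t - s) f ((w.1 s.toNNReal).1, y)
          ≤ evol P (t - s) f ((w.1 s.toNNReal).2, y) := not_lt.1 hw
      rw [tsub_eq_zero_of_le hle2]
      simp
  rw [split] at step
  refine (ENNReal.le_of_add_le_add_left hfin step).trans ?_
  gcongr with w r w
  · exact hm'm _
  · exact hm'm _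

end Coupling

/-! ### A Lyapunov function for leaving the cone ‖y‖ ≤ (M + 1) r -/

section Escape

variable {d : ℕ}

lemma hasDerivAt_max_zero_sq (x : ℝ) : HasDerivAt (fun x : ℝ => (max x 0) ^ 2) (2 * max x 0) x := by
  have h : (fun y : ℝ => (max y 0) ^ 2 - (2 * max x 0) * (y - x) - (max x 0) ^ 2)
      =O[𝓝 x] fun y => ‖y - x‖ ^ 2 := by
    refine Asymptotics.IsBigO.of_bound 1 (.of_forall fun y => ?_)
    rw [one_mul, norm_pow, norm_norm, Real.norm_eq_abs, Real.norm_eq_abs, sq_abs]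
    rcases le_total x 0 with hx | hx <;> rcases le_total y 0 with hy | hy <;>
      simp only [max_eq_left, max_eq_right, hx, hy] <;> rw [abs_le] <;> constructor <;> nlinarith
  have h1 := h.hasFDerivAt (𝕜 := ℝ) (by norm_num)
  have h2 : HasDerivAt (fun y : ℝ => (max y 0) ^ 2 - (2 * max x 0) * (y - x) - (max x 0) ^ 2) 0 x := by
    have := h1.hasDerivAt
    simpa using this
  have h3 : HasDerivAt (fun y : ℝ => (2 * max x 0) * (y - x) + (max x 0) ^ 2) (2 * max x 0) x := by
    have := (((hasDerivAt_id x).sub_const x).const_mul (2 * max x 0)).add_const ((max x 0) ^ 2)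
    simpa using this
  have h4 := h2.add h3
  rw [zero_add] at h4
  refine h4.congr_of_eventuallyEq (.of_forall fun y => ?_)
  simp

/-- The function `(((‖y‖ - M r)⁺) / r)²`, which is at least `1` for `‖y‖ ≥ (M + 1) r`. -/
noncomputable def escape (M r : ℝ) (y : IntLattice d) : ℝ≥0∞ :=
  ENNReal.ofReal ((max (‖y‖ - M * r) 0 / r) ^ 2)

/-- The rate at which `escape` decreases in time. -/
noncomputable def escapeRate (M r : ℝ) (y : IntLattice d) : ℝ≥0∞ :=
  ENNReal.ofReal (2 * M * max (‖y‖ - M * r) 0 / r ^ 2)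

/-- `∑_z λ_z min(1, ‖z‖² / r²)`. -/
noncomputable def truncMoment (lam : IntLattice d → ℝ≥0∞) (r : ℝ) : ℝ≥0∞ :=
  ∑' z, lam z * ENNReal.ofReal (min 1 ((‖z‖ / r) ^ 2))

lemma measurable_escape (M : ℝ) (y : IntLattice d) : Measurable fun r => escape M r y := by
  unfold escape; fun_prop

lemma measurable_escapeRate (M : ℝ) (y : IntLattice d) : Measurable fun r => escapeRate M r y := by
  unfold escapeRate; fun_prop

lemma measurable_truncMoment (lam : IntLattice d → ℝ≥0∞) : Measurable (truncMoment lam) := by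
  refine Measurable.tsum fun z => ?_
  fun_prop

lemma one_le_escape {M r : ℝ} (hr : 0 < r) {y : IntLattice d} (hy : (M + 1) * r ≤ ‖y‖) :
    1 ≤ escape M r y := by
  rw [escape, ENNReal.one_le_ofReal]
  have h1 : r ≤ max (‖y‖ - M * r) 0 := le_max_of_le_left (by linarith)
  exact one_le_pow₀ ((one_le_div hr).2 h1)

lemma ofReal_add_lintegral_le {F F' : ℝ → ℝ} {s r : ℝ} (hsr : s ≤ r)
    (hder : ∀ u ∈ uIcc s r, HasDerivAt F (F' u) u) (hcont : ContinuousOn F' (uIcc s r))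
    (hF : 0 ≤ F r) {v : ℝ → ℝ} (hv0 : ∀ u ∈ Ioo s r, 0 ≤ v u) (hv : ∀ u ∈ Ioo s r, v u ≤ - F' u) :
    ENNReal.ofReal (F r) + ∫⁻ u in Ioo s r, ENNReal.ofReal (v u) ≤ ENNReal.ofReal (F s) := by
  have hint := intervalIntegral.integral_eq_sub_of_hasDerivAt hder hcont.intervalIntegrable
  have h0 : 0 ≤ ∫ u in s..r, - F' u := by
    rw [intervalIntegral.integral_of_le hsr, integral_Ioc_eq_integral_Ioo]
    exact setIntegral_nonneg measurableSet_Ioo fun u hu => (hv0 u hu).trans (hv u hu)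
  have h1 : ∫⁻ u in Ioo s r, ENNReal.ofReal (v u) ≤ ENNReal.ofReal (∫ u in s..r, - F' u) := by
    rw [intervalIntegral.integral_of_le hsr, integral_Ioc_eq_integral_Ioo,
      ofReal_integral_eq_lintegral_ofReal]
    · exact setLIntegral_mono' measurableSet_Ioo fun u hu => ENNReal.ofReal_le_ofReal (hv u hu)
    · rw [uIcc_of_le hsr] at hcont
      exact (hcont.neg.integrableOn_Icc).mono_set Ioo_subset_Icc_self
    · exact (ae_restrict_iff' measurableSet_Ioo).2 (.of_forall fun u hu => (hv0 u hu).trans (hv u hu))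
  rw [intervalIntegral.integral_neg, hint] at h0 h1
  refine (add_le_add le_rfl h1).trans ?_
  rw [← ENNReal.ofReal_add hF h0]
  exact ENNReal.ofReal_le_ofReal (by linarith)

/-- With a = (‖y‖ - Mρ)⁺, minus the ρ-derivative of (a/ρ)² is 2Ma/ρ² + 2a²/ρ³. The first term comes
from the motion of the inner cone at speed M and is `escapeRate`; the second is dropped. -/
lemma escape_add_lintegral_le {M : ℝ} (hM : 0 ≤ M) {s r : ℝ} (hs : 0 < s) (hsr : s ≤ r)
    (y : IntLattice d) :
    escape M r y + ∫⁻ ρ in Ioo s r, escapeRate M ρ y ≤ escape M s y := by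
  set A := ‖y‖
  let a : ℝ → ℝ := fun ρ => max (A - M * ρ) 0
  let F' : ℝ → ℝ := fun ρ => ((2 * a ρ * (-M)) * ρ ^ 2 - (a ρ) ^ 2 * (2 * ρ)) / (ρ ^ 2) ^ 2
  have ha : ∀ ρ, 0 ≤ a ρ := fun ρ => le_max_right _ _
  have hder : ∀ ρ ∈ uIcc s r, HasDerivAt (fun ρ => (a ρ) ^ 2 / ρ ^ 2) (F' ρ) ρ := by
    intro ρ hρ
    rw [uIcc_of_le hsr] at hρ
    have hρ0 : ρ ≠ 0 := (hs.trans_le hρ.1).ne'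
    have h1 : HasDerivAt (fun ρ : ℝ => A - M * ρ) (-M) ρ := by
      simpa using ((hasDerivAt_id ρ).const_mul M).const_sub A
    have h2 : HasDerivAt (fun ρ : ℝ => (a ρ) ^ 2) (2 * a ρ * (-M)) ρ :=
      (hasDerivAt_max_zero_sq _).comp ρ h1
    have h3 : HasDerivAt (fun ρ : ℝ => ρ ^ 2) (2 * ρ) ρ := by
      simpa using hasDerivAt_pow 2 ρ
    exact h2.div h3 (pow_ne_zero 2 hρ0)
  have hcont : ContinuousOn F' (uIcc s r) := by
    rw [uIcc_of_le hsr]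
    refine ContinuousOn.div (by fun_prop) (by fun_prop) fun ρ hρ => ?_
    exact pow_ne_zero 2 (pow_ne_zero 2 (hs.trans_le hρ.1).ne')
  have := ofReal_add_lintegral_le hsr hder hcont (by positivity) (v := fun ρ => 2 * M * a ρ / ρ ^ 2)
    (fun ρ hρ => div_nonneg (mul_nonneg (by positivity) (ha ρ)) (by positivity)) fun ρ hρ => ?_
  · simpa only [escape, escapeRate, div_pow] using this
  · have hρ0 : 0 < ρ := hs.trans hρ.1
    have e : - F' ρ = 2 * M * a ρ / ρ ^ 2 + 2 * (a ρ) ^ 2 / ρ ^ 3 := by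
      simp only [F']; field_simp; ring
    rw [e]
    exact le_add_of_nonneg_right (by positivity)

/-- A short jump raises ((a/r))² by at most 2a‖z‖/r² + ‖z‖²/r². Summed against the rates, the linear
term is at most the rate at which `escape` decreases in time; the quadratic term, together with the
cost 1 of a jump longer than r, is `truncMoment`. -/
lemma tsum_escape_le {lam Γ : IntLattice d → ℝ≥0∞} (hlam : ∑' z, ‖z‖ₑ * lam z ≠ ∞) {Λ : ℝ}
    (hΓ : ∀ z, Γ z ≤ lam z) (hΓΛ : ∑' z, Γ z ≤ ENNReal.ofReal Λ) {r : ℝ} (hr : 0 < r)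
    (y : IntLattice d) :
    ∑' z, Γ z * (if ‖z‖ ≤ r then escape (∑' z, ‖z‖ₑ * lam z).toReal r (y + z) else 1)
      ≤ ENNReal.ofReal Λ * escape (∑' z, ‖z‖ₑ * lam z).toReal r y
        + escapeRate (∑' z, ‖z‖ₑ * lam z).toReal r y + truncMoment lam r := by
  set M := (∑' z, ‖z‖ₑ * lam z).toReal with hMdef
  set a : ℝ := max (‖y‖ - M * r) 0 with ha
  have ha0 : 0 ≤ a := le_max_right _ _
  have hpt : ∀ z, Γ z * (if ‖z‖ ≤ r then escape M r (y + z) else 1)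
      ≤ Γ z * escape M r y + (ENNReal.ofReal (2 * a / r ^ 2) * (‖z‖ₑ * lam z)
        + lam z * ENNReal.ofReal (min 1 ((‖z‖ / r) ^ 2))) := by
    intro z
    split_ifs with hz
    · have h1 : max (‖y + z‖ - M * r) 0 ≤ a + ‖z‖ := by
        refine max_le ?_ (by positivity)
        have := norm_add_le y z
        have := le_max_left (‖y‖ - M * r) 0
        linarith
      have h2 : (max (‖y + z‖ - M * r) 0 / r) ^ 2
          ≤ (a / r) ^ 2 + (2 * a / r ^ 2 * ‖z‖ + min 1 ((‖z‖ / r) ^ 2)) := by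
        have h3 : ‖z‖ / r ≤ 1 := (div_le_one hr).2 hz
        rw [min_eq_right (pow_le_one₀ (by positivity) h3)]
        calc _ ≤ ((a + ‖z‖) / r) ^ 2 := by gcongr
          _ = _ := by field_simp; ring
      have h3 : escape M r (y + z) ≤ escape M r y + (ENNReal.ofReal (2 * a / r ^ 2) * ‖z‖ₑ
          + ENNReal.ofReal (min 1 ((‖z‖ / r) ^ 2))) := by
        rw [escape, escape, ← ofReal_norm, ← ENNReal.ofReal_mul (by positivity),
          ← ENNReal.ofReal_add (by positivity) (by positivity),
          ← ENNReal.ofReal_add (by positivity) (by positivity)]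
        exact ENNReal.ofReal_le_ofReal h2
      calc Γ z * escape M r (y + z) ≤ Γ z * escape M r y
            + Γ z * (ENNReal.ofReal (2 * a / r ^ 2) * ‖z‖ₑ
              + ENNReal.ofReal (min 1 ((‖z‖ / r) ^ 2))) := by
            rw [← mul_add]; gcongr
        _ ≤ Γ z * escape M r y + lam z * (ENNReal.ofReal (2 * a / r ^ 2) * ‖z‖ₑ
              + ENNReal.ofReal (min 1 ((‖z‖ / r) ^ 2))) := by gcongr; exact hΓ z
        _ = _ := by ring
    · have h3 : 1 ≤ ‖z‖ / r := (one_le_div hr).2 (le_of_not_ge hz)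
      rw [min_eq_left (one_le_pow₀ h3)]
      simp only [ENNReal.ofReal_one, mul_one]
      exact (hΓ z).trans (le_add_self.trans le_add_self)
  refine (ENNReal.tsum_le_tsum hpt).trans ?_
  rw [ENNReal.tsum_add, ENNReal.tsum_add, ENNReal.tsum_mul_right, ENNReal.tsum_mul_left, ← add_assoc]
  refine add_le_add (add_le_add (by gcongr) ?_) le_rfl
  rw [← ENNReal.ofReal_toReal hlam, ← hMdef, ← ENNReal.ofReal_mul (by positivity), escapeRate]
  exact ENNReal.ofReal_le_ofReal (le_of_eq (by rw [← ha]; ring))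

lemma lintegral_min_one_sq_le {b : ℝ} (hb : 0 ≤ b) :
    ∫⁻ r in Ioi (0 : ℝ), ENNReal.ofReal (min 1 ((b / r) ^ 2)) ≤ 2 * ENNReal.ofReal b := by
  rcases hb.eq_or_lt with rfl | hb
  · simp
  rw [← Ioc_union_Ioi_eq_Ioi hb.le]
  refine (lintegral_union_le _ _ _).trans ?_
  rw [two_mul]
  refine add_le_add ?_ ?_
  · calc _ ≤ ∫⁻ _ in Ioc (0 : ℝ) b, 1 := lintegral_mono fun r => by
          rw [ENNReal.ofReal_le_one]; exact min_le_left _ _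
      _ = _ := by simp
  · have hi := integrableOn_Ioi_rpow_of_lt (show (-2 : ℝ) < -1 by norm_num) hb
    calc _ ≤ ∫⁻ r in Ioi b, ENNReal.ofReal (b ^ 2 * r ^ (-2 : ℝ)) := by
          refine setLIntegral_mono' measurableSet_Ioi fun r hr => ENNReal.ofReal_le_ofReal ?_
          refine (min_le_right _ _).trans (le_of_eq ?_)
          have hr0 : 0 < r := hb.trans hr
          rw [Real.rpow_neg hr0.le, div_pow, div_eq_mul_inv]
          norm_num
      _ = ENNReal.ofReal b := by
          rw [← ofReal_integral_eq_lintegral_ofReal (hi.const_mul _), integral_const_mul,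
            integral_Ioi_rpow_of_lt (by norm_num) hb]
          · congr 1
            rw [show (-2 : ℝ) + 1 = -1 by norm_num, Real.rpow_neg_one]
            field_simp
          · refine (ae_restrict_iff' measurableSet_Ioi).2 (.of_forall fun r hr => ?_)
            exact mul_nonneg (sq_nonneg _) (Real.rpow_nonneg (hb.trans hr).le _)

/-- Integrating min(1, ‖z‖²/r²) over r gives at most 2‖z‖: one ‖z‖ from r ≤ ‖z‖ and one from the
tail. So a first moment of the jumps suffices although the Lyapunov function is quadratic. -/
lemma lintegral_truncMoment_lt_top {lam : IntLattice d → ℝ≥0∞} (hlam : ∑' z, ‖z‖ₑ * lam z ≠ ∞) :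
    ∫⁻ r in Ioi (0 : ℝ), truncMoment lam r < ∞ := by
  have h : ∫⁻ r in Ioi (0 : ℝ), truncMoment lam r ≤ 2 * ∑' z, ‖z‖ₑ * lam z := by
    simp only [truncMoment]
    rw [lintegral_tsum fun z => by fun_prop, ← ENNReal.tsum_mul_left]
    refine ENNReal.tsum_le_tsum fun z => ?_
    rw [lintegral_const_mul _ (by fun_prop)]
    calc _ ≤ lam z * (2 * ENNReal.ofReal ‖z‖) := by gcongr; exact lintegral_min_one_sq_le (norm_nonneg z)
      _ = _ := by rw [ofReal_norm]; ring
  exact h.trans_lt (ENNReal.mul_lt_top (by simp) hlam.lt_top)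

lemma tendsto_lintegral_Ioi_atTop_zero {k : ℝ → ℝ≥0∞} (hk : Measurable k)
    (h : ∫⁻ r in Ioi (0 : ℝ), k r ≠ ∞) : Tendsto (fun T => ∫⁻ r in Ioi T, k r) atTop (𝓝 0) := by
  simp_rw [← lintegral_indicator measurableSet_Ioi] at h ⊢
  rw [← lintegral_zero (μ := (volume : Measure ℝ))]
  refine tendsto_lintegral_filter_of_dominated_convergence _
    (.of_forall fun T => hk.indicator measurableSet_Ioi) ?_ h (.of_forall fun r => ?_)
  · filter_upwards [eventually_ge_atTop 0] with T hT
    exact .of_forall fun r => indicator_le_indicator_of_subset (Ioi_subset_Ioi hT) (fun _ => zero_le) r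
  · refine tendsto_const_nhds.congr' ?_
    filter_upwards [eventually_ge_atTop r] with T hT
    simp [hT]

lemma tsum_ball_le {R : ℝ} (hR : 0 ≤ R) :
    ∑' y : IntLattice d, (if ‖y‖ ≤ R then (1 : ℝ≥0∞) else 0) ≤ ENNReal.ofReal ((2 * R + 1) ^ d) := by
  classical
  let s : Finset (IntLattice d) := Fintype.piFinset fun _ => Finset.Icc (-⌊R⌋) ⌊R⌋
  have hs : ∀ y : IntLattice d, ‖y‖ ≤ R → y ∈ s := by
    intro y hy
    rw [Fintype.mem_piFinset]
    intro i
    have h1 : |(y i : ℝ)| ≤ R := by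
      have := norm_le_pi_norm y i
      rw [Int.norm_eq_abs] at this
      exact this.trans hy
    rw [abs_le] at h1
    rw [Finset.mem_Icc]
    refine ⟨?_, Int.le_floor.2 h1.2⟩
    have : -(y i) ≤ ⌊R⌋ := Int.le_floor.2 (by push_cast; linarith)
    omega
  rw [tsum_eq_sum (s := s) fun y hy => if_neg fun h => hy (hs y h)]
  calc ∑ y ∈ s, (if ‖y‖ ≤ R then (1 : ℝ≥0∞) else 0) ≤ ∑ _ ∈ s, 1 :=
        Finset.sum_le_sum fun y _ => by split_ifs <;> simp
    _ = ENNReal.ofReal (s.card : ℝ) := by simp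
    _ ≤ _ := by
      refine ENNReal.ofReal_le_ofReal ?_
      have hfl : 0 ≤ ⌊R⌋ := Int.floor_nonneg.2 hR
      have h1 : ((⌊R⌋ + 1 - -⌊R⌋).toNat : ℝ) ≤ 2 * R + 1 := by
        have h2 : (((⌊R⌋ + 1 - -⌊R⌋).toNat : ℤ) : ℝ) = 2 * (⌊R⌋ : ℝ) + 1 := by
          rw [Int.toNat_of_nonneg (by omega)]; push_cast; ring
        rw [Int.cast_natCast] at h2
        rw [h2]
        have := Int.floor_le R
        linarith
      rw [Fintype.card_piFinset_const, Int.card_Icc]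
      push_cast
      gcongr

end Escape

/-! ### Iterating the gap inequality along joint jumps -/

section Contraction

lemma lintegral_mul_const_mul {W : Type*} [MeasurableSpace W] {μ : Measure W} {m f : W → ℝ≥0∞}
    (hm : Measurable m) (hf : Measurable f) (c : ℝ≥0∞) :
    ∫⁻ w, m w * (c * f w) ∂μ = c * ∫⁻ w, m w * f w ∂μ := by
  have h : Measurable fun w => m w * f w := hm.mul hf
  rw [← lintegral_const_mul _ h]
  exact lintegral_congr fun w => by ring

variable {d : ℕ} {E : Type*} [MetricSpace E] [CompactSpace E] [MeasurableSpace E] [BorelSpace E]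
  {PE : Kernel (Config d E) (CadlagPath (Config d E))} {β : Config d E → IntLattice d → ℝ≥0∞}
  {lam : IntLattice d → ℝ≥0∞} {Λ : ℝ}
  {P : Kernel (Config d E × IntLattice d) (CadlagPath (Config d E × IntLattice d))}
  {Q : Measure (CadlagPath (Config d E × Config d E))}

/-- The total rate of decoupling of two walkers at a common site of the ball of radius `R`. -/
noncomputable def decoupling (β : Config d E → IntLattice d → ℝ≥0∞) (R : ℝ)
    (p : Config d E × Config d E) : ℝ≥0∞ :=
  ∑' y : IntLattice d, (if ‖y‖ ≤ R then 1 else 0)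
    * ∑' z, (β (shiftConfig (-y) p.1) z - β (shiftConfig (-y) p.2) z)

/-- The rate of joint jumps by `z` from `y`, restricted to short jumps within a ball. -/
noncomputable def jointRate (β : Config d E → IntLattice d → ℝ≥0∞) (K : ℝ) (y : IntLattice d)
    (r : ℝ) (z : IntLattice d) (p : Config d E × Config d E) : ℝ≥0∞ :=
  if ‖z‖ ≤ r ∧ ‖y + z‖ ≤ K * r then
    min (β (shiftConfig (-y) p.1) z) (β (shiftConfig (-y) p.2) z) else 0

lemma jointRate_le (K : ℝ) (y : IntLattice d) (r : ℝ) (z : IntLattice d)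
    (p : Config d E × Config d E) : jointRate β K y r z p
      ≤ min (β (shiftConfig (-y) p.1) z) (β (shiftConfig (-y) p.2) z) := by
  rw [jointRate]; split_ifs
  · exact le_rfl
  · exact zero_le

lemma IsUniformizedRate.measurable_jointRate (hβ : IsUniformizedRate β lam Λ) (K : ℝ)
    (y z : IntLattice d) :
    Measurable fun q : ℝ × Config d E × Config d E => jointRate β K y q.1 z q.2 := by
  have mβ : ∀ y z, Measurable fun ζ => β (shiftConfig y ζ) z := fun y z =>
    ((hβ.continuous z).comp (continuous_shiftConfig y)).measurable
  refine Measurable.ite ?_ (((mβ _ _).comp (measurable_fst.comp measurable_snd)).min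
    ((mβ _ _).comp (measurable_snd.comp measurable_snd))) measurable_const
  exact (measurableSet_le measurable_const measurable_fst).inter
    (measurableSet_le measurable_const (measurable_fst.const_mul K))

lemma IsUniformizedRate.measurable_decoupling (hβ : IsUniformizedRate β lam Λ) :
    Measurable fun q : ℝ × Config d E × Config d E => decoupling β q.1 q.2 := by
  have mβ : ∀ y z, Measurable fun ζ => β (shiftConfig y ζ) z := fun y z =>
    ((hβ.continuous z).comp (continuous_shiftConfig y)).measurable
  refine Measurable.tsum fun y => Measurable.mul ?_ (Measurable.tsum fun z => ?_)
  · exact Measurable.ite (measurableSet_le measurable_const measurable_fst) measurable_const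
      measurable_const
  · exact ((mβ _ _).comp (measurable_fst.comp measurable_snd)).sub
      ((mβ _ _).comp (measurable_snd.comp measurable_snd))

/-- Coupling is lost in three ways: the rates differ (`decoupling`), the jump is longer than r, or
it leaves the cone. The last is paid for by `escape`, which is at least 1 outside the cone, and the
long jumps by `truncMoment`. Hence Y + D(escape + X) dominates the effect of a ring up to the stated
rates. -/
lemma IsUniformizedRate.tsum_jointRate_mul_le (hβ : IsUniformizedRate β lam Λ) {r : ℝ} (hr : 0 < r)
    {M : ℝ} (hM : M = (∑' z, ‖z‖ₑ * lam z).toReal) {y : IntLattice d} (hy : ‖y‖ ≤ (M + 1) * r)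
    (p : Config d E × Config d E) (Y D X : ℝ≥0∞) :
    ∑' z, jointRate β (M + 1) y r z p * (Y + D * (escape M r (y + z) + X))
        + (ENNReal.ofReal Λ - ∑' z, jointRate β (M + 1) y r z p) * D
      ≤ ENNReal.ofReal Λ * (Y + D * (escape M r y + X))
        + D * (escapeRate M r y + truncMoment lam r + decoupling β ((M + 1) * r) p) := by
  set G : IntLattice d → ℝ≥0∞ := fun z => jointRate β (M + 1) y r z p
  set Γ : IntLattice d → ℝ≥0∞ := fun z =>
    min (β (shiftConfig (-y) p.1) z) (β (shiftConfig (-y) p.2) z)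
  have hGΓ : ∀ z, G z ≤ Γ z := fun z => jointRate_le _ y r z p
  have hΓΛ : ∑' z, Γ z ≤ ENNReal.ofReal Λ :=
    (ENNReal.tsum_le_tsum fun z => min_le_left _ _).trans_eq (hβ.tsum_eq (shiftConfig (-y) p.1))
  have hGΛ : ∑' z, G z ≤ ENNReal.ofReal Λ := (ENNReal.tsum_le_tsum hGΓ).trans hΓΛ
  -- The rate not used by joint jumps is the part excluded by the restriction on jumps (`Γ - G`)
  -- plus the excess of the first rates over the second ones at y, a single term of `decoupling`
  -- because y lies in the ball.
  have hdec : ENNReal.ofReal Λ - ∑' z, G z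
      ≤ ∑' z, (Γ z - G z) + decoupling β ((M + 1) * r) p := by
    rw [tsub_le_iff_right]
    calc ENNReal.ofReal Λ = ∑' z, β (shiftConfig (-y) p.1) z := (hβ.tsum_eq _).symm
      _ ≤ ∑' z, (((Γ z - G z) + (β (shiftConfig (-y) p.1) z - β (shiftConfig (-y) p.2) z)) + G z) := by
          refine ENNReal.tsum_le_tsum fun z => ?_
          rw [add_right_comm, tsub_add_cancel_of_le (hGΓ z)]
          rcases le_total (β (shiftConfig (-y) p.1) z) (β (shiftConfig (-y) p.2) z) with h | h
          · simp only [Γ, min_eq_left h]; exact le_self_add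
          · simp only [Γ, min_eq_right h]; exact le_add_tsub
      _ = ∑' z, (Γ z - G z) + ∑' z, (β (shiftConfig (-y) p.1) z - β (shiftConfig (-y) p.2) z)
          + ∑' z, G z := by rw [ENNReal.tsum_add, ENNReal.tsum_add]
      _ ≤ _ := by
          gcongr
          refine le_trans (le_of_eq ?_) (ENNReal.le_tsum y)
          rw [if_pos hy, one_mul]
  have hesc : ∑' z, G z * escape M r (y + z) + ∑' z, (Γ z - G z)
      ≤ ∑' z, Γ z * (if ‖z‖ ≤ r then escape M r (y + z) else 1) := by
    rw [← ENNReal.tsum_add]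
    refine ENNReal.tsum_le_tsum fun z => ?_
    by_cases hz : ‖z‖ ≤ r
    · rw [if_pos hz]
      by_cases hyz : ‖y + z‖ ≤ (M + 1) * r
      · have : G z = Γ z := if_pos ⟨hz, hyz⟩
        simp [this]
      · have : G z = 0 := if_neg fun h => hyz h.2
        rw [this, zero_mul, zero_add, tsub_zero]
        exact le_mul_of_one_le_right' (one_le_escape hr (not_le.1 hyz).le)
    · have : G z = 0 := if_neg fun h => hz h.1
      simp [this, hz]
  have hmain := tsum_escape_le hβ.moment (fun z => (min_le_left _ _).trans (hβ.le _ z)) hΓΛ hr y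
    (Γ := Γ)
  rw [← hM] at hmain
  calc ∑' z, G z * (Y + D * (escape M r (y + z) + X)) + (ENNReal.ofReal Λ - ∑' z, G z) * D
      = (∑' z, G z) * (Y + D * X) + D * (∑' z, G z * escape M r (y + z)
        + (ENNReal.ofReal Λ - ∑' z, G z)) := by
        have e : ∑' z, G z * (Y + D * (escape M r (y + z) + X))
            = (∑' z, G z) * (Y + D * X) + D * ∑' z, G z * escape M r (y + z) := by
          rw [← ENNReal.tsum_mul_right, ← ENNReal.tsum_mul_left, ← ENNReal.tsum_add]
          exact tsum_congr fun z => by ring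
        rw [e]; ring
    _ ≤ ENNReal.ofReal Λ * (Y + D * X) + D * (∑' z, G z * escape M r (y + z)
        + (∑' z, (Γ z - G z) + decoupling β ((M + 1) * r) p)) := by gcongr
    _ = ENNReal.ofReal Λ * (Y + D * X) + D * ((∑' z, G z * escape M r (y + z)
        + ∑' z, (Γ z - G z)) + decoupling β ((M + 1) * r) p) := by ring
    _ ≤ ENNReal.ofReal Λ * (Y + D * X) + D * ((ENNReal.ofReal Λ * escape M r y
        + escapeRate M r y + truncMoment lam r) + decoupling β ((M + 1) * r) p) :=
        add_le_add le_rfl (mul_le_mul' le_rfl (add_le_add (hesc.trans hmain) le_rfl))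
    _ = _ := by ring

lemma lintegral_Ioo_add_Ioi_le (k : ℝ → ℝ≥0∞) {s r : ℝ} (h : s ≤ r) :
    (∫⁻ u in Ioi r, k u) + ∫⁻ u in Ioo s r, k u ≤ ∫⁻ u in Ioi s, k u := by
  rw [← lintegral_union measurableSet_Ioo]
  · exact lintegral_mono_set (union_subset (Ioi_subset_Ioi h) Ioo_subset_Ioi_self)
  · exact disjoint_left.2 fun u hu hu' => lt_asymm hu hu'.2

lemma lintegral_Ioo_add_Ioo_le (k : ℝ → ℝ≥0∞) {s r t : ℝ} (hsr : s ≤ r) (hrt : r ≤ t) :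
    (∫⁻ u in Ioo r t, k u) + ∫⁻ u in Ioo s r, k u ≤ ∫⁻ u in Ioo s t, k u := by
  rw [← lintegral_union measurableSet_Ioo]
  · exact lintegral_mono_set (union_subset (Ioo_subset_Ioo_left hsr) (Ioo_subset_Ioo_right hrt))
  · exact disjoint_left.2 fun u hu hu' => lt_asymm hu.1 hu'.2

/-- The bound on the future probability of escaping or decoupling. -/
noncomputable def lossBound (β : Config d E → IntLattice d → ℝ≥0∞) (lam : IntLattice d → ℝ≥0∞)
    (K t s : ℝ) (w : CadlagPath (Config d E × Config d E)) : ℝ≥0∞ :=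
  (∫⁻ r in Ioi s, truncMoment lam r) + ∫⁻ r in Ioo s t, decoupling β (K * r) (w.1 r.toNNReal)

lemma IsUniformizedRate.measurable_decoupling_path (hβ : IsUniformizedRate β lam Λ) (K : ℝ) :
    Measurable fun q : ℝ × CadlagPath (Config d E × Config d E) =>
      decoupling β (K * q.1) (q.2.1 q.1.toNNReal) :=
  hβ.measurable_decoupling.comp
    ((measurable_fst.const_mul K).prodMk CadlagPath.measurable_real_eval)

lemma IsUniformizedRate.measurable_lossBound (hβ : IsUniformizedRate β lam Λ) (K t : ℝ) :
    Measurable fun q : ℝ × CadlagPath (Config d E × Config d E) => lossBound β lam K t q.1 q.2 := by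
  refine Measurable.add (f := fun q : ℝ × CadlagPath (Config d E × Config d E) =>
    ∫⁻ r in Ioi q.1, truncMoment lam r) ?_ ?_
  · have : Antitone fun s => ∫⁻ r in Ioi s, truncMoment lam r := fun a b h =>
      lintegral_mono_set (Ioi_subset_Ioi h)
    exact this.measurable.comp measurable_fst
  · have hset : MeasurableSet {b : (ℝ × CadlagPath (Config d E × Config d E)) × ℝ |
        b.1.1 < b.2 ∧ b.2 < t} :=
      (measurableSet_lt (measurable_fst.comp measurable_fst) measurable_snd).inter
        (measurableSet_lt measurable_snd measurable_const)
    have hm : Measurable fun b : (ℝ × CadlagPath (Config d E × Config d E)) × ℝ =>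
        decoupling β (K * b.2) (b.1.2.1 b.2.toNNReal) :=
      (hβ.measurable_decoupling_path K).comp
        (measurable_snd.prodMk (measurable_snd.comp measurable_fst))
    have e : (fun q : ℝ × CadlagPath (Config d E × Config d E) => ∫⁻ r in Ioo q.1 t,
        decoupling β (K * r) (q.2.1 r.toNNReal)) = fun q => ∫⁻ r,
          {b : (ℝ × CadlagPath (Config d E × Config d E)) × ℝ | b.1.1 < b.2 ∧ b.2 < t}.indicator
          (fun b => decoupling β (K * b.2) (b.1.2.1 b.2.toNNReal)) (q, r) := by
      funext q
      rw [← lintegral_indicator measurableSet_Ioo]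
      refine lintegral_congr fun r => ?_
      simp [indicator_apply]
    rw [e]
    exact (hm.indicator hset).lintegral_prod_right' (ν := volume)

lemma lossBound_add_le (K : ℝ) {s r t : ℝ} (hsr : s ≤ r) (hrt : r ≤ t)
    (hβ : IsUniformizedRate β lam Λ) (w : CadlagPath (Config d E × Config d E)) :
    lossBound β lam K t r w + ∫⁻ u in Ioo s r, (truncMoment lam u
      + decoupling β (K * u) (w.1 u.toNNReal)) ≤ lossBound β lam K t s w := by
  rw [lintegral_add_left (measurable_truncMoment lam)]
  calc _ = ((∫⁻ u in Ioi r, truncMoment lam u) + ∫⁻ u in Ioo s r, truncMoment lam u)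
        + ((∫⁻ u in Ioo r t, decoupling β (K * u) (w.1 u.toNNReal))
          + ∫⁻ u in Ioo s r, decoupling β (K * u) (w.1 u.toNNReal)) := by rw [lossBound]; abel
    _ ≤ _ := add_le_add (lintegral_Ioo_add_Ioi_le _ hsr) (lintegral_Ioo_add_Ioo_le _ hsr hrt)

/-- Induction on the number n of rings taken into account. A joint jump by z at time r gives the
same problem at time r and site y + z, with `m` multiplied by the joint rate, which is again
measurable with respect to the past; the weights thus play the part of the coupled walk. The terms
in D bound what is lost by leaving the cone, by long jumps or differing rates, and by more than n
rings. -/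
theorem lintegral_mul_gap_le_of_pow [IsMarkovKernel PE] [IsMarkovKernel P] [IsProbabilityMeasure Q]
    (h1 : StrongMarginalMarkov PE Q Prod.fst) (h2 : StrongMarginalMarkov PE Q Prod.snd)
    (hβ : IsUniformizedRate β lam Λ) (hP : SolvesForward PE β Λ (evol P)) {t : ℝ}
    {f : Config d E × IntLattice d → ℝ≥0∞} {a D : ℝ≥0∞} (ha : a ≠ ∞) (hD : D ≠ ∞)
    (hf : Measurable f) (hfa : ∀ q, a ≤ f q) (hfD : ∀ q, f q ≤ a + D)
    {M : ℝ} (hM : M = (∑' z, ‖z‖ₑ * lam z).toReal)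
    {Y : Config d E × Config d E → ℝ≥0∞} (hYm : Measurable Y)
    (hY : ∀ p y, ‖y‖ ≤ (M + 1) * t → f (p.1, y) - f (p.2, y) ≤ Y p) (n : ℕ)
    {s : ℝ} (hs : 0 < s) (hst : s ≤ t) {y : IntLattice d} (hy : ‖y‖ ≤ (M + 1) * s)
    {m : CadlagPath (Config d E × Config d E) → ℝ≥0∞}
    (hm : Measurable[canonicalFiltration (Config d E × Config d E) s.toNNReal] m)
    {c : ℝ≥0∞} (hc : c ≠ ∞) (hmc : ∀ w, m w ≤ c) :
    ∫⁻ w, m w * (evol P (t - s) f ((w.1 s.toNNReal).1, y)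
        - evol P (t - s) f ((w.1 s.toNNReal).2, y)) ∂Q
      ≤ ∫⁻ w, m w * (Y (w.1 t.toNNReal) + D * (escape M s y
        + (lossBound β lam (M + 1) t s w + (1 - decay Λ t) ^ n))) ∂Q := by
  have hM0 : 0 ≤ M := hM ▸ ENNReal.toReal_nonneg
  induction n generalizing s y m c with
  | zero =>
    refine lintegral_mono fun w => ?_
    gcongr
    rw [pow_zero, tsub_le_iff_right]
    have h3 := evol_le P hfD (t - s) ((w.1 s.toNNReal).1, y)
    have h4 : a ≤ evol P (t - s) f ((w.1 s.toNNReal).2, y) :=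
      (evol_const P (t - s) a _).symm.le.trans (evol_mono P _ hfa _)
    calc _ ≤ D * 1 + a := by rw [mul_one, add_comm]; exact h3
      _ ≤ _ := by
        refine add_le_add (le_add_left ?_) h4
        gcongr
        exact le_add_self.trans le_add_self
  | succ n ih =>
    set κ := 1 - decay Λ t with hκ
    have hm' : Measurable m := hm.mono ((canonicalFiltration _).le _) le_rfl
    have hev : ∀ s : ℝ, Measurable fun w : CadlagPath (Config d E × Config d E) => w.1 s.toNNReal :=
      fun r => CadlagPath.measurable_eval _
    have mL := hβ.measurable_lossBound (M + 1) t
    have mdecp := hβ.measurable_decoupling_path (M + 1)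
    have mdec : Measurable fun r => decay Λ (r - s) :=
      (measurable_decay Λ).comp (measurable_id.sub_const s)
    have mYw : Measurable fun w : CadlagPath (Config d E × Config d E) => Y (w.1 t.toNNReal) :=
      hYm.comp (hev t)
    -- the bound on the integrand
    let R : ℝ → CadlagPath (Config d E × Config d E) → ℝ≥0∞ := fun r w =>
      ENNReal.ofReal Λ * (Y (w.1 t.toNNReal) + D * (escape M r y
        + (lossBound β lam (M + 1) t r w + κ ^ n)))
        + D * (escapeRate M r y + truncMoment lam r
          + decoupling β ((M + 1) * r) (w.1 r.toNNReal))
    have mR : Measurable fun q : ℝ × CadlagPath (Config d E × Config d E) => R q.1 q.2 := by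
      refine (((mYw.comp measurable_snd).add ((((measurable_escape M y).comp measurable_fst).add
        (mL.add_const _)).const_mul _)).const_mul _).add (Measurable.const_mul ?_ _)
      exact (((measurable_escapeRate M y).comp measurable_fst).add
        ((measurable_truncMoment lam).comp measurable_fst)).add mdecp
    have inner : ∀ r ∈ Ioo s t, ∫⁻ w, m w * (∑' z, jointRate β (M + 1) y r z (w.1 r.toNNReal)
            * (evol P (t - r) f ((w.1 r.toNNReal).1, y + z)
              - evol P (t - r) f ((w.1 r.toNNReal).2, y + z))
            + (ENNReal.ofReal Λ - ∑' z, jointRate β (M + 1) y r z (w.1 r.toNNReal)) * D) ∂Q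
        ≤ ∫⁻ w, m w * R r w ∂Q := by
      intro r hr
      have hr0 : 0 < r := hs.trans hr.1
      have hyr : ‖y‖ ≤ (M + 1) * r := hy.trans (by gcongr; exact hr.1.le)
      have mu := measurable_evol P (t - r) hf
      have mG : ∀ z, Measurable fun w : CadlagPath (Config d E × Config d E) =>
          jointRate β (M + 1) y r z (w.1 r.toNNReal) := fun z =>
        (hβ.measurable_jointRate (M + 1) y z).comp (measurable_const.prodMk (hev r))
      have mGF : ∀ z, Measurable[canonicalFiltration (Config d E × Config d E) r.toNNReal]
          fun w : CadlagPath (Config d E × Config d E) =>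
          jointRate β (M + 1) y r z (w.1 r.toNNReal) := fun z => by
        have h3 : Measurable fun p : Config d E × Config d E => jointRate β (M + 1) y r z p :=
          (hβ.measurable_jointRate (M + 1) y z).comp measurable_prodMk_left
        exact h3.comp (CadlagPath.measurable_eval_canonicalFiltration le_rfl)
      have mΔ : ∀ z, Measurable fun w : CadlagPath (Config d E × Config d E) =>
          evol P (t - r) f ((w.1 r.toNNReal).1, y + z)
            - evol P (t - r) f ((w.1 r.toNNReal).2, y + z) := fun z =>
        (mu.comp ((measurable_fst.comp (hev r)).prodMk measurable_const)).sub
          (mu.comp ((measurable_snd.comp (hev r)).prodMk measurable_const))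
      have mX : Measurable fun w : CadlagPath (Config d E × Config d E) =>
          lossBound β lam (M + 1) t r w := mL.comp measurable_prodMk_left
      have mB : ∀ z, Measurable fun w : CadlagPath (Config d E × Config d E) =>
          Y (w.1 t.toNNReal) + D * (escape M r (y + z)
            + (lossBound β lam (M + 1) t r w + κ ^ n)) := fun z =>
        mYw.add (((mX.add_const _).const_add _).const_mul _)
      have hz : ∀ z, ∫⁻ w, m w * jointRate β (M + 1) y r z (w.1 r.toNNReal)
            * (evol P (t - r) f ((w.1 r.toNNReal).1, y + z)
              - evol P (t - r) f ((w.1 r.toNNReal).2, y + z)) ∂Q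
          ≤ ∫⁻ w, m w * jointRate β (M + 1) y r z (w.1 r.toNNReal)
            * (Y (w.1 t.toNNReal) + D * (escape M r (y + z)
            + (lossBound β lam (M + 1) t r w + κ ^ n))) ∂Q := by
        intro z
        -- The joint rate vanishes unless y + z is in the cone at time r, exactly where the
        -- induction hypothesis is available. The new weight is bounded by c λ_z.
        by_cases hA : ‖z‖ ≤ r ∧ ‖y + z‖ ≤ (M + 1) * r
        · refine ih hr0 hr.2.le hA.2 (m := fun w => m w * jointRate β (M + 1) y r z (w.1 r.toNNReal))
            (Measurable.mul (hm.mono ((canonicalFiltration _).mono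
              (Real.toNNReal_le_toNNReal hr.1.le)) le_rfl) (mGF z)) (c := c * lam z)
            (ENNReal.mul_ne_top hc (ENNReal.ne_top_of_tsum_ne_top hβ.tsum_bound z)) fun w => ?_
          exact mul_le_mul' (hmc w) ((jointRate_le _ _ _ _ _).trans
            ((min_le_left _ _).trans (hβ.le _ z)))
        · simp [jointRate, hA]
      have mb : Measurable fun w : CadlagPath (Config d E × Config d E) =>
          (ENNReal.ofReal Λ - ∑' z, jointRate β (M + 1) y r z (w.1 r.toNNReal)) * D :=
        (measurable_const.sub (Measurable.tsum mG)).mul_const D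
      have split : ∀ F : IntLattice d → CadlagPath (Config d E × Config d E) → ℝ≥0∞,
          (∀ z, Measurable (F z)) →
          ∫⁻ w, m w * (∑' z, jointRate β (M + 1) y r z (w.1 r.toNNReal) * F z w
            + (ENNReal.ofReal Λ - ∑' z, jointRate β (M + 1) y r z (w.1 r.toNNReal)) * D) ∂Q
          = ∑' z, ∫⁻ w, m w * jointRate β (M + 1) y r z (w.1 r.toNNReal) * F z w ∂Q
            + ∫⁻ w, m w * ((ENNReal.ofReal Λ
              - ∑' z, jointRate β (M + 1) y r z (w.1 r.toNNReal)) * D) ∂Q := by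
        intro F hF
        have mS : Measurable fun w : CadlagPath (Config d E × Config d E) =>
            ∑' z, jointRate β (M + 1) y r z (w.1 r.toNNReal) * F z w :=
          Measurable.tsum fun z => (mG z).mul (hF z)
        rw [lintegral_mul_add hm' mS]
        congr 1
        have m3 : ∀ z, AEMeasurable (fun w => m w * jointRate β (M + 1) y r z (w.1 r.toNNReal)
            * F z w) Q := fun z => ((hm'.mul (mG z)).mul (hF z)).aemeasurable
        rw [← lintegral_tsum m3]
        refine lintegral_congr fun w => ?_
        rw [← ENNReal.tsum_mul_left]
        exact tsum_congr fun z => by ring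
      rw [split (fun z w => evol P (t - r) f ((w.1 r.toNNReal).1, y + z)
              - evol P (t - r) f ((w.1 r.toNNReal).2, y + z)) mΔ]
      refine (add_le_add (ENNReal.tsum_le_tsum hz) le_rfl).trans ?_
      rw [← split (fun z w => Y (w.1 t.toNNReal) + D * (escape M r (y + z)
            + (lossBound β lam (M + 1) t r w + κ ^ n))) mB]
      refine lintegral_mono fun w => ?_
      gcongr
      exact hβ.tsum_jointRate_mul_le hr0 hM hyr _ _ _ _
    have pathwise : ∀ w : CadlagPath (Config d E × Config d E),
        decay Λ (t - s) * Y (w.1 t.toNNReal) + ∫⁻ r in Ioo s t, decay Λ (r - s) * R r w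
          ≤ Y (w.1 t.toNNReal) + D * (escape M s y
            + (lossBound β lam (M + 1) t s w + κ ^ (n + 1))) := by
      intro w
      -- For a fixed path of the environments, `H` decreases in time at least at the rate `v` at
      -- which coupling is lost; hence it is a supersolution of the mild equation, and averaging
      -- over the next ring closes the induction.
      let H : ℝ → ℝ≥0∞ := fun r => Y (w.1 t.toNNReal) + D * (escape M r y
        + lossBound β lam (M + 1) t r w)
      let v : ℝ → ℝ≥0∞ := fun r => D * (escapeRate M r y + (truncMoment lam r
          + decoupling β ((M + 1) * r) (w.1 r.toNNReal)))
      have mLw : Measurable fun r => lossBound β lam (M + 1) t r w := mL.comp measurable_prodMk_right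
      have mdw : Measurable fun r : ℝ => decoupling β ((M + 1) * r) (w.1 r.toNNReal) :=
        mdecp.comp measurable_prodMk_right
      have mtd : Measurable fun u => truncMoment lam u
          + decoupling β ((M + 1) * u) (w.1 u.toNNReal) := (measurable_truncMoment lam).add mdw
      have metd : Measurable fun u => escapeRate M u y + (truncMoment lam u
          + decoupling β ((M + 1) * u) (w.1 u.toNNReal)) := (measurable_escapeRate M y).add mtd
      have mH : Measurable H := (((measurable_escape M y).add mLw).const_mul _).const_add _
      have mv : Measurable v := metd.const_mul _
      have hHv : ∀ r, s ≤ r → r ≤ t → H r + ∫⁻ u in Ioo s r, v u ≤ H s := by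
        intro r hsr hrt
        have e1 : ∫⁻ u in Ioo s r, v u = D * ((∫⁻ u in Ioo s r, escapeRate M u y)
            + ∫⁻ u in Ioo s r, (truncMoment lam u
              + decoupling β ((M + 1) * u) (w.1 u.toNNReal))) := by
          rw [lintegral_const_mul _ metd,
            lintegral_add_left (measurable_escapeRate M y)]
        rw [e1]
        calc H r + D * ((∫⁻ u in Ioo s r, escapeRate M u y)
            + ∫⁻ u in Ioo s r, (truncMoment lam u
              + decoupling β ((M + 1) * u) (w.1 u.toNNReal)))
            = Y (w.1 t.toNNReal) + D * ((escape M r y + ∫⁻ u in Ioo s r, escapeRate M u y)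
              + (lossBound β lam (M + 1) t r w + ∫⁻ u in Ioo s r, (truncMoment lam u
              + decoupling β ((M + 1) * u) (w.1 u.toNNReal)))) := by simp only [H]; ring
          _ ≤ _ := by
              simp only [H]
              gcongr
              · exact escape_add_lintegral_le hM0 hs hsr y
              · exact lossBound_add_le (M + 1) hsr hrt hβ w
      have mild := lintegral_decay_mul_le hβ.pos hst mH mv hHv
      have hR : ∀ r, decay Λ (r - s) * R r w = decay Λ (r - s) * (ENNReal.ofReal Λ * H r + v r)
          + decay Λ (r - s) * ENNReal.ofReal Λ * (D * κ ^ n) := fun r => by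
        simp only [R, H, v]; ring
      have m2 : Measurable fun r => decay Λ (r - s) * ENNReal.ofReal Λ := mdec.mul_const _
      have e2 : ∫⁻ r in Ioo s t, decay Λ (r - s) * ENNReal.ofReal Λ = 1 - decay Λ (t - s) := by
        rw [lintegral_Ioo_sub_right (fun r => decay Λ r * ENNReal.ofReal Λ), sub_self,
          lintegral_decay hβ.pos (sub_nonneg.2 hst)]
      have hκle : 1 - decay Λ (t - s) ≤ κ := tsub_le_tsub_left (decay_anti hβ.pos.le (by linarith)) _
      simp_rw [hR]
      rw [lintegral_add_right _ (m2.mul_const _), lintegral_mul_const _ m2, e2]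
      calc _ = (decay Λ (t - s) * Y (w.1 t.toNNReal)
            + ∫⁻ r in Ioo s t, decay Λ (r - s) * (ENNReal.ofReal Λ * H r + v r))
            + (1 - decay Λ (t - s)) * (D * κ ^ n) := by ring
        _ ≤ H s + κ * (D * κ ^ n) := by
            refine add_le_add (le_trans ?_ mild) (by gcongr)
            gcongr
            exact le_self_add
        _ = _ := by simp only [H]; ring
    refine (lintegral_mul_gap_le h1 h2 hβ hP hs.le hst hm hc hmc ha hD hf hfa hfD y
      (hβ.measurable_jointRate (M + 1) y) (fun r z p => jointRate_le _ _ _ _ _)).trans ?_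
    have mmR : Measurable fun q : CadlagPath (Config d E × Config d E) × ℝ =>
        m q.1 * (decay Λ (q.2 - s) * R q.2 q.1) :=
      (hm'.comp measurable_fst).mul ((mdec.comp measurable_snd).mul (mR.comp measurable_swap))
    have mRw : ∀ w, Measurable fun r => decay Λ (r - s) * R r w := fun w =>
      mdec.mul (mR.comp measurable_prodMk_right)
    calc _ ≤ decay Λ (t - s) * ∫⁻ w, m w * Y (w.1 t.toNNReal) ∂Q
          + ∫⁻ r in Ioo s t, decay Λ (r - s) * ∫⁻ w, m w * R r w ∂Q := by
          refine add_le_add ?_ (setLIntegral_mono' measurableSet_Ioo fun r hr => ?_)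
          · gcongr with w
            exact hY (w.1 t.toNNReal) y (hy.trans (by gcongr))
          · gcongr _ * ?_
            exact inner r hr
      _ = ∫⁻ w, m w * (decay Λ (t - s) * Y (w.1 t.toNNReal)
            + ∫⁻ r in Ioo s t, decay Λ (r - s) * R r w) ∂Q := by
          have mdY : Measurable fun w : CadlagPath (Config d E × Config d E) =>
            decay Λ (t - s) * Y (w.1 t.toNNReal) := mYw.const_mul _
          rw [lintegral_mul_add hm' mdY]
          congr 1
          · rw [lintegral_mul_const_mul hm' mYw]
          · simp_rw [← lintegral_const_mul _ (mRw _)]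
            rw [lintegral_lintegral_swap mmR.aemeasurable]
            refine lintegral_congr fun r => ?_
            have mRr : Measurable fun w => R r w := mR.comp measurable_prodMk_left
            rw [lintegral_mul_const_mul hm' mRr]
      _ ≤ _ := by
          exact lintegral_mono fun w => mul_le_mul' le_rfl (pathwise w)

end Contraction

/-! ### From the gap inequality to bounds uniform in the starting environments -/

section Oscillation

variable {d : ℕ} {E : Type*} [MetricSpace E] [CompactSpace E] [MeasurableSpace E] [BorelSpace E]
  {PE : Kernel (Config d E) (CadlagPath (Config d E))} {β : Config d E → IntLattice d → ℝ≥0∞}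
  {lam : IntLattice d → ℝ≥0∞} {Λ : ℝ}
  {P : Kernel (Config d E × IntLattice d) (CadlagPath (Config d E × IntLattice d))}

/-- Let the number of rings tend to infinity. The walkers are at the origin at time T, where
`escape` vanishes, so of the loss only the integrated rates after T remain. -/
theorem lintegral_gap_le {Q : Measure (CadlagPath (Config d E × Config d E))}
    [IsMarkovKernel PE] [IsMarkovKernel P] [IsProbabilityMeasure Q]
    (h1 : StrongMarginalMarkov PE Q Prod.fst) (h2 : StrongMarginalMarkov PE Q Prod.snd)
    (hβ : IsUniformizedRate β lam Λ) (hP : SolvesForward PE β Λ (evol P)) {T t : ℝ} (hT : 0 < T)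
    (hTt : T ≤ t) {f : Config d E × IntLattice d → ℝ≥0∞} {a D : ℝ≥0∞} (ha : a ≠ ∞) (hD : D ≠ ∞)
    (hf : Measurable f) (hfa : ∀ q, a ≤ f q) (hfD : ∀ q, f q ≤ a + D)
    {M : ℝ} (hM : M = (∑' z, ‖z‖ₑ * lam z).toReal)
    {Y : Config d E × Config d E → ℝ≥0∞} (hYm : Measurable Y)
    (hY : ∀ p y, ‖y‖ ≤ (M + 1) * t → f (p.1, y) - f (p.2, y) ≤ Y p) :
    ∫⁻ w, (evol P (t - T) f ((w.1 T.toNNReal).1, 0) - evol P (t - T) f ((w.1 T.toNNReal).2, 0)) ∂Q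
      ≤ ∫⁻ w, Y (w.1 t.toNNReal) ∂Q + D * ((∫⁻ r in Ioi T, truncMoment lam r)
        + ∫⁻ r in Ioo T t, ∫⁻ w, decoupling β ((M + 1) * r) (w.1 r.toNNReal) ∂Q) := by
  have hM0 : 0 ≤ M := hM ▸ ENNReal.toReal_nonneg
  refine ENNReal.le_of_forall_le_add_mul_pow hD (one_sub_decay_lt_one Λ t) fun n => ?_
  have h := lintegral_mul_gap_le_of_pow h1 h2 hβ hP ha hD hf hfa hfD hM hYm hY n hT hTt (y := 0)
    (by rw [norm_zero]; positivity) (m := fun _ => 1) (@measurable_const _ _ _ (_) _)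
    ENNReal.one_ne_top (fun _ => le_rfl)
  simp only [one_mul] at h
  refine h.trans (le_of_eq ?_)
  have hesc : escape M T (0 : IntLattice d) = 0 := by
    have : -(M * T) ≤ 0 := by nlinarith
    simp [escape, max_eq_right this]
  have mY : Measurable fun w : CadlagPath (Config d E × Config d E) => Y (w.1 t.toNNReal) :=
    hYm.comp (CadlagPath.measurable_eval _)
  have mL : Measurable fun w : CadlagPath (Config d E × Config d E) => lossBound β lam (M + 1) t T w :=
    (hβ.measurable_lossBound (M + 1) t).comp measurable_prodMk_left
  have mD : Measurable fun q : CadlagPath (Config d E × Config d E) × ℝ =>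
      decoupling β ((M + 1) * q.2) (q.1.1 q.2.toNNReal) :=
    (hβ.measurable_decoupling_path (M + 1)).comp measurable_swap
  rw [lintegral_add_left mY, lintegral_const_mul _ ((mL.add_const _).const_add _), hesc]
  simp only [zero_add]
  rw [lintegral_add_left mL, lintegral_const]
  simp only [lossBound, measure_univ, mul_one]
  rw [lintegral_add_left measurable_const, lintegral_const,
    lintegral_lintegral_swap mD.aemeasurable]
  simp only [measure_univ, mul_one]
  ring

variable {Q : Config d E → Config d E → Measure (CadlagPath (Config d E × Config d E))}

/-- The supremum over the starting points of the expected distance at the origin. -/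
noncomputable def couplingDist
    (Q : Config d E → Config d E → Measure (CadlagPath (Config d E × Config d E))) (t : ℝ) : ℝ≥0∞ :=
  ⨆ (η : Config d E) (ξ : Config d E),
    ∫⁻ w, edist ((w.1 t.toNNReal).1 0) ((w.1 t.toNNReal).2 0) ∂(Q η ξ)

lemma measurable_edist_site (x : IntLattice d) :
    Measurable fun p : Config d E × Config d E => edist (p.1 x) (p.2 x) :=
  (Continuous.edist ((continuous_apply x).comp continuous_fst)
    ((continuous_apply x).comp continuous_snd)).measurable

/-- Translation invariance of the coupling moves the site x to the origin, and the supremum over the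
starting points absorbs the shift of the initial configurations. -/
lemma IsEnvironmentCoupling.lintegral_edist_le (hQ : IsEnvironmentCoupling PE Q) (η ξ : Config d E)
    (x : IntLattice d) (t : ℝ) :
    ∫⁻ w, edist ((w.1 t.toNNReal).1 x) ((w.1 t.toNNReal).2 x) ∂(Q η ξ) ≤ couplingDist Q t := by
  have ev := CadlagPath.measurable_eval (S := Config d E × Config d E) t.toNNReal
  have msh : Measurable fun w : CadlagPath (Config d E × Config d E) =>
      (shiftConfig (-x) (w.1 t.toNNReal).1, shiftConfig (-x) (w.1 t.toNNReal).2) :=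
    ((continuous_shiftConfig (-x)).measurable.comp (measurable_fst.comp ev)).prodMk
      ((continuous_shiftConfig (-x)).measurable.comp (measurable_snd.comp ev))
  have h : (Q η ξ).map (fun w => (shiftConfig (-x) (w.1 t.toNNReal).1,
      shiftConfig (-x) (w.1 t.toNNReal).2))
      = (Q (shiftConfig (-x) η) (shiftConfig (-x) ξ)).map fun w => w.1 t.toNNReal := by
    ext A hA
    rw [Measure.map_apply msh hA, Measure.map_apply ev hA]
    exact hQ.translation (-x) η ξ t.toNNReal A hA
  have h2 := congrArg (fun μ => ∫⁻ p, edist (p.1 0) (p.2 0) ∂μ) h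
  rw [lintegral_map (measurable_edist_site 0) msh, lintegral_map (measurable_edist_site 0) ev] at h2
  simp only [shiftConfig, sub_neg_eq_add, zero_add] at h2
  rw [h2]
  exact le_iSup₂ (f := fun η ξ => ∫⁻ w, edist ((w.1 t.toNNReal).1 0) ((w.1 t.toNNReal).2 0) ∂(Q η ξ))
    _ _

/-- At every site the rates differ by a sum of distances with summable coefficients; a ball of
radius R has at most (2R + 1)^d sites. This is the source of the factor t^d in the decay condition.
-/
lemma IsEnvironmentCoupling.lintegral_decoupling_le (hQ : IsEnvironmentCoupling PE Q)
    (hβ : IsUniformizedRate β lam Λ) {κ : IntLattice d → ℝ≥0∞}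
    (hκ : ∀ η ξ, ∑' z, (β η z - β ξ z) ≤ ∑' x, κ x * edist (η x) (ξ x)) (η ξ : Config d E)
    {R : ℝ} (hR : 0 ≤ R) (t : ℝ) :
    ∫⁻ w, decoupling β R (w.1 t.toNNReal) ∂(Q η ξ)
      ≤ ENNReal.ofReal ((2 * R + 1) ^ d) * ((∑' x, κ x) * couplingDist Q t) := by
  have ev := CadlagPath.measurable_eval (S := Config d E × Config d E) t.toNNReal
  have mβ : ∀ y z, Measurable fun ζ => β (shiftConfig y ζ) z := fun y z =>
    ((hβ.continuous z).comp (continuous_shiftConfig y)).measurable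
  have mS : ∀ y, Measurable fun w : CadlagPath (Config d E × Config d E) =>
      ∑' z, (β (shiftConfig (-y) (w.1 t.toNNReal).1) z - β (shiftConfig (-y) (w.1 t.toNNReal).2) z) :=
    fun y => Measurable.tsum fun z => ((mβ _ _).comp (measurable_fst.comp ev)).sub
      ((mβ _ _).comp (measurable_snd.comp ev))
  have hsite : ∀ y, ∫⁻ w, ∑' z, (β (shiftConfig (-y) (w.1 t.toNNReal).1) z
      - β (shiftConfig (-y) (w.1 t.toNNReal).2) z) ∂(Q η ξ) ≤ (∑' x, κ x) * couplingDist Q t := by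
    intro y
    have me : ∀ x, Measurable fun w : CadlagPath (Config d E × Config d E) =>
        edist (shiftConfig (-y) (w.1 t.toNNReal).1 x) (shiftConfig (-y) (w.1 t.toNNReal).2 x) :=
      fun x => (measurable_edist_site (x - -y)).comp ev
    calc _ ≤ ∫⁻ w, ∑' x, κ x * edist (shiftConfig (-y) (w.1 t.toNNReal).1 x)
          (shiftConfig (-y) (w.1 t.toNNReal).2 x) ∂(Q η ξ) := lintegral_mono fun w => hκ _ _
      _ = ∑' x, κ x * ∫⁻ w, edist (shiftConfig (-y) (w.1 t.toNNReal).1 x)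
          (shiftConfig (-y) (w.1 t.toNNReal).2 x) ∂(Q η ξ) := by
          rw [lintegral_tsum fun x => ((me x).const_mul _).aemeasurable]
          exact tsum_congr fun x => lintegral_const_mul _ (me x)
      _ ≤ ∑' x, κ x * couplingDist Q t := ENNReal.tsum_le_tsum fun x => by
          gcongr
          exact hQ.lintegral_edist_le η ξ (x - -y) t
      _ = _ := ENNReal.tsum_mul_right
  simp only [decoupling]
  rw [lintegral_tsum fun y => ((mS y).const_mul _).aemeasurable]
  calc _ ≤ ∑' y : IntLattice d, (if ‖y‖ ≤ R then (1 : ℝ≥0∞) else 0)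
        * ((∑' x, κ x) * couplingDist Q t) := ENNReal.tsum_le_tsum fun y => by
        rw [lintegral_const_mul _ (mS y)]
        gcongr
        exact hsite y
    _ ≤ _ := by
        rw [ENNReal.tsum_mul_right]
        gcongr
        exact tsum_ball_le hR

lemma IsEnvironmentCoupling.ae_start (hPE : IsMarkovProcess PE) (hQ : IsEnvironmentCoupling PE Q)
    (η ξ : Config d E) : ∀ᵐ w ∂(Q η ξ), w.1 0 = (η, ξ) := by
  have m1 : ∀ ζ : Config d E, MeasurableSet {w : ℝ≥0 → Config d E | w 0 ≠ ζ} := fun ζ =>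
    ((measurableSet_singleton ζ).compl.preimage (measurable_pi_apply (0 : ℝ≥0)) : _)
  have h1 : ∀ᵐ w ∂(Q η ξ), (w.1 0).1 = η := by
    rw [ae_iff]
    exact (hQ.marginal_fst η ξ _ (m1 η)).trans (ae_iff.1 (hPE.start η))
  have h2 : ∀ᵐ w ∂(Q η ξ), (w.1 0).2 = ξ := by
    rw [ae_iff]
    exact (hQ.marginal_snd η ξ _ (m1 ξ)).trans (ae_iff.1 (hPE.start ξ))
  filter_upwards [h1, h2] with w hw1 hw2
  exact Prod.ext hw1 hw2

/-- The gap inequality without joint jumps: with probability e^{-ΛT} no clock rings before T and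
both walkers are still at the origin; otherwise the difference is bounded by the oscillation D. -/
theorem evol_sub_evol_le [IsMarkovKernel P] (hPE : IsMarkovProcess PE)
    (hPm : IsMarkovProcess P) (hQ : IsEnvironmentCoupling PE Q)
    (hβ : IsUniformizedRate β lam Λ) (hP : SolvesForward PE β Λ (evol P)) {T t : ℝ} (hT : 0 < T)
    (hTt : T ≤ t) {f : Config d E × IntLattice d → ℝ≥0∞} {a D : ℝ≥0∞} (ha : a ≠ ∞) (hD : D ≠ ∞)
    (hf : Measurable f) (hfa : ∀ q, a ≤ f q) (hfD : ∀ q, f q ≤ a + D) (η ξ : Config d E) :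
    evol P t f (η, 0) - evol P t f (ξ, 0)
      ≤ decay Λ T * ∫⁻ w, (evol P (t - T) f ((w.1 T.toNNReal).1, 0)
          - evol P (t - T) f ((w.1 T.toNNReal).2, 0)) ∂(Q η ξ) + (1 - decay Λ T) * D := by
  have : IsMarkovKernel PE := ⟨hPE.prob⟩
  have := hQ.prob η ξ
  have h := lintegral_mul_gap_le (hQ.markov_fst η ξ) (hQ.markov_snd η ξ) hβ hP le_rfl hT.le
    (m := fun _ => 1) (@measurable_const _ _ _ (_) _) ENNReal.one_ne_top (fun _ => le_rfl)
    (f := evol P (t - T) f) ha hD (measurable_evol P _ hf)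
    (fun q => (evol_const P _ a q).symm.le.trans (evol_mono P _ hfa q))
    (fun q => evol_le P hfD _ q) 0 (G := fun _ _ _ => 0) (fun _ => measurable_const)
    (fun _ _ _ => zero_le)
  simp only [one_mul, sub_zero, tsub_zero, zero_mul, tsum_zero, zero_add, lintegral_const, measure_univ, mul_one]
    at h
  have e : ∀ ζ, evol P T (evol P (t - T) f) ζ = evol P t f ζ := fun ζ => by
    rw [← hPm.evol_add_time hT.le (sub_nonneg.2 hTt) hf]
    congr 1; ring
  have e2 : ∫⁻ w, (evol P T (evol P (t - T) f) ((w.1 (0 : ℝ).toNNReal).1, 0)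
      - evol P T (evol P (t - T) f) ((w.1 (0 : ℝ).toNNReal).2, 0)) ∂(Q η ξ)
      = evol P t f (η, 0) - evol P t f (ξ, 0) := by
    rw [lintegral_congr_ae (g := fun _ => evol P t f (η, 0) - evol P t f (ξ, 0))]
    · simp
    · filter_upwards [hQ.ae_start hPE η ξ] with w hw
      simp only [Real.toNNReal_zero, hw, e]
  rw [e2] at h
  refine h.trans (le_of_eq ?_)
  congr 1
  simp_rw [← mul_assoc]
  rw [lintegral_mul_const _ ((measurable_decay Λ).mul_const _), lintegral_decay hβ.pos hT.le]

end Oscillation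

/-! ### Tails of integrals and moduli of continuity on the product space -/

lemma exists_forall_lintegral_Ioi_le {F : ℝ → ℝ≥0∞} (hF : ∫⁻ t in Ioi (0 : ℝ), F t < ∞)
    {ε : ℝ≥0∞} (hε : 0 < ε) : ∃ T : ℝ, 1 ≤ T ∧ ∀ g : ℝ → ℝ≥0∞, Measurable g →
      (∀ t, 0 < t → g t ≤ F t) → ∫⁻ t in Ioi T, g t ≤ ε := by
  -- F will be a supremum over starting points and need not be measurable. A measurable minorant
  -- with the same integral has small tails and dominates almost everywhere each measurable g ≤ F.
  obtain ⟨F', hF'm, hF'F, hF'e⟩ := exists_measurable_le_lintegral_eq (volume.restrict (Ioi (0 : ℝ))) F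
  have hfin : ∫⁻ t in Ioi (0 : ℝ), F' t ≠ ∞ := hF'e ▸ hF.ne
  have ht := tendsto_lintegral_Ioi_atTop_zero hF'm hfin
  obtain ⟨T, hT1, hT⟩ := ((ht.eventually (ge_mem_nhds hε)).and (eventually_ge_atTop 1)).exists
  refine ⟨T, hT, fun g hg hgF => ?_⟩
  -- max(g, F') is measurable and lies below F, so its integral cannot exceed that of F'.
  have h0 : ∫⁻ t in Ioi (0 : ℝ), (max (g t) (F' t) - F' t) = 0 := by
    rw [lintegral_sub hF'm hfin (.of_forall fun t => le_max_right _ _), tsub_eq_zero_iff_le, ← hF'e]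
    exact setLIntegral_mono' measurableSet_Ioi fun t ht => max_le (hgF t ht) (hF'F t)
  calc ∫⁻ t in Ioi T, g t ≤ ∫⁻ t in Ioi T, ((max (g t) (F' t) - F' t) + F' t) :=
        lintegral_mono fun t => (le_max_left _ _).trans le_tsub_add
    _ = (∫⁻ t in Ioi T, (max (g t) (F' t) - F' t)) + ∫⁻ t in Ioi T, F' t :=
        lintegral_add_right _ hF'm
    _ ≤ 0 + ε := by
        refine add_le_add ?_ hT1
        rw [← h0]
        exact lintegral_mono_set (Ioi_subset_Ioi (by linarith))
    _ = ε := zero_add _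

lemma exists_ge_le_of_lintegral_lt_top {F : ℝ → ℝ≥0∞} (hF : ∫⁻ t in Ioi (0 : ℝ), F t < ∞)
    {ε : ℝ≥0∞} (hε : 0 < ε) (T : ℝ) : ∃ t, T ≤ t ∧ F t ≤ ε := by
  by_contra! h
  have h1 : ∫⁻ _ in Ioi (max T 0), ε ≤ ∫⁻ t in Ioi (0 : ℝ), F t :=
    (setLIntegral_mono' measurableSet_Ioi fun t ht =>
      (h t ((le_max_left T 0).trans (le_of_lt ht))).le).trans
      (lintegral_mono_set (Ioi_subset_Ioi (le_max_right _ _)))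
  rw [setLIntegral_const, Real.volume_Ioi, ENNReal.mul_top hε.ne'] at h1
  exact absurd (top_le_iff.1 h1) hF.ne

/-- Uniform continuity on a compact product involves only finitely many coordinates. If they are all
close, g changes by at most ε; if one is not, the bound B is absorbed by a large multiple of its
distance. -/
lemma exists_le_add_sum_edist_of_continuous {d : ℕ} {E : Type*} [MetricSpace E] [CompactSpace E]
    {g : Config d E → ℝ≥0∞} (hg : Continuous g) {B : ℝ} (hB : ∀ ζ, g ζ ≤ ENNReal.ofReal B) {ε : ℝ}
    (hε : 0 < ε) : ∃ C : ℝ, ∃ F : Finset (IntLattice d), ∀ η ξ, g η ≤ g ξ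
      + (ENNReal.ofReal ε + ENNReal.ofReal C * ∑ x ∈ F, edist (η x) (ξ x)) := by
  classical
  have hft : ∀ ζ, g ζ ≠ ∞ := fun ζ => ((hB ζ).trans_lt ENNReal.ofReal_lt_top).ne
  have hc : Continuous fun ζ => (g ζ).toReal := ENNReal.continuousOn_toReal.comp_continuous hg hft
  have hu := CompactSpace.uniformContinuous_of_continuous hc
  have hb : (uniformity (Config d E)).HasBasis
      (fun If : Set (IntLattice d) × (IntLattice d → ℝ) => If.1.Finite ∧ ∀ i ∈ If.1, 0 < If.2 i)
      (fun If => ⋂ i ∈ If.1, (fun a : Config d E × Config d E => (a.1 i, a.2 i)) ⁻¹'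
        {p | dist p.1 p.2 < If.2 i}) := by
    rw [Pi.uniformity]
    exact HasBasis.iInf' fun i => Metric.uniformity_basis_dist.comap _
  obtain ⟨⟨I, δ⟩, ⟨hI, hδ⟩, h⟩ := (hb.uniformContinuous_iff Metric.uniformity_basis_dist).1 hu ε hε
  refine ⟨∑ x ∈ hI.toFinset, max B 0 / δ x, hI.toFinset, fun η ξ => ?_⟩
  by_cases hx : ∀ x ∈ I, dist (η x) (ξ x) < δ x
  · have h1 := h η ξ (by simpa using hx)
    simp only [mem_setOf_eq, Real.dist_eq] at h1
    have h2 : (g η).toReal ≤ (g ξ).toReal + ε := by linarith [(abs_lt.1 h1).2]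
    have h3 := ENNReal.ofReal_le_ofReal h2
    rw [ENNReal.ofReal_toReal (hft η), ENNReal.ofReal_add ENNReal.toReal_nonneg hε.le,
      ENNReal.ofReal_toReal (hft ξ)] at h3
    exact h3.trans (add_le_add le_rfl le_self_add)
  · push Not at hx
    obtain ⟨x, hxI, hx⟩ := hx
    have hx' : x ∈ hI.toFinset := hI.mem_toFinset.2 hxI
    have h0 : ∀ y ∈ hI.toFinset, 0 ≤ max B 0 / δ y := fun y hy =>
      div_nonneg (le_max_right _ _) (hδ y (hI.mem_toFinset.1 hy)).le
    have h1 : B ≤ (∑ x ∈ hI.toFinset, max B 0 / δ x) * dist (η x) (ξ x) := by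
      calc B ≤ max B 0 := le_max_left _ _
        _ = max B 0 / δ x * δ x := (div_mul_cancel₀ _ (hδ x hxI).ne').symm
        _ ≤ _ := mul_le_mul (Finset.single_le_sum h0 hx') hx (hδ x hxI).le (Finset.sum_nonneg h0)
    calc g η ≤ ENNReal.ofReal B := hB η
      _ ≤ ENNReal.ofReal (∑ x ∈ hI.toFinset, max B 0 / δ x) * edist (η x) (ξ x) := by
          rw [edist_dist, ← ENNReal.ofReal_mul (Finset.sum_nonneg h0)]
          exact ENNReal.ofReal_le_ofReal h1
      _ ≤ ENNReal.ofReal (∑ x ∈ hI.toFinset, max B 0 / δ x)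
            * ∑ x ∈ hI.toFinset, edist (η x) (ξ x) := by
          gcongr
          exact Finset.single_le_sum (f := fun x => edist (η x) (ξ x)) (fun _ _ => zero_le) hx'
      _ ≤ _ := le_add_self.trans le_add_self

/-! ### Choice of the times T and t from the decay of the coupling -/

section Mixing

variable {d : ℕ} {E : Type*} [MetricSpace E] [CompactSpace E] [MeasurableSpace E] [BorelSpace E]
  {PE : Kernel (Config d E) (CadlagPath (Config d E))} {β : Config d E → IntLattice d → ℝ≥0∞}
  {lam : IntLattice d → ℝ≥0∞} {Λ : ℝ}
  {P : Kernel (Config d E × IntLattice d) (CadlagPath (Config d E × IntLattice d))}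
  {Q : Config d E → Config d E → Measure (CadlagPath (Config d E × Config d E))}

lemma ofReal_ball_le {K t : ℝ} (hK : 0 ≤ K) (ht : 1 ≤ t) :
    ENNReal.ofReal ((2 * (K * t) + 1) ^ d)
      ≤ ENNReal.ofReal ((2 * K + 1) ^ d) * ENNReal.ofReal (t ^ d) := by
  rw [← ENNReal.ofReal_mul (by positivity), ← mul_pow]
  refine ENNReal.ofReal_le_ofReal (pow_le_pow_left₀ (by positivity) (by nlinarith) _)

/-- Both loss rates are integrable at infinity: `truncMoment` by the first moment of the jumps,
`decoupling` in the growing ball by the t^d condition. T serves all starting points and all later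
horizons t; each of the two parts is made at most 1/4. -/
theorem exists_loss_le_half (hQ : IsEnvironmentCoupling PE Q) (hd : IntegrableCouplingDecay Q)
    (hβ : IsUniformizedRate β lam Λ) {M : ℝ} (hM : 0 ≤ M) : ∃ T : ℝ, 1 ≤ T ∧
      ∀ (t : ℝ) (η ξ : Config d E), (∫⁻ r in Ioi T, truncMoment lam r)
        + ∫⁻ r in Ioo T t, ∫⁻ w, decoupling β ((M + 1) * r) (w.1 r.toNNReal) ∂(Q η ξ) ≤ 1 / 2 := by
  obtain ⟨κ, hκs, hκ⟩ := hβ.lipschitz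
  have h4 : (0 : ℝ≥0∞) < 1 / 4 := ENNReal.div_pos one_ne_zero (by simp)
  obtain ⟨T₁, hT₁, h1⟩ := exists_forall_lintegral_Ioi_le
    (lintegral_truncMoment_lt_top hβ.moment) h4
  set C := ENNReal.ofReal ((2 * (M + 1) + 1) ^ d) * ∑' x, κ x with hC
  have hCt : C ≠ ∞ := ENNReal.mul_ne_top ENNReal.ofReal_ne_top hκs
  have hF : ∫⁻ t in Ioi (0 : ℝ), C * (ENNReal.ofReal (t ^ d) * couplingDist Q t) < ∞ := by
    rw [lintegral_const_mul' _ _ hCt]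
    exact ENNReal.mul_lt_top hCt.lt_top hd
  obtain ⟨T₂, hT₂, h2⟩ := exists_forall_lintegral_Ioi_le hF h4
  refine ⟨max T₁ T₂, hT₁.trans (le_max_left _ _), fun t η ξ => ?_⟩
  have := hQ.prob η ξ
  have hm : Measurable fun r => ∫⁻ w, decoupling β ((M + 1) * r) (w.1 r.toNNReal) ∂(Q η ξ) :=
    (hβ.measurable_decoupling_path (M + 1)).lintegral_prod_right'
  have e4 : (1 / 2 : ℝ≥0∞) = 1 / 4 + 1 / 4 := by
    rw [ENNReal.div_add_div_same, ENNReal.div_eq_div_iff] <;> norm_num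
  rw [e4]
  refine add_le_add ((lintegral_mono_set (Ioi_subset_Ioi (le_max_left _ _))).trans
    (h1 _ (measurable_truncMoment lam) fun _ _ => le_rfl)) ?_
  -- Cutting to r > 1 is harmless as T₂ ≥ 1, and it is needed to bound the number of sites of the
  -- ball by a multiple of r^d.
  refine le_trans ?_ (h2 _ (hm.indicator (measurableSet_Ioi (a := 1))) fun r _ => ?_)
  · calc ∫⁻ r in Ioo (max T₁ T₂) t, ∫⁻ w, decoupling β ((M + 1) * r) (w.1 r.toNNReal) ∂(Q η ξ)
        ≤ ∫⁻ r in Ioi T₂, ∫⁻ w, decoupling β ((M + 1) * r) (w.1 r.toNNReal) ∂(Q η ξ) :=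
          lintegral_mono_set fun r hr => (le_max_right T₁ T₂).trans_lt hr.1
      _ ≤ _ := by
          refine setLIntegral_mono' measurableSet_Ioi fun r hr => ?_
          rw [indicator_of_mem (show r ∈ Ioi 1 from lt_of_le_of_lt hT₂ hr)]
  · by_cases hr : r ∈ Ioi (1 : ℝ)
    · rw [indicator_of_mem hr]
      have hr1 : (1 : ℝ) ≤ r := le_of_lt hr
      refine (hQ.lintegral_decoupling_le hβ hκ η ξ (by positivity) r).trans ?_
      calc _ ≤ ENNReal.ofReal ((2 * (M + 1) + 1) ^ d) * ENNReal.ofReal (r ^ d)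
            * ((∑' x, κ x) * couplingDist Q r) := by
            gcongr; exact ofReal_ball_le (by positivity) hr1
        _ = _ := by rw [hC]; ring
    · rw [indicator_of_notMem hr]; exact zero_le

/-- Y bounds the gap at all sites of the ball of radius Kt at once, by summing local distances over
the ball. Its expectation is at most ε/2 plus a constant times t^d `couplingDist Q t`, and
integrability makes the latter small at some arbitrarily late time t. -/
theorem exists_lintegral_modulus_le (hQ : IsEnvironmentCoupling PE Q)
    (hd : IntegrableCouplingDecay Q) {K : ℝ} (hK : 0 ≤ K) {g : Config d E → ℝ≥0∞}
    (hg : Continuous g) {B : ℝ} (hB : ∀ ζ, g ζ ≤ ENNReal.ofReal B) {ε : ℝ} (hε : 0 < ε) (T : ℝ) :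
    ∃ t, T ≤ t ∧ ∃ Y : Config d E × Config d E → ℝ≥0∞, Measurable Y ∧
      (∀ p y, ‖y‖ ≤ K * t → liftEP g (p.1, y) - liftEP g (p.2, y) ≤ Y p) ∧
      ∀ η ξ, ∫⁻ w, Y (w.1 t.toNNReal) ∂(Q η ξ) ≤ ENNReal.ofReal ε := by
  obtain ⟨C, F, hCF⟩ := exists_le_add_sum_edist_of_continuous hg hB (half_pos hε)
  set C' := ENNReal.ofReal C * (F.card * ENNReal.ofReal ((2 * K + 1) ^ d)) with hC'
  have hC't : C' ≠ ∞ := ENNReal.mul_ne_top ENNReal.ofReal_ne_top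
    (ENNReal.mul_ne_top (by simp) ENNReal.ofReal_ne_top)
  have hδ : 0 < ENNReal.ofReal (ε / 2) / C' :=
    ENNReal.div_pos (ENNReal.ofReal_pos.2 (half_pos hε)).ne' hC't
  obtain ⟨t, ht, htF⟩ := exists_ge_le_of_lintegral_lt_top hd hδ (max T 1)
  have ht1 : 1 ≤ t := (le_max_right _ _).trans ht
  have mS : Measurable fun p : Config d E × Config d E => ∑' y : IntLattice d,
      (if ‖y‖ ≤ K * t then (1 : ℝ≥0∞) else 0) * ∑ x ∈ F, edist (p.1 (x - -y)) (p.2 (x - -y)) :=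
    Measurable.tsum fun y => (Finset.measurable_fun_sum F fun x _ =>
      measurable_edist_site (x - -y)).const_mul _
  refine ⟨t, (le_max_left _ _).trans ht, fun p => ENNReal.ofReal (ε / 2) + ENNReal.ofReal C
    * ∑' y : IntLattice d, (if ‖y‖ ≤ K * t then (1 : ℝ≥0∞) else 0)
      * ∑ x ∈ F, edist (p.1 (x - -y)) (p.2 (x - -y)), (mS.const_mul _).const_add _,
      fun p y hy => ?_, fun η ξ => ?_⟩
  · rw [tsub_le_iff_left]
    refine (hCF (shiftConfig (-y) p.1) (shiftConfig (-y) p.2)).trans ?_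
    refine add_le_add le_rfl (add_le_add le_rfl (mul_le_mul' le_rfl ?_))
    refine le_trans (le_of_eq ?_) (ENNReal.le_tsum y)
    rw [if_pos hy, one_mul]
    rfl
  · have := hQ.prob η ξ
    have ev := CadlagPath.measurable_eval (S := Config d E × Config d E) t.toNNReal
    have me : ∀ x, Measurable fun w : CadlagPath (Config d E × Config d E) =>
        edist ((w.1 t.toNNReal).1 x) ((w.1 t.toNNReal).2 x) :=
      fun x => (measurable_edist_site x).comp ev
    have mSw : ∀ y : IntLattice d, Measurable fun w : CadlagPath (Config d E × Config d E) =>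
        ∑ x ∈ F, edist ((w.1 t.toNNReal).1 (x - -y)) ((w.1 t.toNNReal).2 (x - -y)) := fun y =>
      Finset.measurable_fun_sum F fun x _ => me (x - -y)
    have mSS : Measurable fun w : CadlagPath (Config d E × Config d E) => ∑' y : IntLattice d,
        (if ‖y‖ ≤ K * t then (1 : ℝ≥0∞) else 0)
        * ∑ x ∈ F, edist ((w.1 t.toNNReal).1 (x - -y)) ((w.1 t.toNNReal).2 (x - -y)) :=
      mS.comp ev
    rw [lintegral_add_left measurable_const, lintegral_const, measure_univ, mul_one,
      lintegral_const_mul _ mSS, lintegral_tsum fun y => ((mSw y).const_mul _).aemeasurable,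
      show ENNReal.ofReal ε = ENNReal.ofReal (ε / 2) + ENNReal.ofReal (ε / 2) by
        rw [← ENNReal.ofReal_add (by positivity) (by positivity), add_halves]]
    refine add_le_add le_rfl ?_
    have hsum : ∑' y : IntLattice d, ∫⁻ w, (if ‖y‖ ≤ K * t then (1 : ℝ≥0∞) else 0)
        * ∑ x ∈ F, edist ((w.1 t.toNNReal).1 (x - -y)) ((w.1 t.toNNReal).2 (x - -y)) ∂(Q η ξ)
        ≤ ENNReal.ofReal ((2 * (K * t) + 1) ^ d) * (F.card * couplingDist Q t) := by
      calc _ ≤ ∑' y : IntLattice d, (if ‖y‖ ≤ K * t then (1 : ℝ≥0∞) else 0)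
            * (F.card * couplingDist Q t) := ENNReal.tsum_le_tsum fun y => by
            rw [lintegral_const_mul _ (mSw y), lintegral_finsetSum _ fun x _ => me (x - -y),
              ← nsmul_eq_mul]
            gcongr
            exact Finset.sum_le_card_nsmul _ _ _ fun x _ => hQ.lintegral_edist_le η ξ _ t
        _ ≤ _ := by
            rw [ENNReal.tsum_mul_right]
            gcongr
            exact tsum_ball_le (by positivity)
    calc _ ≤ ENNReal.ofReal C * (ENNReal.ofReal ((2 * K + 1) ^ d) * ENNReal.ofReal (t ^ d)
          * (F.card * couplingDist Q t)) := by
          gcongr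
          exact hsum.trans (mul_le_mul' (ofReal_ball_le hK ht1) le_rfl)
      _ = C' * (ENNReal.ofReal (t ^ d) * couplingDist Q t) := by rw [hC']; ring
      _ ≤ C' * (ENNReal.ofReal (ε / 2) / C') := by gcongr; exact htF
      _ ≤ _ := ENNReal.mul_div_le

end Mixing

/-! ### Contraction of the oscillation and uniform mixing -/

section Mixing

variable {d : ℕ} {E : Type*} [MetricSpace E] [CompactSpace E] [MeasurableSpace E] [BorelSpace E]
  {PE : Kernel (Config d E) (CadlagPath (Config d E))} {β : Config d E → IntLattice d → ℝ≥0∞}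
  {lam : IntLattice d → ℝ≥0∞} {Λ : ℝ}
  {P : Kernel (Config d E × IntLattice d) (CadlagPath (Config d E × IntLattice d))}
  {Q : Config d E → Config d E → Measure (CadlagPath (Config d E × Config d E))}

/-- The semigroup of the environment process. -/
noncomputable def evolEP (P : Kernel (Config d E × IntLattice d)
    (CadlagPath (Config d E × IntLattice d))) (t : ℝ) (g : Config d E → ℝ≥0∞) (ζ : Config d E) :
    ℝ≥0∞ := evol P t (liftEP g) (ζ, 0)

lemma measurable_evolEP [IsMarkovKernel P] (t : ℝ) {g : Config d E → ℝ≥0∞} (hg : Measurable g) :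
    Measurable (evolEP P t g) :=
  (measurable_evol P t hg.liftEP).comp measurable_prodMk_right

lemma evolEP_le [IsMarkovKernel P] (t : ℝ) {g : Config d E → ℝ≥0∞} {c : ℝ≥0∞} (h : ∀ ζ, g ζ ≤ c)
    (ζ : Config d E) : evolEP P t g ζ ≤ c :=
  evol_le P (fun _ => h _) t _

lemma le_evolEP [IsMarkovKernel P] (t : ℝ) {g : Config d E → ℝ≥0∞} {c : ℝ≥0∞} (h : ∀ ζ, c ≤ g ζ)
    (ζ : Config d E) : c ≤ evolEP P t g ζ :=
  (evol_const P t c (ζ, 0)).symm.le.trans (evol_mono P t (fun _ => h _) _)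

lemma SolvesForward.evol_liftEP_eq [IsMarkovKernel P] (hPE : IsEnvironment PE)
    (hβ : IsUniformizedRate β lam Λ) (hP : SolvesForward PE β Λ (evol P)) {t : ℝ} (ht : 0 ≤ t)
    {g : Config d E → ℝ≥0∞} {c : ℝ≥0∞} (hc : c ≠ ∞) (hg : Measurable g) (hgc : ∀ q, g q ≤ c) :
    evol P t (liftEP g) = liftEP (evolEP P t g) :=
  funext fun p => hP.evol_liftEP hPE hβ ht hc hg hgc p

lemma SolvesForward.evolEP_add [IsMarkovKernel P] (hPE : IsEnvironment PE)
    (hPm : IsMarkovProcess P) (hβ : IsUniformizedRate β lam Λ)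
    (hP : SolvesForward PE β Λ (evol P)) {s t : ℝ} (hs : 0 ≤ s) (ht : 0 ≤ t)
    {g : Config d E → ℝ≥0∞} {c : ℝ≥0∞} (hc : c ≠ ∞) (hg : Measurable g) (hgc : ∀ q, g q ≤ c) :
    evolEP P (s + t) g = evolEP P s (evolEP P t g) := by
  funext ζ
  rw [evolEP, hPm.evol_add_time hs ht hg.liftEP, hP.evol_liftEP_eq hPE hβ ht hc hg hgc]
  rfl

lemma SolvesForward.continuous_evolEP [IsMarkovKernel P] (hPE : IsEnvironment PE)
    (hβ : IsUniformizedRate β lam Λ) (hP : SolvesForward PE β Λ (evol P)) {t : ℝ} (ht : 0 ≤ t)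
    {g : Config d E → ℝ≥0∞} {c : ℝ≥0∞} (hc : c ≠ ∞) (hg : Continuous g) (hgc : ∀ q, g q ≤ c) :
    Continuous (evolEP P t g) := by
  have hl : Continuous (liftEP g) := by
    refine continuous_prod_of_discrete_right.2 fun x => ?_
    exact hg.comp (continuous_shiftConfig (-x))
  exact (hP.continuous_evol hPE hβ ht hl hc fun q => hgc _).comp (Continuous.prodMk_left 0)

/-- Nothing rings before T with probability e^{-ΛT}, and from then on at most half of the
oscillation is lost; so κ = e^{-ΛT}/2 + (1 - e^{-ΛT}) < 1. Neither T nor κ depends on g; only the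
time t at which the environments are compared does. -/
theorem exists_evolEP_le_add_mul [Nonempty E] [IsMarkovKernel P] (hPE : IsEnvironment PE)
    (hPm : IsMarkovProcess P) (hQ : IsEnvironmentCoupling PE Q) (hd : IntegrableCouplingDecay Q)
    (hβ : IsUniformizedRate β lam Λ) (hP : SolvesForward PE β Λ (evol P)) :
    ∃ κ : ℝ≥0∞, κ < 1 ∧ ∀ (g : Config d E → ℝ≥0∞) (B : ℝ) (D : ℝ≥0∞), Continuous g →
      (∀ ζ, g ζ ≤ ENNReal.ofReal B) → D ≠ ∞ → (∀ η ξ, g η ≤ g ξ + D) → ∀ ε : ℝ, 0 < ε →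
      ∃ t : ℝ, 0 ≤ t ∧ ∀ η ξ, evolEP P t g η ≤ evolEP P t g ξ + (ENNReal.ofReal ε + κ * D) := by
  have : IsMarkovKernel PE := ⟨hPE.markov.prob⟩
  set M := (∑' z, ‖z‖ₑ * lam z).toReal with hM
  have hM0 : 0 ≤ M := ENNReal.toReal_nonneg
  obtain ⟨T, hT1, hT⟩ := exists_loss_le_half hQ hd hβ hM0
  have hT0 : 0 < T := by linarith
  have hd1 : decay Λ T ≤ 1 := decay_le_one hβ.pos.le hT0.le
  have hd0 : decay Λ T ≠ 0 := (ENNReal.ofReal_pos.2 (Real.exp_pos _)).ne'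
  refine ⟨decay Λ T * (1 / 2) + (1 - decay Λ T), ?_, ?_⟩
  · calc decay Λ T * (1 / 2) + (1 - decay Λ T) < decay Λ T + (1 - decay Λ T) := by
          refine ENNReal.add_lt_add_right (by simp) ?_
          calc decay Λ T * (1 / 2) < decay Λ T * 1 := by
                rw [ENNReal.mul_lt_mul_iff_right hd0 (decay_ne_top _ _)]
                simp
            _ = _ := mul_one _
      _ = 1 := add_tsub_cancel_of_le hd1
  · intro g B D hg hB hD hosc ε hε
    obtain ⟨t, hTt, Y, hYm, hY, hYi⟩ := exists_lintegral_modulus_le hQ hd (K := M + 1) (by positivity)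
      hg hB hε T
    refine ⟨t, hT0.le.trans hTt, fun η ξ => ?_⟩
    have := hQ.prob η ξ
    set a := ⨅ ζ, g ζ with ha
    have hat : a ≠ ∞ := ((iInf_le g η).trans_lt ((hB η).trans_lt ENNReal.ofReal_lt_top)).ne
    have haD : ∀ ζ, g ζ ≤ a + D := fun ζ => by
      rw [ha, ENNReal.iInf_add]
      exact le_iInf fun ξ => hosc ζ ξ
    have h1 := evol_sub_evol_le hPE.markov hPm hQ hβ hP hT0 hTt hat hD hg.measurable.liftEP
      (fun q => iInf_le g _) (fun q => haD _) η ξ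
    have h2 := lintegral_gap_le (hQ.markov_fst η ξ) (hQ.markov_snd η ξ) hβ hP hT0 hTt hat hD
      hg.measurable.liftEP (fun q => iInf_le g _) (fun q => haD _) hM hYm hY
    rw [← tsub_le_iff_left]
    calc _ ≤ decay Λ T * (ENNReal.ofReal ε + D * (1 / 2)) + (1 - decay Λ T) * D := by
          refine h1.trans (add_le_add (mul_le_mul' le_rfl (h2.trans ?_)) le_rfl)
          exact add_le_add (hYi η ξ) (mul_le_mul' le_rfl (hT t η ξ))
      _ ≤ 1 * ENNReal.ofReal ε + decay Λ T * (D * (1 / 2)) + (1 - decay Λ T) * D := by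
          rw [mul_add]; gcongr
      _ = _ := by ring

/-- The environment process forgets its starting point, uniformly. -/
theorem exists_forall_evolEP_le_add [Nonempty E] [IsMarkovKernel P] (hPE : IsEnvironment PE)
    (hPm : IsMarkovProcess P) (hQ : IsEnvironmentCoupling PE Q) (hd : IntegrableCouplingDecay Q)
    (hβ : IsUniformizedRate β lam Λ) (hP : SolvesForward PE β Λ (evol P))
    {g : Config d E → ℝ≥0∞} (hg : Continuous g) {B : ℝ} (hB : ∀ ζ, g ζ ≤ ENNReal.ofReal B)
    {ε : ℝ} (hε : 0 < ε) : ∃ t₀ : ℝ, 0 ≤ t₀ ∧ ∀ t, t₀ ≤ t → ∀ η ξ,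
      evolEP P t g η ≤ evolEP P t g ξ + ENNReal.ofReal ε := by
  obtain ⟨κ, hκ, hstep⟩ := exists_evolEP_le_add_mul hPE hPm hQ hd hβ hP
  have hBt : ENNReal.ofReal B ≠ ∞ := ENNReal.ofReal_ne_top
  have hle : ∀ t ζ, evolEP P t g ζ ≤ ENNReal.ofReal B := fun t => evolEP_le t hB
  have key : ∀ n : ℕ, ∀ ε : ℝ, 0 < ε → ∃ t : ℝ, 0 ≤ t ∧ ∀ η ξ, evolEP P t g η
      ≤ evolEP P t g ξ + (ENNReal.ofReal ε + κ ^ n * ENNReal.ofReal B) := by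
    intro n
    induction n with
    | zero =>
      intro ε _
      refine ⟨0, le_rfl, fun η ξ => (hle 0 η).trans ?_⟩
      rw [pow_zero, one_mul]
      exact le_add_self.trans le_add_self
    | succ n ih =>
      intro ε hε
      obtain ⟨t, ht, h1⟩ := ih (ε / 2) (half_pos hε)
      -- The contraction is applied to the evolved function, continuous by the Feller property,
      -- whose oscillation is already reduced.
      obtain ⟨s, hs, h2⟩ := hstep (evolEP P t g) B _ (hP.continuous_evolEP hPE hβ ht hBt hg hB)
        (hle t) (ENNReal.add_ne_top.2 ⟨ENNReal.ofReal_ne_top,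
          ENNReal.mul_ne_top (ENNReal.pow_ne_top (hκ.trans_le le_top).ne) hBt⟩) h1 (ε / 2) (half_pos hε)
      refine ⟨s + t, add_nonneg hs ht, fun η ξ => ?_⟩
      rw [hP.evolEP_add hPE hPm hβ hs ht hBt hg.measurable hB]
      refine (h2 η ξ).trans (add_le_add le_rfl ?_)
      calc ENNReal.ofReal (ε / 2) + κ * (ENNReal.ofReal (ε / 2) + κ ^ n * ENNReal.ofReal B)
          ≤ ENNReal.ofReal (ε / 2) + (1 * ENNReal.ofReal (ε / 2) + κ ^ (n + 1) * ENNReal.ofReal B) := by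
            rw [mul_add, pow_succ', mul_assoc]
            gcongr
        _ = _ := by
            rw [one_mul, ← add_assoc, ← ENNReal.ofReal_add (by positivity) (by positivity), add_halves]
  have hlim : Tendsto (fun n : ℕ => κ ^ n * ENNReal.ofReal B) atTop (𝓝 0) := by
    have := ENNReal.Tendsto.mul_const (b := ENNReal.ofReal B)
      (ENNReal.tendsto_pow_atTop_nhds_zero_of_lt_one hκ) (.inr hBt)
    rwa [zero_mul] at this
  obtain ⟨n, hn⟩ := (hlim.eventually (ge_mem_nhds (ENNReal.ofReal_pos.2 (half_pos hε)))).exists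
  obtain ⟨t, ht, h⟩ := key n (ε / 2) (half_pos hε)
  have h' : ∀ η ξ, evolEP P t g η ≤ evolEP P t g ξ + ENNReal.ofReal ε := by
    intro η ξ
    refine (h η ξ).trans (add_le_add le_rfl ?_)
    calc _ ≤ ENNReal.ofReal (ε / 2) + ENNReal.ofReal (ε / 2) := by gcongr
      _ = _ := by rw [← ENNReal.ofReal_add (by positivity) (by positivity), add_halves]
  -- A Markov operator does not increase the oscillation, so what holds at time t holds at all later
  -- times.
  refine ⟨t, ht, fun r hr η ξ => ?_⟩
  rw [show r = (r - t) + t by ring, hP.evolEP_add hPE hPm hβ (sub_nonneg.2 hr) ht hBt hg.measurable hB]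
  have h2 : ∀ ζ, evolEP P t g ζ ≤ (⨅ ζ, evolEP P t g ζ) + ENNReal.ofReal ε := fun ζ => by
    rw [ENNReal.iInf_add]
    exact le_iInf fun ξ => h' ζ ξ
  calc _ ≤ (⨅ ζ, evolEP P t g ζ) + ENNReal.ofReal ε := evolEP_le (r - t) h2 η
    _ ≤ _ := by
      gcongr
      exact le_evolEP (r - t) (fun ζ => iInf_le _ ζ) ξ

end Mixing

/-! ### The stationary measure: existence, uniqueness, ergodicity -/

section Invariant

variable {d : ℕ} {E : Type*} [MetricSpace E] [CompactSpace E] [MeasurableSpace E] [BorelSpace E]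
  {P : Kernel (Config d E × IntLattice d) (CadlagPath (Config d E × IntLattice d))}

/-- The transition semigroup of the environment process contracts to the measure `μ`. -/
def IsMixingEP (P : Kernel (Config d E × IntLattice d) (CadlagPath (Config d E × IntLattice d)))
    (μ : Measure (Config d E)) : Prop :=
  ∀ (g : Config d E → ℝ≥0∞) (B : ℝ), Continuous g → (∀ ζ, g ζ ≤ ENNReal.ofReal B) →
    ∀ ε : ℝ, 0 < ε → ∃ t₀ : ℝ, 0 ≤ t₀ ∧ ∀ t, t₀ ≤ t → ∀ ζ,
      evolEP P t g ζ ≤ ∫⁻ ξ, g ξ ∂μ + ENNReal.ofReal ε ∧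
      ∫⁻ ξ, g ξ ∂μ ≤ evolEP P t g ζ + ENNReal.ofReal ε

lemma ENNReal.le_of_forall_pos_le_add_ofReal {a b : ℝ≥0∞}
    (h : ∀ ε : ℝ, 0 < ε → a ≤ b + ENNReal.ofReal ε) : a ≤ b := by
  refine ENNReal.le_of_forall_pos_le_add fun ε hε _ => ?_
  have := h ε (by exact_mod_cast hε)
  rwa [ENNReal.ofReal_coe_nnreal] at this

/-- The probability measures on a compact space are compact; μ is an ultrafilter limit of the laws
at integer times from one starting point. For n ≥ t the law at time n averages values of the evolved
function at time t, which are within ε of each other, and this passes to the limit. -/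
theorem exists_isMixingEP [Nonempty E] [IsMarkovKernel P]
    (hcont : ∀ (t : ℝ) (g : Config d E → ℝ≥0∞) (c : ℝ≥0∞), 0 ≤ t → c ≠ ∞ → Continuous g →
      (∀ ζ, g ζ ≤ c) → Continuous (evolEP P t g))
    (hadd : ∀ (s t : ℝ) (g : Config d E → ℝ≥0∞) (c : ℝ≥0∞), 0 ≤ s → 0 ≤ t → c ≠ ∞ → Measurable g →
      (∀ ζ, g ζ ≤ c) → evolEP P (s + t) g = evolEP P s (evolEP P t g))
    (hosc : ∀ (g : Config d E → ℝ≥0∞) (B : ℝ), Continuous g → (∀ ζ, g ζ ≤ ENNReal.ofReal B) →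
      ∀ ε : ℝ, 0 < ε → ∃ t₀ : ℝ, 0 ≤ t₀ ∧ ∀ t, t₀ ≤ t → ∀ η ξ,
        evolEP P t g η ≤ evolEP P t g ξ + ENNReal.ofReal ε) :
    ∃ μ : Measure (Config d E), IsProbabilityMeasure μ ∧ IsMixingEP P μ := by
  obtain ⟨ζ₀⟩ : Nonempty (Config d E) := inferInstance
  have mz : ∀ n : ℕ, Measurable fun w : CadlagPath (Config d E × IntLattice d) =>
      shiftConfig (-(w.1 (n : ℝ).toNNReal).2) (w.1 (n : ℝ).toNNReal).1 := fun n =>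
    measurable_shift_neg.comp (CadlagPath.measurable_eval _)
  let μs : ℕ → ProbabilityMeasure (Config d E) := fun n =>
    ⟨(P (ζ₀, 0)).map fun w => shiftConfig (-(w.1 (n : ℝ).toNNReal).2) (w.1 (n : ℝ).toNNReal).1,
      Measure.isProbabilityMeasure_map (mz n).aemeasurable⟩
  have hμs : ∀ (n : ℕ) (g : Config d E → ℝ≥0∞), Measurable g →
      ∫⁻ ζ, g ζ ∂(μs n : Measure (Config d E)) = evolEP P n g ζ₀ := fun n g hg =>
    lintegral_map hg (mz n)
  let ℱ : Ultrafilter ℕ := hyperfilter ℕ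
  obtain ⟨μ, -, hμ⟩ := isCompact_univ.ultrafilter_le_nhds (ℱ.map μs) (by simp)
  have hlim : Tendsto μs ℱ (𝓝 μ) := hμ
  refine ⟨μ, inferInstance, fun g B hg hB ε hε => ?_⟩
  have hBt : ENNReal.ofReal B ≠ ∞ := ENNReal.ofReal_ne_top
  have hgt : ∀ ζ, g ζ ≠ ∞ := fun ζ => ne_top_of_le_ne_top hBt (hB ζ)
  have hconv : Tendsto (fun n : ℕ => evolEP P n g ζ₀) ℱ (𝓝 (∫⁻ ξ, g ξ ∂(μ : Measure _))) := by
    let g' : BoundedContinuousFunction (Config d E) ℝ≥0 :=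
      BoundedContinuousFunction.mkOfCompact ⟨fun ζ => (g ζ).toNNReal,
        ENNReal.continuousOn_toNNReal.comp_continuous hg hgt⟩
    have h := (ProbabilityMeasure.tendsto_iff_forall_lintegral_tendsto.1 hlim) g'
    have e : (fun ζ => (g' ζ : ℝ≥0∞)) = g := funext fun ζ => ENNReal.coe_toNNReal (hgt ζ)
    simp only [e] at h
    exact h.congr fun n => hμs n g hg.measurable
  obtain ⟨t₀, ht₀, h⟩ := hosc g B hg hB ε hε
  refine ⟨t₀, ht₀, fun t ht ζ => ?_⟩
  have ht0 : 0 ≤ t := ht₀.trans ht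
  have hev : ∀ᶠ n : ℕ in ℱ, t ≤ n :=
    (tendsto_natCast_atTop_atTop.eventually_ge_atTop t).filter_mono Nat.hyperfilter_le_atTop
  have hsplit : ∀ n : ℕ, t ≤ n → evolEP P n g ζ₀ = evolEP P (n - t) (evolEP P t g) ζ₀ := by
    intro n hn
    rw [← hadd _ _ g _ (sub_nonneg.2 hn) ht0 hBt hg.measurable hB, sub_add_cancel]
  constructor
  · refine ge_of_tendsto (hconv.add_const _) (hev.mono fun n hn => ?_)
    rw [hsplit n hn, ← tsub_le_iff_right]
    exact le_evolEP _ (fun ξ => tsub_le_iff_right.2 (h t ht ζ ξ)) _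
  · refine le_of_tendsto hconv (hev.mono fun n hn => ?_)
    rw [hsplit n hn]
    exact evolEP_le _ (fun ξ => h t ht ξ ζ) _

/-- The transition kernel of the environment process. -/
noncomputable def kernelEP (P : Kernel (Config d E × IntLattice d)
    (CadlagPath (Config d E × IntLattice d))) [IsMarkovKernel P] (t : ℝ) :
    Kernel (Config d E) (Config d E) :=
  ((transitionKernel P).map fun q : Config d E × IntLattice d => shiftConfig (-q.2) q.1).comap
    (fun ζ => (t, (ζ, (0 : IntLattice d))))
    (measurable_const.prodMk (measurable_id.prodMk measurable_const))

instance [IsMarkovKernel P] (t : ℝ) : IsMarkovKernel (kernelEP P t) := by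
  have := Kernel.IsMarkovKernel.map (transitionKernel P) (measurable_shift_neg (d := d) (E := E))
  unfold kernelEP
  infer_instance

lemma lintegral_kernelEP [IsMarkovKernel P] (t : ℝ) {g : Config d E → ℝ≥0∞} (hg : Measurable g)
    (ζ : Config d E) : ∫⁻ ξ, g ξ ∂(kernelEP P t ζ) = evolEP P t g ζ := by
  rw [kernelEP, Kernel.comap_apply, Kernel.lintegral_map _ measurable_shift_neg _ hg]
  exact lintegral_transitionKernel P t _ hg.liftEP

lemma kernelEP_apply [IsMarkovKernel P] (t : ℝ≥0) {A : Set (Config d E)} (hA : MeasurableSet A)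
    (η : Config d E) : kernelEP P t η A = P (η, 0) {w | seenFromWalker w t ∈ A} := by
  have mz : Measurable fun w : CadlagPath (Config d E × IntLattice d) => seenFromWalker w t :=
    measurable_shift_neg.comp (CadlagPath.measurable_eval _)
  rw [← lintegral_indicator_one hA, lintegral_kernelEP _ (measurable_one.indicator hA), evolEP, evol,
    ← lintegral_indicator_one (show MeasurableSet {w | seenFromWalker w t ∈ A} from mz hA)]
  refine lintegral_congr fun w => ?_
  simp only [Real.toNNReal_coe]
  rfl

lemma isStationaryEP_iff [IsMarkovKernel P] {ν : Measure (Config d E)} :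
    IsStationaryEP P ν ↔ ∀ t : ℝ≥0, ν.bind (kernelEP P t) = ν := by
  refine forall_congr' fun t => ⟨fun h => ?_, fun h A hA => ?_⟩
  · ext A hA
    rw [Measure.bind_apply hA (kernelEP P t).measurable.aemeasurable, ← h A hA]
    exact lintegral_congr fun η => kernelEP_apply t hA η
  · conv_rhs => rw [← h, Measure.bind_apply hA (kernelEP P t).measurable.aemeasurable]
    exact lintegral_congr fun η => (kernelEP_apply t hA η).symm

lemma IsStationaryEP.lintegral_evolEP [IsMarkovKernel P] {ν : Measure (Config d E)}
    (h : IsStationaryEP P ν) {t : ℝ} (ht : 0 ≤ t) {g : Config d E → ℝ≥0∞} (hg : Measurable g) :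
    ∫⁻ ζ, evolEP P t g ζ ∂ν = ∫⁻ ζ, g ζ ∂ν := by
  have := isStationaryEP_iff.1 h t.toNNReal
  rw [Real.coe_toNNReal _ ht] at this
  conv_rhs => rw [← this, Measure.lintegral_bind (kernelEP P t).measurable.aemeasurable
    hg.aemeasurable]
  exact lintegral_congr fun ζ => (lintegral_kernelEP t hg ζ).symm

lemma measure_eq_of_lintegral_continuous {μ ν : Measure (Config d E)} [IsFiniteMeasure μ]
    (h : ∀ (g : Config d E → ℝ≥0∞) (B : ℝ), Continuous g →
      (∀ ζ, g ζ ≤ ENNReal.ofReal B) → ∫⁻ ζ, g ζ ∂μ = ∫⁻ ζ, g ζ ∂ν) : μ = ν := by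
  refine ext_of_forall_lintegral_eq_of_IsFiniteMeasure fun f => ?_
  have hc : Continuous fun ζ => (f ζ : ℝ≥0∞) := ENNReal.continuous_coe.comp f.continuous
  obtain ⟨B, hB⟩ := isCompact_univ.exists_bound_of_continuousOn
    (NNReal.continuous_coe.comp f.continuous).continuousOn
  refine h _ B hc fun ζ => ?_
  rw [← ENNReal.ofReal_coe_nnreal]
  exact ENNReal.ofReal_le_ofReal ((le_abs_self _).trans (hB ζ (mem_univ _)))

variable {μ : Measure (Config d E)} [IsProbabilityMeasure μ]

/-- At late times, `evolEP P (s + t) g ζ` is close to the integral of g by mixing of g, and to the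
integral of `evolEP P t g` by mixing of the evolved function. -/
theorem IsMixingEP.isStationaryEP [IsMarkovKernel P] [Nonempty E]
    (hcont : ∀ (t : ℝ) (g : Config d E → ℝ≥0∞) (c : ℝ≥0∞), 0 ≤ t → c ≠ ∞ → Continuous g →
      (∀ ζ, g ζ ≤ c) → Continuous (evolEP P t g))
    (hadd : ∀ (s t : ℝ) (g : Config d E → ℝ≥0∞) (c : ℝ≥0∞), 0 ≤ s → 0 ≤ t → c ≠ ∞ → Measurable g →
      (∀ ζ, g ζ ≤ c) → evolEP P (s + t) g = evolEP P s (evolEP P t g))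
    (hμ : IsMixingEP P μ) : IsStationaryEP P μ := by
  obtain ⟨ζ⟩ : Nonempty (Config d E) := inferInstance
  refine isStationaryEP_iff.2 fun t => (measure_eq_of_lintegral_continuous fun g B hg hB => ?_).symm
  have hBt : ENNReal.ofReal B ≠ ∞ := ENNReal.ofReal_ne_top
  rw [Measure.lintegral_bind (kernelEP P t).measurable.aemeasurable hg.measurable.aemeasurable]
  simp_rw [lintegral_kernelEP _ hg.measurable]
  have key : ∀ ε : ℝ, 0 < ε → ∃ s : ℝ,
      evolEP P s g ζ ≤ ∫⁻ ξ, g ξ ∂μ + ENNReal.ofReal ε ∧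
      ∫⁻ ξ, g ξ ∂μ ≤ evolEP P s g ζ + ENNReal.ofReal ε ∧
      evolEP P s g ζ ≤ ∫⁻ ξ, evolEP P t g ξ ∂μ + ENNReal.ofReal ε ∧
      ∫⁻ ξ, evolEP P t g ξ ∂μ ≤ evolEP P s g ζ + ENNReal.ofReal ε := by
    intro ε hε
    obtain ⟨s₁, hs₁, h1⟩ := hμ g B hg hB ε hε
    obtain ⟨s₂, hs₂, h2⟩ := hμ (evolEP P t g) B (hcont t g _ t.2 hBt hg hB) (evolEP_le t hB) ε hε
    refine ⟨max s₁ s₂ + t, (h1 _ ((le_max_left _ _).trans (le_add_of_nonneg_right t.2)) ζ).1,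
      (h1 _ ((le_max_left _ _).trans (le_add_of_nonneg_right t.2)) ζ).2, ?_⟩
    rw [hadd (max s₁ s₂) t g _ (hs₁.trans (le_max_left _ _)) t.2 hBt hg.measurable hB]
    exact h2 _ (le_max_right _ _) ζ
  refine le_antisymm ?_ ?_ <;> refine ENNReal.le_of_forall_pos_le_add_ofReal fun ε hε => ?_ <;>
    obtain ⟨s, h1, h2, h3, h4⟩ := key (ε / 2) (half_pos hε) <;>
    rw [← add_halves ε, ENNReal.ofReal_add (half_pos hε).le (half_pos hε).le, ← add_assoc]
  · exact h2.trans (add_le_add h3 le_rfl)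
  · exact h4.trans (add_le_add h1 le_rfl)

/-- Integrate the mixing estimate against ν: stationarity makes the left side the ν-integral of g at
every time. -/
theorem IsMixingEP.eq_of_isStationaryEP [IsMarkovKernel P] (hμ : IsMixingEP P μ)
    {ν : Measure (Config d E)} [IsProbabilityMeasure ν] (hν : IsStationaryEP P ν) : ν = μ := by
  refine measure_eq_of_lintegral_continuous fun g B hg hB => ?_
  have hm : ∀ t, Measurable (evolEP P t g) := fun t => measurable_evolEP t hg.measurable
  refine le_antisymm ?_ ?_ <;> refine ENNReal.le_of_forall_pos_le_add_ofReal fun ε hε => ?_ <;>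
    obtain ⟨t, ht, h⟩ := hμ g B hg hB ε hε <;> rw [← hν.lintegral_evolEP ht hg.measurable]
  · calc _ ≤ ∫⁻ _, (∫⁻ ξ, g ξ ∂μ + ENNReal.ofReal ε) ∂ν := lintegral_mono fun ζ => (h t le_rfl ζ).1
      _ = _ := by simp
  · calc ∫⁻ ξ, g ξ ∂μ = ∫⁻ _, (∫⁻ ξ, g ξ ∂μ) ∂ν := by simp
      _ ≤ ∫⁻ ζ, (evolEP P t g ζ + ENNReal.ofReal ε) ∂ν := lintegral_mono fun ζ => (h t le_rfl ζ).2
      _ = _ := by rw [lintegral_add_left (hm t)]; simp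

/-- A unique stationary law is ergodic. -/
theorem IsStationaryEP.isErgodicEP [IsMarkovKernel P] (hμ : IsStationaryEP P μ)
    (huniq : ∀ ν : Measure (Config d E), IsProbabilityMeasure ν → IsStationaryEP P ν → ν = μ) :
    IsErgodicEP P μ := by
  refine ⟨hμ, fun A hA hinv => ?_⟩
  by_cases h0 : μ A = 0
  · exact .inl h0
  right
  have hν : IsProbabilityMeasure (μ[|A]) := cond_isProbabilityMeasure h0
  have hst : IsStationaryEP P (μ[|A]) := by
    intro t B hB
    have hk : ∀ η C, MeasurableSet C → P (η, 0) {w | seenFromWalker w t ∈ C} = kernelEP P t η C :=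
      fun η C hC => (kernelEP_apply t hC η).symm
    -- Almost surely the process stays in an invariant set A, or outside it, at time t. Hence
    -- conditioning μ on A gives a stationary measure, and uniqueness forces μ(A) = 1.
    have h1 : ∀ᵐ η ∂μ, A.indicator (fun η => kernelEP P t η B) η = kernelEP P t η (B ∩ A) := by
      filter_upwards [hinv t] with η hη
      rw [hk η A hA] at hη
      by_cases hηA : η ∈ A
      · rw [indicator_of_mem hηA] at hη ⊢
        have h2 : kernelEP P t η Aᶜ = 0 := by
          rw [prob_compl_eq_zero_iff hA]; simpa using hη
        exact (measure_inter_conull' (measure_mono_null (diff_subset_compl _ _) h2)).symm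
      · rw [indicator_of_notMem hηA] at hη ⊢
        exact (measure_mono_null inter_subset_right hη).symm
    have h3 : ∫⁻ η in A, kernelEP P t η B ∂μ = μ (B ∩ A) := by
      rw [← lintegral_indicator hA, lintegral_congr_ae h1, ← hμ t _ (hB.inter hA)]
      exact lintegral_congr fun η => kernelEP_apply t (hB.inter hA) η
    simp_rw [hk _ _ hB]
    rw [ProbabilityTheory.cond, lintegral_smul_measure, h3, Measure.smul_apply,
      Measure.restrict_apply hB]
  have h := huniq _ hν hst
  rw [← h]
  exact cond_apply_self h0 (measure_ne_top _ _)

end Invariant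

/-! ### Moment bounds for the displacement of the walk -/

section Supersolution

variable {d : ℕ} {E : Type*} [MetricSpace E] [CompactSpace E] [MeasurableSpace E] [BorelSpace E]
  {PE : Kernel (Config d E) (CadlagPath (Config d E))} {β : Config d E → IntLattice d → ℝ≥0∞}
  {lam : IntLattice d → ℝ≥0∞} {Λ : ℝ}
  {P : Kernel (Config d E × IntLattice d) (CadlagPath (Config d E × IntLattice d))}

/-- A function of time and position that dominates its own expected increments dominates the
transition operator of the walk. -/
theorem SolvesForward.evol_le_of_supersolution [IsMarkovKernel PE] [IsMarkovKernel P]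
    (hβ : IsUniformizedRate β lam Λ) (hP : SolvesForward PE β Λ (evol P)) {h : ℝ} (hh : 0 ≤ h)
    {f : Config d E × IntLattice d → ℝ≥0∞} {c : ℝ≥0∞} (hc : c ≠ ∞) (hf : Measurable f)
    (hfc : ∀ q, f q ≤ c) {H v : ℝ → IntLattice d → ℝ≥0∞} (mH : ∀ y, Measurable fun r => H r y)
    (mv : ∀ y, Measurable fun r => v r y) (hend : ∀ q, f q ≤ H h q.2)
    (hH : ∀ y s r, 0 ≤ s → s ≤ r → r ≤ h → H r y + ∫⁻ u in Ioo s r, v u y ≤ H s y)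
    (hJ : ∀ ζ y r, 0 ≤ r → r ≤ h →
      ∑' z, β ζ z * H r (y + z) ≤ ENNReal.ofReal Λ * H r y + v r y)
    (p : Config d E × IntLattice d) : evol P h f p ≤ H 0 p.2 := by
  set κ : ℝ≥0∞ := 1 - decay Λ h with hκ
  have md := measurable_decay Λ
  -- Induction on the number of rings along the backward equation; more than n rings cost c κ^n.
  have key : ∀ n : ℕ, ∀ s, 0 ≤ s → s ≤ h → ∀ q, evol P (h - s) f q ≤ H s q.2 + c * κ ^ n := by
    intro n
    induction n with
    | zero =>
      intro s _ _ q
      rw [pow_zero, mul_one]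
      exact (evol_le P hfc _ q).trans le_add_self
    | succ n ih =>
      intro s hs hsh q
      have hsub : 0 ≤ h - s := sub_nonneg.2 hsh
      rw [hP.evol_eq_backwardOp hβ hsub hc hf hfc q, _root_.backwardOp]
      have h1 : evolEnv PE (h - s) f q ≤ H h q.2 := evol_le PE (fun ζ => hend (ζ, q.2)) _ _
      have h2 : ∀ u ∈ Ioo 0 (h - s), evolEnv PE u (jumpOp β (evol P (h - s - u) f)) q
          ≤ ENNReal.ofReal Λ * H (u + s) q.2 + v (u + s) q.2 + ENNReal.ofReal Λ * (c * κ ^ n) := by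
        intro u hu
        refine evol_le PE (fun ζ => ?_) _ _
        have h3 := ih (u + s) (by linarith [hu.1]) (by linarith [hu.2])
        rw [show h - (u + s) = h - s - u by ring] at h3
        calc jumpOp β (evol P (h - s - u) f) (ζ, q.2)
            ≤ ∑' z, β (shiftConfig (-q.2) ζ) z * (H (u + s) (q.2 + z) + c * κ ^ n) :=
              ENNReal.tsum_le_tsum fun z => by gcongr; exact h3 _
          _ = ∑' z, β (shiftConfig (-q.2) ζ) z * H (u + s) (q.2 + z)
              + ENNReal.ofReal Λ * (c * κ ^ n) := by
              simp_rw [mul_add]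
              rw [ENNReal.tsum_add, ENNReal.tsum_mul_right, hβ.tsum_eq]
          _ ≤ _ := by
              refine add_le_add (hJ _ _ _ (by linarith [hu.1]) (by linarith [hu.2])) le_rfl
      have h4 : ∫⁻ u in Ioo 0 (h - s), decay Λ u *
            (ENNReal.ofReal Λ * H (u + s) q.2 + v (u + s) q.2)
          = ∫⁻ r in Ioo s h, decay Λ (r - s) * (ENNReal.ofReal Λ * H r q.2 + v r q.2) := by
        have := lintegral_Ioo_sub_right (fun u => decay Λ u *
            (ENNReal.ofReal Λ * H (u + s) q.2 + v (u + s) q.2)) s h s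
        simp only [sub_add_cancel, sub_self] at this
        exact this.symm
      calc decay Λ (h - s) * evolEnv PE (h - s) f q
            + ∫⁻ u in Ioo 0 (h - s), decay Λ u * evolEnv PE u (jumpOp β (evol P (h - s - u) f)) q
          ≤ decay Λ (h - s) * H h q.2 + ∫⁻ u in Ioo 0 (h - s),
            (decay Λ u * (ENNReal.ofReal Λ * H (u + s) q.2 + v (u + s) q.2)
              + decay Λ u * ENNReal.ofReal Λ * (c * κ ^ n)) := by
            refine add_le_add (by gcongr) (setLIntegral_mono' measurableSet_Ioo fun u hu => ?_)
            rw [mul_assoc, ← mul_add]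
            gcongr
            exact h2 u hu
        _ = (decay Λ (h - s) * H h q.2 + ∫⁻ r in Ioo s h,
              decay Λ (r - s) * (ENNReal.ofReal Λ * H r q.2 + v r q.2))
            + (1 - decay Λ (h - s)) * (c * κ ^ n) := by
            rw [lintegral_add_right _ ((md.mul_const _).mul_const _),
              lintegral_mul_const _ (md.mul_const _), lintegral_decay hβ.pos hsub, h4, add_assoc]
        _ ≤ _ := by
            refine add_le_add (lintegral_decay_mul_le hβ.pos hsh (mH q.2) (mv q.2)
              fun r hsr hrh => hH q.2 s r hs hsr hrh) ?_
            have : 1 - decay Λ (h - s) ≤ κ :=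
              tsub_le_tsub_left (decay_anti hβ.pos.le (by linarith)) _
            calc (1 - decay Λ (h - s)) * (c * κ ^ n) ≤ κ * (c * κ ^ n) := by gcongr
              _ = _ := by ring
  refine ENNReal.le_of_forall_le_add_mul_pow hc (one_sub_decay_lt_one Λ h) fun n => ?_
  simpa only [sub_zero] using key n 0 le_rfl hh p

lemma measurable_ofReal_comp_snd (φ : IntLattice d → ℝ) :
    Measurable fun q : Config d E × IntLattice d => ENNReal.ofReal (φ q.2) :=
  ENNReal.measurable_ofReal.comp ((measurable_of_countable φ).comp measurable_snd)

lemma min_norm_add_le (x y z : IntLattice d) {k : ℝ} (hk : 0 ≤ k) :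
    min ‖y + z - x‖ k ≤ min ‖y - x‖ k + min ‖z‖ k := by
  have h : ‖y + z - x‖ ≤ ‖y - x‖ + ‖z‖ := by
    rw [show y + z - x = (y - x) + z by abel]; exact norm_add_le _ _
  rcases le_total ‖y - x‖ k with h1 | h1 <;> rcases le_total ‖z‖ k with h2 | h2
  · rw [min_eq_left h1, min_eq_left h2]; exact (min_le_left _ _).trans h
  · rw [min_eq_right h2]
    exact (min_le_right _ _).trans (le_add_of_nonneg_left (le_min (norm_nonneg _) hk))
  · rw [min_eq_right h1]
    exact (min_le_right _ _).trans (le_add_of_nonneg_right (le_min (norm_nonneg _) hk))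
  · rw [min_eq_right h1]
    exact (min_le_right _ _).trans (le_add_of_nonneg_right (le_min (norm_nonneg _) hk))

/-- The function min(‖y - x‖, k) + M(h - r) loses M per unit of time, which pays for the mean length
of the jumps. The cap k supplies the boundedness required for comparison and is removed by monotone
convergence. -/
theorem SolvesForward.evol_enorm_sub_le [IsMarkovKernel PE] [IsMarkovKernel P]
    (hβ : IsUniformizedRate β lam Λ) (hP : SolvesForward PE β Λ (evol P)) {h : ℝ} (hh : 0 ≤ h)
    (p : Config d E × IntLattice d) :
    evol P h (fun q => ‖q.2 - p.2‖ₑ) p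
      ≤ ENNReal.ofReal ((∑' z, ‖z‖ₑ * lam z).toReal * h) := by
  set M := (∑' z, ‖z‖ₑ * lam z).toReal with hM
  have hM0 : 0 ≤ M := ENNReal.toReal_nonneg
  set x := p.2
  have key : ∀ k : ℕ, evol P h (fun q => ENNReal.ofReal (min ‖q.2 - x‖ k)) p
      ≤ ENNReal.ofReal (M * h) := by
    intro k
    have hk : (0 : ℝ) ≤ k := Nat.cast_nonneg k
    have := hP.evol_le_of_supersolution hβ hh (c := ENNReal.ofReal k) ENNReal.ofReal_ne_top
      (measurable_ofReal_comp_snd fun y => min ‖y - x‖ k)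
      (fun q => ENNReal.ofReal_le_ofReal (min_le_right _ _))
      (H := fun r y => ENNReal.ofReal (min ‖y - x‖ k + M * (h - r)))
      (v := fun _ _ => ENNReal.ofReal M) (fun y => by fun_prop) (fun y => by fun_prop)
      (fun q => by simp) ?_ ?_ p
    · simpa [x, min_eq_left hk] using this
    · intro y s r hs hsr hrh
      refine ofReal_add_lintegral_le (F := fun r => min ‖y - x‖ k + M * (h - r))
        (F' := fun _ => -M) hsr (fun u _ => ?_) continuousOn_const ?_ (fun _ _ => hM0)
        (fun _ _ => by simp)
      · simpa using ((((hasDerivAt_id u).const_sub h).const_mul M).const_add (min ‖y - x‖ k))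
      · have := sub_nonneg.2 hrh; positivity
    · intro ζ y r hr hrh
      have h0 : 0 ≤ M * (h - r) := mul_nonneg hM0 (sub_nonneg.2 hrh)
      calc ∑' z, β ζ z * ENNReal.ofReal (min ‖y + z - x‖ k + M * (h - r))
          ≤ ∑' z, (β ζ z * ENNReal.ofReal (min ‖y - x‖ k + M * (h - r)) + ‖z‖ₑ * lam z) := by
            refine ENNReal.tsum_le_tsum fun z => ?_
            have h1 : ENNReal.ofReal (min ‖y + z - x‖ k + M * (h - r))
                ≤ ENNReal.ofReal (min ‖y - x‖ k + M * (h - r)) + ‖z‖ₑ := by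
              rw [← ofReal_norm, ← ENNReal.ofReal_add (by positivity) (norm_nonneg _)]
              refine ENNReal.ofReal_le_ofReal ?_
              have := min_norm_add_le x y z hk
              have := min_le_left ‖z‖ (k : ℝ)
              linarith
            calc _ ≤ β ζ z * (ENNReal.ofReal (min ‖y - x‖ k + M * (h - r)) + ‖z‖ₑ) := by gcongr
              _ ≤ _ := by
                rw [mul_add, mul_comm (β ζ z) ‖z‖ₑ]
                gcongr
                exact hβ.le ζ z
        _ = _ := by
            rw [ENNReal.tsum_add, ENNReal.tsum_mul_right, hβ.tsum_eq, hM,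
              ENNReal.ofReal_toReal hβ.moment]
  have hsup : ∀ q : Config d E × IntLattice d, ‖q.2 - x‖ₑ
      = ⨆ k : ℕ, ENNReal.ofReal (min ‖q.2 - x‖ k) := by
    intro q
    refine le_antisymm ?_ (iSup_le fun k => ?_)
    · refine le_iSup_of_le ⌈‖q.2 - x‖⌉₊ ?_
      rw [min_eq_left (Nat.le_ceil _), ofReal_norm]
    · rw [← ofReal_norm]; exact ENNReal.ofReal_le_ofReal (min_le_left _ _)
  unfold evol
  simp_rw [hsup]
  rw [lintegral_iSup]
  · exact iSup_le key
  · exact fun k => (measurable_ofReal_comp_snd fun y => min ‖y - x‖ k).comp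
      (CadlagPath.measurable_eval _)
  · intro a b hab w
    exact ENNReal.ofReal_le_ofReal (min_le_min_left _ (by exact_mod_cast hab))

/-- Same comparison with a square: the cross term of a jump is paid for by the growth of M(h - r)
inside the square, and the capped second moment of the jumps is k² `truncMoment`. The constant C
leaves room for iteration over a time grid. -/
theorem SolvesForward.evol_sq_le [IsMarkovKernel PE] [IsMarkovKernel P]
    (hβ : IsUniformizedRate β lam Λ) (hP : SolvesForward PE β Λ (evol P)) {h : ℝ} (hh : 0 ≤ h)
    {k C : ℝ} (hk : 0 < k) (hC : 0 ≤ C) (x : IntLattice d) (p : Config d E × IntLattice d) :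
    evol P h (fun q => ENNReal.ofReal ((min ‖q.2 - x‖ k + C) ^ 2)) p
      ≤ ENNReal.ofReal ((min ‖p.2 - x‖ k + C + (∑' z, ‖z‖ₑ * lam z).toReal * h) ^ 2)
        + ENNReal.ofReal (k ^ 2) * truncMoment lam k * ENNReal.ofReal h := by
  set M := (∑' z, ‖z‖ₑ * lam z).toReal with hM
  have hM0 : 0 ≤ M := ENNReal.toReal_nonneg
  set W := ENNReal.ofReal (k ^ 2) * truncMoment lam k with hW
  have hA0 : ∀ y, 0 ≤ min ‖y - x‖ k := fun y => le_min (norm_nonneg _) hk.le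
  have := hP.evol_le_of_supersolution hβ hh (c := ENNReal.ofReal ((k + C) ^ 2))
      ENNReal.ofReal_ne_top
      (measurable_ofReal_comp_snd fun y => (min ‖y - x‖ k + C) ^ 2)
      (fun q => ENNReal.ofReal_le_ofReal ?_)
      (H := fun r y => ENNReal.ofReal ((min ‖y - x‖ k + C + M * (h - r)) ^ 2)
        + W * ENNReal.ofReal (h - r))
      (v := fun r y => ENNReal.ofReal (2 * M * (min ‖y - x‖ k + C + M * (h - r))) + W)
      (fun y => by fun_prop) (fun y => by fun_prop)
      (fun q => by simp) ?_ ?_ p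
  · simpa using this
  · have := min_le_right ‖q.2 - x‖ k
    have := hA0 q.2
    gcongr
  · intro y s r hs hsr hrh
    have hA := hA0 y
    have h1 := ofReal_add_lintegral_le (F := fun r => (min ‖y - x‖ k + C + M * (h - r)) ^ 2)
        (F' := fun r => 2 * (min ‖y - x‖ k + C + M * (h - r)) * -M) hsr (fun u _ => ?_)
        (by fun_prop) (sq_nonneg _)
        (v := fun r => 2 * M * (min ‖y - x‖ k + C + M * (h - r))) (fun u hu => ?_)
        (fun u _ => le_of_eq (by ring))
    · rw [lintegral_add_right _ measurable_const, setLIntegral_const, Real.volume_Ioo]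
      calc _ = (ENNReal.ofReal ((min ‖y - x‖ k + C + M * (h - r)) ^ 2)
            + ∫⁻ u in Ioo s r, ENNReal.ofReal (2 * M * (min ‖y - x‖ k + C + M * (h - u))))
            + W * (ENNReal.ofReal (h - r) + ENNReal.ofReal (r - s)) := by ring
        _ ≤ _ := by
            refine add_le_add h1 ?_
            rw [← ENNReal.ofReal_add (sub_nonneg.2 hrh) (sub_nonneg.2 hsr), sub_add_sub_cancel]
    · have h2 : HasDerivAt (fun r => min ‖y - x‖ k + C + M * (h - r)) (-M) u := by
        simpa using ((((hasDerivAt_id u).const_sub h).const_mul M).const_add (min ‖y - x‖ k + C))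
      simpa using h2.fun_pow 2
    · have : 0 ≤ h - u := by linarith [hu.2]
      positivity
  · intro ζ y r hr hrh
    have hA := hA0 y
    have hhr := sub_nonneg.2 hrh
    set B := min ‖y - x‖ k + C + M * (h - r) with hB
    have hB0 : 0 ≤ B := by positivity
    calc ∑' z, β ζ z * (ENNReal.ofReal ((min ‖y + z - x‖ k + C + M * (h - r)) ^ 2)
            + W * ENNReal.ofReal (h - r))
        ≤ ∑' z, (β ζ z * (ENNReal.ofReal (B ^ 2) + W * ENNReal.ofReal (h - r))
            + (ENNReal.ofReal (2 * B) * (‖z‖ₑ * lam z)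
              + ENNReal.ofReal (k ^ 2) * (lam z * ENNReal.ofReal (min 1 ((‖z‖ / k) ^ 2))))) := by
          refine ENNReal.tsum_le_tsum fun z => ?_
          have hδ0 : 0 ≤ min ‖z‖ k := le_min (norm_nonneg _) hk.le
          have hδ1 := min_le_left ‖z‖ k
          have hδ2 : (min ‖z‖ k) ^ 2 ≤ k ^ 2 * min 1 ((‖z‖ / k) ^ 2) := by
            rw [mul_min_of_nonneg _ _ (sq_nonneg k), mul_one, div_pow, mul_div_cancel₀ _ (by positivity)]
            exact le_min (pow_le_pow_left₀ hδ0 (min_le_right _ _) 2) (pow_le_pow_left₀ hδ0 hδ1 2)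
          have h1 : ENNReal.ofReal ((min ‖y + z - x‖ k + C + M * (h - r)) ^ 2)
              ≤ ENNReal.ofReal (B ^ 2) + (ENNReal.ofReal (2 * B) * ‖z‖ₑ
                + ENNReal.ofReal (k ^ 2) * ENNReal.ofReal (min 1 ((‖z‖ / k) ^ 2))) := by
            rw [← ofReal_norm, ← ENNReal.ofReal_mul (by positivity),
              ← ENNReal.ofReal_mul (by positivity), ← ENNReal.ofReal_add (by positivity) (by positivity),
              ← ENNReal.ofReal_add (by positivity) (by positivity)]
            refine ENNReal.ofReal_le_ofReal ?_
            have h2 : (min ‖y + z - x‖ k + C + M * (h - r)) ^ 2 ≤ (B + min ‖z‖ k) ^ 2 := by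
              have h3 := hA0 (y + z)
              refine pow_le_pow_left₀ (by positivity) ?_ 2
              have := min_norm_add_le x y z hk.le
              linarith
            nlinarith [mul_le_mul_of_nonneg_left hδ1 hB0]
          calc _ ≤ β ζ z * (ENNReal.ofReal (B ^ 2) + (ENNReal.ofReal (2 * B) * ‖z‖ₑ
                + ENNReal.ofReal (k ^ 2) * ENNReal.ofReal (min 1 ((‖z‖ / k) ^ 2)))
                + W * ENNReal.ofReal (h - r)) := mul_le_mul' le_rfl (add_le_add h1 le_rfl)
            _ = β ζ z * (ENNReal.ofReal (B ^ 2) + W * ENNReal.ofReal (h - r))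
                + β ζ z * (ENNReal.ofReal (2 * B) * ‖z‖ₑ
                + ENNReal.ofReal (k ^ 2) * ENNReal.ofReal (min 1 ((‖z‖ / k) ^ 2))) := by ring
            _ ≤ β ζ z * (ENNReal.ofReal (B ^ 2) + W * ENNReal.ofReal (h - r))
                + lam z * (ENNReal.ofReal (2 * B) * ‖z‖ₑ
                + ENNReal.ofReal (k ^ 2) * ENNReal.ofReal (min 1 ((‖z‖ / k) ^ 2))) :=
              add_le_add le_rfl (mul_le_mul' (hβ.le ζ z) le_rfl)
            _ = _ := by ring
      _ = _ := by
          rw [ENNReal.tsum_add, ENNReal.tsum_mul_right, hβ.tsum_eq, ENNReal.tsum_add,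
            ENNReal.tsum_mul_left, ENNReal.tsum_mul_left, hW, truncMoment,
            show 2 * M * B = 2 * B * M by ring, ENNReal.ofReal_mul (by positivity : 0 ≤ 2 * B), hM,
            ENNReal.ofReal_toReal hβ.moment]

end Supersolution

/-! ### A maximal inequality and summable tail bounds -/

section Maximal

variable {d : ℕ} {E : Type*} [MetricSpace E] [CompactSpace E] [MeasurableSpace E] [BorelSpace E]
  {PE : Kernel (Config d E) (CadlagPath (Config d E))} {β : Config d E → IntLattice d → ℝ≥0∞}
  {lam : IntLattice d → ℝ≥0∞} {Λ : ℝ}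
  {P : Kernel (Config d E × IntLattice d) (CadlagPath (Config d E × IntLattice d))}

/-- A bound for the probability that the walk moves by `k` or more within a unit of time. -/
noncomputable def moveBound (lam : IntLattice d → ℝ≥0∞) (k : ℝ) : ℝ≥0∞ :=
  ENNReal.ofReal (((∑' z, ‖z‖ₑ * lam z).toReal / k) ^ 2) + truncMoment lam k

lemma measurable_position {S : Type*} [MeasurableSpace S]
    {ξ : S → Config d E × IntLattice d} (hξ : Measurable ξ) (A : Set (IntLattice d)) :
    MeasurableSet {s | (ξ s).2 ∈ A} :=
  (measurable_snd.comp hξ) (MeasurableSet.of_discrete)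

/-- A maximal inequality of Doob type by induction from the end of the grid. If the displacement is
already k or more at time b, the right side is at least k² times the weight; otherwise one Markov
step and `evol_sq_le` reduce to the grid started at b + h. -/
theorem SolvesForward.lintegral_grid_le [IsMarkovKernel PE] [IsMarkovKernel P]
    (hβ : IsUniformizedRate β lam Λ) (hP : SolvesForward PE β Λ (evol P)) (hPm : IsMarkovProcess P)
    (p : Config d E × IntLattice d) (h : ℝ≥0) {k : ℝ} (hk : 0 < k) (x : IntLattice d) (j : ℕ) :
    ∀ (b : ℝ≥0) (m : CadlagPath (Config d E × IntLattice d) → ℝ≥0∞),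
      Measurable[canonicalFiltration (Config d E × IntLattice d) b] m →
      ENNReal.ofReal (k ^ 2) * ∫⁻ w, m w * {w | ∃ i ≤ j, k ≤ ‖(w.1 (b + i * h)).2 - x‖}.indicator 1 w
          ∂(P p)
        ≤ ∫⁻ w, m w * (ENNReal.ofReal ((min ‖(w.1 b).2 - x‖ k
              + (∑' z, ‖z‖ₑ * lam z).toReal * (j * h)) ^ 2)
            + ENNReal.ofReal (k ^ 2) * truncMoment lam k * ENNReal.ofReal (j * h)) ∂(P p) := by
  set M := (∑' z, ‖z‖ₑ * lam z).toReal with hM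
  have hM0 : 0 ≤ M := ENNReal.toReal_nonneg
  set W := ENNReal.ofReal (k ^ 2) * truncMoment lam k with hW
  have hA0 : ∀ y, 0 ≤ min ‖y - x‖ k := fun y => le_min (norm_nonneg _) hk.le
  have hle := fun b => (canonicalFiltration (Config d E × IntLattice d)).le b
  induction j with
  | zero =>
    intro b m hm
    have m0 : Measurable m := hm.mono (hle b) le_rfl
    have ms : MeasurableSet {w : CadlagPath (Config d E × IntLattice d) |
        k ≤ ‖(w.1 b).2 - x‖} :=
      measurable_position (CadlagPath.measurable_eval b) {y | k ≤ ‖y - x‖}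
    have e : {w : CadlagPath (Config d E × IntLattice d) |
        ∃ i ≤ 0, k ≤ ‖(w.1 (b + (i : ℕ) * h)).2 - x‖} = {w | k ≤ ‖(w.1 b).2 - x‖} := by
      ext w; simp
    have m1 : Measurable fun w => m w * {w : CadlagPath (Config d E × IntLattice d) |
        k ≤ ‖(w.1 b).2 - x‖}.indicator 1 w := m0.mul (measurable_one.indicator ms)
    rw [e, ← lintegral_const_mul _ m1]
    refine lintegral_mono fun w => ?_
    by_cases hw : k ≤ ‖(w.1 b).2 - x‖
    · rw [indicator_of_mem (show w ∈ {w | k ≤ ‖(w.1 b).2 - x‖} from hw), min_eq_right hw]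
      simp [mul_comm]
    · rw [indicator_of_notMem (show w ∉ {w | k ≤ ‖(w.1 b).2 - x‖} from hw)]
      simp
  | succ j ih =>
    intro b m hm
    have m0 : Measurable m := hm.mono (hle b) le_rfl
    set C : ℝ := M * (j * h) with hC
    have hC0 : 0 ≤ C := by positivity
    have ms : MeasurableSet[canonicalFiltration (Config d E × IntLattice d) b]
        {w : CadlagPath (Config d E × IntLattice d) | k ≤ ‖(w.1 b).2 - x‖} :=
      (measurable_snd.comp (CadlagPath.measurable_eval_canonicalFiltration le_rfl))
        (MeasurableSet.of_discrete (s := {y : IntLattice d | k ≤ ‖y - x‖}))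
    set S := {w : CadlagPath (Config d E × IntLattice d) | k ≤ ‖(w.1 b).2 - x‖} with hS
    let m1 : CadlagPath (Config d E × IntLattice d) → ℝ≥0∞ := S.indicator m
    let m2 : CadlagPath (Config d E × IntLattice d) → ℝ≥0∞ := Sᶜ.indicator m
    have hm2 : Measurable[canonicalFiltration (Config d E × IntLattice d) b] m2 :=
      hm.indicator ms.compl
    have hm1 : Measurable m1 := m0.indicator (hle b _ ms)
    have hm2' : Measurable[canonicalFiltration (Config d E × IntLattice d) (b + h)] m2 :=
      hm2.mono ((canonicalFiltration (Config d E × IntLattice d)).mono le_self_add) le_rfl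
    have hm12 : ∀ w, m w = m1 w + m2 w := fun w => (indicator_self_add_compl_apply S m w).symm
    have hpt : ∀ w, m w * {w : CadlagPath (Config d E × IntLattice d) |
          ∃ i ≤ j + 1, k ≤ ‖(w.1 (b + (i : ℕ) * h)).2 - x‖}.indicator 1 w
        ≤ m1 w + m2 w * {w : CadlagPath (Config d E × IntLattice d) |
          ∃ i ≤ j, k ≤ ‖(w.1 (b + h + (i : ℕ) * h)).2 - x‖}.indicator 1 w := by
      intro w
      by_cases hw : w ∈ S
      · have : m1 w = m w := indicator_of_mem hw _
        rw [this]
        refine le_add_right ((mul_le_mul' le_rfl (indicator_le_self' (fun _ _ => zero_le_one) w)).trans ?_)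
        simp
      · have : m2 w = m w := indicator_of_mem hw _
        rw [this]
        refine le_add_left (mul_le_mul' le_rfl ?_)
        by_cases hex : ∃ i ≤ j + 1, k ≤ ‖(w.1 (b + (i : ℕ) * h)).2 - x‖
        · obtain ⟨i, hi, hik⟩ := hex
          rcases i with _ | i
          · exact absurd (show k ≤ ‖(w.1 b).2 - x‖ by simpa using hik) hw
          · have hmem : w ∈ {w : CadlagPath (Config d E × IntLattice d) |
                ∃ i ≤ j, k ≤ ‖(w.1 (b + h + (i : ℕ) * h)).2 - x‖} := by
              refine ⟨i, by omega, ?_⟩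
              rw [show b + h + (i : ℝ≥0) * h = b + ((i + 1 : ℕ) : ℝ≥0) * h by push_cast; ring]
              exact hik
            rw [indicator_of_mem hmem]
            exact indicator_le_self' (fun _ _ => zero_le_one) w
        · rw [indicator_of_notMem (show w ∉ {w : CadlagPath (Config d E × IntLattice d) |
            ∃ i ≤ j + 1, k ≤ ‖(w.1 (b + (i : ℕ) * h)).2 - x‖} from hex)]
          exact zero_le
    have evb : Measurable fun w : CadlagPath (Config d E × IntLattice d) => w.1 b :=
      CadlagPath.measurable_eval b
    have mA : Measurable fun w : CadlagPath (Config d E × IntLattice d) =>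
        ENNReal.ofReal ((min ‖(w.1 b).2 - x‖ k + M * ((j + 1 : ℕ) * h)) ^ 2)
          + W * ENNReal.ofReal ((j + 1 : ℕ) * h) :=
      ((measurable_ofReal_comp_snd fun y => (min ‖y - x‖ k + M * ((j + 1 : ℕ) * h)) ^ 2).comp
        evb).add_const _
    have h1 : ENNReal.ofReal (k ^ 2) * ∫⁻ w, m1 w ∂(P p) ≤ ∫⁻ w, m1 w *
        (ENNReal.ofReal ((min ‖(w.1 b).2 - x‖ k + M * ((j + 1 : ℕ) * h)) ^ 2)
          + W * ENNReal.ofReal ((j + 1 : ℕ) * h)) ∂(P p) := by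
      rw [← lintegral_const_mul _ hm1]
      refine lintegral_mono fun w => ?_
      by_cases hw : w ∈ S
      · rw [mul_comm]
        refine mul_le_mul' le_rfl (le_add_right (ENNReal.ofReal_le_ofReal ?_))
        rw [min_eq_right (show k ≤ ‖(w.1 b).2 - x‖ from hw)]
        have : 0 ≤ M * ((j + 1 : ℕ) * h) := by positivity
        nlinarith
      · simp [m1, indicator_of_notMem hw]
    have h2 : ENNReal.ofReal (k ^ 2) * ∫⁻ w, m2 w * {w : CadlagPath (Config d E × IntLattice d) |
          ∃ i ≤ j, k ≤ ‖(w.1 (b + h + (i : ℕ) * h)).2 - x‖}.indicator 1 w ∂(P p)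
        ≤ ∫⁻ w, m2 w *
        (ENNReal.ofReal ((min ‖(w.1 b).2 - x‖ k + M * ((j + 1 : ℕ) * h)) ^ 2)
          + W * ENNReal.ofReal ((j + 1 : ℕ) * h)) ∂(P p) := by
      refine (ih (b + h) m2 hm2').trans ?_
      have mφ := measurable_ofReal_comp_snd (E := E) fun y => (min ‖y - x‖ k + C) ^ 2
      rw [hPm.lintegral_mul_eval p b h hm2 (Φ := fun q => ENNReal.ofReal ((min ‖q.2.2 - x‖ k + C) ^ 2)
        + W * ENNReal.ofReal (j * h)) ((mφ.comp measurable_snd).add_const _)]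
      refine lintegral_mono fun w => mul_le_mul' le_rfl ?_
      rw [lintegral_add_right _ measurable_const, lintegral_const, measure_univ, mul_one]
      have h3 := hP.evol_sq_le hβ h.2 hk hC0 x (w.1 b)
      have e1 : evol P (h : ℝ) (fun q => ENNReal.ofReal ((min ‖q.2 - x‖ k + C) ^ 2)) (w.1 b)
          = ∫⁻ w', ENNReal.ofReal ((min ‖(w'.1 h).2 - x‖ k + C) ^ 2) ∂(P (w.1 b)) := by
        simp [evol]
      rw [← e1]
      refine (add_le_add h3 le_rfl).trans (le_of_eq ?_)
      rw [add_assoc, ← mul_add, ← ENNReal.ofReal_add h.2 (by positivity)]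
      congr 3 <;> simp only [hC, NNReal.val_eq_coe] <;> push_cast <;> ring
    calc _ ≤ ENNReal.ofReal (k ^ 2) * ∫⁻ w, (m1 w + m2 w *
            {w : CadlagPath (Config d E × IntLattice d) |
              ∃ i ≤ j, k ≤ ‖(w.1 (b + h + (i : ℕ) * h)).2 - x‖}.indicator 1 w) ∂(P p) :=
          mul_le_mul' le_rfl (lintegral_mono hpt)
      _ ≤ _ := by
          rw [lintegral_add_left hm1, mul_add]
          refine (add_le_add h1 h2).trans (le_of_eq ?_)
          have mm : Measurable fun w => m1 w *
              (ENNReal.ofReal ((min ‖(w.1 b).2 - x‖ k + M * ((j + 1 : ℕ) * h)) ^ 2)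
                + W * ENNReal.ofReal ((j + 1 : ℕ) * h)) := hm1.mul mA
          rw [← lintegral_add_left mm]
          simp_rw [← add_mul, ← hm12]

/-- Split according to the position x at time b and use dyadic grids of [b, b + 1], which increase
with N. By right-continuity into a discrete lattice, a displacement by k or more at time t persists
just after t and is seen on a fine enough grid. -/
theorem SolvesForward.measure_exists_le [IsMarkovKernel PE] [IsMarkovKernel P]
    (hβ : IsUniformizedRate β lam Λ) (hP : SolvesForward PE β Λ (evol P)) (hPm : IsMarkovProcess P)
    (p : Config d E × IntLattice d) (b : ℝ≥0) {k : ℝ} (hk : 0 < k) :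
    P p {w | ∃ t, b ≤ t ∧ t ≤ b + 1 ∧ k ≤ ‖(w.1 t).2 - (w.1 b).2‖} ≤ moveBound lam k := by
  set M := (∑' z, ‖z‖ₑ * lam z).toReal with hM
  let B : IntLattice d → Set (CadlagPath (Config d E × IntLattice d)) := fun x => {w | (w.1 b).2 = x}
  let G : IntLattice d → ℕ → Set (CadlagPath (Config d E × IntLattice d)) := fun x N =>
    {w | (w.1 b).2 = x ∧ ∃ i ≤ 2 ^ N, k ≤ ‖(w.1 (b + (i : ℕ) * (2 ^ N)⁻¹)).2 - x‖}
  have mB : ∀ x, MeasurableSet (B x) := fun x =>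
    measurable_position (CadlagPath.measurable_eval b) {x}
  have hkpos : 0 < ENNReal.ofReal (k ^ 2) := ENNReal.ofReal_pos.2 (by positivity)
  have hGN : ∀ x N, P p (G x N) ≤ P p (B x) * moveBound lam k := by
    intro x N
    have mb : Measurable[canonicalFiltration (Config d E × IntLattice d) b]
        ((B x).indicator (1 : CadlagPath (Config d E × IntLattice d) → ℝ≥0∞)) := by
      refine Measurable.indicator (measurable_const (a := (1 : ℝ≥0∞))) ?_
      exact (measurable_snd.comp (CadlagPath.measurable_eval_canonicalFiltration le_rfl))
        (MeasurableSet.of_discrete (s := {x}))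
    have h1 := hP.lintegral_grid_le hβ hPm p (2 ^ N)⁻¹ hk x (2 ^ N) b _ mb
    have mS : MeasurableSet {w : CadlagPath (Config d E × IntLattice d) |
        ∃ i ≤ 2 ^ N, k ≤ ‖(w.1 (b + (i : ℕ) * (2 ^ N)⁻¹)).2 - x‖} := by
      have : {w : CadlagPath (Config d E × IntLattice d) |
        ∃ i ≤ 2 ^ N, k ≤ ‖(w.1 (b + (i : ℕ) * (2 ^ N)⁻¹)).2 - x‖}
        = ⋃ i : ℕ, ⋃ _ : i ≤ 2 ^ N, {w | k ≤ ‖(w.1 (b + (i : ℕ) * (2 ^ N)⁻¹)).2 - x‖} := by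
        ext w; simp
      rw [this]
      exact .iUnion fun i => .iUnion fun _ =>
        measurable_position (CadlagPath.measurable_eval _) {y | k ≤ ‖y - x‖}
    have hN : ((2 ^ N : ℕ) : ℝ) * (((2 ^ N)⁻¹ : ℝ≥0) : ℝ) = 1 := by
      push_cast; field_simp
    rw [hN, mul_one, ENNReal.ofReal_one, mul_one] at h1
    have e1 : ∀ w, (B x).indicator (1 : CadlagPath (Config d E × IntLattice d) → ℝ≥0∞) w
        * {w : CadlagPath (Config d E × IntLattice d) |
          ∃ i ≤ 2 ^ N, k ≤ ‖(w.1 (b + (i : ℕ) * (2 ^ N)⁻¹)).2 - x‖}.indicator 1 w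
        = (G x N).indicator 1 w := by
      intro w
      rw [show G x N = B x ∩ {w : CadlagPath (Config d E × IntLattice d) |
          ∃ i ≤ 2 ^ N, k ≤ ‖(w.1 (b + (i : ℕ) * (2 ^ N)⁻¹)).2 - x‖} from rfl, inter_indicator_one]
      rfl
    have e2 : ∀ w, (B x).indicator (1 : CadlagPath (Config d E × IntLattice d) → ℝ≥0∞) w
        * (ENNReal.ofReal ((min ‖(w.1 b).2 - x‖ k + M) ^ 2)
          + ENNReal.ofReal (k ^ 2) * truncMoment lam k)
        = ENNReal.ofReal (k ^ 2) * moveBound lam k * (B x).indicator 1 w := by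
      intro w
      by_cases hw : w ∈ B x
      · have hw' : (w.1 b).2 = x := hw
        simp only [indicator_of_mem hw, hw', sub_self, norm_zero, min_eq_left hk.le, Pi.one_apply,
          one_mul, mul_one, zero_add]
        rw [moveBound, mul_add, ← ENNReal.ofReal_mul (by positivity), ← hM, div_pow,
          mul_div_cancel₀ _ (by positivity)]
      · simp [indicator_of_notMem hw]
    rw [← hM] at h1
    simp_rw [e1, e2] at h1
    have mG : MeasurableSet (G x N) := (mB x).inter mS
    rw [lintegral_const_mul _ (measurable_one.indicator (mB x)), lintegral_indicator_one (mB x),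
      lintegral_indicator_one mG, mul_assoc] at h1
    rw [mul_comm (P p (B x))]
    exact (ENNReal.mul_le_mul_iff_right hkpos.ne' ENNReal.ofReal_ne_top).1 h1
  have hmono : ∀ x, Monotone (G x) := by
    intro x
    refine monotone_nat_of_le_succ fun N => ?_
    rintro w ⟨hw, i, hi, hik⟩
    refine ⟨hw, 2 * i, by rw [pow_succ]; omega, ?_⟩
    convert hik using 6
    push_cast
    rw [pow_succ]
    field_simp
  have hsub : {w : CadlagPath (Config d E × IntLattice d) |
      ∃ t, b ≤ t ∧ t ≤ b + 1 ∧ k ≤ ‖(w.1 t).2 - (w.1 b).2‖} ⊆ ⋃ x, ⋃ N, G x N := by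
    rintro w ⟨t, hbt, htb, hk'⟩
    rw [mem_iUnion]
    refine ⟨(w.1 b).2, ?_⟩
    have hc : ContinuousWithinAt (fun t => (w.1 t).2) (Ici t) t :=
      continuous_snd.continuousAt.comp_continuousWithinAt (w.2 t).1
    have ho : ∀ᶠ s in 𝓝[≥] t, k ≤ ‖(w.1 s).2 - (w.1 b).2‖ :=
      hc.eventually ((isOpen_discrete {y : IntLattice d | k ≤ ‖y - (w.1 b).2‖}).mem_nhds hk')
    -- The first dyadic time at or after t. Rounding up allows right-continuity to be used and does
    -- not pass b + 1, as t - b ≤ 1.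
    let u : ℕ → ℝ≥0 := fun N => b + (⌈(t - b) * 2 ^ N⌉₊ : ℕ) * (2 ^ N)⁻¹
    have hu1 : ∀ N, t ≤ u N := by
      intro N
      have h1 := Nat.le_ceil ((t - b) * 2 ^ N)
      have h2 : t - b ≤ (⌈(t - b) * 2 ^ N⌉₊ : ℕ) * (2 ^ N)⁻¹ := by
        rw [← div_eq_mul_inv, le_div_iff₀ (by positivity)]; exact h1
      calc t = b + (t - b) := (add_tsub_cancel_of_le hbt).symm
        _ ≤ _ := by simp only [u]; gcongr
    have hu2 : ∀ N, u N ≤ t + (2 ^ N)⁻¹ := by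
      intro N
      have h1 := (Nat.ceil_lt_add_one (zero_le (a := (t - b) * 2 ^ N))).le
      have h2 : (⌈(t - b) * 2 ^ N⌉₊ : ℕ) * (2 ^ N)⁻¹ ≤ (t - b) + ((2 : ℝ≥0) ^ N)⁻¹ := by
        rw [← div_eq_mul_inv, div_le_iff₀ (by positivity), add_mul, inv_mul_cancel₀ (by positivity)]
        exact h1
      calc u N ≤ b + ((t - b) + ((2 : ℝ≥0) ^ N)⁻¹) := by simp only [u]; gcongr
        _ = _ := by rw [← add_assoc, add_tsub_cancel_of_le hbt]
    have hlim0 : Tendsto (fun N : ℕ => t + ((2 : ℝ≥0) ^ N)⁻¹) atTop (𝓝 t) := by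
      have : Tendsto (fun N : ℕ => ((2 : ℝ≥0) ^ N)⁻¹) atTop (𝓝 0) := by
        simp_rw [← inv_pow]
        exact NNReal.tendsto_pow_atTop_nhds_zero_of_lt_one (by
          rw [← NNReal.coe_lt_coe]; push_cast; norm_num)
      simpa using this.const_add t
    have hlim : Tendsto u atTop (𝓝[≥] t) :=
      tendsto_nhdsWithin_iff.2 ⟨tendsto_of_tendsto_of_tendsto_of_le_of_le tendsto_const_nhds hlim0
        hu1 hu2, .of_forall hu1⟩
    obtain ⟨N, hN⟩ := (hlim.eventually ho).exists
    rw [mem_iUnion]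
    refine ⟨N, rfl, ⌈(t - b) * 2 ^ N⌉₊, ?_, hN⟩
    rw [Nat.ceil_le]
    push_cast
    have : t - b ≤ 1 := tsub_le_iff_left.2 htb
    calc (t - b) * 2 ^ N ≤ 1 * 2 ^ N := by gcongr
      _ = _ := one_mul _
  calc _ ≤ P p (⋃ x, ⋃ N, G x N) := measure_mono hsub
    _ ≤ ∑' x, P p (⋃ N, G x N) := measure_iUnion_le _
    _ ≤ ∑' x, P p (B x) * moveBound lam k := by
        refine ENNReal.tsum_le_tsum fun x => ?_
        rw [(hmono x).measure_iUnion]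
        exact iSup_le fun N => hGN x N
    _ = moveBound lam k := by
        rw [ENNReal.tsum_mul_right]
        have : ∑' x, P p (B x) = 1 := by
          have h1 := measure_iUnion (μ := P p) (f := B) (fun x y hxy => by
            refine disjoint_left.2 fun w hx hy => hxy ?_
            exact (show (w.1 b).2 = x from hx).symm.trans hy) mB
          rw [← h1, iUnion_eq_univ_iff.2 fun w => ⟨(w.1 b).2, rfl⟩, measure_univ]
        rw [this, one_mul]

lemma tsum_min_one_sq_le {b : ℝ} (hb : 0 ≤ b) :
    ∑' n : ℕ, ENNReal.ofReal (min 1 ((b / (n + 1)) ^ 2)) ≤ 2 * ENNReal.ofReal b := by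
  refine le_trans ?_ (lintegral_min_one_sq_le hb)
  have hd : Pairwise (Function.onFun Disjoint fun n : ℕ => Ioc (n : ℝ) (n + 1)) := by
    have := pairwise_disjoint_Ioc_add_intCast (0 : ℝ)
    intro m n hmn
    have := this (show (m : ℤ) ≠ n by exact_mod_cast hmn)
    simpa [Function.onFun] using this
  have hU : (⋃ n : ℕ, Ioc (n : ℝ) (n + 1)) ⊆ Ioi 0 :=
    iUnion_subset fun n x hx => lt_of_le_of_lt (Nat.cast_nonneg n) hx.1
  refine le_trans ?_ (lintegral_mono_set hU)
  rw [lintegral_iUnion (fun n => measurableSet_Ioc) hd]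
  refine ENNReal.tsum_le_tsum fun n => ?_
  calc _ = ∫⁻ _ in Ioc (n : ℝ) (n + 1), ENNReal.ofReal (min 1 ((b / (n + 1)) ^ 2)) := by simp
    _ ≤ _ := by
      refine setLIntegral_mono' measurableSet_Ioc fun r hr => ENNReal.ofReal_le_ofReal ?_
      have hr0 : 0 < r := lt_of_le_of_lt (Nat.cast_nonneg n) hr.1
      exact min_le_min_left _ (by gcongr; exact hr.2)

/-- The quadratic part sums like 1/n². The sum of min(1, (‖z‖/(εn))²) over n ≥ 1 is at most 2‖z‖/ε,
so the first moment is enough. This feeds Borel–Cantelli and the variance condition of the strong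
law. -/
lemma tsum_moveBound_ne_top {lam : IntLattice d → ℝ≥0∞} (hlam : ∑' z, ‖z‖ₑ * lam z ≠ ∞) {ε : ℝ}
    (hε : 0 < ε) : ∑' n : ℕ, moveBound lam (ε * (n + 1)) ≠ ∞ := by
  set M := (∑' z, ‖z‖ₑ * lam z).toReal with hM
  simp only [moveBound]
  rw [ENNReal.tsum_add]
  refine ENNReal.add_ne_top.2 ⟨?_, ?_⟩
  · have hs : Summable fun n : ℕ => (M / (ε * (n + 1))) ^ 2 := by
      have h1 : Summable fun n : ℕ => 1 / ((n : ℝ) + 1) ^ 2 := by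
        have := (summable_nat_add_iff 1).2 (Real.summable_one_div_nat_pow.2 (by norm_num : 1 < 2))
        simpa using this
      refine (h1.mul_left ((M / ε) ^ 2)).congr fun n => ?_
      field_simp
    exact hs.tsum_ofReal_ne_top
  · have h : ∑' n : ℕ, truncMoment lam (ε * (n + 1))
        ≤ 2 * ENNReal.ofReal (1 / ε) * ∑' z, ‖z‖ₑ * lam z := by
      simp only [truncMoment]
      rw [ENNReal.tsum_comm, ← ENNReal.tsum_mul_left]
      refine ENNReal.tsum_le_tsum fun z => ?_
      rw [ENNReal.tsum_mul_left]
      have h1 := tsum_min_one_sq_le (b := ‖z‖ / ε) (by positivity)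
      calc _ = lam z * ∑' n : ℕ, ENNReal.ofReal (min 1 ((‖z‖ / ε / (n + 1)) ^ 2)) := by
            simp_rw [div_div]
        _ ≤ lam z * (2 * ENNReal.ofReal (‖z‖ / ε)) := by gcongr
        _ = _ := by
            rw [show ‖z‖ / ε = 1 / ε * ‖z‖ by ring, ENNReal.ofReal_mul (by positivity), ofReal_norm]
            ring
    exact ne_top_of_le_ne_top (ENNReal.mul_ne_top (by finiteness) hlam) h

/-- A bound for the expected excess over `l` of a step of the walk. -/
noncomputable def excessBound (lam : IntLattice d → ℝ≥0∞) (l : ℕ) : ℝ≥0∞ :=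
  ∑' j : ℕ, moveBound lam ((j + l : ℕ) + 1)

lemma tendsto_excessBound {lam : IntLattice d → ℝ≥0∞} (hlam : ∑' z, ‖z‖ₑ * lam z ≠ ∞) :
    Tendsto (excessBound lam) atTop (𝓝 0) := by
  have := tsum_moveBound_ne_top hlam one_pos
  simp only [one_mul] at this
  exact ENNReal.tendsto_sum_nat_add _ this

/-- Layer-cake bound: the excess of a over l + 1 is at most the number of integers of the form j + l
+ 1 that do not exceed a. It turns tail probabilities into an expected excess. -/
lemma ofReal_sub_le_tsum (a : ℝ) (l : ℕ) :
    ENNReal.ofReal (a - (l + 1)) ≤ ∑' j : ℕ, (Ici ((j + l : ℕ) + 1 : ℝ)).indicator 1 a := by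
  have h1 : ENNReal.ofReal (a - (l + 1)) ≤ ∑ j ∈ Finset.range ⌈a - (l + 1)⌉₊, (1 : ℝ≥0∞) := by
    rw [Finset.sum_const, Finset.card_range, nsmul_one]
    exact (ENNReal.ofReal_le_ofReal (Nat.le_ceil _)).trans_eq (ENNReal.ofReal_natCast _)
  refine h1.trans (le_trans ?_ (ENNReal.sum_le_tsum (Finset.range ⌈a - (l + 1)⌉₊)))
  refine Finset.sum_le_sum fun j hj => ?_
  rw [Finset.mem_range, Nat.lt_ceil] at hj
  rw [indicator_of_mem]
  · exact le_rfl
  · rw [mem_Ici]; push_cast; linarith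

theorem SolvesForward.lintegral_excess_le [IsMarkovKernel PE] [IsMarkovKernel P]
    (hβ : IsUniformizedRate β lam Λ) (hP : SolvesForward PE β Λ (evol P)) (hPm : IsMarkovProcess P)
    (p : Config d E × IntLattice d) (b : ℝ≥0) (l : ℕ) :
    ∫⁻ w, ENNReal.ofReal (‖(w.1 (b + 1)).2 - (w.1 b).2‖ - (l + 1)) ∂(P p) ≤ excessBound lam l := by
  have ms : ∀ j : ℕ, MeasurableSet {w : CadlagPath (Config d E × IntLattice d) |
      ((j + l : ℕ) + 1 : ℝ) ≤ ‖(w.1 (b + 1)).2 - (w.1 b).2‖} := by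
    intro j
    have m : Measurable fun w : CadlagPath (Config d E × IntLattice d) =>
        ((w.1 (b + 1)).2, (w.1 b).2) :=
      (measurable_snd.comp (CadlagPath.measurable_eval _)).prodMk
        (measurable_snd.comp (CadlagPath.measurable_eval _))
    exact m (MeasurableSet.of_discrete (s := {q | ((j + l : ℕ) + 1 : ℝ) ≤ ‖q.1 - q.2‖}))
  calc _ ≤ ∫⁻ w, ∑' j : ℕ, {w : CadlagPath (Config d E × IntLattice d) |
      ((j + l : ℕ) + 1 : ℝ) ≤ ‖(w.1 (b + 1)).2 - (w.1 b).2‖}.indicator 1 w ∂(P p) :=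
        lintegral_mono fun w => ofReal_sub_le_tsum _ l
    _ = ∑' j : ℕ, P p {w | ((j + l : ℕ) + 1 : ℝ) ≤ ‖(w.1 (b + 1)).2 - (w.1 b).2‖} := by
        rw [lintegral_tsum fun j => (measurable_one.indicator (ms j)).aemeasurable]
        simp_rw [lintegral_indicator_one (ms _)]
    _ ≤ _ := by
        refine ENNReal.tsum_le_tsum fun j => ?_
        refine le_trans (measure_mono fun w hw => ?_)
          (hP.measure_exists_le hβ hPm p b (k := (j + l : ℕ) + 1) (by positivity))
        exact ⟨b + 1, le_self_add, le_rfl, hw⟩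

end Maximal

/-! ### The local drift and cut-off coordinates -/

section Drift

variable {d : ℕ} {E : Type*} [MetricSpace E] {α : Config d E → IntLattice d → ℝ}

/-- A bound for the local drift. -/
noncomputable def driftBound (α : Config d E → IntLattice d → ℝ) : ℝ :=
  (∑' z : IntLattice d, ‖z‖ₑ * ⨆ η, ‖α η z‖ₑ).toReal

lemma driftBound_nonneg : 0 ≤ driftBound α := ENNReal.toReal_nonneg

lemma abs_apply_le_norm (z : IntLattice d) (i : Fin d) : |(z i : ℝ)| ≤ ‖z‖ :=
  (Int.norm_eq_abs (z i)).symm.le.trans (norm_le_pi_norm z i)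

lemma norm_intCast_le (z : IntLattice d) : ‖(fun i => (z i : ℝ) : Fin d → ℝ)‖ ≤ ‖z‖ :=
  (pi_norm_le_iff_of_nonneg (norm_nonneg z)).2 fun i => abs_apply_le_norm z i

lemma IsJumpRate.exists_majorant (hα : IsJumpRate α) : ∃ u : IntLattice d → ℝ,
    HasSum u (driftBound α) ∧ ∀ ζ z, α ζ z * ‖z‖ ≤ u z := by
  have hne : ∀ z, ‖z‖ₑ * ⨆ η, ‖α η z‖ₑ ≠ ∞ :=
    fun z => ENNReal.ne_top_of_tsum_ne_top hα.moment.ne z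
  refine ⟨fun z => (‖z‖ₑ * ⨆ η, ‖α η z‖ₑ).toReal, ?_, fun ζ z => ?_⟩
  · rw [driftBound, ENNReal.tsum_toReal_eq hne]
    exact (ENNReal.summable_toReal hα.moment.ne).hasSum
  · rw [← ENNReal.ofReal_le_iff_le_toReal (hne z), ENNReal.ofReal_mul (hα.nonneg ζ z), mul_comm,
      ofReal_norm]
    gcongr
    refine le_iSup_of_le ζ ?_
    rw [← ofReal_norm, Real.norm_of_nonneg (hα.nonneg ζ z)]

lemma IsJumpRate.localDrift_apply (hα : IsJumpRate α) (ζ : Config d E) (i : Fin d) :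
    localDrift α ζ i = ∑' z, α ζ z * z i := by
  obtain ⟨u, hu, huz⟩ := hα.exists_majorant
  have hs : Summable fun z : IntLattice d => α ζ z • (fun i => (z i : ℝ) : Fin d → ℝ) := by
    refine Summable.of_norm_bounded hu.summable fun z => ?_
    rw [norm_smul, Real.norm_of_nonneg (hα.nonneg ζ z)]
    exact (mul_le_mul_of_nonneg_left (norm_intCast_le z) (hα.nonneg ζ z)).trans (huz ζ z)
  rw [localDrift, tsum_apply hs]
  rfl

lemma IsJumpRate.abs_tsum_le (hα : IsJumpRate α) {a : IntLattice d → ℝ} (ha : ∀ z, |a z| ≤ ‖z‖)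
    (ζ : Config d E) : |∑' z, α ζ z * a z| ≤ driftBound α := by
  obtain ⟨u, hu, huz⟩ := hα.exists_majorant
  rw [← Real.norm_eq_abs]
  refine tsum_of_norm_bounded hu fun z => ?_
  rw [norm_mul, Real.norm_of_nonneg (hα.nonneg ζ z)]
  exact (mul_le_mul_of_nonneg_left (ha z) (hα.nonneg ζ z)).trans (huz ζ z)

lemma IsJumpRate.continuous_tsum (hα : IsJumpRate α) {a : IntLattice d → ℝ}
    (ha : ∀ z, |a z| ≤ ‖z‖) : Continuous fun ζ => ∑' z, α ζ z * a z := by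
  obtain ⟨u, hu, huz⟩ := hα.exists_majorant
  refine _root_.continuous_tsum (fun z => (hα.continuous z).mul_const _) hu.summable fun z ζ => ?_
  rw [norm_mul, Real.norm_of_nonneg (hα.nonneg ζ z)]
  exact (mul_le_mul_of_nonneg_left (ha z) (hα.nonneg ζ z)).trans (huz ζ z)

lemma IsJumpRate.abs_localDrift_apply_le (hα : IsJumpRate α) (ζ : Config d E) (i : Fin d) :
    |localDrift α ζ i| ≤ driftBound α := by
  rw [hα.localDrift_apply]
  exact hα.abs_tsum_le (fun z => abs_apply_le_norm z i) ζ

lemma IsJumpRate.continuous_localDrift (hα : IsJumpRate α) : Continuous (localDrift α) := by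
  refine continuous_pi fun i => ?_
  simp_rw [hα.localDrift_apply]
  exact hα.continuous_tsum fun z => abs_apply_le_norm z i

lemma IsJumpRate.integrable_localDrift [CompactSpace E] [MeasurableSpace E] [BorelSpace E]
    (hα : IsJumpRate α) (μ : Measure (Config d E)) [IsFiniteMeasure μ] :
    Integrable (localDrift α) μ := by
  refine Integrable.of_bound hα.continuous_localDrift.measurable.aestronglyMeasurable
    (driftBound α) (.of_forall fun ζ => ?_)
  exact (pi_norm_le_iff_of_nonneg driftBound_nonneg).2 fun i => hα.abs_localDrift_apply_le ζ i

/-- The coordinate `y i`, cut off so that it has finite support. -/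
noncomputable def cutCoord (i : Fin d) (N : ℝ) (y : IntLattice d) : ℝ :=
  max (-max (N - ‖y‖) 0) (min (y i : ℝ) (max (N - ‖y‖) 0))

lemma abs_cutCoord_le (i : Fin d) (N : ℝ) (y : IntLattice d) :
    |cutCoord i N y| ≤ min ‖y‖ (max N 0) := by
  have h1 := abs_le.1 (abs_apply_le_norm y i)
  have h2 : 0 ≤ max (N - ‖y‖) 0 := le_max_right _ _
  have h3 : max (N - ‖y‖) 0 ≤ max N 0 := max_le_max_right _ (by linarith [norm_nonneg y])
  unfold cutCoord
  rw [abs_le]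
  refine ⟨?_, max_le (by linarith [le_min (norm_nonneg y) (le_max_right N 0)])
    (min_le_min h1.2 h3)⟩
  rcases le_total (y i : ℝ) (max (N - ‖y‖) 0) with h | h
  · rw [min_eq_left h, ← max_neg_neg]
    exact max_le (le_max_of_le_right h1.1) (le_max_of_le_left (by linarith))
  · rw [min_eq_right h]
    exact le_max_of_le_right (by linarith [le_min (norm_nonneg y) (le_max_right N 0)])

/-- Both the coordinate and the cutting level (N - ‖y‖)⁺ change by at most ‖z‖. The bound does not
depend on N, so the jump parts of the cut-off coordinates are dominated as N → ∞. -/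
lemma abs_cutCoord_sub_le (i : Fin d) (N : ℝ) (y z : IntLattice d) :
    |cutCoord i N (y + z) - cutCoord i N y| ≤ ‖z‖ := by
  have h1 : |((y + z) i : ℝ) - (y i : ℝ)| ≤ ‖z‖ := by
    rw [Pi.add_apply]; push_cast
    rw [add_sub_cancel_left]
    exact abs_apply_le_norm z i
  have h2 : |max (N - ‖y + z‖) 0 - max (N - ‖y‖) 0| ≤ ‖z‖ := by
    refine (abs_max_sub_max_le_abs _ _ _).trans ?_
    rw [sub_sub_sub_cancel_left, abs_sub_comm]
    simpa using abs_norm_sub_norm_le (y + z) y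
  unfold cutCoord
  refine (abs_max_sub_max_le_max _ _ _ _).trans (max_le ?_ ?_)
  · rwa [neg_sub_neg, abs_sub_comm]
  · exact (abs_min_sub_min_le_max _ _ _ _).trans (max_le h1 h2)

lemma tendsto_cutCoord (i : Fin d) (y : IntLattice d) :
    Tendsto (fun N : ℕ => cutCoord i N y) atTop (𝓝 (y i)) := by
  refine tendsto_const_nhds.congr' ?_
  filter_upwards [eventually_ge_atTop ⌈2 * ‖y‖⌉₊] with N hN
  have h0 : 2 * ‖y‖ ≤ N := Nat.ceil_le.1 hN
  have h1 := abs_le.1 (abs_apply_le_norm y i)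
  have h2 := norm_nonneg y
  have e : max ((N : ℝ) - ‖y‖) 0 = N - ‖y‖ := max_eq_left (by linarith)
  rw [cutCoord, e, min_eq_left (by linarith), max_eq_right (by linarith)]

lemma finite_cutCoord (i : Fin d) (N : ℝ) : {y | cutCoord i N y ≠ 0}.Finite := by
  refine ((isCompact_closedBall (0 : IntLattice d) N).finite_of_discrete).subset fun y hy => ?_
  rw [mem_closedBall_zero_iff]
  by_contra h
  refine hy ?_
  have e : max (N - ‖y‖) 0 = 0 := max_eq_right (by linarith)
  rw [cutCoord, e, neg_zero]
  exact max_eq_left (min_le_right _ _)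

end Drift

/-! ### Dynkin's formula for the position, and the corrector -/

section MeanStep

variable {d : ℕ} {E : Type*} [MetricSpace E] [CompactSpace E] [MeasurableSpace E] [BorelSpace E]
  {PE : Kernel (Config d E) (CadlagPath (Config d E))} {β : Config d E → IntLattice d → ℝ≥0∞}
  {lam : IntLattice d → ℝ≥0∞} {Λ : ℝ} {α : Config d E → IntLattice d → ℝ}
  {P : Kernel (Config d E × IntLattice d) (CadlagPath (Config d E × IntLattice d))}

lemma hasGenerator_const {S : Type*} [TopologicalSpace S] [MeasurableSpace S]
    (P : Kernel S (CadlagPath S)) [IsMarkovKernel P] (c : ℝ) :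
    HasGenerator P (fun _ => c) (fun _ => 0) := by
  rw [HasGenerator, Metric.tendstoUniformly_iff]
  intro ε hε
  simp [semigroup, hε]

lemma SolvesForward.integrable_norm_position [IsMarkovKernel PE] [IsMarkovKernel P]
    (hβ : IsUniformizedRate β lam Λ) (hP : SolvesForward PE β Λ (evol P)) (t : ℝ≥0)
    (p : Config d E × IntLattice d) : Integrable (fun w => ‖(w.1 t).2‖) (P p) := by
  have ms : Measurable fun w : CadlagPath (Config d E × IntLattice d) => (w.1 t).2 :=
    measurable_snd.comp (CadlagPath.measurable_eval t)
  have m : Measurable fun w : CadlagPath (Config d E × IntLattice d) => ‖(w.1 t).2‖ :=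
    (measurable_of_countable fun y : IntLattice d => ‖y‖).comp ms
  refine ⟨m.aestronglyMeasurable, ?_⟩
  have h := (hP.evol_enorm_sub_le hβ t.2 p).trans_lt ENNReal.ofReal_lt_top
  simp only [evol, NNReal.val_eq_coe, Real.toNNReal_coe] at h
  have hle : ∀ w : CadlagPath (Config d E × IntLattice d),
      ‖(‖(w.1 t).2‖)‖ₑ ≤ ‖(w.1 t).2 - p.2‖ₑ + ‖p.2‖ₑ := by
    intro w
    rw [enorm_norm]
    calc ‖(w.1 t).2‖ₑ = ‖((w.1 t).2 - p.2) + p.2‖ₑ := by rw [sub_add_cancel]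
      _ ≤ _ := enorm_add_le _ _
  refine (lintegral_mono hle).trans_lt ?_
  rw [lintegral_add_right _ measurable_const, lintegral_const, measure_univ, mul_one]
  exact ENNReal.add_lt_top.2 ⟨h, enorm_lt_top⟩

lemma SolvesForward.integrable_position [IsMarkovKernel PE] [IsMarkovKernel P]
    (hβ : IsUniformizedRate β lam Λ) (hP : SolvesForward PE β Λ (evol P)) (t : ℝ≥0)
    (p : Config d E × IntLattice d) (i : Fin d) :
    Integrable (fun w => ((w.1 t).2 i : ℝ)) (P p) := by
  refine (hP.integrable_norm_position hβ t p).mono' ?_ (.of_forall fun w => abs_apply_le_norm _ i)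
  exact ((measurable_of_countable fun y : IntLattice d => (y i : ℝ)).comp
    (measurable_snd.comp (CadlagPath.measurable_eval t))).aestronglyMeasurable

/-- Dynkin's formula for the coordinates of the walk. -/
theorem IsWalkInEnvironment.integral_position_sub (hPE : IsEnvironment PE) (hα : IsJumpRate α)
    (hW : IsWalkInEnvironment PE α P) (hβ : IsUniformizedRate β lam Λ)
    (hP : SolvesForward PE β Λ (evol P)) (t : ℝ≥0) (p : Config d E × IntLattice d) (i : Fin d) :
    ∫ s in (0 : ℝ)..t, semigroup P s.toNNReal
        (fun q => localDrift α (shiftConfig (-q.2) q.1) i) p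
      = ∫ w, ((w.1 t).2 i : ℝ) ∂(P p) - p.2 i := by
  have : IsMarkovKernel PE := ⟨hPE.markov.prob⟩
  have : IsMarkovKernel P := ⟨hW.markov.prob⟩
  set A := driftBound α with hA
  have hA0 : 0 ≤ A := driftBound_nonneg
  let G : ℕ → Config d E × IntLattice d → ℝ := fun N q =>
    ∑' z, α (shiftConfig (-q.2) q.1) z * (cutCoord i N (q.2 + z) - cutCoord i N q.2)
  have hGb : ∀ N q, |G N q| ≤ A := fun N q =>
    hα.abs_tsum_le (fun z => abs_cutCoord_sub_le i N q.2 z) _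
  have mG : ∀ N, Measurable (G N) := fun N => measurable_from_prod_countable_left fun x =>
    ((hα.continuous_tsum fun z => abs_cutCoord_sub_le i N x z).comp
      (continuous_shiftConfig (-x))).measurable
  have mcut : ∀ N : ℕ, Measurable fun q : Config d E × IntLattice d => cutCoord i N q.2 :=
    fun N => (measurable_of_countable (cutCoord i N)).comp measurable_snd
  have key : ∀ N : ℕ, ∫ s in (0 : ℝ)..t, semigroup P s.toNNReal (G N) p
      = semigroup P t (fun q => cutCoord i N q.2) p - cutCoord i N p.2 := by
    intro N
    have hgen := hW.generator (fun y _ => cutCoord i N y) (fun _ _ => 0)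
      ((finite_cutCoord i N).subset fun y hy h => hy (by funext; simp [h]))
      (fun y => continuous_const) (fun y => hasGenerator_const PE _)
    simp only [zero_add] at hgen
    -- Duhamel's formula with c = 0 for a test function constant in time and in the environment; the
    -- finite support of the cut-off coordinate makes it admissible.
    have := hW.markov.integral_semigroup_eq_sub (t := t) (g := fun _ q => cutCoord i N q.2)
      (g' := fun _ _ => 0) (G := fun _ => G N) (C := N + A) 0
      ((mcut N).comp measurable_snd)
      (fun s q => ((abs_cutCoord_le i N q.2).trans (min_le_right _ _)).trans
        (by rw [max_eq_left (Nat.cast_nonneg N)]; linarith))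
      (fun s => continuous_const) (fun s q => by rw [abs_zero]; positivity) measurable_const
      ((mG N).comp measurable_snd)
      (fun s q => (hGb N q).trans (le_add_of_nonneg_left (Nat.cast_nonneg N)))
      (fun s _ _ => hgen) (fun s h _ _ _ q => by simp; positivity) p
    simpa only [zero_mul, Real.exp_zero, one_mul, add_zero] using this
  have hGlim : ∀ q : Config d E × IntLattice d, Tendsto (fun N => G N q) atTop
      (𝓝 (localDrift α (shiftConfig (-q.2) q.1) i)) := by
    intro q
    obtain ⟨u, hu, huz⟩ := hα.exists_majorant
    rw [hα.localDrift_apply]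
    refine tendsto_tsum_of_dominated_convergence hu.summable (fun z => ?_)
      (.of_forall fun N z => ?_)
    · have h := ((tendsto_cutCoord i (q.2 + z)).sub (tendsto_cutCoord i q.2)).const_mul
        (α (shiftConfig (-q.2) q.1) z)
      simpa using h
    · rw [norm_mul, Real.norm_of_nonneg (hα.nonneg _ z)]
      exact (mul_le_mul_of_nonneg_left (abs_cutCoord_sub_le i N q.2 z) (hα.nonneg _ z)).trans
        (huz _ z)
  have lim1 : Tendsto (fun N : ℕ => ∫ s in (0 : ℝ)..t, semigroup P s.toNNReal (G N) p) atTop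
      (𝓝 (∫ s in (0 : ℝ)..t, semigroup P s.toNNReal
        (fun q => localDrift α (shiftConfig (-q.2) q.1) i) p)) := by
    refine intervalIntegral.tendsto_integral_filter_of_dominated_convergence (fun _ => A)
      (.of_forall fun N => ?_) (.of_forall fun N => .of_forall fun s _ => ?_) (by simp)
      (.of_forall fun s _ => ?_)
    · exact (Measurable.semigroup P (F := fun _ => G N) ((mG N).comp measurable_snd)
        measurable_real_toNNReal measurable_const).aestronglyMeasurable
    · exact abs_semigroup_le P (hGb N) _ _
    · refine tendsto_integral_of_dominated_convergence (fun _ => A) (fun N => ?_)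
        (integrable_const _) (fun N => .of_forall fun w => hGb N _) (.of_forall fun w => hGlim _)
      exact ((mG N).comp (CadlagPath.measurable_eval _)).aestronglyMeasurable
  have lim2 : Tendsto (fun N : ℕ => semigroup P t (fun q => cutCoord i N q.2) p - cutCoord i N p.2)
      atTop (𝓝 (∫ w, ((w.1 t).2 i : ℝ) ∂(P p) - p.2 i)) := by
    refine Tendsto.sub ?_ (tendsto_cutCoord i p.2)
    refine tendsto_integral_of_dominated_convergence (fun w => ‖(w.1 t).2‖) (fun N => ?_)
      (hP.integrable_norm_position hβ t p)
      (fun N => .of_forall fun w => (abs_cutCoord_le i N _).trans (min_le_left _ _))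
      (.of_forall fun w => tendsto_cutCoord i _)
    exact ((mcut N).comp (CadlagPath.measurable_eval _)).aestronglyMeasurable
  simp_rw [key] at lim1
  exact tendsto_nhds_unique lim1 lim2

/-- The expected displacement in direction `i` in a unit of time, shifted so that it is
nonnegative, as a function of the environment seen from the walker. -/
noncomputable def meanStep (P : Kernel (Config d E × IntLattice d)
      (CadlagPath (Config d E × IntLattice d)))
    (α : Config d E → IntLattice d → ℝ) (i : Fin d) (ζ : Config d E) : ℝ≥0∞ :=
  ∫⁻ s in Ioo (0 : ℝ) 1, evolEP P s (fun ξ => ENNReal.ofReal (localDrift α ξ i + driftBound α)) ζ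

lemma IsJumpRate.localDrift_add_nonneg (hα : IsJumpRate α) (ζ : Config d E) (i : Fin d) :
    0 ≤ localDrift α ζ i + driftBound α := by
  have := (abs_le.1 (hα.abs_localDrift_apply_le ζ i)).1
  linarith

lemma IsJumpRate.localDrift_add_le (hα : IsJumpRate α) (ζ : Config d E) (i : Fin d) :
    localDrift α ζ i + driftBound α ≤ 2 * driftBound α := by
  have := (abs_le.1 (hα.abs_localDrift_apply_le ζ i)).2
  linarith

/-- Dynkin's formula over a unit of time, with `driftBound` added to stay among nonnegative
functions. By covariance the answer depends only on the environment seen from the walker, so mixing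
applies to it. -/
theorem IsWalkInEnvironment.meanStep_eq (hPE : IsEnvironment PE) (hα : IsJumpRate α)
    (hW : IsWalkInEnvironment PE α P) (hβ : IsUniformizedRate β lam Λ)
    (hP : SolvesForward PE β Λ (evol P)) (p : Config d E × IntLattice d) (i : Fin d) :
    0 ≤ ∫ w, ((w.1 1).2 i : ℝ) ∂(P p) - p.2 i + driftBound α ∧
    ENNReal.ofReal (∫ w, ((w.1 1).2 i : ℝ) ∂(P p) - p.2 i + driftBound α)
      = meanStep P α i (shiftConfig (-p.2) p.1) := by
  have : IsMarkovKernel PE := ⟨hPE.markov.prob⟩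
  have : IsMarkovKernel P := ⟨hW.markov.prob⟩
  set A := driftBound α with hA
  have md : Measurable fun ξ => localDrift α ξ i :=
    (measurable_pi_apply i).comp hα.continuous_localDrift.measurable
  have ml : Measurable fun q : Config d E × IntLattice d =>
      localDrift α (shiftConfig (-q.2) q.1) i := md.comp measurable_shift_neg
  have h0 := hW.integral_position_sub hPE hα hβ hP 1 p i
  rw [NNReal.coe_one, intervalIntegral.integral_of_le zero_le_one, integral_Ioc_eq_integral_Ioo] at h0
  have mS : Measurable fun s : ℝ => semigroup P s.toNNReal
      (fun q => localDrift α (shiftConfig (-q.2) q.1) i) p :=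
    Measurable.semigroup P (F := fun _ q => localDrift α (shiftConfig (-q.2) q.1) i)
      (ml.comp measurable_snd) measurable_real_toNNReal measurable_const
  have hSb : ∀ s : ℝ, |semigroup P s.toNNReal
      (fun q => localDrift α (shiftConfig (-q.2) q.1) i) p| ≤ A :=
    fun s => abs_semigroup_le P (fun q => hα.abs_localDrift_apply_le _ i) _ _
  have iS : IntegrableOn (fun s : ℝ => semigroup P s.toNNReal
      (fun q => localDrift α (shiftConfig (-q.2) q.1) i) p) (Ioo 0 1) :=
    Integrable.of_bound mS.aestronglyMeasurable A (.of_forall hSb)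
  have h1 : ∫ w, ((w.1 1).2 i : ℝ) ∂(P p) - p.2 i + A = ∫ s in Ioo (0 : ℝ) 1,
      semigroup P s.toNNReal (fun q => localDrift α (shiftConfig (-q.2) q.1) i + A) p := by
    rw [← h0]
    have : ∀ s : ℝ, semigroup P s.toNNReal
        (fun q => localDrift α (shiftConfig (-q.2) q.1) i + A) p
        = semigroup P s.toNNReal (fun q => localDrift α (shiftConfig (-q.2) q.1) i) p + A := by
      intro s
      rw [semigroup_add P ml measurable_const (fun q => hα.abs_localDrift_apply_le _ i)
        (fun _ => le_refl |A|), semigroup_const]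
    simp_rw [this]
    rw [integral_add iS (by simp)]
    simp
  have hpos : ∀ s : ℝ, 0 ≤ semigroup P s.toNNReal
      (fun q => localDrift α (shiftConfig (-q.2) q.1) i + A) p := fun s =>
    integral_nonneg fun w => hα.localDrift_add_nonneg _ i
  rw [h1]
  refine ⟨integral_nonneg hpos, ?_⟩
  rw [ofReal_integral_eq_lintegral_ofReal _ (.of_forall hpos), meanStep]
  · refine setLIntegral_congr_fun measurableSet_Ioo fun s hs => ?_
    rw [ofReal_semigroup P (ml.add_const A) (fun q => hα.localDrift_add_nonneg _ i)
      (fun q => hα.localDrift_add_le _ i)]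
    have := hP.evol_liftEP hPE hβ hs.1.le (c := ENNReal.ofReal (2 * A)) ENNReal.ofReal_ne_top
      (g := fun ξ => ENNReal.ofReal (localDrift α ξ i + A))
      (ENNReal.measurable_ofReal.comp (md.add_const A))
      (fun ξ => ENNReal.ofReal_le_ofReal (hα.localDrift_add_le ξ i)) p
    exact this
  · refine Integrable.of_bound ?_ (2 * A) (.of_forall fun s => ?_)
    · exact (Measurable.semigroup P (F := fun _ q => localDrift α (shiftConfig (-q.2) q.1) i + A)
        ((ml.add_const A).comp measurable_snd) measurable_real_toNNReal
        measurable_const).aestronglyMeasurable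
    · refine abs_semigroup_le P (fun q => ?_) _ _
      rw [abs_of_nonneg (hα.localDrift_add_nonneg _ i)]
      exact hα.localDrift_add_le _ i

lemma meanStep_le (hα : IsJumpRate α) [IsMarkovKernel P] (i : Fin d) (ζ : Config d E) :
    meanStep P α i ζ ≤ ENNReal.ofReal (2 * driftBound α) := by
  calc meanStep P α i ζ ≤ ∫⁻ _ in Ioo (0 : ℝ) 1, ENNReal.ofReal (2 * driftBound α) :=
        lintegral_mono fun s => evolEP_le s
          (fun ξ => ENNReal.ofReal_le_ofReal (hα.localDrift_add_le ξ i)) ζ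
    _ = _ := by simp

lemma measurable_evolEP_drift [IsMarkovKernel P] (hα : IsJumpRate α) (i : Fin d) :
    Measurable fun q : ℝ × Config d E =>
      evolEP P q.1 (fun ξ => ENNReal.ofReal (localDrift α ξ i + driftBound α)) q.2 := by
  have md : Measurable fun ξ => ENNReal.ofReal (localDrift α ξ i + driftBound α) :=
    ENNReal.measurable_ofReal.comp (((measurable_pi_apply i).comp
      hα.continuous_localDrift.measurable).add_const _)
  exact Measurable.evol P (F := fun _ => liftEP _) (md.liftEP.comp measurable_snd) measurable_fst
    (measurable_snd.prodMk measurable_const)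

lemma IsWalkInEnvironment.continuous_meanStep (hPE : IsEnvironment PE) (hα : IsJumpRate α)
    (hW : IsWalkInEnvironment PE α P) (hβ : IsUniformizedRate β lam Λ)
    (hP : SolvesForward PE β Λ (evol P)) (i : Fin d) : Continuous (meanStep P α i) := by
  have : IsMarkovKernel PE := ⟨hPE.markov.prob⟩
  have : IsMarkovKernel P := ⟨hW.markov.prob⟩
  have hc : Continuous fun ξ => ENNReal.ofReal (localDrift α ξ i + driftBound α) :=
    ENNReal.continuous_ofReal.comp
      (((continuous_apply i).comp hα.continuous_localDrift).add continuous_const)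
  have hle : ∀ ξ, ENNReal.ofReal (localDrift α ξ i + driftBound α)
      ≤ ENNReal.ofReal (2 * driftBound α) :=
    fun ξ => ENNReal.ofReal_le_ofReal (hα.localDrift_add_le ξ i)
  refine continuous_iff_continuousAt.2 fun ζ => ?_
  refine tendsto_lintegral_filter_of_dominated_convergence
    (fun _ => ENNReal.ofReal (2 * driftBound α)) (.of_forall fun ξ => ?_)
    (.of_forall fun ξ => .of_forall fun s => evolEP_le s hle ξ) ?_ ?_
  · exact (measurable_evolEP_drift hα i).comp measurable_prodMk_right
  · rw [setLIntegral_const]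
    exact ENNReal.mul_ne_top ENNReal.ofReal_ne_top (by simp)
  · refine (ae_restrict_iff' measurableSet_Ioo).2 (.of_forall fun s hs => ?_)
    exact (hP.continuous_evolEP hPE hβ hs.1.le ENNReal.ofReal_ne_top hc hle).tendsto ζ

lemma IsStationaryEP.lintegral_meanStep [IsMarkovKernel P] (hα : IsJumpRate α)
    {μ : Measure (Config d E)} [IsProbabilityMeasure μ] (hμ : IsStationaryEP P μ) (i : Fin d) :
    0 ≤ ∫ ζ, localDrift α ζ i ∂μ + driftBound α ∧ ∫⁻ ζ, meanStep P α i ζ ∂μ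
      = ENNReal.ofReal (∫ ζ, localDrift α ζ i ∂μ + driftBound α) := by
  have md : Measurable fun ξ => localDrift α ξ i :=
    (measurable_pi_apply i).comp hα.continuous_localDrift.measurable
  have id : Integrable (fun ξ => localDrift α ξ i) μ :=
    Integrable.of_bound md.aestronglyMeasurable (driftBound α)
      (.of_forall fun ζ => hα.abs_localDrift_apply_le ζ i)
  have e : ∫ ζ, localDrift α ζ i ∂μ + driftBound α = ∫ ζ, (localDrift α ζ i + driftBound α) ∂μ := by
    rw [integral_add id (integrable_const _)]; simp
  rw [e]
  refine ⟨integral_nonneg fun ζ => hα.localDrift_add_nonneg ζ i, ?_⟩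
  have id' : Integrable (fun ξ => localDrift α ξ i + driftBound α) μ := id.add (integrable_const _)
  rw [ofReal_integral_eq_lintegral_ofReal id'
    (.of_forall fun ζ => hα.localDrift_add_nonneg ζ i)]
  unfold meanStep
  rw [lintegral_lintegral_swap]
  · have : ∀ s ∈ Ioo (0 : ℝ) 1, ∫⁻ ζ, evolEP P s
        (fun ξ => ENNReal.ofReal (localDrift α ξ i + driftBound α)) ζ ∂μ
        = ∫⁻ ζ, ENNReal.ofReal (localDrift α ζ i + driftBound α) ∂μ := fun s hs =>
      hμ.lintegral_evolEP hs.1.le (ENNReal.measurable_ofReal.comp (md.add_const _))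
    rw [setLIntegral_congr_fun measurableSet_Ioo this]
    simp
  · exact ((measurable_evolEP_drift hα i).comp measurable_swap).aemeasurable

/-- Up to the increments of a bounded function of the environment process and a small error, the
expected displacement of the walk in a unit of time does not depend on the environment. -/
theorem IsWalkInEnvironment.exists_corrector [Nonempty E] (hPE : IsEnvironment PE)
    (hα : IsJumpRate α)
    (hW : IsWalkInEnvironment PE α P) (hβ : IsUniformizedRate β lam Λ)
    (hP : SolvesForward PE β Λ (evol P)) {μ : Measure (Config d E)} [IsProbabilityMeasure μ]
    (hμ : IsMixingEP P μ) (hst : IsStationaryEP P μ) (i : Fin d) {ε : ℝ} (hε : 0 < ε) :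
    ∃ (g : Config d E → ℝ) (C : ℝ), Measurable g ∧ (∀ ζ, |g ζ| ≤ C) ∧
      ∀ p : Config d E × IntLattice d,
        |∫ w, (((w.1 1).2 i : ℝ) - p.2 i + (g (shiftConfig (-(w.1 1).2) (w.1 1).1)
          - g (shiftConfig (-p.2) p.1))) ∂(P p) - ∫ ζ, localDrift α ζ i ∂μ| ≤ ε := by
  have : IsMarkovKernel PE := ⟨hPE.markov.prob⟩
  have : IsMarkovKernel P := ⟨hW.markov.prob⟩
  set A := driftBound α with hA
  set U := meanStep P α i with hU
  have hA0 : 0 ≤ A := driftBound_nonneg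
  have hUc := hW.continuous_meanStep hPE hα hβ hP i
  have hUm := hUc.measurable
  have hUb : ∀ ζ, U ζ ≤ ENNReal.ofReal (2 * A) := meanStep_le hα i
  obtain ⟨t₀, ht₀, hmix⟩ := hμ U (2 * A) hUc hUb ε hε
  obtain ⟨hv0, hv⟩ := hst.lintegral_meanStep hα i
  set v := ∫ ζ, localDrift α ζ i ∂μ with hvdef
  set m := ⌈t₀⌉₊
  -- An approximate solution of the Poisson equation: the sum of the evolved mean steps up to the
  -- mixing time.
  let gE : Config d E → ℝ≥0∞ := fun ζ => ∑ j ∈ Finset.range m, evolEP P (j : ℕ) U ζ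
  have hEb : ∀ (t : ℝ) ζ, evolEP P t U ζ ≤ ENNReal.ofReal (2 * A) := fun t => evolEP_le t hUb
  have hEm : ∀ t : ℝ, Measurable (evolEP P t U) := fun t => measurable_evolEP t hUm
  have hgb : ∀ ζ, gE ζ ≤ ENNReal.ofReal (m * (2 * A)) := by
    intro ζ
    have h : gE ζ ≤ ∑ _ ∈ Finset.range m, ENNReal.ofReal (2 * A) :=
      Finset.sum_le_sum fun j _ => hEb j ζ
    refine h.trans (le_of_eq ?_)
    rw [Finset.sum_const, Finset.card_range, nsmul_eq_mul, ENNReal.ofReal_mul (Nat.cast_nonneg m),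
      ENNReal.ofReal_natCast]
  have hgt : ∀ ζ, gE ζ ≠ ∞ := fun ζ => ne_top_of_le_ne_top ENNReal.ofReal_ne_top (hgb ζ)
  have hgm : Measurable gE := Finset.measurable_sum _ fun j _ => hEm j
  have hgC : ∀ ζ, |(gE ζ).toReal| ≤ m * (2 * A) := fun ζ => by
    rw [abs_of_nonneg ENNReal.toReal_nonneg]
    exact ENNReal.toReal_le_of_le_ofReal (by positivity) (hgb ζ)
  refine ⟨fun ζ => (gE ζ).toReal, m * (2 * A), hgm.ennreal_toReal, hgC, fun p => ?_⟩
  set ζ := shiftConfig (-p.2) p.1 with hζ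
  obtain ⟨ha0, ha⟩ := hW.meanStep_eq hPE hα hβ hP p i
  set a := ∫ w, ((w.1 1).2 i : ℝ) ∂(P p) - p.2 i with hadef
  have mZ : Measurable fun w : CadlagPath (Config d E × IntLattice d) =>
      gE (shiftConfig (-(w.1 1).2) (w.1 1).1) :=
    hgm.liftEP.comp (CadlagPath.measurable_eval 1)
  have hZ : ∫ w, (gE (shiftConfig (-(w.1 1).2) (w.1 1).1)).toReal ∂(P p)
      = (evol P 1 (liftEP gE) p).toReal := by
    rw [integral_toReal mZ.aemeasurable (.of_forall fun w => (hgt _).lt_top)]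
    simp [evol, liftEP]
  have hZb : evol P 1 (liftEP gE) p ≤ ENNReal.ofReal (m * (2 * A)) := evol_le P (fun q => hgb _) _ _
  have hstep : evol P 1 (liftEP gE) p = ∑ j ∈ Finset.range m, evolEP P ((j + 1 : ℕ) : ℝ) U ζ := by
    rw [hP.evol_liftEP hPE hβ zero_le_one ENNReal.ofReal_ne_top hgm hgb p]
    change evol P 1 (fun q => ∑ j ∈ Finset.range m, liftEP (evolEP P (j : ℕ) U) q) (ζ, 0) = _
    have mE : ∀ j : ℕ, Measurable fun w : CadlagPath (Config d E × IntLattice d) =>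
        liftEP (evolEP P (j : ℕ) U) (w.1 (1 : ℝ).toNNReal) :=
      fun j => (hEm j).liftEP.comp (CadlagPath.measurable_eval _)
    unfold evol
    rw [lintegral_finsetSum _ fun j _ => mE j]
    refine Finset.sum_congr rfl fun j _ => ?_
    change evolEP P 1 (evolEP P (j : ℕ) U) ζ = _
    rw [← hP.evolEP_add hPE hW.markov hβ zero_le_one (Nat.cast_nonneg j) ENNReal.ofReal_ne_top hUm hUb]
    push_cast; rw [add_comm]
  have hzero : evolEP P ((0 : ℕ) : ℝ) U ζ = U ζ := by
    rw [Nat.cast_zero, evolEP, hW.markov.evol_zero]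
    simp [liftEP, shiftConfig_zero]
  -- One unit of time shifts the sum by one index, so it telescopes: the mean step plus the expected
  -- increment of the corrector is the mean step evolved to time m, which is constant up to ε.
  have hid : U ζ + evol P 1 (liftEP gE) p = gE ζ + evolEP P (m : ℕ) U ζ := by
    rw [hstep, ← hzero, add_comm]
    simp only [gE]
    rw [← Finset.sum_range_succ (fun j => evolEP P ((j : ℕ) : ℝ) U ζ),
      ← Finset.sum_range_succ' (fun j => evolEP P ((j : ℕ) : ℝ) U ζ)]
  have hfinE : ∀ t : ℝ, evolEP P t U ζ ≠ ∞ := fun t =>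
    ne_top_of_le_ne_top ENNReal.ofReal_ne_top (hEb t ζ)
  have hid' : a + A + (evol P 1 (liftEP gE) p).toReal
      = (gE ζ).toReal + (evolEP P (m : ℕ) U ζ).toReal := by
    have := congrArg ENNReal.toReal hid
    rwa [ENNReal.toReal_add (ne_top_of_le_ne_top ENNReal.ofReal_ne_top (hUb ζ))
      (ne_top_of_le_ne_top ENNReal.ofReal_ne_top hZb), ENNReal.toReal_add (hgt ζ) (hfinE _), hU, hζ, ← ha,
      ENNReal.toReal_ofReal ha0] at this
  have hlim : |(evolEP P (m : ℕ) U ζ).toReal - (v + A)| ≤ ε := by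
    obtain ⟨h1, h2⟩ := hmix m (Nat.le_ceil t₀) ζ
    rw [hv] at h1 h2
    rw [← ENNReal.ofReal_add hv0 hε.le] at h1
    have h1' := ENNReal.toReal_le_of_le_ofReal (by positivity) h1
    rw [← ENNReal.ofReal_toReal (hfinE m), ← ENNReal.ofReal_add ENNReal.toReal_nonneg hε.le] at h2
    have h2' := (ENNReal.ofReal_le_ofReal_iff (by positivity)).1 h2
    rw [abs_le]; constructor <;> linarith
  have hi := hP.integrable_position hβ 1 p i
  have hgi : Integrable (fun w : CadlagPath (Config d E × IntLattice d) =>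
      (gE (shiftConfig (-(w.1 1).2) (w.1 1).1)).toReal) (P p) :=
    Integrable.of_bound mZ.ennreal_toReal.aestronglyMeasurable _ (.of_forall fun w => hgC _)
  have hcalc : ∫ w, (((w.1 1).2 i : ℝ) - p.2 i + ((gE (shiftConfig (-(w.1 1).2) (w.1 1).1)).toReal
          - (gE ζ).toReal)) ∂(P p) = a + ((evol P 1 (liftEP gE) p).toReal - (gE ζ).toReal) := by
    have i1 : Integrable (fun w : CadlagPath (Config d E × IntLattice d) =>
        ((w.1 1).2 i : ℝ) - p.2 i) (P p) := hi.sub (integrable_const _)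
    have i2 : Integrable (fun w : CadlagPath (Config d E × IntLattice d) =>
        (gE (shiftConfig (-(w.1 1).2) (w.1 1).1)).toReal - (gE ζ).toReal) (P p) :=
      hgi.sub (integrable_const _)
    rw [integral_add i1 i2, integral_sub hi (integrable_const _), integral_sub hgi (integrable_const _), hZ, hadef]
    simp
  rw [hcalc]
  convert hlim using 2
  linarith

end MeanStep

/-! ### Laws of large numbers for martingale differences -/

section MartingaleDifferences

/-- Kronecker's lemma with weights k + 1: summation by parts gives the partial sum minus the Cesàro
mean of the partial sums, and both tend to s. -/
lemma tendsto_inv_mul_sum_of_tendsto {a : ℕ → ℝ} {s : ℝ}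
    (h : Tendsto (fun n => ∑ k ∈ Finset.range n, a k) atTop (𝓝 s)) :
    Tendsto (fun n : ℕ => (n : ℝ)⁻¹ * ∑ k ∈ Finset.range n, ((k : ℝ) + 1) * a k) atTop (𝓝 0) := by
  have key : ∀ n : ℕ, ∑ k ∈ Finset.range n, ((k : ℝ) + 1) * a k
      = n * ∑ k ∈ Finset.range n, a k
        - ∑ k ∈ Finset.range n, ∑ j ∈ Finset.range k, a j := by
    intro n
    induction n with
    | zero => simp
    | succ n ih =>
      rw [Finset.sum_range_succ, ih, Finset.sum_range_succ a,
        Finset.sum_range_succ fun k => ∑ j ∈ Finset.range k, a j]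
      push_cast; ring
  have h2 := h.sub h.cesaro
  rw [sub_self] at h2
  refine h2.congr' ?_
  filter_upwards [eventually_ge_atTop 1] with n hn
  have : (n : ℝ) ≠ 0 := by positivity
  rw [key, mul_sub, inv_mul_cancel_left₀ this]

lemma integral_abs_le_of_integral_sq_le {Ω : Type*} [MeasurableSpace Ω] {μ : Measure Ω}
    [IsProbabilityMeasure μ] {f : Ω → ℝ} (hf : Integrable f μ)
    (hf2 : Integrable (fun ω => f ω ^ 2) μ) {c : ℝ} (hc : 0 < c) (h : ∫ ω, f ω ^ 2 ∂μ ≤ c ^ 2) :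
    ∫ ω, |f ω| ∂μ ≤ c := by
  have h1 : ∀ ω, |f ω| ≤ (2 * c)⁻¹ * (f ω ^ 2 + c ^ 2) := by
    intro ω
    rw [inv_mul_eq_div, le_div_iff₀ (by positivity), ← sq_abs (f ω)]
    nlinarith [sq_nonneg (|f ω| - c)]
  calc ∫ ω, |f ω| ∂μ ≤ ∫ ω, (2 * c)⁻¹ * (f ω ^ 2 + c ^ 2) ∂μ :=
        integral_mono hf.abs ((hf2.add (integrable_const _)).const_mul _) h1
    _ = (2 * c)⁻¹ * (∫ ω, f ω ^ 2 ∂μ + c ^ 2) := by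
        rw [integral_const_mul, integral_add hf2 (integrable_const _)]; simp
    _ ≤ (2 * c)⁻¹ * (c ^ 2 + c ^ 2) := by gcongr
    _ = c := by field_simp; ring

/-- Bounded martingale differences. -/
structure IsMartingaleDiff {Ω : Type*} {m0 : MeasurableSpace Ω} (ℱ : Filtration ℕ m0)
    (μ : Measure Ω) (D : ℕ → Ω → ℝ) (b : ℕ → ℝ) : Prop where
  measurable : ∀ k, Measurable[ℱ (k + 1)] (D k)
  bound : ∀ k ω, |D k ω| ≤ b k
  condExp : ∀ k, μ[D k | ℱ k] =ᵐ[μ] 0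

namespace IsMartingaleDiff

variable {Ω : Type*} {m0 : MeasurableSpace Ω} {ℱ : Filtration ℕ m0} {μ : Measure Ω}
  {D : ℕ → Ω → ℝ} {b : ℕ → ℝ}

lemma const_mul (h : IsMartingaleDiff ℱ μ D b) (a : ℕ → ℝ) :
    IsMartingaleDiff ℱ μ (fun k ω => a k * D k ω) fun k => |a k| * b k where
  measurable k := (h.measurable k).const_mul _
  bound k ω := by rw [abs_mul]; exact mul_le_mul_of_nonneg_left (h.bound k ω) (abs_nonneg _)
  condExp k := by
    have h1 := condExp_smul (a k) (D k) (ℱ k) (μ := μ)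
    have e : (fun ω => a k * D k ω) = a k • D k := rfl
    rw [e]
    filter_upwards [h1, h.condExp k] with ω h1 h2
    rw [h1, Pi.smul_apply, h2]
    simp

lemma measurable_sum (h : IsMartingaleDiff ℱ μ D b) (n : ℕ) :
    Measurable[ℱ n] fun ω => ∑ k ∈ Finset.range n, D k ω :=
  Finset.measurable_sum _ fun k hk => (h.measurable k).mono
    (ℱ.mono (Nat.succ_le_of_lt (Finset.mem_range.1 hk))) le_rfl

lemma abs_sum_le (h : IsMartingaleDiff ℱ μ D b) (n : ℕ) (ω : Ω) :
    |∑ k ∈ Finset.range n, D k ω| ≤ ∑ k ∈ Finset.range n, b k :=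
  (Finset.abs_sum_le_sum_abs _ _).trans (Finset.sum_le_sum fun k _ => h.bound k ω)

variable [IsProbabilityMeasure μ]

lemma integrable (h : IsMartingaleDiff ℱ μ D b) (k : ℕ) : Integrable (D k) μ :=
  Integrable.of_bound ((h.measurable k).mono (ℱ.le _) le_rfl).aestronglyMeasurable (b k)
    (.of_forall (h.bound k))

lemma integrable_sq (h : IsMartingaleDiff ℱ μ D b) (k : ℕ) :
    Integrable (fun ω => D k ω ^ 2) μ :=
  Integrable.of_bound (((h.measurable k).mono (ℱ.le _) le_rfl).pow_const 2).aestronglyMeasurable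
    (b k ^ 2) (.of_forall fun ω => by
      rw [Real.norm_eq_abs, abs_pow]; exact pow_le_pow_left₀ (abs_nonneg _) (h.bound k ω) 2)

lemma integrable_sum (h : IsMartingaleDiff ℱ μ D b) (n : ℕ) :
    Integrable (fun ω => ∑ k ∈ Finset.range n, D k ω) μ :=
  integrable_finsetSum _ fun k _ => h.integrable k

lemma integrable_sum_sq (h : IsMartingaleDiff ℱ μ D b) (n : ℕ) :
    Integrable (fun ω => (∑ k ∈ Finset.range n, D k ω) ^ 2) μ :=
  Integrable.of_bound (((h.measurable_sum n).mono (ℱ.le _) le_rfl).pow_const 2).aestronglyMeasurable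
    ((∑ k ∈ Finset.range n, b k) ^ 2) (.of_forall fun ω => by
      rw [Real.norm_eq_abs, abs_pow]; exact pow_le_pow_left₀ (abs_nonneg _) (h.abs_sum_le n ω) 2)

/-- Martingale differences are orthogonal: the partial sum up to n is known at time n, and the next
difference has conditional mean zero there. -/
theorem integral_sum_sq (h : IsMartingaleDiff ℱ μ D b) (n : ℕ) :
    ∫ ω, (∑ k ∈ Finset.range n, D k ω) ^ 2 ∂μ = ∑ k ∈ Finset.range n, ∫ ω, D k ω ^ 2 ∂μ := by
  induction n with
  | zero => simp
  | succ n ih =>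
    set S : Ω → ℝ := fun ω => ∑ k ∈ Finset.range n, D k ω with hS
    have hSm : StronglyMeasurable[ℱ n] S := (h.measurable_sum n).stronglyMeasurable
    have iSD : Integrable (S * D n) μ :=
      (h.integrable n).bdd_mul (c := ∑ k ∈ Finset.range n, b k)
        (hSm.mono (ℱ.le n)).aestronglyMeasurable (.of_forall (h.abs_sum_le n))
    have h0 : ∫ ω, (S * D n) ω ∂μ = 0 := by
      rw [← integral_condExp (ℱ.le n), integral_congr_ae
        (condExp_mul_of_stronglyMeasurable_left hSm iSD (h.integrable n))]
      have : S * μ[D n | ℱ n] =ᵐ[μ] 0 := by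
        filter_upwards [h.condExp n] with ω hω
        rw [Pi.mul_apply, hω]; simp
      rw [integral_congr_ae this]; simp
    have e : ∀ ω, (∑ k ∈ Finset.range (n + 1), D k ω) ^ 2
        = (S ω ^ 2 + D n ω ^ 2) + 2 * (S * D n) ω := by
      intro ω
      rw [Finset.sum_range_succ, Pi.mul_apply]
      ring
    simp_rw [e]
    have i1 : Integrable (fun ω => S ω ^ 2 + D n ω ^ 2) μ :=
      (h.integrable_sum_sq n).add (h.integrable_sq n)
    rw [integral_add i1 (iSD.const_mul 2), integral_const_mul, h0, mul_zero, add_zero,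
      integral_add (h.integrable_sum_sq n) (h.integrable_sq n), ih, Finset.sum_range_succ]

lemma martingale_sum (h : IsMartingaleDiff ℱ μ D b) :
    Martingale (fun n ω => ∑ k ∈ Finset.range n, D k ω) ℱ μ := by
  refine martingale_of_condExp_sub_eq_zero_nat (fun n => (h.measurable_sum n).stronglyMeasurable)
    h.integrable_sum fun n => ?_
  have e : ((fun ω => ∑ k ∈ Finset.range (n + 1), D k ω) - fun ω => ∑ k ∈ Finset.range n, D k ω)
      = D n := by
    funext ω; simp [Finset.sum_range_succ]
  rw [e]
  exact h.condExp n

/-- The strong law of large numbers for martingale differences. -/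
theorem ae_tendsto_inv_mul_sum (h : IsMartingaleDiff ℱ μ D b) {R : ℝ} (hR : 0 < R)
    (hv : ∀ n, ∑ k ∈ Finset.range n, (((k : ℝ) + 1)⁻¹) ^ 2 * ∫ ω, D k ω ^ 2 ∂μ ≤ R ^ 2) :
    ∀ᵐ ω ∂μ, Tendsto (fun n : ℕ => (n : ℝ)⁻¹ * ∑ k ∈ Finset.range n, D k ω) atTop (𝓝 0) := by
  -- The differences divided by k + 1 have partial sums bounded in L², hence in L¹, so this
  -- martingale converges almost surely; Kronecker's lemma then undoes the division.
  have h' := h.const_mul fun k => ((k : ℝ) + 1)⁻¹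
  have hL1 : ∀ n, eLpNorm (fun ω => ∑ k ∈ Finset.range n, ((k : ℝ) + 1)⁻¹ * D k ω) 1 μ
      ≤ (R.toNNReal : ℝ≥0∞) := by
    intro n
    have hi := h'.integrable_sum n
    rw [eLpNorm_one_eq_lintegral_enorm, ← ofReal_integral_norm_eq_lintegral_enorm hi]
    refine ENNReal.ofReal_le_ofReal ?_
    refine integral_abs_le_of_integral_sq_le hi (h'.integrable_sum_sq n) hR ?_
    rw [h'.integral_sum_sq n]
    refine le_trans (le_of_eq (Finset.sum_congr rfl fun k _ => ?_)) (hv n)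
    rw [← integral_const_mul]
    simp_rw [mul_pow]
  filter_upwards [h'.martingale_sum.submartingale.exists_ae_tendsto_of_bdd hL1] with ω hω
  obtain ⟨c, hc⟩ := hω
  refine (tendsto_inv_mul_sum_of_tendsto hc).congr fun n => ?_
  congr 1
  refine Finset.sum_congr rfl fun k _ => ?_
  rw [mul_inv_cancel_left₀ (by positivity)]

theorem integral_abs_sum_le (h : IsMartingaleDiff ℱ μ D b) {B : ℝ} (hB : 0 < B)
    (hb : ∀ k, b k ≤ B) {n : ℕ} (hn : 0 < n) :
    ∫ ω, |∑ k ∈ Finset.range n, D k ω| ∂μ ≤ √n * B := by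
  refine integral_abs_le_of_integral_sq_le (h.integrable_sum n) (h.integrable_sum_sq n)
    (by positivity) ?_
  rw [h.integral_sum_sq n, mul_pow, Real.sq_sqrt (Nat.cast_nonneg n)]
  have h1 : ∀ k, ∫ ω, D k ω ^ 2 ∂μ ≤ B ^ 2 := by
    intro k
    calc _ ≤ ∫ _, B ^ 2 ∂μ := by
          refine integral_mono (h.integrable_sq k) (integrable_const _) fun ω => ?_
          change D k ω ^ 2 ≤ B ^ 2
          rw [← sq_abs]
          exact pow_le_pow_left₀ (abs_nonneg _) ((h.bound k ω).trans (hb k)) 2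
      _ = _ := by simp
  calc _ ≤ ∑ _ ∈ Finset.range n, B ^ 2 := Finset.sum_le_sum fun k _ => h1 k
    _ = _ := by simp

end IsMartingaleDiff

end MartingaleDifferences

/-! ### Martingale differences along a Markov process -/

section MarkovDifferences

variable {S : Type*} [TopologicalSpace S] [MeasurableSpace S]

/-- The canonical filtration at integer times. -/
def natFiltration (S : Type*) [TopologicalSpace S] [MeasurableSpace S] :
    Filtration ℕ (inferInstance : MeasurableSpace (CadlagPath S)) where
  seq n := canonicalFiltration S n
  mono' _ _ h := (canonicalFiltration S).mono (by exact_mod_cast h)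
  le' n := (canonicalFiltration S).le n

/-- Adding B makes Φ nonnegative, so the statement on each event of the past is `lintegral_mul_eval`
with an indicator as weight. -/
theorem IsMarkovProcess.condExp_pair {P : Kernel S (CadlagPath S)} (hP : IsMarkovProcess P)
    (x : S) (s t : ℝ≥0) {Φ : S × S → ℝ} (hΦ : Measurable Φ) {B : ℝ} (hB : ∀ q, |Φ q| ≤ B) :
    (P x)[fun w => Φ (w.1 s, w.1 (s + t)) | canonicalFiltration S s]
      =ᵐ[P x] fun w => ∫ w', Φ (w.1 s, w'.1 t) ∂(P (w.1 s)) := by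
  have : IsMarkovKernel P := ⟨hP.prob⟩
  have hle := (canonicalFiltration S).le s
  have ev := fun r => CadlagPath.measurable_eval (S := S) r
  have mΦ : Measurable fun w : CadlagPath S => Φ (w.1 s, w.1 (s + t)) :=
    hΦ.comp ((ev s).prodMk (ev (s + t)))
  have mc : Measurable fun y : S => ∫ w', Φ (y, w'.1 t) ∂(P y) := by
    have : StronglyMeasurable (Function.uncurry fun (y : S) (w' : CadlagPath S) => Φ (y, w'.1 t)) :=
      (hΦ.comp (measurable_fst.prodMk ((ev t).comp measurable_snd))).stronglyMeasurable
    exact this.integral_kernel_prod_right'.measurable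
  have mcs : Measurable[canonicalFiltration S s]
      fun w : CadlagPath S => ∫ w', Φ (w.1 s, w'.1 t) ∂(P (w.1 s)) :=
    mc.comp (CadlagPath.measurable_eval_canonicalFiltration le_rfl)
  have iΦ : Integrable (fun w : CadlagPath S => Φ (w.1 s, w.1 (s + t))) (P x) :=
    Integrable.of_bound mΦ.aestronglyMeasurable B (.of_forall fun w => hB _)
  have hcB : ∀ y, |∫ w', Φ (y, w'.1 t) ∂(P y)| ≤ B := by
    intro y
    have := norm_integral_le_of_norm_le_const (μ := P y)
      (f := fun w' : CadlagPath S => Φ (y, w'.1 t)) (.of_forall fun w => hB _)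
    simpa using this
  have ic : Integrable (fun w : CadlagPath S => ∫ w', Φ (w.1 s, w'.1 t) ∂(P (w.1 s))) (P x) :=
    Integrable.of_bound (mcs.mono hle le_rfl).aestronglyMeasurable B (.of_forall fun w => hcB _)
  refine (ae_eq_condExp_of_forall_setIntegral_eq hle iΦ (fun _ _ _ => ic.integrableOn)
    (fun A hA _ => ?_) mcs.stronglyMeasurable.aestronglyMeasurable).symm
  have hA' := hle A hA
  have hpos : ∀ q, 0 ≤ Φ q + B := fun q => by linarith [(abs_le.1 (hB q)).1]
  have hposc : ∀ y, 0 ≤ ∫ w', Φ (y, w'.1 t) ∂(P y) + B := fun y => by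
    linarith [(abs_le.1 (hcB y)).1]
  have key : ∫⁻ w in A, ENNReal.ofReal (∫ w', Φ (w.1 s, w'.1 t) ∂(P (w.1 s)) + B) ∂(P x)
      = ∫⁻ w in A, ENNReal.ofReal (Φ (w.1 s, w.1 (s + t)) + B) ∂(P x) := by
    have h1 := hP.lintegral_mul_eval x s t (m := A.indicator 1)
      (Measurable.indicator (measurable_const (a := (1 : ℝ≥0∞))) hA)
      (Φ := fun q => ENNReal.ofReal (Φ q + B)) (ENNReal.measurable_ofReal.comp (hΦ.add_const B))
    have h2 : ∀ y, ∫⁻ w', ENNReal.ofReal (Φ (y, w'.1 t) + B) ∂(P y)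
        = ENNReal.ofReal (∫ w', Φ (y, w'.1 t) ∂(P y) + B) := by
      intro y
      have i1 : Integrable (fun w' : CadlagPath S => Φ (y, w'.1 t)) (P y) :=
        Integrable.of_bound (hΦ.comp (measurable_const.prodMk (ev t))).aestronglyMeasurable B
          (.of_forall fun w => hB _)
      have i2 : Integrable (fun w' : CadlagPath S => Φ (y, w'.1 t) + B) (P y) :=
        i1.add (integrable_const _)
      rw [← ofReal_integral_eq_lintegral_ofReal i2 (.of_forall fun w => hpos _),
        integral_add i1 (integrable_const _)]
      simp
    simp_rw [h2] at h1
    have h3 : ∀ F : CadlagPath S → ℝ≥0∞, ∫⁻ w, A.indicator 1 w * F w ∂(P x) = ∫⁻ w in A, F w ∂(P x) := by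
      intro F
      rw [← lintegral_indicator hA']
      refine lintegral_congr fun w => ?_
      by_cases hw : w ∈ A <;> simp [hw]
    rw [h3, h3] at h1
    exact h1.symm
  have iΦB : Integrable (fun w : CadlagPath S => Φ (w.1 s, w.1 (s + t)) + B) ((P x).restrict A) :=
    (iΦ.add (integrable_const _)).integrableOn
  have icB : Integrable (fun w : CadlagPath S => ∫ w', Φ (w.1 s, w'.1 t) ∂(P (w.1 s)) + B)
      ((P x).restrict A) := (ic.add (integrable_const _)).integrableOn
  rw [← ofReal_integral_eq_lintegral_ofReal icB (.of_forall fun w => hposc _),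
    ← ofReal_integral_eq_lintegral_ofReal iΦB (.of_forall fun w => hpos _),
    ENNReal.ofReal_eq_ofReal_iff (integral_nonneg fun w => hposc _) (integral_nonneg fun w => hpos _),
    integral_add ic.integrableOn (integrable_const _),
    integral_add iΦ.integrableOn (integrable_const _)] at key
  exact add_right_cancel key

/-- The centred increments of a bounded function of two successive states. -/
theorem IsMarkovProcess.isMartingaleDiff {P : Kernel S (CadlagPath S)} (hP : IsMarkovProcess P)
    (x : S) {Φ : ℕ → S × S → ℝ} (hΦ : ∀ k, Measurable (Φ k)) {B : ℕ → ℝ}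
    (hB : ∀ k q, |Φ k q| ≤ B k) :
    IsMartingaleDiff (natFiltration S) (P x)
      (fun k w => Φ k (w.1 k, w.1 (k + 1)) - ∫ w', Φ k (w.1 k, w'.1 1) ∂(P (w.1 k)))
      fun k => 2 * B k := by
  have : IsMarkovKernel P := ⟨hP.prob⟩
  have ev := fun r => CadlagPath.measurable_eval (S := S) r
  have mc : ∀ k, Measurable fun y : S => ∫ w', Φ k (y, w'.1 1) ∂(P y) := by
    intro k
    have : StronglyMeasurable
        (Function.uncurry fun (y : S) (w' : CadlagPath S) => Φ k (y, w'.1 1)) :=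
      ((hΦ k).comp (measurable_fst.prodMk ((ev 1).comp measurable_snd))).stronglyMeasurable
    exact this.integral_kernel_prod_right'.measurable
  have hcB : ∀ k y, |∫ w', Φ k (y, w'.1 1) ∂(P y)| ≤ B k := by
    intro k y
    have := norm_integral_le_of_norm_le_const (μ := P y)
      (f := fun w' : CadlagPath S => Φ k (y, w'.1 1)) (.of_forall fun w => hB k _)
    simpa using this
  have mcs : ∀ k : ℕ, Measurable[natFiltration S k]
      fun w : CadlagPath S => ∫ w', Φ k (w.1 k, w'.1 1) ∂(P (w.1 k)) := fun k =>
    (mc k).comp (CadlagPath.measurable_eval_canonicalFiltration le_rfl)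
  refine ⟨fun k => ?_, fun k w => ?_, fun k => ?_⟩
  · refine Measurable.sub ?_ ((mcs k).mono ((natFiltration S).mono k.le_succ) le_rfl)
    refine (hΦ k).comp (Measurable.prodMk ?_ ?_)
    · exact CadlagPath.measurable_eval_canonicalFiltration (by push_cast; exact le_self_add)
    · exact CadlagPath.measurable_eval_canonicalFiltration (by push_cast; exact le_rfl)
  · refine (abs_sub _ _).trans ?_
    have := hB k (w.1 k, w.1 (k + 1))
    have := hcB k (w.1 k)
    linarith
  · have iΦ : Integrable (fun w : CadlagPath S => Φ k (w.1 k, w.1 (k + 1))) (P x) :=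
      Integrable.of_bound ((hΦ k).comp ((ev _).prodMk (ev _))).aestronglyMeasurable (B k)
        (.of_forall fun w => hB k _)
    have ic : Integrable (fun w : CadlagPath S => ∫ w', Φ k (w.1 k, w'.1 1) ∂(P (w.1 k))) (P x) :=
      Integrable.of_bound ((mc k).comp (ev _)).aestronglyMeasurable (B k)
        (.of_forall fun w => hcB k _)
    have h1 := condExp_sub iΦ ic (natFiltration S k)
    have h2 := hP.condExp_pair x k 1 (hΦ k) (hB k)
    have h3 := condExp_of_stronglyMeasurable ((natFiltration S).le k) (mcs k).stronglyMeasurable ic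
    refine h1.trans ?_
    rw [h3]
    filter_upwards [h2] with w hw
    rw [Pi.sub_apply]
    exact sub_eq_zero.2 hw

end MarkovDifferences

/-! ### Truncated and corrected steps of the walk -/

section TruncatedStep

variable {d : ℕ} {E : Type*} [MetricSpace E]

/-- Truncation to the interval `[-K, K]`. -/
noncomputable def clamp (K a : ℝ) : ℝ := max (-K) (min a K)

lemma abs_clamp_le {K : ℝ} (hK : 0 ≤ K) (a : ℝ) : |clamp K a| ≤ min |a| K := by
  unfold clamp
  refine le_min ?_ (abs_le.2 ⟨le_max_left _ _, max_le (by linarith) (min_le_right _ _)⟩)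
  rcases le_total a K with h | h
  · rw [min_eq_left h]
    rcases le_total (-K) a with h' | h'
    · rw [max_eq_right h']
    · rw [max_eq_left h', abs_neg, abs_of_nonneg hK, abs_of_nonpos (by linarith)]
      linarith
  · rw [min_eq_right h, max_eq_right (by linarith), abs_of_nonneg hK]
    exact h.trans (le_abs_self a)

lemma abs_sub_clamp_le {K : ℝ} (hK : 0 ≤ K) (a : ℝ) : |a - clamp K a| ≤ max (|a| - K) 0 := by
  unfold clamp
  rcases le_total a K with h | h
  · rw [min_eq_left h]
    rcases le_total (-K) a with h' | h'
    · rw [max_eq_right h', sub_self, abs_zero]; exact le_max_right _ _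
    · rw [max_eq_left h', abs_of_nonpos (by linarith), abs_of_nonpos (by linarith)]
      exact le_max_of_le_left (by linarith)
  · rw [min_eq_right h, max_eq_right (by linarith), abs_of_nonneg (by linarith)]
    exact le_max_of_le_left (by linarith [le_abs_self a])

/-- A truncated increment of the walk, corrected by an increment of a function of the environment
process. -/
noncomputable def truncStep (i : Fin d) (g : Config d E → ℝ) (K : ℝ)
    (q : (Config d E × IntLattice d) × (Config d E × IntLattice d)) : ℝ :=
  clamp K ((q.2.2 i : ℝ) - q.1.2 i)
    + (g (shiftConfig (-q.2.2) q.2.1) - g (shiftConfig (-q.1.2) q.1.1))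

lemma abs_truncStep_le (i : Fin d) {g : Config d E → ℝ} {C : ℝ} (hg : ∀ ζ, |g ζ| ≤ C) {K : ℝ}
    (hK : 0 ≤ K) (q : (Config d E × IntLattice d) × (Config d E × IntLattice d)) :
    |truncStep i g K q| ≤ K + 2 * C := by
  refine (abs_add_le _ _).trans (add_le_add ((abs_clamp_le hK _).trans (min_le_right _ _)) ?_)
  refine (abs_sub _ _).trans ?_
  have := hg (shiftConfig (-q.2.2) q.2.1)
  have := hg (shiftConfig (-q.1.2) q.1.1)
  linarith

lemma measurable_truncStep [CompactSpace E] [MeasurableSpace E] [BorelSpace E] (i : Fin d)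
    {g : Config d E → ℝ} (hg : Measurable g) (K : ℝ) :
    Measurable (truncStep (E := E) i g K) := by
  have m : Measurable fun q : Config d E × IntLattice d => (q.2 i : ℝ) :=
    (measurable_of_countable fun y : IntLattice d => (y i : ℝ)).comp measurable_snd
  have mg : Measurable fun q : Config d E × IntLattice d => g (shiftConfig (-q.2) q.1) :=
    hg.comp measurable_shift_neg
  exact (measurable_const.max (((m.comp measurable_snd).sub (m.comp measurable_fst)).min
    measurable_const)).add ((mg.comp measurable_snd).sub (mg.comp measurable_fst))

/-- Telescoping splits the position into a centred sum, the truncation errors, the compensators c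
and a boundary term; with c_k the conditional means the first sum is a martingale, and the boundary
term is bounded because the corrector is. -/
lemma position_eq (i : Fin d) (g : Config d E → ℝ) (K c : ℕ → ℝ)
    (w : CadlagPath (Config d E × IntLattice d)) (n : ℕ) :
    ((w.1 n).2 i : ℝ) = ∑ k ∈ Finset.range n, (truncStep i g (K k) (w.1 k, w.1 (k + 1)) - c k)
      + ∑ k ∈ Finset.range n, ((((w.1 (k + 1)).2 i : ℝ) - (w.1 k).2 i)
        - clamp (K k) (((w.1 (k + 1)).2 i : ℝ) - (w.1 k).2 i))
      + ∑ k ∈ Finset.range n, c k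
      + (((w.1 0).2 i : ℝ) - (g (shiftConfig (-(w.1 n).2) (w.1 n).1)
        - g (shiftConfig (-(w.1 0).2) (w.1 0).1))) := by
  induction n with
  | zero => simp
  | succ n ih =>
    simp only [Finset.sum_range_succ, truncStep, Nat.cast_succ] at ih ⊢
    linarith

end TruncatedStep

/-! ### Moments of single steps -/

section Steps

variable {d : ℕ} {E : Type*} [MetricSpace E] [CompactSpace E] [MeasurableSpace E] [BorelSpace E]
  {PE : Kernel (Config d E) (CadlagPath (Config d E))} {β : Config d E → IntLattice d → ℝ≥0∞}
  {lam : IntLattice d → ℝ≥0∞} {Λ : ℝ}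
  {P : Kernel (Config d E × IntLattice d) (CadlagPath (Config d E × IntLattice d))}

lemma measurable_step (b s : ℝ≥0) {R : Type*} [MeasurableSpace R] (φ : IntLattice d → R) :
    Measurable fun w : CadlagPath (Config d E × IntLattice d) => φ ((w.1 s).2 - (w.1 b).2) :=
  (measurable_of_countable fun q : IntLattice d × IntLattice d => φ (q.1 - q.2)).comp
    ((measurable_snd.comp (CadlagPath.measurable_eval _)).prodMk
      (measurable_snd.comp (CadlagPath.measurable_eval _)))

lemma IsMarkovProcess.lintegral_step (hPm : IsMarkovProcess P) (p : Config d E × IntLattice d)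
    (b h : ℝ≥0) (φ : IntLattice d → ℝ≥0∞) {c : ℝ≥0∞}
    (hφ : ∀ q : Config d E × IntLattice d, evol P h (fun q' => φ (q'.2 - q.2)) q ≤ c) :
    ∫⁻ w, φ ((w.1 (b + h)).2 - (w.1 b).2) ∂(P p) ≤ c := by
  have : IsMarkovKernel P := ⟨hPm.prob⟩
  have m : Measurable fun q : (Config d E × IntLattice d) × (Config d E × IntLattice d) =>
      φ (q.2.2 - q.1.2) :=
    (measurable_of_countable fun q : IntLattice d × IntLattice d => φ (q.1 - q.2)).comp
      ((measurable_snd.comp measurable_snd).prodMk (measurable_snd.comp measurable_fst))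
  have := hPm.lintegral_mul_eval p b h (m := fun _ => 1) measurable_const m
  simp only [one_mul] at this
  rw [this]
  calc _ ≤ ∫⁻ _, c ∂(P p) := lintegral_mono fun w => by simpa [evol] using hφ (w.1 b)
    _ = c := by simp

theorem SolvesForward.lintegral_enorm_step_le [IsMarkovKernel PE] [IsMarkovKernel P]
    (hβ : IsUniformizedRate β lam Λ) (hP : SolvesForward PE β Λ (evol P)) (hPm : IsMarkovProcess P)
    (p : Config d E × IntLattice d) (b h : ℝ≥0) :
    ∫⁻ w, ‖(w.1 (b + h)).2 - (w.1 b).2‖ₑ ∂(P p)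
      ≤ ENNReal.ofReal ((∑' z, ‖z‖ₑ * lam z).toReal * h) :=
  hPm.lintegral_step p b h (fun y => ‖y‖ₑ) fun q => hP.evol_enorm_sub_le hβ h.2 q

theorem SolvesForward.lintegral_sq_step_le [IsMarkovKernel PE] [IsMarkovKernel P]
    (hβ : IsUniformizedRate β lam Λ) (hP : SolvesForward PE β Λ (evol P)) (hPm : IsMarkovProcess P)
    (p : Config d E × IntLattice d) (b : ℝ≥0) {K : ℝ} (hK : 0 < K) :
    ∫⁻ w, ENNReal.ofReal ((min ‖(w.1 (b + 1)).2 - (w.1 b).2‖ K) ^ 2) ∂(P p)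
      ≤ ENNReal.ofReal (K ^ 2) * moveBound lam K := by
  refine hPm.lintegral_step p b 1 (fun y => ENNReal.ofReal ((min ‖y‖ K) ^ 2)) fun q => ?_
  have := hP.evol_sq_le hβ zero_le_one hK le_rfl q.2 q
  simp only [add_zero, sub_self, norm_zero, min_eq_left hK.le, zero_add, mul_one,
    ENNReal.ofReal_one] at this
  rw [NNReal.coe_one]
  refine this.trans (le_of_eq ?_)
  rw [moveBound, mul_add, ← ENNReal.ofReal_mul (by positivity), div_pow,
    mul_div_cancel₀ _ (by positivity)]

lemma excessBound_le (lam : IntLattice d → ℝ≥0∞) (l : ℕ) : excessBound lam l ≤ excessBound lam 0 :=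
  ENNReal.tsum_comp_le_tsum_of_injective (add_left_injective l)
    fun j : ℕ => moveBound lam ((j + 0 : ℕ) + 1)

lemma IsUniformizedRate.excessBound_ne_top (hβ : IsUniformizedRate β lam Λ) (l : ℕ) :
    excessBound lam l ≠ ∞ := by
  have := tsum_moveBound_ne_top hβ.moment one_pos
  simp only [one_mul] at this
  exact ne_top_of_le_ne_top this (excessBound_le lam l)

/-- The conditional mean of a truncated step. -/
theorem SolvesForward.abs_integral_truncStep_sub_le [IsMarkovKernel PE] [IsMarkovKernel P]
    (hβ : IsUniformizedRate β lam Λ) (hP : SolvesForward PE β Λ (evol P)) (hPm : IsMarkovProcess P)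
    {i : Fin d} {g : Config d E → ℝ} {C v ε : ℝ} (hg : Measurable g) (hgC : ∀ ζ, |g ζ| ≤ C)
    (hc : ∀ p : Config d E × IntLattice d,
        |∫ w, (((w.1 1).2 i : ℝ) - p.2 i + (g (shiftConfig (-(w.1 1).2) (w.1 1).1)
          - g (shiftConfig (-p.2) p.1))) ∂(P p) - v| ≤ ε)
    (l : ℕ) (p : Config d E × IntLattice d) :
    |∫ w, truncStep i g (l + 1) (p, w.1 1) ∂(P p) - v| ≤ ε + (excessBound lam l).toReal := by
  have hl : (0 : ℝ) ≤ l + 1 := by positivity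
  have ev := CadlagPath.measurable_eval (S := Config d E × IntLattice d) 1
  have i1 : Integrable (fun w : CadlagPath (Config d E × IntLattice d) =>
      truncStep i g (l + 1) (p, w.1 1)) (P p) :=
    Integrable.of_bound ((measurable_truncStep i hg _).comp
      (measurable_const.prodMk ev)).aestronglyMeasurable _
      (.of_forall fun w => abs_truncStep_le i hgC hl _)
  have i2 : Integrable (fun w : CadlagPath (Config d E × IntLattice d) =>
      ((w.1 1).2 i : ℝ) - p.2 i + (g (shiftConfig (-(w.1 1).2) (w.1 1).1)
          - g (shiftConfig (-p.2) p.1))) (P p) := by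
    refine ((hP.integrable_position hβ 1 p i).sub (integrable_const _)).add
      (Integrable.sub ?_ (integrable_const _))
    exact Integrable.of_bound ((hg.comp measurable_shift_neg).comp ev).aestronglyMeasurable C
      (.of_forall fun w => hgC _)
  have h1 : |∫ w, truncStep i g (l + 1) (p, w.1 1) ∂(P p)
      - ∫ w, (((w.1 1).2 i : ℝ) - p.2 i + (g (shiftConfig (-(w.1 1).2) (w.1 1).1)
          - g (shiftConfig (-p.2) p.1))) ∂(P p)| ≤ (excessBound lam l).toReal := by
    rw [← integral_sub i1 i2, ← Real.norm_eq_abs]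
    refine (norm_integral_le_lintegral_norm _).trans (ENNReal.toReal_mono
      (hβ.excessBound_ne_top l) (le_trans (lintegral_mono_ae ?_)
        (hP.lintegral_excess_le hβ hPm p 0 l)))
    filter_upwards [hPm.start p] with w hw
    rw [hw, zero_add]
    refine (ENNReal.ofReal_le_ofReal
      (q := max (‖(w.1 1).2 - p.2‖ - (l + 1)) 0) ?_).trans_eq (by simp)
    rw [Real.norm_eq_abs, abs_sub_comm, truncStep, add_sub_add_right_eq_sub]
    refine (abs_sub_clamp_le hl _).trans (max_le_max_right _ (sub_le_sub_right ?_ _))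
    have := abs_apply_le_norm ((w.1 1).2 - p.2) i
    rw [Pi.sub_apply] at this
    push_cast at this
    exact this
  have := hc p
  calc _ ≤ _ + _ := abs_sub_le _ (∫ w, (((w.1 1).2 i : ℝ) - p.2 i
          + (g (shiftConfig (-(w.1 1).2) (w.1 1).1) - g (shiftConfig (-p.2) p.1))) ∂(P p)) _
    _ ≤ _ := by linarith

end Steps

/-! ### Coordinatewise law of large numbers, almost surely and in L¹ -/

section LawOfLargeNumbers

variable {d : ℕ} {E : Type*} [MetricSpace E] [CompactSpace E] [MeasurableSpace E] [BorelSpace E]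
  {PE : Kernel (Config d E) (CadlagPath (Config d E))} {β : Config d E → IntLattice d → ℝ≥0∞}
  {lam : IntLattice d → ℝ≥0∞} {Λ : ℝ}
  {P : Kernel (Config d E × IntLattice d) (CadlagPath (Config d E × IntLattice d))}
  {i : Fin d} {v : ℝ}

/-- Up to the increments of a bounded function of the environment process and an error `ε`, the
mean displacement of the walk in a unit of time is `v`. -/
def HasCorrector (P : Kernel (Config d E × IntLattice d) (CadlagPath (Config d E × IntLattice d)))
    (i : Fin d) (v ε : ℝ) : Prop :=
  ∃ (g : Config d E → ℝ) (C : ℝ), Measurable g ∧ (∀ ζ, |g ζ| ≤ C) ∧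
    ∀ p : Config d E × IntLattice d,
      |∫ w, (((w.1 1).2 i : ℝ) - p.2 i + (g (shiftConfig (-(w.1 1).2) (w.1 1).1)
        - g (shiftConfig (-p.2) p.1))) ∂(P p) - v| ≤ ε

lemma abs_step_apply_le (w : CadlagPath (Config d E × IntLattice d)) (s t : ℝ≥0) (i : Fin d) :
    |((w.1 t).2 i : ℝ) - (w.1 s).2 i| ≤ ‖(w.1 t).2 - (w.1 s).2‖ := by
  have := abs_apply_le_norm ((w.1 t).2 - (w.1 s).2) i
  rw [Pi.sub_apply] at this
  push_cast at this
  exact this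

/-- Borel–Cantelli with the summable maximal bounds. It serves twice: truncation at level n + 1 is
eventually inactive, and the motion between integer times is negligible. -/
lemma SolvesForward.ae_eventually_move_lt [IsMarkovKernel PE] [IsMarkovKernel P]
    (hβ : IsUniformizedRate β lam Λ) (hP : SolvesForward PE β Λ (evol P)) (hPm : IsMarkovProcess P)
    (p : Config d E × IntLattice d) {ε : ℝ} (hε : 0 < ε) :
    ∀ᵐ w ∂(P p), ∀ᶠ n : ℕ in atTop, ∀ t : ℝ≥0, (n : ℝ≥0) ≤ t → t ≤ n + 1 →
      ‖(w.1 t).2 - (w.1 n).2‖ < ε * (n + 1) := by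
  have h := ae_eventually_notMem (μ := P p)
    (s := fun n : ℕ => {w : CadlagPath (Config d E × IntLattice d) |
      ∃ t : ℝ≥0, n ≤ t ∧ t ≤ n + 1 ∧ ε * (n + 1) ≤ ‖(w.1 t).2 - (w.1 n).2‖})
    (ne_top_of_le_ne_top (tsum_moveBound_ne_top hβ.moment hε) (ENNReal.tsum_le_tsum fun n =>
      hP.measure_exists_le hβ hPm p n (by positivity)))
  filter_upwards [h] with w hw
  filter_upwards [hw] with n hn t h1 h2
  by_contra h3
  exact hn ⟨t, h1, h2, not_lt.1 h3⟩

lemma exists_forall_sum_le_sq {u : ℕ → ℝ} (hu : Summable u) (h0 : ∀ k, 0 ≤ u k) :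
    ∃ R : ℝ, 0 < R ∧ ∀ n, ∑ k ∈ Finset.range n, u k ≤ R ^ 2 := by
  have h1 : 0 ≤ ∑' k, u k := tsum_nonneg h0
  refine ⟨∑' k, u k + 1, by positivity, fun n => ?_⟩
  have := hu.sum_le_tsum (Finset.range n) fun k _ => h0 k
  nlinarith

/-- In the decomposition `position_eq` the martingale part is o(n) by the strong law, the truncation
errors vanish for late steps, the boundary term is bounded, and the conditional means are within ε +
τ_k of v, where τ_k → 0. -/
theorem SolvesForward.ae_eventually_abs_le [IsMarkovKernel PE] [IsMarkovKernel P]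
    (hβ : IsUniformizedRate β lam Λ) (hP : SolvesForward PE β Λ (evol P)) (hPm : IsMarkovProcess P)
    {ε : ℝ} (hε : 0 < ε) (hv : HasCorrector P i v ε) (p : Config d E × IntLattice d) :
    ∀ᵐ w ∂(P p), ∀ᶠ n : ℕ in atTop, |(n : ℝ)⁻¹ * (w.1 n).2 i - v| ≤ 2 * ε := by
  obtain ⟨g, C, hg, hgC, hc⟩ := hv
  have ev := fun r => CadlagPath.measurable_eval (S := Config d E × IntLattice d) r
  have hC : 0 ≤ C := (abs_nonneg _).trans (hgC (shiftConfig (-p.2) p.1))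
  -- The level grows with k: slowly enough that the variances divided by (k + 1)² are summable, as
  -- they are controlled by `moveBound` at k + 1, and fast enough that almost surely only finitely
  -- many steps are cut.
  let K : ℕ → ℝ := fun k => k + 1
  have hK : ∀ k, 0 < K k := fun k => by positivity
  let τ : ℕ → ℝ := fun k => (excessBound lam k).toReal
  let c : ℕ → Config d E × IntLattice d → ℝ := fun k q =>
    ∫ w', truncStep i g (K k) (q, w'.1 1) ∂(P q)
  have hcv : ∀ k q, |c k q - v| ≤ ε + τ k :=
    fun k q => hP.abs_integral_truncStep_sub_le hβ hPm hg hgC hc k q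
  set V := |v| + ε + τ 0 with hV
  have hcV : ∀ k q, |c k q| ≤ V := fun k q => by
    have h1 := hcv k q
    have h2 : τ k ≤ τ 0 := ENNReal.toReal_mono (hβ.excessBound_ne_top 0) (excessBound_le lam k)
    have := abs_sub_abs_le_abs_sub (c k q) v
    linarith
  have hD := hPm.isMartingaleDiff p (Φ := fun k => truncStep i g (K k))
    (fun k => measurable_truncStep i hg _) (B := fun k => K k + 2 * C)
    fun k q => abs_truncStep_le i hgC (hK k).le q
  have hmt : ∀ k : ℕ, moveBound lam (K k) ≠ ∞ := by
    have := tsum_moveBound_ne_top hβ.moment one_pos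
    simp only [one_mul] at this
    exact fun k => ENNReal.ne_top_of_tsum_ne_top this k
  have hmsum : Summable fun k : ℕ => (moveBound lam (K k)).toReal := by
    have := tsum_moveBound_ne_top hβ.moment one_pos
    simp only [one_mul] at this
    exact ENNReal.summable_toReal this
  -- second moments of the truncated steps
  have hsq : ∀ k : ℕ, ∫ w, (truncStep i g (K k) (w.1 k, w.1 (k + 1)) - c k (w.1 k)) ^ 2 ∂(P p)
      ≤ 3 * (K k ^ 2 * (moveBound lam (K k)).toReal) + 3 * ((2 * C) ^ 2 + V ^ 2) := by
    intro k
    have mm : Measurable fun w : CadlagPath (Config d E × IntLattice d) =>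
        (min ‖(w.1 (k + 1)).2 - (w.1 k).2‖ (K k)) ^ 2 :=
      measurable_step k (k + 1) fun y => (min ‖y‖ (K k)) ^ 2
    have im : Integrable (fun w : CadlagPath (Config d E × IntLattice d) =>
        (min ‖(w.1 (k + 1)).2 - (w.1 k).2‖ (K k)) ^ 2) (P p) := by
      refine Integrable.of_bound mm.aestronglyMeasurable (K k ^ 2) (.of_forall fun w => ?_)
      rw [Real.norm_of_nonneg (sq_nonneg _)]
      exact pow_le_pow_left₀ (le_min (norm_nonneg _) (hK k).le) (min_le_right _ _) 2
    have h1 : ∫ w, (min ‖(w.1 (k + 1)).2 - (w.1 k).2‖ (K k)) ^ 2 ∂(P p)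
        ≤ K k ^ 2 * (moveBound lam (K k)).toReal := by
      rw [integral_eq_lintegral_of_nonneg_ae (.of_forall fun w => sq_nonneg _)
        mm.aestronglyMeasurable]
      refine (ENNReal.toReal_mono (ENNReal.mul_ne_top ENNReal.ofReal_ne_top (hmt k))
        (hP.lintegral_sq_step_le hβ hPm p k (hK k))).trans_eq ?_
      rw [ENNReal.toReal_mul, ENNReal.toReal_ofReal (sq_nonneg _)]
    have h2 : ∀ w : CadlagPath (Config d E × IntLattice d),
        (truncStep i g (K k) (w.1 k, w.1 (k + 1)) - c k (w.1 k)) ^ 2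
        ≤ 3 * (min ‖(w.1 (k + 1)).2 - (w.1 k).2‖ (K k)) ^ 2 + 3 * ((2 * C) ^ 2 + V ^ 2) := by
      intro w
      have a1 : |clamp (K k) (((w.1 (k + 1)).2 i : ℝ) - (w.1 k).2 i)|
          ≤ min ‖(w.1 (k + 1)).2 - (w.1 k).2‖ (K k) :=
        (abs_clamp_le (hK k).le _).trans (min_le_min_right _ (abs_step_apply_le w _ _ i))
      have a2 : |g (shiftConfig (-(w.1 (k + 1)).2) (w.1 (k + 1)).1)
          - g (shiftConfig (-(w.1 k).2) (w.1 k).1)| ≤ 2 * C := by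
        refine (abs_sub _ _).trans ?_
        have := hgC (shiftConfig (-(w.1 (k + 1)).2) (w.1 (k + 1)).1)
        have := hgC (shiftConfig (-(w.1 k).2) (w.1 k).1)
        linarith
      have b1 := pow_le_pow_left₀ (abs_nonneg _) a1 2
      have b2 := pow_le_pow_left₀ (abs_nonneg _) a2 2
      have b3 := pow_le_pow_left₀ (abs_nonneg _) (hcV k (w.1 k)) 2
      rw [sq_abs] at b1 b2 b3
      rw [truncStep]
      set x := clamp (K k) (((w.1 (k + 1)).2 i : ℝ) - (w.1 k).2 i)
      set y := g (shiftConfig (-(w.1 (k + 1)).2) (w.1 (k + 1)).1)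
          - g (shiftConfig (-(w.1 k).2) (w.1 k).1)
      set z := c k (w.1 k)
      -- This is (x + y - z)² ≤ 3(x² + y² + z²).
      nlinarith [sq_nonneg (x - y), sq_nonneg (x + z), sq_nonneg (y + z)]
    refine (integral_mono (hD.integrable_sq k) ((im.const_mul 3).add (integrable_const _)) h2).trans ?_
    have e : ∫ w, (3 * (min ‖(w.1 (k + 1)).2 - (w.1 k).2‖ (K k)) ^ 2
          + 3 * ((2 * C) ^ 2 + V ^ 2)) ∂(P p)
        = 3 * ∫ w, (min ‖(w.1 (k + 1)).2 - (w.1 k).2‖ (K k)) ^ 2 ∂(P p)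
          + 3 * ((2 * C) ^ 2 + V ^ 2) := by
      rw [integral_add (im.const_mul 3) (integrable_const _), integral_const_mul]; simp
    refine e.le.trans ?_
    gcongr
  have hinv : Summable fun k : ℕ => (((k : ℝ) + 1)⁻¹) ^ 2 := by
    have := (summable_nat_add_iff 1).2 (Real.summable_one_div_nat_pow.2 (by norm_num : 1 < 2))
    simpa using this
  obtain ⟨R, hR, hRn⟩ := exists_forall_sum_le_sq
    ((hmsum.mul_left 3).add (hinv.mul_right (3 * ((2 * C) ^ 2 + V ^ 2))))
    fun k => by positivity
  have hslln := hD.ae_tendsto_inv_mul_sum hR fun n => by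
    refine le_trans (Finset.sum_le_sum fun k _ => ?_) (hRn n)
    refine (mul_le_mul_of_nonneg_left (hsq k) (by positivity)).trans (le_of_eq ?_)
    have : (k : ℝ) + 1 ≠ 0 := by positivity
    simp only [K]
    field_simp
  filter_upwards [hslln, hP.ae_eventually_move_lt hβ hPm p one_pos] with w hw hmove
  -- the truncation is eventually not felt
  have hclamp : Tendsto (fun k : ℕ => (((w.1 (k + 1)).2 i : ℝ) - (w.1 k).2 i)
      - clamp (K k) (((w.1 (k + 1)).2 i : ℝ) - (w.1 k).2 i)) atTop (𝓝 0) := by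
    refine tendsto_const_nhds.congr' ?_
    filter_upwards [hmove] with k hk
    have h1 := hk (k + 1) le_self_add le_rfl
    have h2 := abs_step_apply_le w k (k + 1) i
    have h3 := abs_sub_clamp_le (hK k).le (((w.1 (k + 1)).2 i : ℝ) - (w.1 k).2 i)
    rw [max_eq_right (by simp only [K]; linarith)] at h3
    exact (abs_nonpos_iff.1 h3).symm
  have hbdd : Tendsto (fun n : ℕ => (n : ℝ)⁻¹ * (((w.1 0).2 i : ℝ)
      - (g (shiftConfig (-(w.1 n).2) (w.1 n).1) - g (shiftConfig (-(w.1 0).2) (w.1 0).1))))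
      atTop (𝓝 0) := by
    refine squeeze_zero_norm (a := fun n : ℕ => (n : ℝ)⁻¹ * (|((w.1 0).2 i : ℝ)| + 2 * C))
      (fun n => ?_) ?_
    · rw [norm_mul, Real.norm_of_nonneg (by positivity)]
      refine mul_le_mul_of_nonneg_left ((abs_sub _ _).trans (add_le_add le_rfl
        ((abs_sub _ _).trans ?_))) (by positivity)
      have := hgC (shiftConfig (-(w.1 n).2) (w.1 n).1)
      have := hgC (shiftConfig (-(w.1 0).2) (w.1 0).1)
      linarith
    · simpa using (tendsto_natCast_atTop_atTop (R := ℝ)).inv_tendsto_atTop.mul_const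
        (|((w.1 0).2 i : ℝ)| + 2 * C)
  have hτ : Tendsto (fun k => ε + τ k) atTop (𝓝 ε) := by
    have := (ENNReal.tendsto_toReal ENNReal.zero_ne_top).comp (tendsto_excessBound hβ.moment)
    simpa using this.const_add ε
  have hlim := ((hw.add hclamp.cesaro).add hbdd).abs.add hτ.cesaro
  rw [add_zero, add_zero, abs_zero, zero_add] at hlim
  filter_upwards [hlim.eventually_lt_const (show ε < 2 * ε by linarith), eventually_ge_atTop 1]
    with n hn hn1
  have hn0 : (0 : ℝ) < n := by exact_mod_cast hn1
  refine le_trans ?_ hn.le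
  rw [position_eq i g K (fun k => c k (w.1 k)) w n, ← mul_add, ← mul_add]
  have hmean : |(n : ℝ)⁻¹ * ∑ k ∈ Finset.range n, c k (w.1 k) - v|
      ≤ (n : ℝ)⁻¹ * ∑ k ∈ Finset.range n, (ε + τ k) := by
    have e : (n : ℝ)⁻¹ * ∑ k ∈ Finset.range n, c k (w.1 k) - v
        = (n : ℝ)⁻¹ * ∑ k ∈ Finset.range n, (c k (w.1 k) - v) := by
      rw [Finset.sum_sub_distrib, Finset.sum_const, Finset.card_range, nsmul_eq_mul, mul_sub,
        inv_mul_cancel_left₀ hn0.ne']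
    rw [e, abs_mul, abs_of_nonneg (inv_nonneg.2 hn0.le)]
    refine mul_le_mul_of_nonneg_left ?_ (inv_nonneg.2 hn0.le)
    exact (Finset.abs_sum_le_sum_abs _ _).trans (Finset.sum_le_sum fun k _ => hcv k _)
  refine le_trans (le_of_eq ?_) ((abs_add_le _ _).trans (add_le_add le_rfl hmean))
  congr 1
  ring

/-- Integer times are handled by letting ε run through 1/(m + 1), with one null set for all m; other
times by comparison with their integer part, over which the walk moves by at most ε(n + 1). -/
theorem SolvesForward.ae_tendsto_position [IsMarkovKernel PE] [IsMarkovKernel P]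
    (hβ : IsUniformizedRate β lam Λ) (hP : SolvesForward PE β Λ (evol P)) (hPm : IsMarkovProcess P)
    (hv : ∀ ε : ℝ, 0 < ε → HasCorrector P i v ε) (p : Config d E × IntLattice d) :
    ∀ᵐ w ∂(P p), Tendsto (fun t : ℝ≥0 => (t : ℝ)⁻¹ * (w.1 t).2 i) atTop (𝓝 v) := by
  have h1 : ∀ᵐ w ∂(P p), ∀ m : ℕ, ∀ᶠ n : ℕ in atTop,
      |(n : ℝ)⁻¹ * (w.1 n).2 i - v| ≤ 2 * (1 / ((m : ℝ) + 1)) :=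
    ae_all_iff.2 fun m => hP.ae_eventually_abs_le hβ hPm (by positivity) (hv _ (by positivity)) p
  have h2 : ∀ᵐ w ∂(P p), ∀ m : ℕ, ∀ᶠ n : ℕ in atTop, ∀ t : ℝ≥0, (n : ℝ≥0) ≤ t → t ≤ n + 1 →
      ‖(w.1 t).2 - (w.1 n).2‖ < 1 / ((m : ℝ) + 1) * (n + 1) :=
    ae_all_iff.2 fun m => hP.ae_eventually_move_lt hβ hPm p (by positivity)
  filter_upwards [h1, h2] with w hw1 hw2
  rw [Metric.tendsto_atTop']
  intro δ hδ
  -- The error at time t will be at most 4εt + |v|; with ε < δ/8 and t ≥ 4|v|/δ the two parts are at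
  -- most δt/2 and δt/4.
  obtain ⟨m, hm⟩ := exists_nat_one_div_lt (show 0 < δ / 8 by positivity)
  set ε : ℝ := 1 / ((m : ℝ) + 1) with hε
  have hε0 : 0 < ε := by positivity
  obtain ⟨N, hN⟩ := eventually_atTop.1 ((hw1 m).and ((hw2 m).and (eventually_ge_atTop 1)))
  refine ⟨max (N + 1 : ℕ) ⟨4 * |v| / δ, by positivity⟩, fun t ht => ?_⟩
  have htN : ((N + 1 : ℕ) : ℝ≥0) ≤ t := (le_max_left _ _).trans ht.le
  have htv : 4 * |v| / δ ≤ t := (le_max_right _ _).trans ht.le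
  set n := ⌊t⌋₊ with hn
  have hnN : N ≤ n := (Nat.le_succ N).trans (Nat.le_floor htN)
  obtain ⟨a1, a2, a3⟩ := hN n hnN
  have hnt : (n : ℝ≥0) ≤ t := Nat.floor_le zero_le
  have htn : t ≤ n + 1 := (Nat.lt_floor_add_one t).le
  have a4 := (abs_step_apply_le w n t i).trans (a2 t hnt htn).le
  have hn1 : (1 : ℝ) ≤ n := by exact_mod_cast a3
  have hnt' : (n : ℝ) ≤ t := by exact_mod_cast hnt
  have htn' : (t : ℝ) ≤ n + 1 := by exact_mod_cast htn
  have ht0 : (0 : ℝ) < t := by linarith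
  have a5 : |((w.1 n).2 i : ℝ) - n * v| ≤ 2 * ε * n := by
    have : ((w.1 n).2 i : ℝ) - n * v = n * ((n : ℝ)⁻¹ * (w.1 n).2 i - v) := by
      rw [mul_sub, mul_inv_cancel_left₀ (by positivity)]
    rw [this, abs_mul, abs_of_nonneg (by positivity), mul_comm]
    exact mul_le_mul_of_nonneg_right a1 (by positivity)
  have a6 : |(n - t) * v| ≤ |v| := by
    rw [abs_mul]
    refine mul_le_of_le_one_left (abs_nonneg v) (abs_le.2 ⟨by linarith, by linarith⟩)
  have a7 : |((w.1 t).2 i : ℝ) - t * v| ≤ 4 * ε * t + |v| := by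
    have e : ((w.1 t).2 i : ℝ) - t * v = (((w.1 t).2 i : ℝ) - (w.1 n).2 i)
        + ((((w.1 n).2 i : ℝ) - n * v) + (n - t) * v) := by ring
    rw [e]
    refine (abs_add_le _ _).trans ((add_le_add a4 ((abs_add_le _ _).trans (add_le_add a5 a6))).trans ?_)
    nlinarith
  have a8 : 4 * |v| ≤ t * δ := (div_le_iff₀ hδ).1 htv
  rw [Real.dist_eq, show (t : ℝ)⁻¹ * (w.1 t).2 i - v = (t : ℝ)⁻¹ * ((w.1 t).2 i - t * v) by
    rw [mul_sub, inv_mul_cancel_left₀ ht0.ne'], abs_mul, abs_of_pos (inv_pos.2 ht0),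
    inv_mul_lt_iff₀ ht0]
  nlinarith

/-- Here one truncation level serves all steps: the martingale differences are bounded by a constant
B and their sum is at most √n B in L¹, while the mean excess over the level is at most ε per step.
None of the bounds involves η, so N is uniform in η. -/
theorem SolvesForward.exists_forall_lintegral_abs_le [IsMarkovKernel PE] [IsMarkovKernel P]
    (hβ : IsUniformizedRate β lam Λ) (hP : SolvesForward PE β Λ (evol P)) (hPm : IsMarkovProcess P)
    (hv : ∀ ε : ℝ, 0 < ε → HasCorrector P i v ε) (x : IntLattice d) {δ : ℝ} (hδ : 0 < δ) :
    ∃ N : ℕ, ∀ n, N ≤ n → ∀ η, ∫⁻ w, ENNReal.ofReal |((w.1 n).2 i : ℝ) - n * v| ∂(P (η, x))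
      ≤ ENNReal.ofReal (δ * n) := by
  -- Five errors of size εn occur: one each from the martingale, the truncation and the boundary,
  -- and two from the conditional means. The choice δ/8 leaves some slack.
  set ε := δ / 8 with hε
  have hε0 : 0 < ε := by positivity
  obtain ⟨g, C, hg, hgC, hc⟩ := hv ε hε0
  obtain ⟨l, hl⟩ : ∃ l, (excessBound lam l) ≤ ENNReal.ofReal ε :=
    ((tendsto_excessBound hβ.moment).eventually_le_const (ENNReal.ofReal_pos.2 hε0)).exists
  have hlt : (excessBound lam l).toReal ≤ ε := ENNReal.toReal_le_of_le_ofReal hε0.le hl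
  set K : ℝ := l + 1 with hKd
  have hK : 0 < K := by positivity
  set B := 2 * (K + 2 * |C|) with hB
  have hB0 : 0 < B := by positivity
  have hgC' : ∀ ζ, |g ζ| ≤ |C| := fun ζ => (hgC ζ).trans (le_abs_self C)
  set b := |(x i : ℝ)| + 2 * |C| with hb
  -- N is so large that the boundary term b is at most εn and that B ≤ ε√n, which turns √n B into at
  -- most εn.
  obtain ⟨N, hN⟩ := eventually_atTop.1 (((tendsto_natCast_atTop_atTop (R := ℝ)).eventually_ge_atTop
    (b / ε)).and ((((tendsto_natCast_atTop_atTop (R := ℝ)).eventually_ge_atTop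
    ((B / ε) ^ 2))).and (eventually_ge_atTop 1)))
  refine ⟨N, fun n hn η => ?_⟩
  obtain ⟨n1, n2, n3⟩ := hN n hn
  have hn0 : (0 : ℝ) < n := by exact_mod_cast n3
  set p : Config d E × IntLattice d := (η, x)
  let c : Config d E × IntLattice d → ℝ := fun q => ∫ w', truncStep i g K (q, w'.1 1) ∂(P q)
  have hcv : ∀ q, |c q - v| ≤ 2 * ε := fun q =>
    (hP.abs_integral_truncStep_sub_le hβ hPm hg hgC hc l q).trans (by linarith)
  have hD := hPm.isMartingaleDiff p (Φ := fun _ => truncStep i g K)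
    (fun k => measurable_truncStep i hg _) (B := fun k => K + 2 * |C|)
    fun k q => abs_truncStep_le i hgC' hK.le q
  have hL1 := hD.integral_abs_sum_le hB0 (fun _ => le_rfl) n3
  have iD := hD.integrable_sum n
  set D : CadlagPath (Config d E × IntLattice d) → ℝ := fun w => ∑ k ∈ Finset.range n,
    (truncStep i g K (w.1 k, w.1 (k + 1)) - c (w.1 k)) with hDd
  have hL1' : ∫⁻ w, ENNReal.ofReal |D w| ∂(P p) ≤ ENNReal.ofReal (√n * B) := by
    rw [← ofReal_integral_eq_lintegral_ofReal iD.abs (.of_forall fun w => abs_nonneg _)]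
    exact ENNReal.ofReal_le_ofReal hL1
  have mex : ∀ k : ℕ, Measurable fun w : CadlagPath (Config d E × IntLattice d) =>
      ENNReal.ofReal (‖(w.1 (k + 1)).2 - (w.1 k).2‖ - (l + 1)) := fun k =>
    measurable_step k (k + 1) fun y => ENNReal.ofReal (‖y‖ - (l + 1))
  have hpt : ∀ᵐ w ∂(P p), ENNReal.ofReal |((w.1 n).2 i : ℝ) - n * v| ≤ ENNReal.ofReal |D w|
      + (∑ k ∈ Finset.range n, ENNReal.ofReal (‖(w.1 (k + 1)).2 - (w.1 k).2‖ - (l + 1))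
        + ENNReal.ofReal (n * (2 * ε) + b)) := by
    filter_upwards [hPm.start p] with w hw
    have e1 : ∑ k ∈ Finset.range n, ENNReal.ofReal (‖(w.1 (k + 1)).2 - (w.1 k).2‖ - (l + 1))
        = ENNReal.ofReal (∑ k ∈ Finset.range n, max (‖(w.1 (k + 1)).2 - (w.1 k).2‖ - (l + 1)) 0) := by
      rw [ENNReal.ofReal_sum_of_nonneg fun k _ => le_max_right _ _]
      simp
    have h0 : 0 ≤ ∑ k ∈ Finset.range n, max (‖(w.1 (k + 1)).2 - (w.1 k).2‖ - (l + 1)) 0 :=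
      Finset.sum_nonneg fun k _ => le_max_right _ _
    rw [e1, ← ENNReal.ofReal_add h0 (by positivity),
      ← ENNReal.ofReal_add (abs_nonneg _) (by positivity)]
    refine ENNReal.ofReal_le_ofReal ?_
    have hpos := position_eq i g (fun _ => K) (fun k => c (w.1 k)) w n
    have h1 : |∑ k ∈ Finset.range n, ((((w.1 (k + 1)).2 i : ℝ) - (w.1 k).2 i)
        - clamp K (((w.1 (k + 1)).2 i : ℝ) - (w.1 k).2 i))|
        ≤ ∑ k ∈ Finset.range n, max (‖(w.1 (k + 1)).2 - (w.1 k).2‖ - (l + 1)) 0 := by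
      refine (Finset.abs_sum_le_sum_abs _ _).trans (Finset.sum_le_sum fun k _ => ?_)
      exact (abs_sub_clamp_le hK.le _).trans
        (max_le_max_right _ (sub_le_sub_right (abs_step_apply_le w _ _ i) _))
    have h2 : |∑ k ∈ Finset.range n, c (w.1 k) - n * v| ≤ n * (2 * ε) := by
      have e : ∑ k ∈ Finset.range n, c (w.1 k) - n * v = ∑ k ∈ Finset.range n, (c (w.1 k) - v) := by
        rw [Finset.sum_sub_distrib, Finset.sum_const, Finset.card_range, nsmul_eq_mul]
      rw [e]
      refine (Finset.abs_sum_le_sum_abs _ _).trans ((Finset.sum_le_sum fun k _ => hcv _).trans_eq ?_)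
      rw [Finset.sum_const, Finset.card_range, nsmul_eq_mul]
    have h3 : |((w.1 0).2 i : ℝ) - (g (shiftConfig (-(w.1 n).2) (w.1 n).1)
        - g (shiftConfig (-(w.1 0).2) (w.1 0).1))| ≤ b := by
      rw [hw]
      refine (abs_sub _ _).trans (add_le_add le_rfl ((abs_sub _ _).trans ?_))
      have := hgC' (shiftConfig (-(w.1 n).2) (w.1 n).1)
      have := hgC' (shiftConfig (-p.2) p.1)
      linarith
    rw [hpos]
    refine le_trans (le_of_eq ?_) ((abs_add_le _ _).trans (add_le_add (le_refl |D w|)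
      ((abs_add_le _ _).trans (add_le_add h1 ((abs_add_le _ _).trans (add_le_add h2 h3))))))
    congr 1
    simp only [hDd]
    ring
  have mD : Measurable fun w => ENNReal.ofReal |D w| :=
    ENNReal.measurable_ofReal.comp (((hD.measurable_sum n).mono ((natFiltration _).le n) le_rfl).abs)
  calc _ ≤ ∫⁻ w, (ENNReal.ofReal |D w|
      + (∑ k ∈ Finset.range n, ENNReal.ofReal (‖(w.1 (k + 1)).2 - (w.1 k).2‖ - (l + 1))
        + ENNReal.ofReal (n * (2 * ε) + b))) ∂(P p) := lintegral_mono_ae hpt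
    _ = ∫⁻ w, ENNReal.ofReal |D w| ∂(P p) + (∑ k ∈ Finset.range n,
          ∫⁻ w, ENNReal.ofReal (‖(w.1 (k + 1)).2 - (w.1 k).2‖ - (l + 1)) ∂(P p)
        + ENNReal.ofReal (n * (2 * ε) + b)) := by
        rw [lintegral_add_left mD, lintegral_add_right _ measurable_const,
          lintegral_finsetSum _ fun k _ => mex k]
        simp
    _ ≤ ENNReal.ofReal (√n * B) + (∑ k ∈ Finset.range n, ENNReal.ofReal ε
        + ENNReal.ofReal (n * (2 * ε) + b)) := by
        refine add_le_add hL1' (add_le_add (Finset.sum_le_sum fun k _ => ?_) le_rfl)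
        exact (hP.lintegral_excess_le hβ hPm p k l).trans hl
    _ = ENNReal.ofReal (√n * B + (n * ε + (n * (2 * ε) + b))) := by
        rw [Finset.sum_const, Finset.card_range, nsmul_eq_mul, ← ENNReal.ofReal_natCast,
          ← ENNReal.ofReal_mul hn0.le, ← ENNReal.ofReal_add (by positivity) (by positivity),
          ← ENNReal.ofReal_add (by positivity) (by positivity)]
    _ ≤ ENNReal.ofReal (δ * n) := by
        refine ENNReal.ofReal_le_ofReal ?_
        have r1 : b ≤ ε * n := by
          have := (div_le_iff₀ hε0).1 n1
          linarith
        have r2 : B / ε ≤ √n := Real.le_sqrt_of_sq_le n2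
        have r3 : B ≤ √n * ε := (div_le_iff₀ hε0).1 r2
        have r4 : √n * B ≤ ε * n := by
          calc √n * B ≤ √n * (√n * ε) := by gcongr
            _ = ε * n := by rw [← mul_assoc, Real.mul_self_sqrt hn0.le]; ring
        have : δ = 8 * ε := by rw [hε]; ring
        rw [this]
        nlinarith

end LawOfLargeNumbers

/-! ### The vector-valued law of large numbers in L¹ -/

section WalkerVector

variable {d : ℕ} {E : Type*} [MetricSpace E] [CompactSpace E] [MeasurableSpace E] [BorelSpace E]
  {PE : Kernel (Config d E) (CadlagPath (Config d E))} {β : Config d E → IntLattice d → ℝ≥0∞}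
  {lam : IntLattice d → ℝ≥0∞} {Λ : ℝ}
  {P : Kernel (Config d E × IntLattice d) (CadlagPath (Config d E × IntLattice d))}

lemma SolvesForward.integrable_walker [IsMarkovKernel PE] [IsMarkovKernel P]
    (hβ : IsUniformizedRate β lam Λ) (hP : SolvesForward PE β Λ (evol P)) (t : ℝ≥0)
    (p : Config d E × IntLattice d) : Integrable (fun w => walker w t) (P p) := by
  refine (hP.integrable_norm_position hβ t p).mono' ?_ (.of_forall fun w => norm_intCast_le _)
  exact ((measurable_of_countable fun y : IntLattice d => (fun i => (y i : ℝ) : Fin d → ℝ)).comp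
    (measurable_snd.comp (CadlagPath.measurable_eval t))).aestronglyMeasurable

lemma enorm_walker_sub_le (v : Fin d → ℝ) (w : CadlagPath (Config d E × IntLattice d))
    {t : ℝ≥0} {n : ℕ} (ht : 0 < t) (hnt : (n : ℝ≥0) ≤ t) (htn : t ≤ n + 1) :
    ‖(t : ℝ)⁻¹ • walker w t - v‖ₑ ≤ ENNReal.ofReal (t : ℝ)⁻¹ *
      (‖(w.1 (n + (t - n))).2 - (w.1 n).2‖ₑ
        + (∑ i, ENNReal.ofReal |((w.1 n).2 i : ℝ) - n * v i| + ENNReal.ofReal ‖v‖)) := by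
  have ht' : (0 : ℝ) < t := ht
  have hnt' : (n : ℝ) ≤ t := by exact_mod_cast hnt
  have htn' : (t : ℝ) ≤ n + 1 := by exact_mod_cast htn
  rw [add_tsub_cancel_of_le hnt, ← ENNReal.ofReal_sum_of_nonneg fun i _ => abs_nonneg _,
    ← ofReal_norm, ← ofReal_norm,
    ← ENNReal.ofReal_add (Finset.sum_nonneg fun i _ => abs_nonneg _) (norm_nonneg _),
    ← ENNReal.ofReal_add (norm_nonneg _) (by positivity),
    ← ENNReal.ofReal_mul (by positivity)]
  refine ENNReal.ofReal_le_ofReal ?_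
  have e : (t : ℝ)⁻¹ • walker w t - v = (t : ℝ)⁻¹ • (walker w t - (t : ℝ) • v) := by
    rw [smul_sub, inv_smul_smul₀ ht'.ne']
  rw [e, norm_smul, Real.norm_of_nonneg (by positivity)]
  refine mul_le_mul_of_nonneg_left ?_ (by positivity)
  refine (pi_norm_le_iff_of_nonneg (by positivity)).2 fun i => ?_
  have h1 := abs_step_apply_le w n t i
  have h2 : |((w.1 n).2 i : ℝ) - n * v i| ≤ ∑ i, |((w.1 n).2 i : ℝ) - n * v i| :=
    Finset.single_le_sum (f := fun i => |((w.1 n).2 i : ℝ) - n * v i|)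
      (fun i _ => abs_nonneg _) (Finset.mem_univ i)
  have h3 : |(n - t) * v i| ≤ ‖v‖ := by
    rw [abs_mul]
    refine (mul_le_of_le_one_left (abs_nonneg _) (abs_le.2 ⟨by linarith, by linarith⟩)).trans ?_
    exact norm_le_pi_norm v i
  have e2 : (walker w t - (t : ℝ) • v) i = (((w.1 t).2 i : ℝ) - (w.1 n).2 i)
      + ((((w.1 n).2 i : ℝ) - n * v i) + (n - t) * v i) := by
    simp only [walker, Pi.sub_apply, Pi.smul_apply, smul_eq_mul]; ring
  rw [e2, Real.norm_eq_abs]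
  exact (abs_add_le _ _).trans (add_le_add h1 ((abs_add_le _ _).trans (add_le_add h2 h3)))

/-- Compare with the integer part of t: the remaining step has mean length at most M, and the sup
norm is bounded by the sum over coordinates, each of them controlled uniformly in η. -/
theorem SolvesForward.tendsto_iSup_lintegral_enorm [IsMarkovKernel PE] [IsMarkovKernel P]
    (hβ : IsUniformizedRate β lam Λ) (hP : SolvesForward PE β Λ (evol P)) (hPm : IsMarkovProcess P)
    {v : Fin d → ℝ} (hv : ∀ i, ∀ ε : ℝ, 0 < ε → HasCorrector P i (v i) ε) (x : IntLattice d) :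
    Tendsto (fun t : ℝ≥0 => ⨆ η : Config d E, ∫⁻ w, ‖(t : ℝ)⁻¹ • walker w t - v‖ₑ ∂(P (η, x)))
      atTop (𝓝 0) := by
  rw [ENNReal.tendsto_nhds_zero]
  intro e he
  obtain ⟨δ, hδ0, hδe⟩ : ∃ δ : ℝ, 0 < δ ∧ ENNReal.ofReal δ ≤ e := by
    rcases eq_or_ne e ∞ with rfl | h
    · exact ⟨1, one_pos, le_top⟩
    · exact ⟨e.toReal, ENNReal.toReal_pos he.ne' h, ENNReal.ofReal_toReal_le⟩
  -- The d coordinates together use at most δ/2; d + 1 instead of d avoids a division by zero in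
  -- dimension 0. The other half of δ covers M + ‖v‖ for large t.
  set δ' := δ / (2 * (d + 1)) with hδ'
  have hδ'0 : 0 < δ' := by positivity
  choose N hN using fun i => hP.exists_forall_lintegral_abs_le hβ hPm (hv i) x hδ'0
  set M := (∑' z, ‖z‖ₑ * lam z).toReal with hM
  have hM0 : 0 ≤ M := ENNReal.toReal_nonneg
  have ev1 : ∀ᶠ t : ℝ≥0 in atTop, ((∑ i, N i + 1 : ℕ) : ℝ≥0) ≤ t := eventually_ge_atTop _
  have ev2 : ∀ᶠ t : ℝ≥0 in atTop, (⟨2 * (M + ‖v‖) / δ, by positivity⟩ : ℝ≥0) ≤ t :=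
    eventually_ge_atTop _
  filter_upwards [ev1, ev2] with t ht1 ht2
  refine (iSup_le fun η => ?_).trans hδe
  have ht0 : 0 < t := lt_of_lt_of_le (by positivity) ht1
  have ht0' : (0 : ℝ) < t := ht0
  set n := ⌊t⌋₊ with hn
  have hnN : ∀ i, N i ≤ n := fun i =>
    (Finset.single_le_sum (fun i _ => Nat.zero_le (N i)) (Finset.mem_univ i)).trans
      ((Nat.le_succ _).trans (Nat.le_floor ht1))
  have hnt : (n : ℝ≥0) ≤ t := Nat.floor_le zero_le
  have htn : t ≤ n + 1 := (Nat.lt_floor_add_one t).le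
  have hnt' : (n : ℝ) ≤ t := by exact_mod_cast hnt
  have hstep : ∫⁻ w, ‖(w.1 (n + (t - n))).2 - (w.1 n).2‖ₑ ∂(P (η, x)) ≤ ENNReal.ofReal M := by
    refine (hP.lintegral_enorm_step_le hβ hPm (η, x) n (t - n)).trans (ENNReal.ofReal_le_ofReal ?_)
    refine mul_le_of_le_one_right hM0 ?_
    exact_mod_cast tsub_le_iff_left.2 htn
  have mc : ∀ i, Measurable fun w : CadlagPath (Config d E × IntLattice d) =>
      ENNReal.ofReal |((w.1 n).2 i : ℝ) - n * v i| := fun i =>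
    (measurable_of_countable fun y : IntLattice d => ENNReal.ofReal |(y i : ℝ) - n * v i|).comp
      (measurable_snd.comp (CadlagPath.measurable_eval _))
  calc ∫⁻ w, ‖(t : ℝ)⁻¹ • walker w t - v‖ₑ ∂(P (η, x))
      ≤ ∫⁻ w, ENNReal.ofReal (t : ℝ)⁻¹ * (‖(w.1 (n + (t - n))).2 - (w.1 n).2‖ₑ
        + (∑ i, ENNReal.ofReal |((w.1 n).2 i : ℝ) - n * v i| + ENNReal.ofReal ‖v‖)) ∂(P (η, x)) :=
        lintegral_mono fun w => enorm_walker_sub_le v w ht0 hnt htn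
    _ = ENNReal.ofReal (t : ℝ)⁻¹ * (∫⁻ w, ‖(w.1 (n + (t - n))).2 - (w.1 n).2‖ₑ ∂(P (η, x))
        + (∑ i, ∫⁻ w, ENNReal.ofReal |((w.1 n).2 i : ℝ) - n * v i| ∂(P (η, x))
          + ENNReal.ofReal ‖v‖)) := by
        rw [lintegral_const_mul' _ _ ENNReal.ofReal_ne_top,
          lintegral_add_left (measurable_step _ _ fun y => ‖y‖ₑ),
          lintegral_add_right _ measurable_const, lintegral_finsetSum _ fun i _ => mc i]
        simp
    _ ≤ ENNReal.ofReal (t : ℝ)⁻¹ * (ENNReal.ofReal M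
        + (∑ _ : Fin d, ENNReal.ofReal (δ' * n) + ENNReal.ofReal ‖v‖)) := by
        refine mul_le_mul' le_rfl (add_le_add hstep (add_le_add (Finset.sum_le_sum fun i _ => ?_) le_rfl))
        exact hN i n (hnN i) η
    _ = ENNReal.ofReal ((t : ℝ)⁻¹ * (M + (d * (δ' * n) + ‖v‖))) := by
        rw [Finset.sum_const, Finset.card_univ, Fintype.card_fin, nsmul_eq_mul,
          ← ENNReal.ofReal_natCast d, ← ENNReal.ofReal_mul (by positivity),
          ← ENNReal.ofReal_add (by positivity) (by positivity),
          ← ENNReal.ofReal_add (by positivity) (by positivity),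
          ← ENNReal.ofReal_mul (by positivity)]
    _ ≤ ENNReal.ofReal δ := by
        refine ENNReal.ofReal_le_ofReal ?_
        rw [inv_mul_le_iff₀ ht0']
        have h1 : 2 * (M + ‖v‖) ≤ t * δ := (div_le_iff₀ hδ0).1 (by exact_mod_cast ht2)
        have h2 : d * δ' ≤ δ / 2 := by
          have : (d + 1) * δ' = δ / 2 := by rw [hδ']; field_simp
          nlinarith
        have h3 : d * (δ' * n) ≤ δ / 2 * t := by
          rw [← mul_assoc]
          exact mul_le_mul h2 hnt' (by positivity) (by positivity)
        linarith

end WalkerVector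

theorem mainTheorem5 {d : ℕ} {E : Type*} [MetricSpace E] [CompactSpace E] [Nonempty E]
    [MeasurableSpace E] [BorelSpace E]
    (PE : Kernel (Config d E) (CadlagPath (Config d E))) (hPE : IsEnvironment PE)
    (Q : Config d E → Config d E → Measure (CadlagPath (Config d E × Config d E)))
    (hQ : IsEnvironmentCoupling PE Q) (hdecay : IntegrableCouplingDecay Q)
    (α : Config d E → IntLattice d → ℝ) (hα : IsJumpRate α)
    (P : Kernel (Config d E × IntLattice d) (CadlagPath (Config d E × IntLattice d)))
    (hP : IsWalkInEnvironment PE α P) :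
    ∃ μEP : Measure (Config d E), IsProbabilityMeasure μEP ∧ IsErgodicEP P μEP ∧
      (∀ ν : Measure (Config d E), IsProbabilityMeasure ν → IsStationaryEP P ν → ν = μEP) ∧
      Integrable (localDrift α) μEP ∧
      (∀ (η : Config d E) (x : IntLattice d), ∀ᵐ w ∂(P (η, x)),
        Tendsto (fun t : ℝ≥0 => (t : ℝ)⁻¹ • walker w t) atTop
          (𝓝 (∫ ζ, localDrift α ζ ∂μEP))) ∧
      (∀ (η : Config d E) (x : IntLattice d) (t : ℝ≥0),
        Integrable (fun w => walker w t) (P (η, x))) ∧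
      (∀ x : IntLattice d,
        Tendsto (fun t : ℝ≥0 => ⨆ η : Config d E,
            ∫⁻ w, ‖(t : ℝ)⁻¹ • walker w t - ∫ ζ, localDrift α ζ ∂μEP‖ₑ ∂(P (η, x)))
          atTop (𝓝 0)) := by
  have : IsMarkovKernel PE := ⟨hPE.markov.prob⟩
  have hPm := hP.markov
  have : IsMarkovKernel P := ⟨hPm.prob⟩
  obtain ⟨lam, Λ, hs, hu0, hβ⟩ := hα.exists_isUniformizedRate
  have hF := hP.solvesForward hPE hs hu0 hβ
  have hcont : ∀ (t : ℝ) (g : Config d E → ℝ≥0∞) (c : ℝ≥0∞), 0 ≤ t → c ≠ ∞ → Continuous g →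
      (∀ ζ, g ζ ≤ c) → Continuous (evolEP P t g) :=
    fun t g c ht hc hg hgc => hF.continuous_evolEP hPE hβ ht hc hg hgc
  have hadd : ∀ (s t : ℝ) (g : Config d E → ℝ≥0∞) (c : ℝ≥0∞), 0 ≤ s → 0 ≤ t → c ≠ ∞ →
      Measurable g → (∀ ζ, g ζ ≤ c) → evolEP P (s + t) g = evolEP P s (evolEP P t g) :=
    fun s t g c hs ht hc hg hgc => hF.evolEP_add hPE hPm hβ hs ht hc hg hgc
  obtain ⟨μ, hμp, hμ⟩ := exists_isMixingEP hcont hadd fun g B hg hB ε hε =>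
    exists_forall_evolEP_le_add hPE hPm hQ hdecay hβ hF hg hB hε
  have hst := hμ.isStationaryEP hcont hadd
  have huniq : ∀ ν : Measure (Config d E), IsProbabilityMeasure ν → IsStationaryEP P ν → ν = μ :=
    fun ν _ hν => hμ.eq_of_isStationaryEP hν
  have hint := hα.integrable_localDrift μ
  have hv : ∀ i, ∀ ε : ℝ, 0 < ε → HasCorrector P i ((∫ ζ, localDrift α ζ ∂μ) i) ε := by
    intro i ε hε
    -- The coordinate of the vector integral is the integral of the coordinate, because projections
    -- are continuous and linear and the local drift is integrable.
    have e : (∫ ζ, localDrift α ζ ∂μ) i = ∫ ζ, localDrift α ζ i ∂μ :=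
      ((ContinuousLinearMap.proj (R := ℝ) (φ := fun _ : Fin d => ℝ) i).integral_comp_comm hint).symm
    rw [e]
    exact hP.exists_corrector hPE hα hβ hF hμ hst i hε
  refine ⟨μ, hμp, hst.isErgodicEP huniq, huniq, hint, fun η x => ?_,
    fun η x t => hF.integrable_walker hβ t (η, x),
    fun x => hF.tendsto_iSup_lintegral_enorm hβ hPm hv x⟩
  filter_upwards [ae_all_iff.2 fun i => hF.ae_tendsto_position hβ hPm (hv i) (η, x)] with w hw
  exact tendsto_pi_nhds.2 hw
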